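/- **Setting.** Let $L>1$ be odd, $R\ge 1$, and let $\Lambda=(\mathbb Z/L^R\mathbb Z)^2$, with $|x|=\max(|x_0|,|x_1|)$, directions $\hat e=\{\pm(1,0),\pm(0,1)\}$ and lattice derivatives $\partial^\mu f_x=f_{x+\mu}-f_x$; sums over $\mu\in\hat e$ include a factor $\frac12$. *Polymers.* For $0\le j\le R$ the $j$-blocks are the translates of $\{|x|\le L^j/2\}$ by vectors of $L^j\mathbb Z^2$; a $j$-polymer is a union of $j$-blocks; $|X|_j$ is the number of $j$-blocks of $X$ and $\mathcal B_j(X)$ is their set. Two blocks are connected if they contain points at $|\cdot|$-distance $1$. $\mathcal P^c_j$ is the set of nonempty connected $j$-polymers and $\mathcal S_j$ the set of those with at most $4$ blocks. $X^*$ is the union of the $Y\in\mathcal S_j$ that meet $X$, $\bar X$ is the smallest $(j+1)$-polymer containing $X$, and $\partial X$ is the set of sites of $X$ with a nearest neighbour outside $X$. *Covariances.* Given $(C_n)_n$ and $c$, independent of $L,R$, a finite range multiscale decomposition with constants $(C_n),c$ consists of positive definite functions $\Gamma_0,\dots,\Gamma_{R-1}$ on $\Lambda$ such that, for small $m>0$,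 the Yukawa potential $$W_\Lambda(x;m)=\frac1{|\Lambda|}\sum_{k\in\Lambda^*}\frac{e^{ikx}}{m^2+2\sum_i(1-\cos k_i)}$$ is a sum $\sum_{j<R}\Gamma_j(x;m)+\Gamma_{\ge R}(x;m)$ of positive definite functions with $\Gamma_j(\cdot\,;m)\to\Gamma_j$ as $m\to0$, and such that $\Gamma_j(x)=0$ for $|x|\ge L^{j+1}/2$; $|\partial^a\Gamma_j(x)|\le C_{|a|}L^{-j|a|}$ for $|x|\le L^{j+1}/2$ and $|a|>0$; $|\Gamma_j(0)-\frac1{2\pi}\ln L|\le cL^{-j/4}$. $\mathbb E_j$ is the expectation over the centred Gaussian field $\zeta$ on $\Lambda$ with covariance $\Gamma_j(x-y)$. *Norms.* Put $\|\nabla^n_jf\|_{L^\infty(S)}=\max_{\mu_1,\dots,\mu_n}\max_{x\in S}L^{nj}|\partial^{\mu_1}\cdots\partial^{\mu_n}f_x|$ and $\|f\|_{\mathcal C^2_j(X)}=\max_{n=0,1,2}\|\nabla_j^nf\|_{L^\infty(X^*)}$. For a smooth complex function $F$ of real fields $\varphi$ on $\Lambda$ that depends on $\varphi|_{X^*}$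 only, and $h>1$, $$\|F(\varphi)\|_{h,T_j(\varphi,X)}=\sum_{n\ge0}\frac{h^n}{n!}\sup_{\|f_i\|_{\mathcal C^2_j(X)}\le1}\Big|\sum_{x_1,\dots,x_n\in X^*}(f_1)_{x_1}\cdots(f_n)_{x_n}\frac{\partial^nF}{\partial\varphi_{x_1}\cdots\partial\varphi_{x_n}}(\varphi)\Big|$$ (complex test functions $f_i$ on $\Lambda$). For $X\in\mathcal S_j$ the norm $\|\cdot\|_{h,T_{j+1}(\varphi,X)}$ is defined in the same way with $L^{n(j+1)}$ in place of $L^{nj}$ and the same set $X^*$. For $c_1,c_3,\kappa_L>0$, $$\ln G_j(\varphi,X)=c_1\kappa_L L^{-2j}\sum_{x\in X,\mu}L^{2j}|\partial^\mu\varphi_x|^2+c_3\kappa_L L^{-j}\sum_{x\in\partial X,\mu}L^{2j}|\partial^\mu\varphi_x|^2+c_1\kappa_L\sum_{B\in\mathcal B_j(X)}\|\nabla^2_j\varphi\|^2_{L^\infty(B^*)},$$ and, for $A>1$, $\|K\|_{h,T_j}=\sup_{X\in\mathcal P^c_j}A^{|X|_j}\sup_\varphi\|K(\varphi,X)\|_{h,T_j(\varphi,X)}/G_j(\varphi,X)$.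 *Activities.* A polymer activity $K_j$ at scale $j$ assigns to each $X\in\mathcal P_j^c$ a $C^\infty$ function $K_j(\varphi,X)$ of the real field $\varphi$ that depends on $\varphi|_{X^*}$ only and satisfies $K_j(\varphi+\frac{2\pi m}\alpha,X)=K_j(\varphi,X)$ for $m\in\mathbb Z$. Its charge-$q$ component is $\hat K_j(q,\varphi,X)=\frac{\alpha}{2\pi}\int_0^{2\pi/\alpha}K_j(\varphi+s,X)e^{-iq\alpha s}\,ds$. **Theorem.** (i) There are an odd $\gamma>1$ and constants $(C_n),c$ such that a finite range multiscale decomposition with these constants exists for all $L=\gamma^M$, $M\ge1$, and all $R\ge1$. (ii) For all $(C_n),c$ there is $C_0>0$ such that $\|\Gamma_j(\cdot)-\Gamma_j(0)\|_{\mathcal C_j^2(X)}\le C_0$ for all odd $L>1$, all $R$, all decompositions with constants $(C_n),c$, all $j<R$ and all $X\in\mathcal S_j$ containing $0$. (iii) There is an absolute $\vartheta>0$ such that the following holds for all $(C_n)$, $c$, all $C_0>0$ as in (ii), and all $c_1>0$, $0<c_3<\vartheta c_1$. There is $c_0>0$ such that, for $\kappa_L=c_\kappa/\ln L$ with any $0<c_\kappa\le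 c_0$, for every $\alpha>0$ with $\alpha^2\ge8\pi$ and every $h>1$ with $h\ge2\alpha C_0$, there are constants $C(\alpha)$ and $L_0$ (depending on $\alpha$ and on the fixed data $(C_n),c,C_0,c_1,c_3,c_\kappa,h$ only) such that for every odd $L\ge L_0$, $L>1$, every $R$, every decomposition with constants $(C_n),c$, every $0\le j<R$, every $A>1$, every polymer activity $K_j$, every integer $q$ with $|q|\ge1$ and every $X\in\mathcal S_j$: for all real fields $\varphi'$, with $\varphi=\varphi'+\zeta$, $$\big\|\mathbb E_j[\hat K_j(q,\varphi,X)]\big\|_{h,T_{j+1}(\varphi',X)}\le C(\alpha)\,L^{-2|q|}\,\|K_j\|_{h,T_j}\Big(\frac A2\Big)^{-|X|_j}G_{j+1}(\varphi',\bar X);$$ moreover, if $\|K_j\|_{h,T_j}<\infty$, the expectation is of an integrable function and is a $C^\infty$ function of $\varphi'$. -/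

import Mathlib

open MeasureTheory ProbabilityTheory Filter Topology
open scoped NNReal ENNReal ContDiff

noncomputable section

namespace CoulombGas

/-- The periodic square lattice `Λ` of side `N`. -/
abbrev Torus (N : ℕ) : Type := ZMod N × ZMod N

/-- `|x| = max (|x₀|, |x₁|)`, each coordinate being represented in `(-N/2, N/2]`. -/
def absMax {N : ℕ} (x : Torus N) : ℕ := max x.1.valMinAbs.natAbs x.2.valMinAbs.natAbs

/-- The four lattice directions `ê`. -/
def dir (N : ℕ) (μ : Fin 4) : Torus N := ![(1, 0), (0, 1), (-1, 0), (0, -1)] μ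

/-- The lattice derivative `∂^μ f (x) = f (x + μ) - f x`. -/
def diff {N : ℕ} {E : Type*} [AddCommGroup E] (μ : Fin 4) (f : Torus N → E) : Torus N → E :=
  fun x => f (x + dir N μ) - f x

/-- The iterated lattice derivative `∂^{μ₁} ⋯ ∂^{μₙ} f`. -/
def iterDiff {N : ℕ} {E : Type*} [AddCommGroup E] (w : List (Fin 4)) (f : Torus N → E) :
    Torus N → E :=
  w.foldr diff f

/-! ### Blocks and polymers (the lattice has side `L ^ R`, the scale is `j`) -/

section Polymers

variable {N : ℕ} [NeZero N]

open Classical in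
/-- The central square `{x : |x| ≤ L ^ j / 2}`. -/
def centralBlock (N L j : ℕ) [NeZero N] : Finset (Torus N) :=
  Finset.univ.filter fun x => 2 * absMax x ≤ L ^ j

open Classical in
/-- The set of `j`-blocks: the translates of the central square by vectors of `L ^ j ℤ²`. -/
def blocks (N L j : ℕ) [NeZero N] : Finset (Finset (Torus N)) :=
  Finset.univ.filter fun B =>
    ∃ v : Torus N, B = (centralBlock N L j).image fun x => x + (L ^ j) • v

open Classical in
/-- The `j`-blocks contained in `X`. -/
def blocksIn (L j : ℕ) (X : Finset (Torus N)) : Finset (Finset (Torus N)) :=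
  (blocks N L j).filter fun B => B ⊆ X

/-- `|X|_j`, the number of `j`-blocks of `X`. -/
def numBlocks (L j : ℕ) (X : Finset (Torus N)) : ℕ := (blocksIn L j X).card

/-- A `j`-polymer is a union of `j`-blocks. -/
def IsPolymer (L j : ℕ) (X : Finset (Torus N)) : Prop :=
  ∀ x ∈ X, ∃ B ∈ blocksIn L j X, x ∈ B

/-- Two blocks touch if they contain points at (maximum norm) distance one. -/
def Touch (B D : Finset (Torus N)) : Prop := ∃ x ∈ B, ∃ y ∈ D, absMax (x - y) = 1

/-- The nonempty connected `j`-polymers. -/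
def IsConnPolymer (L j : ℕ) (X : Finset (Torus N)) : Prop :=
  X.Nonempty ∧ IsPolymer L j X ∧
    ∀ B ∈ blocksIn L j X, ∀ D ∈ blocksIn L j X,
      Relation.ReflTransGen (fun B' D' => D' ∈ blocksIn L j X ∧ Touch B' D') B D

/-- The small polymers: connected, with at most four blocks. -/
def IsSmall (L j : ℕ) (X : Finset (Torus N)) : Prop :=
  IsConnPolymer L j X ∧ numBlocks L j X ≤ 4

open Classical in
/-- The small set neighbourhood `X^*` of `X` at scale `j`: the union of the small `j`-polymers
that meet `X`. -/
def nbhd (L j : ℕ) (X : Finset (Torus N)) : Finset (Torus N) :=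
  Finset.univ.filter fun x => ∃ Y : Finset (Torus N), IsSmall L j Y ∧ x ∈ Y ∧ (Y ∩ X).Nonempty

open Classical in
/-- The smallest `j`-polymer that contains `X`. -/
def polymerClosure (L j : ℕ) (X : Finset (Torus N)) : Finset (Torus N) :=
  Finset.univ.filter fun x => ∃ B ∈ blocks N L j, x ∈ B ∧ (B ∩ X).Nonempty

open Classical in
/-- `∂X`: the sites of `X` with a nearest neighbour outside `X`. -/
def bdry (X : Finset (Torus N)) : Finset (Torus N) :=
  X.filter fun x => ∃ μ : Fin 4, x + dir N μ ∉ X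

end Polymers

/-! ### The covariances -/

/-- The Yukawa potential of mass `m` on the periodic lattice of side `N`,
`W(x; m) = |Λ|⁻¹ ∑_k e^{ikx} / (m² + 2 ∑ᵢ (1 - cos kᵢ))`, the sum being over
`k ∈ (2π / N) (ℤ / N)²`. -/
def yukawa (N : ℕ) [NeZero N] (m : ℝ) (x : Torus N) : ℝ :=
  ((N : ℝ) ^ 2)⁻¹ * ∑ n : Torus N,
    Real.cos (2 * Real.pi / N * ((n.1.val : ℝ) * x.1.val + (n.2.val : ℝ) * x.2.val)) /
      (m ^ 2 + 2 * ((1 - Real.cos (2 * Real.pi / N * n.1.val)) +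
        (1 - Real.cos (2 * Real.pi / N * n.2.val))))

/-- The translation invariant matrix `Γ (x - y)`. -/
def covMatrix {N : ℕ} (Γ : Torus N → ℝ) : Matrix (Torus N) (Torus N) ℝ :=
  Matrix.of fun x y => Γ (x - y)

/-- `Γ 0, …, Γ (R - 1)` are the massless covariances of a finite range multiscale decomposition of
the Yukawa potential on the periodic lattice of side `L ^ R`, with constants `C` and `c`. -/
structure IsMultiscaleDecomposition (C : ℕ → ℝ) (c : ℝ) (L R : ℕ) [NeZero L]
    (Γ : ℕ → Torus (L ^ R) → ℝ) : Prop where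
  /-- The `Γ j` are positive definite functions (possibly degenerate). -/
  posDef : ∀ j < R, (covMatrix (Γ j)).PosSemidef
  /-- The Yukawa potential of small mass `m` is the sum of positive definite functions
  `Γ_0 (·; m), …, Γ_{R-1} (·; m)` and `Γ_{≥ R} (·; m)`, and `Γ_j (·; m) → Γ_j` as `m → 0`. -/
  decomposition : ∃ (Γm : ℝ → ℕ → Torus (L ^ R) → ℝ) (tail : ℝ → Torus (L ^ R) → ℝ) (m₀ : ℝ),
    0 < m₀ ∧
    (∀ m, 0 < m → m < m₀ →
      (∀ j < R, (covMatrix (Γm m j)).PosSemidef) ∧ (covMatrix (tail m)).PosSemidef ∧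
      ∀ x, yukawa (L ^ R) m x = ∑ j ∈ Finset.range R, Γm m j x + tail m x) ∧
    ∀ j < R, ∀ x, Tendsto (fun m => Γm m j x) (𝓝[>] 0) (𝓝 (Γ j x))
  /-- `Γ_j (x) = 0` for `|x| ≥ L ^ (j + 1) / 2`. -/
  finiteRange : ∀ j < R, ∀ x, L ^ (j + 1) ≤ 2 * absMax x → Γ j x = 0
  /-- `|∂^a Γ_j (x)| ≤ C_a L ^ (-j |a|)` for `|x| ≤ L ^ (j + 1) / 2` and `|a| > 0`. -/
  deriv_le : ∀ j < R, ∀ x, 2 * absMax x ≤ L ^ (j + 1) → ∀ w : List (Fin 4), w ≠ [] →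
    |iterDiff w (Γ j) x| ≤ C w.length * ((L : ℝ) ^ (j * w.length))⁻¹
  /-- `Γ_j (0) = (2π)⁻¹ ln L + c_j (L)` with `|c_j (L)| ≤ c L ^ (-j / 4)`. -/
  diag : ∀ j < R,
    |Γ j 0 - Real.log L / (2 * Real.pi)| ≤ c * (L : ℝ) ^ (-((j : ℝ) / 4))

/-- The law `dP_j` of the centred Gaussian field on `Λ` with covariance `Γ (x - y)`. -/
def fieldLaw {N : ℕ} [NeZero N] (Γ : Torus N → ℝ) : Measure (Torus N → ℝ) :=
  (multivariateGaussian (0 : EuclideanSpace ℝ (Torus N)) (covMatrix Γ)).map fun v => v.ofLp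

/-! ### Norms of fields, field regulators -/

section Norms

variable {N : ℕ} [NeZero N]

/-- `‖∇_j^n f‖_{L^∞(S)} = max_{μ₁ … μₙ} max_{x ∈ S} L ^ (n j) |∂^{μ₁} ⋯ ∂^{μₙ} f_x|`. -/
def linfGrad {E : Type*} [NormedAddCommGroup E] (L j n : ℕ) (S : Finset (Torus N))
    (f : Torus N → E) : ℝ≥0 :=
  ((Finset.univ : Finset (Fin n → Fin 4)) ×ˢ S).sup fun p =>
    (L : ℝ≥0) ^ (n * j) * ‖iterDiff (List.ofFn p.1) f p.2‖₊

/-- `max_{n = 0, 1, 2} ‖∇_j^n f‖_{L^∞(S)}`; for `S = X^*` it is the norm of `C²_j(X)`. -/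
def c2Norm {E : Type*} [NormedAddCommGroup E] (L j : ℕ) (S : Finset (Torus N))
    (f : Torus N → E) : ℝ≥0 :=
  (Finset.range 3).sup fun n => linfGrad L j n S f

/-- `‖∇_j φ‖²_{L²_j(X)}`; as everywhere for sums over the four directions, a factor `1/2`
is included in the sum over `μ`. -/
def l2GradSq (L j : ℕ) (X : Finset (Torus N)) (φ : Torus N → ℝ) : ℝ :=
  ((L : ℝ) ^ (2 * j))⁻¹ * ∑ x ∈ X, (1 / 2) * ∑ μ : Fin 4, (L : ℝ) ^ (2 * j) * (diff μ φ x) ^ 2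

/-- `‖∇_j φ‖²_{L²_j(∂X)}`, with the same convention. -/
def l2GradBdrySq (L j : ℕ) (X : Finset (Torus N)) (φ : Torus N → ℝ) : ℝ :=
  ((L : ℝ) ^ j)⁻¹ * ∑ x ∈ bdry X, (1 / 2) * ∑ μ : Fin 4, (L : ℝ) ^ (2 * j) * (diff μ φ x) ^ 2

/-- `W_j(∇_j² φ, X)² = ∑_{B ∈ B_j(X)} ‖∇_j² φ‖²_{L^∞(B^*)}`. -/
def wHessSq (L j : ℕ) (X : Finset (Torus N)) (φ : Torus N → ℝ) : ℝ :=
  ∑ B ∈ blocksIn L j X, ((linfGrad L j 2 (nbhd L j B) φ : ℝ≥0) : ℝ) ^ 2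

/-- The field regulator `G_j(φ, X)`, with constants `c₁`, `c₃`, `κ`. -/
def regulator (c₁ c₃ κ : ℝ) (L j : ℕ) (X : Finset (Torus N)) (φ : Torus N → ℝ) : ℝ :=
  Real.exp (c₁ * κ * l2GradSq L j X φ + c₃ * κ * l2GradBdrySq L j X φ + c₁ * κ * wHessSq L j X φ)

/-! ### Norms of polymer activities -/

/-- `D^n F(φ) · (f₁, …, fₙ) = ∑_{x₁, …, xₙ ∈ S} (f₁)_{x₁} ⋯ (fₙ)_{xₙ} ∂ⁿF / ∂φ_{x₁} ⋯ ∂φ_{xₙ}`. -/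
def dirDeriv (S : Finset (Torus N)) (F : (Torus N → ℝ) → ℂ) (n : ℕ) (φ : Torus N → ℝ)
    (f : Fin n → Torus N → ℂ) : ℂ :=
  ∑ x ∈ Fintype.piFinset (fun _ : Fin n => S),
    (∏ i, f i (x i)) * iteratedFDeriv ℝ n F φ fun i => Pi.single (x i) 1

/-- For `S = X^*`, the norm `‖F(φ, X)‖_{h, T_j(φ, X)} = ∑ₙ hⁿ / n! ‖F(φ, X)‖_{Tⁿ_j(φ, X)}`, where
`‖F(φ, X)‖_{Tⁿ_j(φ, X)}` is the supremum of `|D^n F(φ) · (f₁, …, fₙ)|` over complex test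
functions whose `C²_j(X)` norm is at most one. -/
def tNorm (h : ℝ) (L j : ℕ) (S : Finset (Torus N)) (F : (Torus N → ℝ) → ℂ) (φ : Torus N → ℝ) :
    ℝ≥0∞ :=
  ∑' n : ℕ, ENNReal.ofReal (h ^ n / n.factorial) *
    ⨆ (f : Fin n → Torus N → ℂ) (_ : ∀ i, c2Norm L j S (f i) ≤ 1), ‖dirDeriv S F n φ f‖ₑ

/-- `‖K‖_{h, T_j} = sup_X A ^ |X|_j sup_φ ‖K(φ, X)‖_{h, T_j(φ, X)} / G_j(φ, X)`, over the connected
`j`-polymers `X` and the real fields `φ`. -/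
def activityNorm (c₁ c₃ κ h A : ℝ) (L j : ℕ) (K : Finset (Torus N) → (Torus N → ℝ) → ℂ) : ℝ≥0∞ :=
  ⨆ (X : Finset (Torus N)) (_ : IsConnPolymer L j X),
    ENNReal.ofReal (A ^ numBlocks L j X) *
      ⨆ φ : Torus N → ℝ, tNorm h L j (nbhd L j X) (K X) φ /
        ENNReal.ofReal (regulator c₁ c₃ κ L j X φ)

/-- A polymer activity at scale `j`: `K(φ, X)` is smooth, depends on `φ` restricted to `X^*` only,
and is invariant under the constant shifts `φ ↦ φ + 2πm/α`. -/
structure IsActivity (α : ℝ) (L j : ℕ) (K : Finset (Torus N) → (Torus N → ℝ) → ℂ) : Prop where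
  smooth : ∀ X, IsConnPolymer L j X → ContDiff ℝ ∞ (K X)
  local_nbhd : ∀ X, IsConnPolymer L j X → ∀ φ ψ : Torus N → ℝ,
    (∀ x ∈ nbhd L j X, φ x = ψ x) → K X φ = K X ψ
  periodic : ∀ X, IsConnPolymer L j X → ∀ (m : ℤ) (φ : Torus N → ℝ),
    K X (fun x => φ x + 2 * m * Real.pi / α) = K X φ

/-- The charge `q` component
`(α / 2π) ∫_0^{2π/α} F(φ + s) e^{-iqαs} ds` of `F`. -/
def chargeComponent (α : ℝ) (q : ℤ) (F : (Torus N → ℝ) → ℂ) (φ : Torus N → ℝ) : ℂ :=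
  (α / (2 * Real.pi) : ℝ) * ∫ s in (0 : ℝ)..(2 * Real.pi / α),
    F (fun x => φ x + s) * Complex.exp (-(Complex.I * q * α * s))

/-- The fluctuation expectation `φ' ↦ 𝔼[F(φ' + ζ)]`, `ζ` Gaussian with covariance `Γ`. -/
def fluctExp (Γ : Torus N → ℝ) (F : (Torus N → ℝ) → ℂ) (φ' : Torus N → ℝ) : ℂ :=
  ∫ ζ, F (φ' + ζ) ∂(fieldLaw Γ)

end Norms

/-- `C₀` bounds the `C²_j(X)` norm of `Γ_j(x) - Γ_j(0)`, for all decompositions with constants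
`C`, `c` and all small `X` that contain the origin. -/
def BoundsIncrements (C : ℕ → ℝ) (c C₀ : ℝ) : Prop :=
  ∀ (L : ℕ) [NeZero L] (R : ℕ) (Γ : ℕ → Torus (L ^ R) → ℝ), Odd L → 1 < L →
    IsMultiscaleDecomposition C c L R Γ →
    ∀ j < R, ∀ X : Finset (Torus (L ^ R)), IsSmall L j X → 0 ∈ X →
      (c2Norm L j (nbhd L j X) (fun x => Γ j x - Γ j 0) : ℝ) ≤ C₀

end CoulombGas

end

/-! Contraction. A component of charge `q` satisfies `F(φ + s) = e^{iqαs} F(φ)`, so a Gaussian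
expectation of it is small for the same reason that `𝔼 e^{iqαζ}` is. To exploit this for a general
`F`, the integration field is shifted by `iη Γ(· - x₀)`, with `x₀` the centre of a block of `X`. The
constant part `iη Γ(0)` of the shift acts through the charge and, together with the Gaussian factor,
produces `exp((η²/2 - qαη) Γ(0))`. The remaining part `Γ(· - x₀) - Γ(0)` is bounded by `C₀` on
`X^*`, uniformly in the scales, and is absorbed into the analyticity radius `h ≥ 2αC₀`. With `η =
±α`, of the sign of `q`, the factor is `exp(-α²(|q| - 1/2) Γ(0))`; since `Γ(0)` is about `ln L / 2π`
and `α² ≥ 8π`, it is at most of order `L^{-(4|q| - 2)}` up to constants to the power `|q|`, and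
`4|q| - 2 ≥ 2|q|` (`exp_mul_exp_le`).

`F` is only a smooth function on real fields, so the complex shift is made by analytic continuation
(`IsCharged.enorm_integral_le`). The Cameron–Martin formula gives the shift by `t Γ(· - x₀)` for
real `t`; the increment part is expanded in a Taylor series, which the finite `T`-norm makes
convergent; both sides are then analytic in `t` and are compared at `t = iη`.

The change of norm from scale `j` to `j + 1` is harmless: a unit test function on scale `j + 1` is a
constant plus a function of size `O(1/L)` on scale `j` (`c2Norm_sub_const_le`). Differentiation in a
constant direction only multiplies a charged function by `iqα`, so these directions cost
`e^{h|q|α}`, while the small ones shrink the radius. The combinatorics is the binomial bound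
`tsum_wordBound_le`, and the pieces are assembled in `tNorm_fluctExp_le`.

For the regulator, the exponent is a sum of squares of seminorms, hence at most twice its value at
`φ'` plus twice its value at `ζ`. The factor two at `φ'` is regained on passing to scale `j + 1`,
because for a small polymer the rescaled exponent gains `L^{-2}` (`two_mul_regExp_le`). The `ζ` part
has exponential moments uniform in all scales when the prefactor is small
(`IsMultiscaleDecomposition.expBdd_regExp`); the supremum of the Hessian is reduced to sums of
squares by a discrete Sobolev inequality.

Increments. `X^*` has diameter `O(L^j)` and the gradient of `Γ_j` is `O(L^{-j})`, so a path argument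
gives `C₀` (`exists_boundsIncrements`).

Existence. Let `x` be the symbol of nearest neighbour averaging, so that the Laplacian has symbol
`4(1 - x)`. Averaging over `3^i` points has a polynomial symbol `a_i(x)`. With the cutoffs `χ_n =
∏_{l<n} a_l²`, the quotients `(χ_i - χ_{i+1}) / 4(1 - x)` are nonnegative polynomials of degree
below `3^{i+1}/2`: positivity and finite range are immediate, and the decay of `χ_n` in `9^n(1 - x)`
gives the derivative bounds. Grouping `M` consecutive slices gives `L = 3^M`. The value `ln 3 / 2π`
per slice comes from an exact quadrature on the torus (`abs_avg_sub_integral_le`) and from the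
self-similarity of the cutoffs under the third Chebyshev polynomial (`exists_integral_slicePoly`).
-/

noncomputable section

namespace CoulombGas

/-! ### The maximum norm on the torus -/

section AbsMax

variable {N : ℕ}

lemma natAbs_valMinAbs_intCast_le [NeZero N] (a : ℤ) : ((a : ZMod N).valMinAbs).natAbs ≤ a.natAbs := by
  refine ZMod.natAbs_min_of_le_div_two N _ _ ?_ (ZMod.natAbs_valMinAbs_le _)
  simp

lemma absMax_intCast_le [NeZero N] (a b : ℤ) (r : ℕ) (ha : a.natAbs ≤ r) (hb : b.natAbs ≤ r) :
    absMax (((a : ZMod N), (b : ZMod N)) : Torus N) ≤ r :=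
  max_le ((natAbs_valMinAbs_intCast_le a).trans ha) ((natAbs_valMinAbs_intCast_le b).trans hb)

lemma absMax_add_le [NeZero N] (x y : Torus N) : absMax (x + y) ≤ absMax x + absMax y := by
  have h (a b : ZMod N) :
      (a + b).valMinAbs.natAbs ≤ a.valMinAbs.natAbs + b.valMinAbs.natAbs :=
    (ZMod.natAbs_valMinAbs_add_le a b).trans (Int.natAbs_add_le _ _)
  have h1 := h x.1 y.1
  have h2 := h x.2 y.2
  simp only [absMax, Prod.fst_add, Prod.snd_add]
  omega

lemma absMax_neg (x : Torus N) : absMax (-x) = absMax x := by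
  simp [absMax, ZMod.natAbs_valMinAbs_neg]

lemma absMax_sub_comm (x y : Torus N) : absMax (x - y) = absMax (y - x) := by
  rw [← absMax_neg, neg_sub]

lemma absMax_zero : absMax (0 : Torus N) = 0 := by simp [absMax]

lemma absMax_eq_zero {x : Torus N} : absMax x = 0 ↔ x = 0 := by
  constructor
  · intro h
    simp only [absMax, Nat.max_eq_zero_iff, Int.natAbs_eq_zero, ZMod.valMinAbs_eq_zero] at h
    exact Prod.ext h.1 h.2
  · rintro rfl
    exact absMax_zero

lemma absMax_sub_le [NeZero N] (x y z : Torus N) :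
    absMax (x - z) ≤ absMax (x - y) + absMax (y - z) := by
  simpa using absMax_add_le (x - y) (y - z)

lemma absMax_dir_le [NeZero N] (μ : Fin 4) : absMax (dir N μ) ≤ 1 := by
  fin_cases μ
  · simpa [dir] using absMax_intCast_le (N := N) 1 0 1 (by simp) (by simp)
  · simpa [dir] using absMax_intCast_le (N := N) 0 1 1 (by simp) (by simp)
  · simpa [dir] using absMax_intCast_le (N := N) (-1) 0 1 (by simp) (by simp)
  · simpa [dir] using absMax_intCast_le (N := N) 0 (-1) 1 (by simp) (by simp)

lemma card_absMax_le [NeZero N] (c : Torus N) (r : ℕ) (S : Finset (Torus N))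
    (hS : ∀ x ∈ S, absMax (x - c) ≤ r) : S.card ≤ (2 * r + 1) ^ 2 := by
  have h : S.card ≤ (Finset.Icc (-(r : ℤ)) r ×ˢ Finset.Icc (-(r : ℤ)) r).card := by
    refine Finset.card_le_card_of_injOn
      (fun x => ((x - c).1.valMinAbs, (x - c).2.valMinAbs)) ?_ ?_
    · intro x hx
      have := hS x hx
      simp only [absMax, max_le_iff] at this
      simp only [Finset.coe_product, Finset.coe_Icc, Set.mem_prod, Set.mem_Icc]
      omega
    · intro x _ y _ hxy
      simp only [Prod.mk.injEq, ZMod.valMinAbs_inj] at hxy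
      have : x - c = y - c := Prod.ext hxy.1 hxy.2
      simpa using this
  refine h.trans (le_of_eq ?_)
  rw [Finset.card_product, Int.card_Icc, sq]
  congr 1 <;> omega

lemma card_absMax_eq_le [NeZero N] (c : Torus N) (r : ℕ) (S : Finset (Torus N))
    (hS : ∀ x ∈ S, absMax (x - c) = r) : S.card ≤ 4 * (2 * r + 1) := by
  classical
  let I := Finset.Icc (-(r : ℤ)) r
  let T : Finset (ℤ × ℤ) := ({(r : ℤ), -(r : ℤ)} : Finset ℤ) ×ˢ I ∪ I ×ˢ ({(r : ℤ), -(r : ℤ)} : Finset ℤ)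
  have h : S.card ≤ T.card := by
    refine Finset.card_le_card_of_injOn
      (fun x => ((x - c).1.valMinAbs, (x - c).2.valMinAbs)) ?_ ?_
    · intro x hx
      have := hS x hx
      simp only [absMax] at this
      simp only [T, I, Finset.coe_union, Finset.coe_product, Finset.coe_Icc, Set.mem_prod,
        Set.mem_Icc, Set.mem_union, Finset.coe_insert, Finset.coe_singleton, Set.mem_insert_iff,
        Set.mem_singleton_iff]
      omega
    · intro x _ y _ hxy
      simp only [Prod.mk.injEq, ZMod.valMinAbs_inj] at hxy
      have : x - c = y - c := Prod.ext hxy.1 hxy.2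
      simpa using this
  refine h.trans ((Finset.card_union_le _ _).trans ?_)
  have hI : I.card = 2 * r + 1 := by
    simp only [I, Int.card_Icc]
    omega
  have h2 : ({(r : ℤ), -(r : ℤ)} : Finset ℤ).card ≤ 2 := Finset.card_le_two
  rw [Finset.card_product, Finset.card_product, hI]
  nlinarith

/-- The square of side `q` centred at `c`. -/
def blk [NeZero N] (q : ℕ) (c : Torus N) : Finset (Torus N) :=
  Finset.univ.filter fun x => 2 * absMax (x - c) ≤ q

lemma mem_blk [NeZero N] {q : ℕ} {c x : Torus N} : x ∈ blk q c ↔ 2 * absMax (x - c) ≤ q := by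
  simp [blk]

lemma self_mem_blk [NeZero N] (q : ℕ) (c : Torus N) : c ∈ blk q c := by
  simp [mem_blk, absMax_zero]

/-- Reduction modulo `N` preserves divisibility by a divisor `q` of `N`. Hence the grid of block
centres on the torus keeps minimal spacing `q`. -/
lemma dvd_valMinAbs_nsmul [NeZero N] {q : ℕ} (hd : q ∣ N) (a : ZMod N) :
    (q : ℤ) ∣ (q • a).valMinAbs := by
  have h1 : (((q • a).valMinAbs : ℤ) : ZMod N) = ((q * a.valMinAbs : ℤ) : ZMod N) := by
    simp
  rw [ZMod.intCast_eq_intCast_iff_dvd_sub] at h1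
  have h2 : (q : ℤ) ∣ q * a.valMinAbs - (q • a).valMinAbs := (Int.natCast_dvd_natCast.mpr hd).trans h1
  have h3 : (q : ℤ) ∣ q * a.valMinAbs := dvd_mul_right _ _
  exact (dvd_sub_right h3).mp h2

lemma eq_zero_of_absMax_nsmul_lt [NeZero N] {q : ℕ} (hd : q ∣ N) (v : Torus N)
    (h : absMax (q • v) < q) : q • v = 0 := by
  have hz : ∀ a : ZMod N, (q • a).valMinAbs.natAbs < q → q • a = 0 := by
    intro a ha
    rw [← ZMod.valMinAbs_eq_zero]
    refine Int.eq_zero_of_abs_lt_dvd (dvd_valMinAbs_nsmul hd a) ?_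
    rw [Int.abs_eq_natAbs]
    exact_mod_cast ha
  simp only [absMax, Prod.smul_fst, Prod.smul_snd, max_lt_iff] at h
  exact Prod.ext (hz _ h.1) (hz _ h.2)

/-- As `q` is odd, a point of a block is within `(q - 1) / 2` of the centre, so centres of
intersecting blocks differ by at most `q - 1`, which is below the grid spacing. Blocks are thus
equal or disjoint. -/
lemma center_eq_of_mem_blk [NeZero N] {q : ℕ} (hq : Odd q) (hd : q ∣ N) {v w x : Torus N}
    (hv : x ∈ blk q (q • v)) (hw : x ∈ blk q (q • w)) : q • v = q • w := by
  rw [mem_blk] at hv hw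
  have h := absMax_sub_le (q • v) x (q • w)
  rw [absMax_sub_comm (q • v) x] at h
  rw [← sub_eq_zero, ← smul_sub]
  apply eq_zero_of_absMax_nsmul_lt hd
  rw [smul_sub]
  obtain ⟨k, rfl⟩ := hq
  omega

/-- Rounding: every integer is within `q / 2` of a multiple of the odd number `q`. -/
lemma exists_round {q : ℕ} (hq : Odd q) (a : ℤ) : ∃ k : ℤ, 2 * (a - q * k).natAbs ≤ q - 1 ∧
    (a.natAbs * 2 ≤ 7 * q → k.natAbs ≤ 3) := by
  obtain ⟨m, rfl⟩ := hq
  -- Dividing `a + m` instead of `a` makes the floor a rounding to the nearest multiple of `2m + 1`.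
  -- A quotient of modulus at least `4` would force `2|a| ≥ 7q + 1`.
  have h1 := Int.emod_add_mul_ediv (a + m) ((2 * m + 1 : ℕ) : ℤ)
  have h2 := Int.emod_nonneg (a + m) (b := ((2 * m + 1 : ℕ) : ℤ)) (by omega)
  have h3 := Int.emod_lt_of_pos (a + m) (b := ((2 * m + 1 : ℕ) : ℤ)) (by omega)
  refine ⟨(a + m) / ((2 * m + 1 : ℕ) : ℤ), by omega, fun h => ?_⟩
  generalize (a + m) / ((2 * m + 1 : ℕ) : ℤ) = k at *
  generalize (a + m) % ((2 * m + 1 : ℕ) : ℤ) = r at *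
  push_cast at *
  by_contra hk
  rcases (by omega : 4 ≤ k ∨ k ≤ -4) with hk | hk
  · have : (2 * (m : ℤ) + 1) * 4 ≤ (2 * m + 1) * k := by
      apply mul_le_mul_of_nonneg_left hk; omega
    omega
  · have : (2 * (m : ℤ) + 1) * k ≤ (2 * m + 1) * (-4) := by
      apply mul_le_mul_of_nonneg_left hk; omega
    omega

lemma exists_center [NeZero N] {q : ℕ} (hq : Odd q) (x : Torus N) :
    ∃ v : Torus N, x ∈ blk q (q • v) := by
  obtain ⟨k, hk, -⟩ := exists_round hq x.1.valMinAbs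
  obtain ⟨l, hl, -⟩ := exists_round hq x.2.valMinAbs
  refine ⟨((k : ZMod N), (l : ZMod N)), ?_⟩
  rw [mem_blk]
  have hx : x - q • (((k : ZMod N), (l : ZMod N)) : Torus N) =
      (((x.1.valMinAbs - q * k : ℤ) : ZMod N), ((x.2.valMinAbs - q * l : ℤ) : ZMod N)) := by
    apply Prod.ext <;> simp
  have := absMax_intCast_le (N := N) (x.1.valMinAbs - q * k) (x.2.valMinAbs - q * l) ((q - 1) / 2)
    (by omega) (by omega)
  rw [hx]
  omega

end AbsMax

/-! ### Blocks, small polymers and their neighbourhoods -/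

section Blocks

variable {N L j : ℕ} [NeZero N]

lemma mem_blocks {B : Finset (Torus N)} :
    B ∈ blocks N L j ↔ ∃ v : Torus N, B = blk (L ^ j) ((L ^ j) • v) := by
  have h (v : Torus N) : (centralBlock N L j).image (fun x => x + (L ^ j) • v) =
      blk (L ^ j) ((L ^ j) • v) := by
    ext x
    simp only [centralBlock, Finset.mem_image, Finset.mem_filter, Finset.mem_univ, true_and, mem_blk]
    constructor
    · rintro ⟨y, hy, rfl⟩
      simpa using hy
    · intro hx
      exact ⟨x - (L ^ j) • v, hx, by simp⟩
  simp only [blocks, Finset.mem_filter, Finset.mem_univ, true_and, h]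

lemma mem_blocksIn {B X : Finset (Torus N)} :
    B ∈ blocksIn L j X ↔ B ∈ blocks N L j ∧ B ⊆ X := by
  simp [blocksIn]

lemma touch_blk {q : ℕ} (hq : Odd q) {c d : Torus N} (h : Touch (blk q c) (blk q d)) :
    absMax (c - d) ≤ q := by
  obtain ⟨x, hx, y, hy, hxy⟩ := h
  rw [mem_blk] at hx hy
  have h1 := absMax_sub_le c x d
  have h2 := absMax_sub_le x y d
  rw [absMax_sub_comm c x] at h1
  obtain ⟨k, rfl⟩ := hq
  omega

/-- The centres differ by `q(s, t)` with `s, t ∈ {-1, 0, 1}` not both trivial. For `q = 2m + 1` the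
points `c + m(s, t)` and `c + (m + 1)(s, t)` lie in the two blocks and are at distance one. -/
lemma touch_of_absMax_le {q : ℕ} (hq : Odd q) (hd : q ∣ N) {v w : Torus N}
    (h : absMax (q • v - q • w) ≤ q) (hne : q • v ≠ q • w) :
    Touch (blk q (q • v)) (blk q (q • w)) := by
  set c := q • v with hc
  set e := q • w - q • v with he
  have hqpos : 0 < q := hq.pos
  have hcoord : ∀ a : ZMod N, (q • a).valMinAbs.natAbs ≤ q →
      ∃ s : ℤ, s.natAbs ≤ 1 ∧ q • a = ((q * s : ℤ) : ZMod N) := by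
    intro a ha
    obtain ⟨s, hs⟩ := dvd_valMinAbs_nsmul hd a
    refine ⟨s, ?_, ?_⟩
    · rw [hs, Int.natAbs_mul, Int.natAbs_natCast] at ha
      exact Nat.le_of_mul_le_mul_left (by simpa using ha) hqpos
    · rw [← hs]; simp
  have he' : e = q • (w - v) := by simp [he, smul_sub]
  have hle : absMax e ≤ q := by rw [he, absMax_sub_comm]; exact h
  rw [he', absMax, max_le_iff] at hle
  obtain ⟨s, hs, hs'⟩ := hcoord (w - v).1 hle.1
  obtain ⟨t, ht, ht'⟩ := hcoord (w - v).2 hle.2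
  obtain ⟨m, hm⟩ := hq
  have hw : q • w = c + ((((q * s : ℤ)) : ZMod N), ((q * t : ℤ) : ZMod N)) := by
    have : q • w = c + q • (w - v) := by rw [smul_sub, hc]; abel
    rw [this]
    congr 1
    exact Prod.ext hs' ht'
  have hst : (((s : ZMod N), (t : ZMod N)) : Torus N) ≠ 0 := by
    intro h0
    apply hne
    rw [hw]
    have h1 : (s : ZMod N) = 0 := congrArg Prod.fst h0
    have h2 : (t : ZMod N) = 0 := congrArg Prod.snd h0
    apply Prod.ext <;> simp [h1, h2]
  refine ⟨c + (((m * s : ℤ) : ZMod N), ((m * t : ℤ) : ZMod N)), ?_,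
    c + ((((m + 1) * s : ℤ) : ZMod N), (((m + 1) * t : ℤ) : ZMod N)), ?_, ?_⟩
  · rw [mem_blk, add_sub_cancel_left]
    have := absMax_intCast_le (N := N) (m * s) (m * t) m
      (by rw [Int.natAbs_mul]; simpa using Nat.mul_le_mul_left m hs)
      (by rw [Int.natAbs_mul]; simpa using Nat.mul_le_mul_left m ht)
    omega
  · rw [mem_blk, hw]
    have hx : c + ((((m + 1) * s : ℤ) : ZMod N), (((m + 1) * t : ℤ) : ZMod N)) -
        (c + ((((q * s : ℤ)) : ZMod N), ((q * t : ℤ) : ZMod N))) =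
        (((-(m * s) : ℤ) : ZMod N), ((-(m * t) : ℤ) : ZMod N)) := by
      rw [add_sub_add_left_eq_sub, hm]
      apply Prod.ext <;> simp <;> ring
    rw [hx]
    have := absMax_intCast_le (N := N) (-(m * s)) (-(m * t)) m
      (by rw [Int.natAbs_neg, Int.natAbs_mul]; simpa using Nat.mul_le_mul_left m hs)
      (by rw [Int.natAbs_neg, Int.natAbs_mul]; simpa using Nat.mul_le_mul_left m ht)
    omega
  · have hx : c + (((m * s : ℤ) : ZMod N), ((m * t : ℤ) : ZMod N)) -
        (c + ((((m + 1) * s : ℤ) : ZMod N), (((m + 1) * t : ℤ) : ZMod N))) =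
        -(((s : ZMod N), (t : ZMod N)) : Torus N) := by
      rw [add_sub_add_left_eq_sub]
      apply Prod.ext <;> simp <;> ring
    rw [hx, absMax_neg]
    have h1 := absMax_intCast_le (N := N) s t 1 hs ht
    have h2 : absMax (((s : ZMod N), (t : ZMod N)) : Torus N) ≠ 0 := by rwa [Ne, absMax_eq_zero]
    omega

/-- In a connected set of `n` points, points are joined by chains of at most `n - 1` steps. -/
lemma dist_le_of_chain {β : Type*} [DecidableEq β] (r : β → β → Prop) (d : β → β → ℝ) (D : ℝ)
    (hD : 0 ≤ D) (h0 : ∀ a, d a a = 0) (htri : ∀ a b c, d a c ≤ d a b + d b c) (n : ℕ) :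
    ∀ (s : Finset β), s.card ≤ n → (∀ a ∈ s, ∀ b ∈ s, r a b → d a b ≤ D) → ∀ a ∈ s, ∀ b,
      Relation.ReflTransGen (fun x y => y ∈ s ∧ r x y) a b → d a b ≤ (n - 1 : ℕ) * D := by
  induction n with
  | zero =>
    intro s hs _ a ha
    simp only [nonpos_iff_eq_zero, Finset.card_eq_zero] at hs
    simp [hs] at ha
  | succ n ih =>
    intro s hs hr a ha b hab
    -- After its last visit to `a`, a chain stays in `s.erase a`; this removes a point and permits
    -- the induction on the cardinality.
    have key : a = b ∨ ∃ c ∈ s.erase a, r a c ∧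
        Relation.ReflTransGen (fun x y => y ∈ s.erase a ∧ r x y) c b := by
      induction hab with
      | refl => exact Or.inl rfl
      | @tail b b' _ hb ih' =>
        by_cases hba : a = b'
        · exact Or.inl hba
        right
        have hb' : b' ∈ s.erase a := Finset.mem_erase.mpr ⟨fun h => hba h.symm, hb.1⟩
        rcases ih' with rfl | ⟨c, hc, hac, hcb⟩
        · exact ⟨b', hb', hb.2, .refl⟩
        · exact ⟨c, hc, hac, hcb.tail ⟨hb', hb.2⟩⟩
    rcases key with rfl | ⟨c, hc, hac, hcb⟩
    · rw [h0]; positivity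
    have hcard : (s.erase a).card ≤ n := by
      rw [Finset.card_erase_of_mem ha]; omega
    have hn : 1 ≤ n := (Finset.card_pos.mpr ⟨c, hc⟩).trans_le hcard
    have h1 := ih (s.erase a) hcard
      (fun x hx y hy => hr x (Finset.mem_of_mem_erase hx) y (Finset.mem_of_mem_erase hy)) c hc b hcb
    have h2 := hr a ha c (Finset.mem_of_mem_erase hc) hac
    have h3 : ((n + 1 - 1 : ℕ) : ℝ) = (n - 1 : ℕ) + 1 := by
      rw [Nat.cast_sub hn]; simp
    rw [h3]
    linarith [htri a c b]

/-- Chains of blocks in a small polymer have at most three steps. -/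
lemma small_dist_le (hq : Odd (L ^ j)) {X : Finset (Torus N)} (hX : IsSmall L j X)
    (hd : L ^ j ∣ N)
    (d : Torus N → Torus N → ℝ) (D : ℝ) (hD : 0 ≤ D) (h0 : ∀ a, d a a = 0)
    (htri : ∀ a b c, d a c ≤ d a b + d b c)
    (hadj : ∀ v w : Torus N, blk (L ^ j) ((L ^ j) • v) ⊆ X → blk (L ^ j) ((L ^ j) • w) ⊆ X →
      absMax ((L ^ j) • v - (L ^ j) • w) ≤ L ^ j → d ((L ^ j) • v) ((L ^ j) • w) ≤ D)
    {v w : Torus N} (hv : blk (L ^ j) ((L ^ j) • v) ⊆ X) (hw : blk (L ^ j) ((L ^ j) • w) ⊆ X) :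
    d ((L ^ j) • v) ((L ^ j) • w) ≤ 3 * D := by
  classical
  -- Chains are made of blocks while `d` compares points, so each block is represented by its
  -- centre. The function `d` is kept general: it is used for the lattice distance and for `‖f a - f
  -- b‖`.
  let ctr : Finset (Torus N) → Torus N := fun B =>
    if h : ∃ v : Torus N, B = blk (L ^ j) ((L ^ j) • v) then (L ^ j) • h.choose else 0
  have hctr : ∀ v : Torus N, ctr (blk (L ^ j) ((L ^ j) • v)) = (L ^ j) • v := by
    intro v
    have h : ∃ v' : Torus N, blk (L ^ j) ((L ^ j) • v) = blk (L ^ j) ((L ^ j) • v') := ⟨v, rfl⟩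
    simp only [ctr, dif_pos h]
    refine (center_eq_of_mem_blk hq hd (x := (L ^ j) • v) (self_mem_blk _ _) ?_).symm
    rw [← h.choose_spec]
    exact self_mem_blk _ _
  have := dist_le_of_chain Touch (fun B B' => d (ctr B) (ctr B')) D hD (fun _ => h0 _)
    (fun _ _ _ => htri _ _ _) 4 (blocksIn L j X) hX.2 ?_ _
    (mem_blocksIn.mpr ⟨mem_blocks.mpr ⟨v, rfl⟩, hv⟩) _
    (hX.1.2.2 _ (mem_blocksIn.mpr ⟨mem_blocks.mpr ⟨v, rfl⟩, hv⟩) _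
      (mem_blocksIn.mpr ⟨mem_blocks.mpr ⟨w, rfl⟩, hw⟩))
  · rw [hctr, hctr] at this
    exact_mod_cast this
  · intro B hB B' hB' ht
    obtain ⟨hB, hBX⟩ := mem_blocksIn.mp hB
    obtain ⟨hB', hBX'⟩ := mem_blocksIn.mp hB'
    obtain ⟨v, rfl⟩ := mem_blocks.mp hB
    obtain ⟨w, rfl⟩ := mem_blocks.mp hB'
    simp only [hctr]
    exact hadj v w hBX hBX' (touch_blk hq ht)

lemma IsPolymer.exists_center {X : Finset (Torus N)} (hX : IsPolymer L j X) {x : Torus N}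
    (hx : x ∈ X) : ∃ v : Torus N, blk (L ^ j) ((L ^ j) • v) ⊆ X ∧ x ∈ blk (L ^ j) ((L ^ j) • v) := by
  obtain ⟨B, hB, hxB⟩ := hX x hx
  obtain ⟨hB, hBX⟩ := mem_blocksIn.mp hB
  obtain ⟨v, rfl⟩ := mem_blocks.mp hB
  exact ⟨v, hBX, hxB⟩

/-- Points of `X^*` are close to a block of `X`. -/
lemma exists_center_of_mem_nbhd (hq : Odd (L ^ j)) (hd : L ^ j ∣ N) {X : Finset (Torus N)}
    (hX : IsPolymer L j X) {x : Torus N} (hx : x ∈ nbhd L j X) :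
    ∃ v : Torus N, blk (L ^ j) ((L ^ j) • v) ⊆ X ∧ 2 * absMax (x - (L ^ j) • v) ≤ 7 * L ^ j := by
  classical
  simp only [nbhd, Finset.mem_filter, Finset.mem_univ, true_and] at hx
  obtain ⟨Y, hY, hxY, ⟨y, hy⟩⟩ := hx
  rw [Finset.mem_inter] at hy
  obtain ⟨w, hwY, hxw⟩ := hY.1.2.1.exists_center hxY
  obtain ⟨v, hvY, hyv⟩ := hY.1.2.1.exists_center hy.1
  obtain ⟨u, huX, hyu⟩ := hX.exists_center hy.2
  have huv := center_eq_of_mem_blk hq hd hyu hyv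
  refine ⟨u, huX, ?_⟩
  have h1 := small_dist_le hq hY hd (fun a b => (absMax (a - b) : ℝ)) (L ^ j : ℕ) (by positivity)
    (by simp [absMax_zero]) (fun a b c => by exact_mod_cast absMax_sub_le a b c)
    (fun v w _ _ h => by exact_mod_cast h) hwY hvY
  have h2 : absMax ((L ^ j) • w - (L ^ j) • v) ≤ 3 * L ^ j := by exact_mod_cast h1
  have h3 := absMax_sub_le x ((L ^ j) • w) ((L ^ j) • v)
  rw [mem_blk] at hxw
  rw [huv]
  omega

/-- Points close to a block that meets `X` belong to `X^*`. -/
lemma mem_nbhd_of_absMax_le (hq : Odd (L ^ j)) (hd : L ^ j ∣ N) {X : Finset (Torus N)}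
    {v z : Torus N} (hv : (blk (L ^ j) ((L ^ j) • v) ∩ X).Nonempty)
    (hz : 2 * absMax (z - (L ^ j) • v) ≤ 7 * L ^ j) : z ∈ nbhd L j X := by
  classical
  set q := L ^ j with hqdef
  set a := (z - q • v).1.valMinAbs with ha
  set b := (z - q • v).2.valMinAbs with hb
  rw [absMax] at hz
  obtain ⟨k, hk, hk3⟩ := exists_round hq a
  obtain ⟨l, hl, hl3⟩ := exists_round hq b
  replace hk3 := hk3 (by omega)
  replace hl3 := hl3 (by omega)
  have hqpos : 0 < q := hq.pos
  -- Clamping the target offset `(k, l)` to `[-i, i]²` gives a path of blocks moving by at most one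
  -- in each coordinate. As `|k|, |l| ≤ 3`, the four blocks `i = 0, …, 3` reach the target, which is
  -- exactly what a small polymer allows.
  let cl : ℤ → ℕ → ℤ := fun k i => max (-(i : ℤ)) (min i k)
  let u : ℕ → Torus N := fun i => v + ((cl k i : ZMod N), (cl l i : ZMod N))
  let Y : Finset (Torus N) := (Finset.range 4).biUnion fun i => blk q (q • u i)
  have hsub : ∀ i < 4, blk q (q • u i) ⊆ Y := fun i hi =>
    Finset.subset_biUnion_of_mem (fun i => blk q (q • u i)) (Finset.mem_range.mpr hi)
  have hu0 : u 0 = v := by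
    have : ∀ k : ℤ, cl k 0 = 0 := fun k => by simp only [cl]; omega
    simp only [u, this]
    simp
  have hblocks : ∀ B ∈ blocksIn L j Y, ∃ i < 4, B = blk q (q • u i) := by
    intro B hB
    obtain ⟨hB, hBY⟩ := mem_blocksIn.mp hB
    obtain ⟨w, rfl⟩ := mem_blocks.mp hB
    have := hBY (self_mem_blk _ _)
    simp only [Y, Finset.mem_biUnion, Finset.mem_range] at this
    obtain ⟨i, hi, hwi⟩ := this
    refine ⟨i, hi, ?_⟩
    rw [center_eq_of_mem_blk hq hd (self_mem_blk _ _) hwi]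
  have hmemB : ∀ i < 4, blk q (q • u i) ∈ blocksIn L j Y := fun i hi =>
    mem_blocksIn.mpr ⟨mem_blocks.mpr ⟨_, rfl⟩, hsub i hi⟩
  have hstep : ∀ i, absMax (q • u i - q • u (i + 1)) ≤ q := by
    intro i
    have : q • u i - q • u (i + 1) = (((q * (cl k i - cl k (i + 1)) : ℤ) : ZMod N),
        ((q * (cl l i - cl l (i + 1)) : ℤ) : ZMod N)) := by
      simp only [u]
      apply Prod.ext <;> simp <;> ring
    rw [this]
    have hc : ∀ k : ℤ, (q * (cl k i - cl k (i + 1))).natAbs ≤ q := by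
      intro k
      rw [Int.natAbs_mul, Int.natAbs_natCast]
      have : (cl k i - cl k (i + 1)).natAbs ≤ 1 := by simp only [cl]; omega
      simpa using Nat.mul_le_mul_left q this
    exact absMax_intCast_le _ _ _ (hc k) (hc l)
  let r : Finset (Torus N) → Finset (Torus N) → Prop :=
    fun B' D' => D' ∈ blocksIn L j Y ∧ Touch B' D'
  have hcon : ∀ i, i + 1 < 4 → Relation.ReflTransGen r (blk q (q • u i)) (blk q (q • u (i + 1))) ∧
      Relation.ReflTransGen r (blk q (q • u (i + 1))) (blk q (q • u i)) := by
    intro i hi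
    by_cases he : q • u i = q • u (i + 1)
    · rw [he]; exact ⟨.refl, .refl⟩
    · refine ⟨.single ⟨hmemB _ hi, touch_of_absMax_le hq hd (hstep i) he⟩,
        .single ⟨hmemB _ (by omega), touch_of_absMax_le hq hd ?_ (Ne.symm he)⟩⟩
      rw [absMax_sub_comm]
      exact hstep i
  have hcon0 : ∀ i < 4, Relation.ReflTransGen r (blk q (q • u 0)) (blk q (q • u i)) ∧
      Relation.ReflTransGen r (blk q (q • u i)) (blk q (q • u 0)) := by
    intro i hi
    induction i with
    | zero => exact ⟨.refl, .refl⟩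
    | succ i ih =>
      obtain ⟨h1, h2⟩ := ih (by omega)
      obtain ⟨h3, h4⟩ := hcon i hi
      exact ⟨h1.trans h3, h4.trans h2⟩
  have hsmall : IsSmall L j Y := by
    refine ⟨⟨⟨q • u 0, hsub 0 (by norm_num) (self_mem_blk _ _)⟩, ?_, ?_⟩, ?_⟩
    · intro x hx
      obtain ⟨i, hi, hxi⟩ := Finset.mem_biUnion.mp hx
      exact ⟨_, hmemB i (Finset.mem_range.mp hi), hxi⟩
    · intro B hB D hD
      obtain ⟨i, hi, rfl⟩ := hblocks B hB
      obtain ⟨i', hi', rfl⟩ := hblocks D hD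
      exact (hcon0 i hi).2.trans (hcon0 i' hi').1
    · have : blocksIn L j Y ⊆ (Finset.range 4).image fun i => blk q (q • u i) := by
        intro B hB
        obtain ⟨i, hi, rfl⟩ := hblocks B hB
        exact Finset.mem_image_of_mem _ (Finset.mem_range.mpr hi)
      exact (Finset.card_le_card this).trans (Finset.card_image_le.trans (by simp))
  simp only [nbhd, Finset.mem_filter, Finset.mem_univ, true_and]
  refine ⟨Y, hsmall, ?_, ?_⟩
  · refine hsub 3 (by norm_num) ?_
    rw [mem_blk]
    have hcl : ∀ k : ℤ, k.natAbs ≤ 3 → cl k 3 = k := fun k hk => by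
      simp only [cl]; push_cast; omega
    have : z - q • u 3 = (((a - q * k : ℤ) : ZMod N), ((b - q * l : ℤ) : ZMod N)) := by
      simp only [u, hcl k hk3, hcl l hl3, ha, hb]
      apply Prod.ext <;> simp <;> ring
    rw [this]
    have := absMax_intCast_le (N := N) (a - q * k) (b - q * l) ((q - 1) / 2) (by omega) (by omega)
    omega
  · rw [← hu0] at hv
    exact hv.mono (Finset.inter_subset_inter_right (hsub 0 (by norm_num)))

lemma IsPolymer.subset_nbhd (hq : Odd (L ^ j)) (hd : L ^ j ∣ N) {X : Finset (Torus N)}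
    (hX : IsPolymer L j X) : X ⊆ nbhd L j X := by
  intro x hx
  obtain ⟨v, hvX, hxv⟩ := hX.exists_center hx
  refine mem_nbhd_of_absMax_le hq hd (v := v) ⟨x, Finset.mem_inter.mpr ⟨hxv, hx⟩⟩ ?_
  rw [mem_blk] at hxv
  omega

lemma IsPolymer.eq_biUnion {X : Finset (Torus N)} [DecidableEq (Torus N)] (hX : IsPolymer L j X) :
    X = (blocksIn L j X).biUnion id := by
  ext x
  simp only [Finset.mem_biUnion, id]
  exact ⟨fun hx => hX x hx, fun ⟨B, hB, hx⟩ => (mem_blocksIn.mp hB).2 hx⟩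

lemma IsSmall.card_le (hq : Odd (L ^ j)) {X : Finset (Torus N)} (hX : IsSmall L j X) :
    X.card ≤ 4 * (L ^ j) ^ 2 := by
  classical
  rw [hX.1.2.1.eq_biUnion]
  refine (Finset.card_biUnion_le_card_mul _ _ ((L ^ j) ^ 2) fun B hB => ?_).trans
    (Nat.mul_le_mul_right _ hX.2)
  obtain ⟨v, rfl⟩ := mem_blocks.mp (mem_blocksIn.mp hB).1
  obtain ⟨m, hm⟩ := hq
  rw [hm]
  refine card_absMax_le ((2 * m + 1) • v) m _ fun x hx => ?_
  simp only [id, mem_blk] at hx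
  omega

/-- A site with a neighbour outside `X` leaves its own block in one step, so it lies on the rim of
that block. A rim has at most `4 L^j` sites and there are at most four blocks. -/
lemma IsSmall.card_bdry_le (hq : Odd (L ^ j)) (hd : L ^ j ∣ N) {X : Finset (Torus N)} (hX : IsSmall L j X) :
    (bdry X).card ≤ 16 * L ^ j := by
  classical
  obtain ⟨m, hm⟩ := hq
  have hsub : bdry X ⊆ (blocksIn L j X).biUnion fun B => B.filter fun x =>
      ∃ v : Torus N, B = blk (L ^ j) ((L ^ j) • v) ∧ absMax (x - (L ^ j) • v) = m := by
    intro x hx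
    simp only [bdry, Finset.mem_filter] at hx
    obtain ⟨hxX, μ, hμ⟩ := hx
    obtain ⟨v, hvX, hxv⟩ := hX.1.2.1.exists_center hxX
    simp only [Finset.mem_biUnion, Finset.mem_filter]
    refine ⟨_, mem_blocksIn.mpr ⟨mem_blocks.mpr ⟨v, rfl⟩, hvX⟩, hxv, v, rfl, ?_⟩
    have h1 : ¬ 2 * absMax (x + dir N μ - (L ^ j) • v) ≤ L ^ j := fun h =>
      hμ (hvX (mem_blk.mpr h))
    rw [mem_blk] at hxv
    have h2 := absMax_add_le (x - (L ^ j) • v) (dir N μ)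
    rw [show x - (L ^ j) • v + dir N μ = x + dir N μ - (L ^ j) • v by abel] at h2
    have h3 := absMax_dir_le (N := N) μ
    omega
  refine (Finset.card_le_card hsub).trans ((Finset.card_biUnion_le_card_mul _ _ (4 * L ^ j)
    fun B hB => ?_).trans ((Nat.mul_le_mul_right _ hX.2).trans (by omega)))
  by_cases hB' : ∃ v : Torus N, B = blk (L ^ j) ((L ^ j) • v)
  · obtain ⟨v, rfl⟩ := hB'
    have := card_absMax_eq_le ((L ^ j) • v) m ((blk (L ^ j) ((L ^ j) • v)).filter fun x =>
      ∃ w : Torus N, blk (L ^ j) ((L ^ j) • v) = blk (L ^ j) ((L ^ j) • w) ∧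
        absMax (x - (L ^ j) • w) = m) ?_
    · rw [← hm] at this; exact this
    · intro x hx
      obtain ⟨-, w, hw, hxw⟩ := Finset.mem_filter.mp hx
      rw [center_eq_of_mem_blk ⟨m, hm⟩ hd (self_mem_blk _ ((L ^ j) • v)) (hw ▸ self_mem_blk _ _)]
      exact hxw
  · rw [Finset.filter_false_of_mem]
    · simp
    · rintro x _ ⟨v, hv, -⟩
      exact hB' ⟨v, hv⟩

end Blocks

/-! ### Lattice derivatives and the norms of test functions -/

section Diff

variable {N : ℕ} {E : Type*} [NormedAddCommGroup E]

@[simp] lemma iterDiff_nil (f : Torus N → E) : iterDiff [] f = f := rfl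

@[simp] lemma iterDiff_cons (μ : Fin 4) (w : List (Fin 4)) (f : Torus N → E) :
    iterDiff (μ :: w) f = diff μ (iterDiff w f) := rfl

lemma iterDiff_append (v w : List (Fin 4)) (f : Torus N → E) :
    iterDiff (v ++ w) f = iterDiff v (iterDiff w f) := by
  simp [iterDiff, List.foldr_append]

lemma diff_sub_const (μ : Fin 4) (f : Torus N → E) (a : E) :
    diff μ (fun x => f x - a) = diff μ f := by
  ext x; simp [diff]

lemma iterDiff_sub_const (w : List (Fin 4)) (hw : w ≠ []) (f : Torus N → E) (a : E) :
    iterDiff w (fun x => f x - a) = iterDiff w f := by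
  induction w with
  | nil => exact absurd rfl hw
  | cons μ w ih =>
    rcases w with _ | ⟨ν, w⟩
    · simp [diff_sub_const]
    · rw [iterDiff_cons, ih (by simp), ← iterDiff_cons]

/-- The opposite direction. -/
def opp (μ : Fin 4) : Fin 4 := μ + 2

lemma dir_opp (μ : Fin 4) : dir N (opp μ) = -dir N μ := by
  fin_cases μ <;> simp [dir, opp]

lemma diff_opp (μ : Fin 4) (f : Torus N → E) (x : Torus N) :
    diff (opp μ) f (x + dir N μ) = -diff μ f x := by
  simp [diff, dir_opp]

lemma norm_line_le (f : Torus N → E) (μ : Fin 4) (D : ℝ) (y : Torus N) (n : ℕ)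
    (h : ∀ i < n, ‖diff μ f (y + i • dir N μ)‖ ≤ D) : ‖f (y + n • dir N μ) - f y‖ ≤ n * D := by
  induction n with
  | zero => simp
  | succ n ih =>
    have h1 := ih fun i hi => h i (hi.trans (Nat.lt_succ_self n))
    have h2 := h n (Nat.lt_succ_self n)
    have : f (y + (n + 1) • dir N μ) - f y =
        diff μ f (y + n • dir N μ) + (f (y + n • dir N μ) - f y) := by
      simp only [diff, succ_nsmul, ← add_assoc]; abel
    rw [this]
    refine (norm_add_le _ _).trans ?_
    push_cast
    linarith

lemma exists_dir_fst [NeZero N] (a : ZMod N) : ∃ μ : Fin 4,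
    (a, 0) = a.valMinAbs.natAbs • dir N μ ∧ ∀ i : ℕ, ∀ b : ℤ, ∀ r : ℕ, i ≤ r → b.natAbs ≤ r →
      absMax (i • dir N μ + (0, (b : ZMod N))) ≤ r := by
  rcases Int.natAbs_eq a.valMinAbs with h | h
  · refine ⟨0, ?_, fun i b r hi hb => ?_⟩
    · apply Prod.ext
      · have := congrArg (Int.cast (R := ZMod N)) h
        simpa [dir] using this
      · simp [dir]
    · simpa [dir] using absMax_intCast_le (N := N) i b r (by simpa using hi) hb
  · refine ⟨2, ?_, fun i b r hi hb => ?_⟩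
    · apply Prod.ext
      · have := congrArg (Int.cast (R := ZMod N)) h
        simpa [dir] using this
      · simp [dir]
    · simpa [dir] using absMax_intCast_le (N := N) (-i) b r (by simpa using hi) hb

lemma exists_dir_snd [NeZero N] (a : ZMod N) : ∃ μ : Fin 4,
    (0, a) = a.valMinAbs.natAbs • dir N μ ∧ ∀ i : ℕ, ∀ r : ℕ, i ≤ r → absMax (i • dir N μ) ≤ r := by
  rcases Int.natAbs_eq a.valMinAbs with h | h
  · refine ⟨1, ?_, fun i r hi => ?_⟩
    · apply Prod.ext
      · simp [dir]
      · have := congrArg (Int.cast (R := ZMod N)) h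
        simpa [dir] using this
    · simpa [dir] using absMax_intCast_le (N := N) 0 i r (by simp) (by simpa using hi)
  · refine ⟨3, ?_, fun i r hi => ?_⟩
    · apply Prod.ext
      · simp [dir]
      · have := congrArg (Int.cast (R := ZMod N)) h
        simpa [dir] using this
    · simpa [dir] using absMax_intCast_le (N := N) 0 (-i) r (by simp) (by simpa using hi)

/-- Mean value bound inside a square. -/
lemma norm_sub_le_of_diff_le [NeZero N] (f : Torus N → E) (c : Torus N) (r : ℕ) (D : ℝ)
    (hD : 0 ≤ D) (h : ∀ z, absMax (z - c) ≤ r → ∀ μ, ‖diff μ f z‖ ≤ D) (z : Torus N)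
    (hz : absMax (z - c) ≤ r) : ‖f z - f c‖ ≤ 2 * r * D := by
  obtain ⟨μ, hμ, hμ'⟩ := exists_dir_fst (z - c).1
  obtain ⟨ν, hν, hν'⟩ := exists_dir_snd (z - c).2
  rw [absMax, max_le_iff] at hz
  have h1 := norm_line_le f ν D c _ fun i hi => h (c + i • dir N ν)
    (by simpa using hν' i r (hi.le.trans hz.2)) ν
  have h2 := norm_line_le f μ D (c + (0, (z - c).2)) _ fun i hi =>
    h (c + (0, (z - c).2) + i • dir N μ) (by
      have := hμ' i (z - c).2.valMinAbs r (hi.le.trans hz.1) hz.2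
      rw [ZMod.coe_valMinAbs] at this
      rwa [show c + (0, (z - c).2) + i • dir N μ - c = i • dir N μ + (0, (z - c).2) by abel]) μ
  rw [← hν] at h1
  rw [← hμ] at h2
  have hzc : c + (0, (z - c).2) + ((z - c).1, 0) = z := by
    apply Prod.ext <;> simp
  rw [hzc] at h2
  have h3 : f z - f c = (f z - f (c + (0, (z - c).2))) + (f (c + (0, (z - c).2)) - f c) := by abel
  rw [h3]
  refine (norm_add_le _ _).trans ?_
  have h4 : (((z - c).1.valMinAbs.natAbs : ℕ) : ℝ) * D ≤ r * D :=
    mul_le_mul_of_nonneg_right (by exact_mod_cast hz.1) hD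
  have h5 : (((z - c).2.valMinAbs.natAbs : ℕ) : ℝ) * D ≤ r * D :=
    mul_le_mul_of_nonneg_right (by exact_mod_cast hz.2) hD
  linarith

lemma linfGrad_le_iff {L j n : ℕ} {S : Finset (Torus N)} {f : Torus N → E} {r : ℝ≥0} :
    linfGrad L j n S f ≤ r ↔ ∀ w : List (Fin 4), w.length = n → ∀ x ∈ S,
      (L : ℝ) ^ (n * j) * ‖iterDiff w f x‖ ≤ r := by
  simp only [linfGrad, Finset.sup_le_iff, Finset.mem_product, Finset.mem_univ, true_and,
    Prod.forall]
  constructor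
  · rintro h w rfl x hx
    have := h (fun i => w.get i) x hx
    rw [List.ofFn_get] at this
    exact_mod_cast this
  · intro h w x hx
    have := h (List.ofFn w) (by simp) x hx
    exact_mod_cast this

lemma le_linfGrad {L j n : ℕ} {S : Finset (Torus N)} (f : Torus N → E) (w : List (Fin 4))
    (hw : w.length = n) {x : Torus N} (hx : x ∈ S) :
    (L : ℝ) ^ (n * j) * ‖iterDiff w f x‖ ≤ linfGrad L j n S f :=
  linfGrad_le_iff.mp le_rfl w hw x hx

lemma c2Norm_le_iff {L j : ℕ} {S : Finset (Torus N)} {f : Torus N → E} {r : ℝ≥0} :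
    c2Norm L j S f ≤ r ↔ ∀ w : List (Fin 4), w.length < 3 → ∀ x ∈ S,
      (L : ℝ) ^ (w.length * j) * ‖iterDiff w f x‖ ≤ r := by
  simp only [c2Norm, Finset.sup_le_iff, Finset.mem_range, linfGrad_le_iff]
  exact ⟨fun h w hw x hx => h _ hw w rfl x hx, fun h n hn w hw x hx => hw ▸ h w (hw ▸ hn) x hx⟩

lemma le_c2Norm {L j : ℕ} {S : Finset (Torus N)} (f : Torus N → E) (w : List (Fin 4))
    (hw : w.length < 3) {x : Torus N} (hx : x ∈ S) :
    (L : ℝ) ^ (w.length * j) * ‖iterDiff w f x‖ ≤ c2Norm L j S f :=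
  c2Norm_le_iff.mp le_rfl w hw x hx

end Diff

/-! ### Uniform bounds on the increments of the covariances -/

section Increments

variable {N : ℕ}

/-- The derivative bounds are given only inside the range. If `x` is outside but `x + μ` is inside,
the derivative at `x` is minus the opposite derivative at `x + μ`; if both are outside it vanishes.
-/
lemma abs_diff_le_of_finiteRange {Γ : Torus N → ℝ} {P : Torus N → Prop} {D : ℝ} (hD : 0 ≤ D)
    (h0 : ∀ x, ¬ P x → Γ x = 0) (h : ∀ x, P x → ∀ μ, |diff μ Γ x| ≤ D) (x : Torus N) (μ : Fin 4) :
    |diff μ Γ x| ≤ D := by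
  by_cases h1 : P x
  · exact h x h1 μ
  by_cases h2 : P (x + dir N μ)
  · have := h _ h2 (opp μ)
    rwa [diff_opp, abs_neg] at this
  · simp [diff, h0 x h1, h0 _ h2, hD]

/-- The second difference involves the four corners of a parallelogram. It can be rewritten, up to
sign, as a second difference based at any corner in the range, and it vanishes if there is none. -/
lemma abs_diff_diff_le_of_finiteRange {Γ : Torus N → ℝ} {P : Torus N → Prop} {D : ℝ} (hD : 0 ≤ D)
    (h0 : ∀ x, ¬ P x → Γ x = 0) (h : ∀ x, P x → ∀ μ ν, |diff μ (diff ν Γ) x| ≤ D) (x : Torus N)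
    (μ ν : Fin 4) : |diff μ (diff ν Γ) x| ≤ D := by
  have hν (y : Torus N) : diff (opp ν) Γ (y + dir N ν) = -diff ν Γ y := diff_opp _ _ _
  by_cases h1 : P x
  · exact h x h1 μ ν
  by_cases h2 : P (x + dir N μ)
  · have := h _ h2 (opp μ) ν
    rwa [diff_opp, abs_neg] at this
  by_cases h3 : P (x + dir N ν)
  · have := h _ h3 μ (opp ν)
    have e : diff μ (diff (opp ν) Γ) (x + dir N ν) = -diff μ (diff ν Γ) x := by
      change diff (opp ν) Γ (x + dir N ν + dir N μ) - diff (opp ν) Γ (x + dir N ν) =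
        -(diff ν Γ (x + dir N μ) - diff ν Γ x)
      rw [show x + dir N ν + dir N μ = x + dir N μ + dir N ν by abel, hν, hν]; abel
    rwa [e, abs_neg] at this
  by_cases h4 : P (x + dir N μ + dir N ν)
  · have := h _ h4 (opp μ) (opp ν)
    have e : diff (opp μ) (diff (opp ν) Γ) (x + dir N μ + dir N ν) = diff μ (diff ν Γ) x := by
      rw [show x + dir N μ + dir N ν = x + dir N ν + dir N μ by abel, diff_opp]
      change -(diff (opp ν) Γ (x + dir N ν + dir N μ) - diff (opp ν) Γ (x + dir N ν)) =
        diff ν Γ (x + dir N μ) - diff ν Γ x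
      rw [show x + dir N ν + dir N μ = x + dir N μ + dir N ν by abel, hν, hν]; abel
    rwa [e] at this
  · simp [diff, h0 x h1, h0 _ h2, h0 _ h3, h0 _ h4, hD]

lemma IsMultiscaleDecomposition.abs_iterDiff_le {C : ℕ → ℝ} {c : ℝ} {L R : ℕ} [NeZero L]
    {Γ : ℕ → Torus (L ^ R) → ℝ} (h : IsMultiscaleDecomposition C c L R Γ) {j : ℕ} (hj : j < R)
    (w : List (Fin 4)) (hw : w ≠ []) (hw2 : w.length < 3) (x : Torus (L ^ R)) :
    (L : ℝ) ^ (w.length * j) * |iterDiff w (Γ j) x| ≤ |C w.length| := by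
  have hL : (0 : ℝ) < L := by exact_mod_cast Nat.pos_of_ne_zero (NeZero.ne L)
  set D : ℝ := |C w.length| * ((L : ℝ) ^ (j * w.length))⁻¹ with hDdef
  have hD : 0 ≤ D := by positivity
  have h0 : ∀ x, ¬ (2 * absMax x ≤ L ^ (j + 1)) → Γ j x = 0 := fun x hx =>
    h.finiteRange j hj x (by omega)
  have hb : ∀ x, 2 * absMax x ≤ L ^ (j + 1) → ∀ v : List (Fin 4), v ≠ [] → v.length = w.length →
      |iterDiff v (Γ j) x| ≤ D := by
    intro x hx v hv hvw
    refine (h.deriv_le j hj x hx v hv).trans ?_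
    rw [hDdef, hvw]
    gcongr
    exact le_abs_self _
  have key : |iterDiff w (Γ j) x| ≤ D := by
    match w, hw, hw2 with
    | [μ], _, _ =>
      exact abs_diff_le_of_finiteRange hD h0 (fun x hx μ => hb x hx [μ] (by simp) rfl) x μ
    | [μ, ν], _, _ =>
      exact abs_diff_diff_le_of_finiteRange hD h0
        (fun x hx μ ν => hb x hx [μ, ν] (by simp) rfl) x μ ν
  calc (L : ℝ) ^ (w.length * j) * |iterDiff w (Γ j) x| ≤ (L : ℝ) ^ (w.length * j) * D := by gcongr
    _ = |C w.length| := by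
      rw [hDdef, mul_comm w.length j]
      field_simp

/-- The increments of the covariances are bounded in `C²_j`. -/
theorem exists_boundsIncrements (C : ℕ → ℝ) (c : ℝ) :
    ∃ C₀ : ℝ, 0 < C₀ ∧ BoundsIncrements C c C₀ := by
  -- Points of `X^*` are within `(7/2 + 3 + 1/2) L^j = 7 L^j` of the origin: from the point to a
  -- centre, along a chain of centres, and from the last centre to `0`. The two coordinate
  -- directions double this to `14`.
  refine ⟨1 + 14 * |C 1| + |C 2|, by positivity, ?_⟩
  intro L _ R Γ hodd hL1 h j hj X hX h0
  have hq : Odd (L ^ j) := hodd.pow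
  have hd : L ^ j ∣ L ^ R := pow_dvd_pow L hj.le
  have hqpos : (0 : ℝ) < (L : ℝ) ^ j := by
    have : (0 : ℝ) < L := by exact_mod_cast (by omega : 0 < L)
    positivity
  have hnn : (0 : ℝ) ≤ 1 + 14 * |C 1| + |C 2| := by positivity
  suffices hs : c2Norm L j (nbhd L j X) (fun x => Γ j x - Γ j 0) ≤
      Real.toNNReal (1 + 14 * |C 1| + |C 2|) by
    rw [← Real.coe_toNNReal _ hnn]
    exact NNReal.coe_le_coe.mpr hs
  rw [c2Norm_le_iff]
  intro w hw x hx
  rw [Real.coe_toNNReal _ hnn]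
  by_cases hw0 : w = []
  · subst hw0
    simp only [List.length_nil, zero_mul, pow_zero, iterDiff_nil, one_mul]
    obtain ⟨v, hvX, hxv⟩ := exists_center_of_mem_nbhd hq hd hX.1.2.1 hx
    obtain ⟨u, huX, hu⟩ := hX.1.2.1.exists_center h0
    have h1 := small_dist_le hq hX hd (fun a b => (absMax (a - b) : ℝ)) (L ^ j : ℕ) (by positivity)
      (by simp [absMax_zero]) (fun a b c => by exact_mod_cast absMax_sub_le a b c)
      (fun v w _ _ h => by exact_mod_cast h) hvX huX
    have h2 : absMax ((L ^ j) • v - (L ^ j) • u) ≤ 3 * L ^ j := by exact_mod_cast h1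
    have h3 := absMax_sub_le x ((L ^ j) • v) ((L ^ j) • u)
    have h4 := absMax_sub_le x ((L ^ j) • u) 0
    rw [mem_blk, absMax_sub_comm] at hu
    have h5 := norm_sub_le_of_diff_le (Γ j) 0 (7 * L ^ j) (|C 1| * ((L : ℝ) ^ j)⁻¹)
      (by positivity) (fun z _ μ => by
        have := h.abs_iterDiff_le hj [μ] (by simp) (by simp) z
        simp only [List.length_singleton, one_mul, iterDiff_cons, iterDiff_nil] at this
        rw [Real.norm_eq_abs, ← div_eq_mul_inv, le_div_iff₀ hqpos, mul_comm]
        exact this) x (by omega)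
    refine h5.trans ?_
    have : 2 * ((7 * L ^ j : ℕ) : ℝ) * (|C 1| * ((L : ℝ) ^ j)⁻¹) = 14 * |C 1| := by
      push_cast; field_simp; ring
    rw [this]
    linarith [abs_nonneg (C 2)]
  · rw [iterDiff_sub_const w hw0]
    refine (h.abs_iterDiff_le hj w hw0 hw x).trans ?_
    have hpos : 0 < w.length := List.length_pos_iff.mpr hw0
    have := abs_nonneg (C 1)
    have := abs_nonneg (C 2)
    interval_cases w.length
    · linarith
    · linarith

end Increments

/-! ### Comparison of the scales `j` and `j + 1` -/

section Scales

variable {N L j : ℕ} [NeZero N]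

set_option linter.unusedSectionVars false

/-- A test function on scale `j + 1` is a constant plus a function of size `O(1 / L)` on
scale `j`. -/
lemma c2Norm_sub_const_le {E : Type*} [NormedAddCommGroup E] (hL : 0 < L) (hq : Odd (L ^ j))
    (hd : L ^ j ∣ N) {X : Finset (Torus N)} (hX : IsSmall L j X) {v : Torus N}
    (hv : blk (L ^ j) ((L ^ j) • v) ⊆ X) (f : Torus N → E)
    (hf : c2Norm L (j + 1) (nbhd L j X) f ≤ 1) :
    ‖f ((L ^ j) • v)‖ ≤ 1 ∧
      c2Norm L j (nbhd L j X) (fun x => f x - f ((L ^ j) • v)) ≤ 28 / (L : ℝ≥0) := by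
  have hLpos : (0 : ℝ) < L := by exact_mod_cast hL
  have hLone : (1 : ℝ) ≤ L := by exact_mod_cast hL
  rw [c2Norm_le_iff] at hf
  have hvn := hX.1.2.1.subset_nbhd hq hd (hv (self_mem_blk _ _))
  refine ⟨by simpa using hf [] (by simp) _ hvn, ?_⟩
  rw [c2Norm_le_iff]
  intro w hw x hx
  push_cast
  by_cases hw0 : w = []
  · subst hw0
    simp only [List.length_nil, zero_mul, pow_zero, iterDiff_nil, one_mul]
    set D : ℝ := ((L : ℝ) ^ (j + 1))⁻¹ with hD
    have hDpos : 0 ≤ D := by positivity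
    -- The derivatives of `f` are controlled on `X^*` only. The squares of radius `7/2 L^j` around
    -- centres of blocks of `X` are contained in it, so paths inside them are admissible.
    have hball : ∀ u : Torus N, blk (L ^ j) ((L ^ j) • u) ⊆ X → ∀ (r : ℕ), 2 * r ≤ 7 * L ^ j →
        ∀ z, absMax (z - (L ^ j) • u) ≤ r → ‖f z - f ((L ^ j) • u)‖ ≤ 2 * r * D := by
      intro u hu r hr z hz
      refine norm_sub_le_of_diff_le f _ r D hDpos (fun y hy μ => ?_) z hz
      have hyn : y ∈ nbhd L j X := mem_nbhd_of_absMax_le hq hd (v := u)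
        ⟨_, Finset.mem_inter.mpr ⟨self_mem_blk _ _, hu (self_mem_blk _ _)⟩⟩ (by omega)
      have := hf [μ] (by simp) y hyn
      simp only [List.length_singleton, one_mul, iterDiff_cons, iterDiff_nil, NNReal.coe_one] at this
      rw [hD, ← one_div, le_div_iff₀ (by positivity), mul_comm]
      exact this
    obtain ⟨u, huX, hxu⟩ := exists_center_of_mem_nbhd hq hd hX.1.2.1 hx
    -- Three steps between adjacent centres cost `6 / L` and the last stretch to `x` costs `7 / L`;
    -- this fits within `28 / L`.
    have h1 := small_dist_le hq hX hd (fun a b => ‖f a - f b‖) (2 * (L ^ j : ℕ) * D) (by positivity)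
      (by simp) (fun a b c => norm_sub_le_norm_sub_add_norm_sub _ _ _)
      (fun v w _ hw h => hball w hw (L ^ j) (by omega) _ h) huX hv
    have h2 := hball u huX _ hxu x le_rfl
    have h3 := norm_sub_le_norm_sub_add_norm_sub (f x) (f ((L ^ j) • u)) (f ((L ^ j) • v))
    have h4 : (2 * (absMax (x - (L ^ j) • u) : ℕ) : ℝ) ≤ 7 * (L : ℝ) ^ j := by exact_mod_cast hxu
    have h5 : 2 * (absMax (x - (L ^ j) • u) : ℝ) * D ≤ 7 * (L : ℝ) ^ j * D :=
      mul_le_mul_of_nonneg_right h4 hDpos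
    have h6 : (L : ℝ) ^ j * D = 1 / L := by
      rw [hD, pow_succ]; field_simp
    have h7 : 0 ≤ 1 / (L : ℝ) := by positivity
    have h8 : 28 / (L : ℝ) = 28 * (1 / L) := by ring
    push_cast at h1
    rw [h8]
    nlinarith
  · rw [iterDiff_sub_const w hw0]
    have := hf w hw x hx
    have hpos : 1 ≤ w.length := List.length_pos_iff.mpr hw0
    rw [mul_add, pow_add, mul_one, NNReal.coe_one] at this
    rw [le_div_iff₀ hLpos]
    calc (L : ℝ) ^ (w.length * j) * ‖iterDiff w f x‖ * L
        ≤ (L : ℝ) ^ (w.length * j) * ‖iterDiff w f x‖ * (L : ℝ) ^ w.length := by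
          gcongr
          exact le_self_pow₀ hLone (by omega)
      _ = (L : ℝ) ^ (w.length * j) * (L : ℝ) ^ w.length * ‖iterDiff w f x‖ := by ring
      _ ≤ 28 := this.trans (by norm_num)

/-- The `(j + 1)`-block that contains a point of `X`, and the neighbourhoods of the `j`-blocks
around that point. -/
lemma exists_block_succ (hL : 3 ≤ L) (hodd : Odd L) (hd : L ^ (j + 1) ∣ N) {X : Finset (Torus N)}
    {x : Torus N} (hx : x ∈ X) : ∃ v : Torus N,
      x ∈ blk (L ^ (j + 1)) ((L ^ (j + 1)) • v) ∧
      blk (L ^ (j + 1)) ((L ^ (j + 1)) • v) ∈ blocksIn L (j + 1) (polymerClosure L (j + 1) X) ∧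
      ∀ u : Torus N, (L ^ j) • u = x →
        nbhd L j (blk (L ^ j) ((L ^ j) • u)) ⊆
          nbhd L (j + 1) (blk (L ^ (j + 1)) ((L ^ (j + 1)) • v)) := by
  classical
  have hq : Odd (L ^ j) := hodd.pow
  have hd' : L ^ j ∣ N := (pow_dvd_pow L (Nat.le_succ j)).trans hd
  obtain ⟨v, hv⟩ := exists_center (q := L ^ (j + 1)) hodd.pow x
  refine ⟨v, hv, mem_blocksIn.mpr ⟨mem_blocks.mpr ⟨v, rfl⟩, fun y hy => ?_⟩, ?_⟩
  · simp only [polymerClosure, Finset.mem_filter, Finset.mem_univ, true_and]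
    exact ⟨_, mem_blocks.mpr ⟨v, rfl⟩, hy, ⟨x, Finset.mem_inter.mpr ⟨hv, hx⟩⟩⟩
  · rintro u rfl z hz
    have hpol : IsPolymer L j (blk (L ^ j) ((L ^ j) • u)) := fun y hy =>
      ⟨_, mem_blocksIn.mpr ⟨mem_blocks.mpr ⟨u, rfl⟩, subset_rfl⟩, hy⟩
    obtain ⟨w, hwu, hzw⟩ := exists_center_of_mem_nbhd hq hd' hpol hz
    have hwu' := center_eq_of_mem_blk hq hd' (self_mem_blk _ _) (hwu (self_mem_blk _ _))
    rw [hwu'] at hzw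
    refine mem_nbhd_of_absMax_le hodd.pow hd (v := v) ?_ ?_
    · rw [Finset.inter_self]
      exact ⟨_, self_mem_blk _ _⟩
    · rw [mem_blk] at hv
      have h1 := absMax_sub_le z ((L ^ j) • u) ((L ^ (j + 1)) • v)
      have h2 : L ^ j * 3 ≤ L ^ (j + 1) := by rw [pow_succ]; exact Nat.mul_le_mul_left _ hL
      omega

lemma sq_le_card_blk {q : ℕ} (hq : Odd q) (hd : q ∣ N) (c : Torus N) : q ^ 2 ≤ (blk q c).card := by
  obtain ⟨m, hm⟩ := hq
  have hle : q ≤ N := Nat.le_of_dvd (Nat.pos_of_ne_zero (NeZero.ne N)) hd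
  have hcard : (Finset.range q ×ˢ Finset.range q).card = q ^ 2 := by simp [sq]
  rw [← hcard]
  refine Finset.card_le_card_of_injOn
    (fun p => c + ((((p.1 : ℤ) - m : ℤ) : ZMod N), (((p.2 : ℤ) - m : ℤ) : ZMod N))) ?_ ?_
  · rintro ⟨a, b⟩ hp
    simp only [Finset.coe_product, Finset.coe_range, Set.mem_prod, Set.mem_Iio] at hp
    simp only [Finset.mem_coe, mem_blk, add_sub_cancel_left]
    have := absMax_intCast_le (N := N) ((a : ℤ) - m) ((b : ℤ) - m) m (by omega) (by omega)
    omega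
  · rintro ⟨a, b⟩ hp ⟨a', b'⟩ hp' h
    simp only [Finset.coe_product, Finset.coe_range, Set.mem_prod, Set.mem_Iio] at hp hp'
    simp only [add_right_inj, Prod.mk.injEq, Int.cast_sub, sub_left_inj, Int.cast_natCast] at h
    have key : ∀ a b : ℕ, a < q → b < q → (a : ZMod N) = b → a = b := by
      intro a b ha hb hab
      rw [ZMod.natCast_eq_natCast_iff'] at hab
      rwa [Nat.mod_eq_of_lt (ha.trans_le hle), Nat.mod_eq_of_lt (hb.trans_le hle)] at hab
    exact Prod.ext (key _ _ hp.1 hp'.1 h.1) (key _ _ hp.2 hp'.2 h.2)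

/-- The square of the discrete gradient, summed over the four directions. -/
def gradSq (φ : Torus N → ℝ) (x : Torus N) : ℝ := ∑ μ : Fin 4, (diff μ φ x) ^ 2

lemma wHessSq_nonneg (X : Finset (Torus N)) (φ : Torus N → ℝ) : 0 ≤ wHessSq L j X φ :=
  Finset.sum_nonneg fun _ _ => sq_nonneg _

lemma sq_linfGrad_le_wHessSq {X B : Finset (Torus N)} (hB : B ∈ blocksIn L j X) (φ : Torus N → ℝ) :
    ((linfGrad L j 2 (nbhd L j B) φ : ℝ≥0) : ℝ) ^ 2 ≤ wHessSq L j X φ :=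
  Finset.single_le_sum (f := fun B => ((linfGrad L j 2 (nbhd L j B) φ : ℝ≥0) : ℝ) ^ 2)
    (fun _ _ => sq_nonneg _) hB

lemma gradSq_nonneg (φ : Torus N → ℝ) (x : Torus N) : 0 ≤ gradSq φ x :=
  Finset.sum_nonneg fun _ _ => sq_nonneg _

lemma l2GradSq_eq (hL : 0 < L) (X : Finset (Torus N)) (φ : Torus N → ℝ) :
    l2GradSq L j X φ = 1 / 2 * ∑ x ∈ X, gradSq φ x := by
  have hLpos : (0 : ℝ) < L := by exact_mod_cast hL
  simp only [l2GradSq, gradSq, ← Finset.mul_sum]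
  field_simp

lemma l2GradBdrySq_eq (hL : 0 < L) (X : Finset (Torus N)) (φ : Torus N → ℝ) :
    l2GradBdrySq L j X φ = 1 / 2 * (L : ℝ) ^ j * ∑ x ∈ bdry X, gradSq φ x := by
  have hLpos : (0 : ℝ) < L := by exact_mod_cast hL
  simp only [l2GradBdrySq, gradSq, ← Finset.mul_sum]
  rw [two_mul, pow_add]
  field_simp

/-- Within a `(j + 1)`-block the gradient varies by at most `L^{-(j+1)}` times the scaled Hessian
norm around its value at the centre. Averaging the resulting pointwise bound over the `L^{2(j+1)}`
sites of the block converts a value at one site into an `L²` norm plus a Hessian term. -/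
lemma gradSq_le (hL : 3 ≤ L) (hodd : Odd L) (hd : L ^ (j + 1) ∣ N) {X : Finset (Torus N)}
    {x : Torus N} (hx : x ∈ X) (φ : Torus N → ℝ) :
    (L : ℝ) ^ (2 * (j + 1)) * gradSq φ x ≤
      2 * ∑ y ∈ polymerClosure L (j + 1) X, gradSq φ y +
        32 * wHessSq L (j + 1) (polymerClosure L (j + 1) X) φ := by
  obtain ⟨v, hxv, hvX, -⟩ := exists_block_succ hL hodd hd hx
  set q := L ^ (j + 1) with hq
  set D := blk q (q • v) with hD
  set H : ℝ := ((linfGrad L (j + 1) 2 (nbhd L (j + 1) D) φ : ℝ≥0) : ℝ) with hH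
  have hqR : (0 : ℝ) < (L : ℝ) ^ (j + 1) := by
    have : (0 : ℝ) < L := by exact_mod_cast (by omega : 0 < L)
    positivity
  have hH0 : 0 ≤ H := NNReal.coe_nonneg _
  have hpol : IsPolymer L (j + 1) D := fun y hy =>
    ⟨D, mem_blocksIn.mpr ⟨mem_blocks.mpr ⟨v, rfl⟩, subset_rfl⟩, hy⟩
  have hDn : D ⊆ nbhd L (j + 1) D := hpol.subset_nbhd hodd.pow hd
  have hcenter : ∀ ν : Fin 4, ∀ y ∈ D, |diff ν φ y - diff ν φ (q • v)| ≤
      ((L : ℝ) ^ (j + 1))⁻¹ * H := by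
    intro ν y hy
    have := norm_sub_le_of_diff_le (diff ν φ) (q • v) ((q - 1) / 2)
      (((L : ℝ) ^ (2 * (j + 1)))⁻¹ * H) (by positivity) (fun z hz μ => ?_) y
      (by rw [mem_blk] at hy; have : Odd q := hodd.pow; obtain ⟨m, hm⟩ := this; omega)
    · rw [Real.norm_eq_abs] at this
      refine this.trans ?_
      have h1 : 2 * (((q - 1) / 2 : ℕ) : ℝ) ≤ (L : ℝ) ^ (j + 1) := by
        have : 2 * ((q - 1) / 2) ≤ L ^ (j + 1) := by omega
        exact_mod_cast this
      calc 2 * (((q - 1) / 2 : ℕ) : ℝ) * (((L : ℝ) ^ (2 * (j + 1)))⁻¹ * H)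
          ≤ (L : ℝ) ^ (j + 1) * (((L : ℝ) ^ (2 * (j + 1)))⁻¹ * H) := by gcongr
        _ = ((L : ℝ) ^ (j + 1))⁻¹ * H := by
          rw [mul_comm 2, pow_mul]; field_simp
    · have hzD : z ∈ D := by rw [hD, mem_blk]; omega
      have := le_linfGrad (L := L) (j := j + 1) φ [μ, ν] rfl (hDn hzD)
      rw [inv_mul_eq_div, le_div_iff₀ (by positivity), mul_comm]
      exact this
  have hcard : (L : ℝ) ^ (2 * (j + 1)) ≤ D.card := by
    have := sq_le_card_blk (N := N) (q := q) hodd.pow hd (q • v)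
    have h2 : L ^ (2 * (j + 1)) ≤ D.card := by
      rw [mul_comm, pow_mul]; exact this
    exact_mod_cast h2
  have hpoint : ∀ y ∈ D, gradSq φ x ≤ 2 * gradSq φ y + 32 * (((L : ℝ) ^ (j + 1))⁻¹ * H) ^ 2 := by
    intro y hy
    simp only [gradSq]
    rw [Finset.mul_sum]
    have : 32 * (((L : ℝ) ^ (j + 1))⁻¹ * H) ^ 2 =
        ∑ _ν : Fin 4, 8 * (((L : ℝ) ^ (j + 1))⁻¹ * H) ^ 2 := by
      simp; ring
    rw [this, ← Finset.sum_add_distrib]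
    refine Finset.sum_le_sum fun ν _ => ?_
    have h1 := hcenter ν x hxv
    have h2 := hcenter ν y hy
    set e := ((L : ℝ) ^ (j + 1))⁻¹ * H
    have h3 : |diff ν φ x - diff ν φ y| ≤ 2 * e := by
      have := abs_sub_le (diff ν φ x) (diff ν φ (q • v)) (diff ν φ y)
      rw [abs_sub_comm (diff ν φ (q • v))] at this
      linarith
    have h4 : (diff ν φ x - diff ν φ y) ^ 2 ≤ (2 * e) ^ 2 := sq_le_sq' (by linarith [abs_le.mp h3])
      (abs_le.mp h3).2
    nlinarith [sq_nonneg (diff ν φ x - 2 * diff ν φ y)]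
  have hsum : (D.card : ℝ) * gradSq φ x ≤
      2 * ∑ y ∈ D, gradSq φ y + D.card * (32 * (((L : ℝ) ^ (j + 1))⁻¹ * H) ^ 2) := by
    have := Finset.sum_le_sum hpoint
    rw [Finset.sum_const, nsmul_eq_mul, Finset.sum_add_distrib, ← Finset.mul_sum, Finset.sum_const,
      nsmul_eq_mul] at this
    exact this
  have hDsub : D ⊆ polymerClosure L (j + 1) X := (mem_blocksIn.mp hvX).2
  have h1 : ∑ y ∈ D, gradSq φ y ≤ ∑ y ∈ polymerClosure L (j + 1) X, gradSq φ y :=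
    Finset.sum_le_sum_of_subset_of_nonneg hDsub fun _ _ _ => gradSq_nonneg _ _
  have h2 : H ^ 2 ≤ wHessSq L (j + 1) (polymerClosure L (j + 1) X) φ :=
    sq_linfGrad_le_wHessSq hvX φ
  have hS : 0 ≤ ∑ y ∈ D, gradSq φ y := Finset.sum_nonneg fun _ _ => gradSq_nonneg _ _
  have hcpos : (0 : ℝ) < D.card := lt_of_lt_of_le (by positivity) hcard
  have e1 : (L : ℝ) ^ (2 * (j + 1)) * (((L : ℝ) ^ (j + 1))⁻¹ * H) ^ 2 = H ^ 2 := by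
    rw [mul_comm 2, pow_mul]; field_simp
  have h3 : gradSq φ x - 32 * (((L : ℝ) ^ (j + 1))⁻¹ * H) ^ 2 ≤ 2 * (∑ y ∈ D, gradSq φ y) / D.card := by
    rw [le_div_iff₀ hcpos]; linarith
  have h4 : (L : ℝ) ^ (2 * (j + 1)) * (2 * (∑ y ∈ D, gradSq φ y) / D.card) ≤
      2 * ∑ y ∈ D, gradSq φ y := by
    rw [mul_div_assoc', div_le_iff₀ hcpos, mul_comm]
    gcongr
  have h5 := mul_le_mul_of_nonneg_left h3 (by positivity : 0 ≤ (L : ℝ) ^ (2 * (j + 1)))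
  nlinarith

/-- Two derivatives rescaled from `j` to `j + 1` gain `L²`, hence `L⁴` after squaring. Each of the
at most four blocks of `X` has its neighbourhood inside that of a `(j + 1)`-block of the closure. -/
lemma wHessSq_le (hL : 3 ≤ L) (hodd : Odd L) (hd : L ^ (j + 1) ∣ N) {X : Finset (Torus N)}
    (hX : IsSmall L j X) (φ : Torus N → ℝ) :
    (L : ℝ) ^ 4 * wHessSq L j X φ ≤ 4 * wHessSq L (j + 1) (polymerClosure L (j + 1) X) φ := by
  have hLpos : (0 : ℝ) < L := by exact_mod_cast (by omega : 0 < L)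
  set W := wHessSq L (j + 1) (polymerClosure L (j + 1) X) φ with hW
  have hterm : ∀ B ∈ blocksIn L j X,
      (L : ℝ) ^ 4 * ((linfGrad L j 2 (nbhd L j B) φ : ℝ≥0) : ℝ) ^ 2 ≤ W := by
    intro B hB
    obtain ⟨hB, hBX⟩ := mem_blocksIn.mp hB
    obtain ⟨u, rfl⟩ := mem_blocks.mp hB
    obtain ⟨v, -, hvX, hn⟩ := exists_block_succ hL hodd hd (hBX (self_mem_blk _ _))
    set H := linfGrad L (j + 1) 2 (nbhd L (j + 1) (blk (L ^ (j + 1)) ((L ^ (j + 1)) • v))) φ with hH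
    have h1 : linfGrad L j 2 (nbhd L j (blk (L ^ j) ((L ^ j) • u))) φ ≤ H / (L : ℝ≥0) ^ 2 := by
      rw [linfGrad_le_iff]
      intro w hw x hx
      have := le_linfGrad (L := L) (j := j + 1) φ w hw (hn u rfl hx)
      push_cast
      rw [le_div_iff₀ (by positivity)]
      refine le_trans (le_of_eq ?_) this
      rw [mul_add, pow_add]; ring
    have h2 : (H : ℝ) ^ 2 ≤ W := sq_linfGrad_le_wHessSq hvX φ
    have h3 : ((linfGrad L j 2 (nbhd L j (blk (L ^ j) ((L ^ j) • u))) φ : ℝ≥0) : ℝ) ≤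
        H / (L : ℝ) ^ 2 := by
      have := NNReal.coe_le_coe.mpr h1
      rwa [NNReal.coe_div, NNReal.coe_pow, NNReal.coe_natCast] at this
    generalize linfGrad L j 2 (nbhd L j (blk (L ^ j) ((L ^ j) • u))) φ = H' at h3 ⊢
    clear_value H W
    calc (L : ℝ) ^ 4 * (H' : ℝ) ^ 2
        ≤ (L : ℝ) ^ 4 * (H / (L : ℝ) ^ 2) ^ 2 := by gcongr
      _ = (H : ℝ) ^ 2 := by field_simp
      _ ≤ W := h2
  calc (L : ℝ) ^ 4 * wHessSq L j X φ
      = ∑ B ∈ blocksIn L j X, (L : ℝ) ^ 4 * ((linfGrad L j 2 (nbhd L j B) φ : ℝ≥0) : ℝ) ^ 2 := by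
        rw [wHessSq, Finset.mul_sum]
    _ ≤ (blocksIn L j X).card • W := Finset.sum_le_card_nsmul _ _ _ hterm
    _ ≤ 4 * W := by
      rw [nsmul_eq_mul]
      have : ((blocksIn L j X).card : ℝ) ≤ 4 := by exact_mod_cast hX.2
      exact mul_le_mul_of_nonneg_right this (wHessSq_nonneg _ _)

/-- The exponent of the field regulator. -/
def regExp (c₁ c₃ : ℝ) (L j : ℕ) (X : Finset (Torus N)) (φ : Torus N → ℝ) : ℝ :=
  c₁ * l2GradSq L j X φ + c₃ * l2GradBdrySq L j X φ + c₁ * wHessSq L j X φ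

lemma regulator_eq (c₁ c₃ κ : ℝ) (X : Finset (Torus N)) (φ : Torus N → ℝ) :
    regulator c₁ c₃ κ L j X φ = Real.exp (κ * regExp c₁ c₃ L j X φ) := by
  rw [regulator, regExp]; congr 1; ring

/-- For small polymers, the regulator on scale `j` is dominated by that on scale `j + 1`. -/
lemma two_mul_regExp_le {c₁ c₃ : ℝ} (hc₁ : 0 < c₁) (hc₃ : 0 < c₃) (hL : 3 ≤ L) (hodd : Odd L)
    (hd : L ^ (j + 1) ∣ N) (hLc : 136 * c₁ + 512 * c₃ ≤ (L : ℝ) ^ 2 * c₁) {X : Finset (Torus N)}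
    (hX : IsSmall L j X) (φ : Torus N → ℝ) :
    2 * regExp c₁ c₃ L j X φ ≤ regExp c₁ c₃ L (j + 1) (polymerClosure L (j + 1) X) φ := by
  have hLpos : (0 : ℝ) < L := by exact_mod_cast (by omega : 0 < L)
  have hd' : L ^ j ∣ N := (pow_dvd_pow L (Nat.le_succ j)).trans hd
  rw [regExp, regExp, l2GradSq_eq (by omega), l2GradSq_eq (by omega), l2GradBdrySq_eq (by omega),
    l2GradBdrySq_eq (by omega)]
  set G := ∑ y ∈ polymerClosure L (j + 1) X, gradSq φ y with hG
  set W := wHessSq L (j + 1) (polymerClosure L (j + 1) X) φ with hW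
  have hW0 : 0 ≤ W := wHessSq_nonneg _ _
  have hG0 : 0 ≤ G := Finset.sum_nonneg fun _ _ => gradSq_nonneg _ _
  have hb : 0 ≤ ∑ x ∈ bdry (polymerClosure L (j + 1) X), gradSq φ x :=
    Finset.sum_nonneg fun _ _ => gradSq_nonneg _ _
  -- A uniform bound for the squared gradient on `X`. Since `X` has at most `4 L^{2j}` sites and
  -- `L^j` times its boundary at most `16 L^{2j}`, both gradient terms become `O(L^{2j} T)`, smaller
  -- by `L^{-2}` than the terms on scale `j + 1`.
  set T : ℝ := (2 * G + 32 * W) / (L : ℝ) ^ (2 * (j + 1)) with hT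
  have hT0 : 0 ≤ T := by positivity
  have hx : ∀ x ∈ X, gradSq φ x ≤ T := fun x hx => by
    rw [hT, le_div_iff₀ (by positivity), mul_comm]
    exact gradSq_le hL hodd hd hx φ
  have hTL : (L : ℝ) ^ 2 * (((L : ℝ) ^ j) ^ 2 * T) = 2 * G + 32 * W := by
    rw [hT, mul_add, pow_add, ← pow_mul, mul_comm j 2, mul_one]
    field_simp
  set Y : ℝ := ((L : ℝ) ^ j) ^ 2 * T with hY
  have h1 : ∑ x ∈ X, gradSq φ x ≤ 4 * Y := by
    refine (Finset.sum_le_card_nsmul _ _ _ hx).trans ?_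
    rw [nsmul_eq_mul, hY, ← mul_assoc]
    refine mul_le_mul_of_nonneg_right ?_ hT0
    exact_mod_cast hX.card_le hodd.pow
  have h2 : (L : ℝ) ^ j * ∑ x ∈ bdry X, gradSq φ x ≤ 16 * Y := by
    have : ∑ x ∈ bdry X, gradSq φ x ≤ 16 * (L : ℝ) ^ j * T := by
      refine (Finset.sum_le_card_nsmul _ _ T fun x hx' => hx x ?_).trans ?_
      · exact (Finset.mem_filter.mp hx').1
      · rw [nsmul_eq_mul]
        refine mul_le_mul_of_nonneg_right ?_ hT0
        exact_mod_cast hX.card_bdry_le hodd.pow hd'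
    calc (L : ℝ) ^ j * ∑ x ∈ bdry X, gradSq φ x ≤ (L : ℝ) ^ j * (16 * (L : ℝ) ^ j * T) := by gcongr
      _ = 16 * Y := by rw [hY]; ring
  have h3 := wHessSq_le hL hodd hd hX φ
  rw [← hW] at h3
  have hV0 : 0 ≤ wHessSq L j X φ := wHessSq_nonneg _ _
  generalize wHessSq L j X φ = V at h3 hV0 ⊢
  clear_value W G
  have hL2 : (1 : ℝ) ≤ (L : ℝ) ^ 2 := one_le_pow₀ (by exact_mod_cast (by omega : 1 ≤ L))
  have h4 : (L : ℝ) ^ 2 * V ≤ 4 * W := by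
    refine le_trans ?_ h3
    have : (L : ℝ) ^ 2 ≤ (L : ℝ) ^ 4 := pow_le_pow_right₀ (by exact_mod_cast (by omega : 1 ≤ L)) (by norm_num)
    gcongr
  set A := ∑ x ∈ X, gradSq φ x
  set Bd := (L : ℝ) ^ j * ∑ x ∈ bdry X, gradSq φ x with hBd
  have e2 : c₃ * (1 / 2 * (L : ℝ) ^ j * ∑ x ∈ bdry X, gradSq φ x) = c₃ / 2 * Bd := by
    rw [hBd]; ring
  rw [e2]
  have h5 : 0 ≤ c₃ * (1 / 2 * (L : ℝ) ^ (j + 1) *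
      ∑ x ∈ bdry (polymerClosure L (j + 1) X), gradSq φ x) := by positivity
  -- After multiplication by `L²` the left side no longer carries inverse powers of `L`; its
  -- coefficients `8c₁ + 32c₃` and `136c₁ + 512c₃` are what the hypothesis `hLc` beats.
  suffices hs : (L : ℝ) ^ 2 * (2 * (c₁ * (1 / 2 * A) + c₃ / 2 * Bd + c₁ * V)) ≤
      (L : ℝ) ^ 2 * (c₁ * (1 / 2 * G) + c₁ * W) by
    have := le_of_mul_le_mul_left hs (by positivity)
    linarith
  have h6 : c₁ * A ≤ c₁ * (4 * Y) := by gcongr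
  have h7 : c₃ * Bd ≤ c₃ * (16 * Y) := by gcongr
  have h8 : c₁ * ((L : ℝ) ^ 2 * V) ≤ c₁ * (4 * W) := by gcongr
  calc (L : ℝ) ^ 2 * (2 * (c₁ * (1 / 2 * A) + c₃ / 2 * Bd + c₁ * V))
      = (L : ℝ) ^ 2 * (c₁ * A + c₃ * Bd) + 2 * (c₁ * ((L : ℝ) ^ 2 * V)) := by ring
    _ ≤ (L : ℝ) ^ 2 * (c₁ * (4 * Y) + c₃ * (16 * Y)) + 2 * (c₁ * (4 * W)) := by gcongr
    _ = (4 * c₁ + 16 * c₃) * ((L : ℝ) ^ 2 * Y) + 8 * c₁ * W := by ring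
    _ = (8 * c₁ + 32 * c₃) * G + (136 * c₁ + 512 * c₃) * W := by rw [hTL]; ring
    _ ≤ (1 / 2 * ((L : ℝ) ^ 2 * c₁)) * G + ((L : ℝ) ^ 2 * c₁) * W := by
        gcongr
        linarith
    _ = (L : ℝ) ^ 2 * (c₁ * (1 / 2 * G) + c₁ * W) := by ring

end Scales

/-! ### Exponential moments of Gaussian quadratic forms -/

section ExpMoments

/-- `∫ exp (x² / (4u)) ≤ 2` for a centred Gaussian of variance at most `u`. -/
lemma lintegral_exp_sq_gaussianReal_le {v : ℝ≥0} {u : ℝ} (hu : 0 < u) (hv : (v : ℝ) ≤ u) {t : ℝ}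
    (ht : t * (4 * u) ≤ 1) :
    ∫⁻ x, ENNReal.ofReal (Real.exp (t * x ^ 2)) ∂(gaussianReal 0 v) ≤ 2 := by
  by_cases hv0 : v = 0
  · subst hv0
    rw [gaussianReal_zero_var, lintegral_dirac' _ (by fun_prop)]
    norm_num
  have hvpos : (0 : ℝ) < v := lt_of_le_of_ne v.2 fun h => hv0 (NNReal.eq h.symm)
  have htv : t ≤ 1 / (4 * v) := by
    rw [le_div_iff₀ (by positivity)]
    rcases le_or_gt t 0 with h | h
    · nlinarith
    · nlinarith
  rw [gaussianReal_of_var_ne_zero _ hv0, lintegral_withDensity_eq_lintegral_mul _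
    (measurable_gaussianPDF 0 v) (by fun_prop)]
  have hb : 0 < 1 / (4 * (v : ℝ)) := by positivity
  have hle : ∀ x : ℝ, (gaussianPDF 0 v * fun x => ENNReal.ofReal (Real.exp (t * x ^ 2))) x ≤
      ENNReal.ofReal ((√(2 * Real.pi * v))⁻¹ * Real.exp (-(1 / (4 * v)) * x ^ 2)) := by
    intro x
    rw [Pi.mul_apply, gaussianPDF, ← ENNReal.ofReal_mul (gaussianPDFReal_nonneg _ _ _)]
    apply ENNReal.ofReal_le_ofReal
    rw [gaussianPDFReal, mul_assoc, ← Real.exp_add]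
    gcongr
    have h1 : t * x ^ 2 ≤ 1 / (4 * v) * x ^ 2 := by gcongr
    have h2 : -(x - 0) ^ 2 / (2 * (v : ℝ)) = -(1 / (4 * v)) * x ^ 2 - 1 / (4 * v) * x ^ 2 := by
      field_simp; ring
    rw [h2]
    linarith
  refine (lintegral_mono hle).trans ?_
  rw [← ofReal_integral_eq_lintegral_ofReal ((integrable_exp_neg_mul_sq hb).const_mul _)
    (Eventually.of_forall fun x => by positivity), integral_const_mul, integral_gaussian]
  rw [← ENNReal.ofReal_ofNat 2]
  apply ENNReal.ofReal_le_ofReal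
  rw [← Real.sqrt_inv, ← Real.sqrt_mul (by positivity)]
  rw [Real.sqrt_le_left (by norm_num)]
  have hpi := Real.pi_pos
  -- At the worst admissible `t` the Gaussian width doubles and the integral equals `√2`.
  have : (2 * Real.pi * (v : ℝ))⁻¹ * (Real.pi / (1 / (4 * v))) = 2 := by field_simp; norm_num
  rw [this]; norm_num

variable {V : Type*} [MeasurableSpace V]

/-- `∫ exp (t Q) ≤ 2` for `0 ≤ t ≤ 1 / s`. -/
def ExpBdd (P : Measure V) (Q : V → ℝ) (s : ℝ) : Prop :=
  Measurable Q ∧ ∀ t : ℝ, 0 ≤ t → t * s ≤ 1 → ∫⁻ x, ENNReal.ofReal (Real.exp (t * Q x)) ∂P ≤ 2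

variable {P : Measure V} {Q Q' : V → ℝ} {s s' : ℝ}

lemma ExpBdd.mono (h : ExpBdd P Q s) (hm : Measurable Q') (hQ : ∀ x, Q' x ≤ Q x) (hs : s ≤ s') :
    ExpBdd P Q' s' := by
  refine ⟨hm, fun t ht hts => (lintegral_mono fun x => ?_).trans (h.2 t ht ?_)⟩
  · have := hQ x
    gcongr
  · exact (mul_le_mul_of_nonneg_left hs ht).trans hts

lemma ExpBdd.const_mul (h : ExpBdd P Q s) {a : ℝ} (ha : 0 ≤ a) :
    ExpBdd P (fun x => a * Q x) (a * s) := by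
  refine ⟨h.1.const_mul a, fun t ht hts => ?_⟩
  have := h.2 (t * a) (by positivity) (by linarith)
  simpa only [mul_assoc] using this

/-- Convexity of `exp` with equal weights bounds the exponential of a sum by an average of
exponentials. No independence is needed; the price is the factor `S.card` in the admissible
exponent. -/
lemma ExpBdd.sum [IsProbabilityMeasure P] {ι : Type*} {S : Finset ι} {Q : ι → V → ℝ}
    (h : ∀ i ∈ S, ExpBdd P (Q i) s) :
    ExpBdd P (fun x => ∑ i ∈ S, Q i x) (S.card * s) := by
  refine ⟨Finset.measurable_sum S fun i hi => (h i hi).1, fun t ht hts => ?_⟩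
  rcases S.eq_empty_or_nonempty with rfl | hne
  · simp
  set n : ℝ := (S.card : ℝ) with hn
  have hn0 : 0 < n := by
    rw [hn, Nat.cast_pos]
    exact Finset.card_pos.mpr hne
  have hle : ∀ x, ENNReal.ofReal (Real.exp (t * ∑ i ∈ S, Q i x)) ≤
      ∑ i ∈ S, ENNReal.ofReal n⁻¹ * ENNReal.ofReal (Real.exp (t * n * Q i x)) := by
    intro x
    have h1 := convexOn_exp.map_sum_le (t := S) (w := fun _ => n⁻¹) (p := fun i => t * n * Q i x)
      (fun _ _ => by positivity) (by simp [← hn, hn0.ne']) (fun _ _ => Set.mem_univ _)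
    have h2 : ∑ i ∈ S, n⁻¹ • (t * n * Q i x) = t * ∑ i ∈ S, Q i x := by
      rw [Finset.mul_sum]
      refine Finset.sum_congr rfl fun i _ => ?_
      rw [smul_eq_mul]; field_simp
    rw [h2] at h1
    refine (ENNReal.ofReal_le_ofReal h1).trans (le_of_eq ?_)
    rw [ENNReal.ofReal_sum_of_nonneg (fun _ _ => by positivity)]
    refine Finset.sum_congr rfl fun i _ => ?_
    rw [smul_eq_mul, ENNReal.ofReal_mul (by positivity)]
  refine (lintegral_mono hle).trans ?_
  rw [lintegral_finsetSum' S fun i hi => by have := (h i hi).1; fun_prop]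
  calc ∑ i ∈ S, ∫⁻ x, ENNReal.ofReal n⁻¹ * ENNReal.ofReal (Real.exp (t * n * Q i x)) ∂P
      ≤ ∑ i ∈ S, ENNReal.ofReal n⁻¹ * 2 := by
        refine Finset.sum_le_sum fun i hi => ?_
        rw [lintegral_const_mul _ (by have := (h i hi).1; fun_prop)]
        gcongr
        exact (h i hi).2 _ (by positivity) (by linarith)
    _ = 2 := by
      rw [Finset.sum_const, nsmul_eq_mul, ← mul_assoc]
      have : (S.card : ℝ≥0∞) = ENNReal.ofReal n := by rw [hn, ENNReal.ofReal_natCast]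
      rw [this, ← ENNReal.ofReal_mul hn0.le, mul_inv_cancel₀ hn0.ne']; simp

/-- Convexity with the weights `s / (s + s')` and `s' / (s + s')`, chosen so that both exponents
become admissible at the same time. -/
lemma ExpBdd.add (h : ExpBdd P Q s) (h' : ExpBdd P Q' s') (hs : 0 < s) (hs' : 0 < s') :
    ExpBdd P (fun x => Q x + Q' x) (s + s') := by
  refine ⟨h.1.add h'.1, fun t ht hts => ?_⟩
  set p := s / (s + s') with hp
  set p' := s' / (s + s') with hp'
  have hpp : p + p' = 1 := by rw [hp, hp']; field_simp
  have hp0 : 0 < p := by positivity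
  have hp0' : 0 < p' := by positivity
  have hle : ∀ x, ENNReal.ofReal (Real.exp (t * (Q x + Q' x))) ≤
      ENNReal.ofReal p * ENNReal.ofReal (Real.exp (t / p * Q x)) +
        ENNReal.ofReal p' * ENNReal.ofReal (Real.exp (t / p' * Q' x)) := by
    intro x
    have h1 := convexOn_exp.2 (Set.mem_univ (t / p * Q x)) (Set.mem_univ (t / p' * Q' x))
      hp0.le hp0'.le hpp
    have h2 : p • (t / p * Q x) + p' • (t / p' * Q' x) = t * (Q x + Q' x) := by
      simp only [smul_eq_mul]; field_simp
    rw [h2] at h1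
    refine (ENNReal.ofReal_le_ofReal h1).trans (le_of_eq ?_)
    rw [smul_eq_mul, smul_eq_mul, ENNReal.ofReal_add (by positivity) (by positivity),
      ENNReal.ofReal_mul hp0.le, ENNReal.ofReal_mul hp0'.le]
  have hm := h.1
  have hm' := h'.1
  refine (lintegral_mono hle).trans ?_
  rw [lintegral_add_left (by fun_prop), lintegral_const_mul _ (by fun_prop),
    lintegral_const_mul _ (by fun_prop)]
  have e1 : t / p * s = t * (s + s') := by rw [hp]; field_simp
  have e2 : t / p' * s' = t * (s + s') := by rw [hp']; field_simp
  calc ENNReal.ofReal p * ∫⁻ x, ENNReal.ofReal (Real.exp (t / p * Q x)) ∂P +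
        ENNReal.ofReal p' * ∫⁻ x, ENNReal.ofReal (Real.exp (t / p' * Q' x)) ∂P
      ≤ ENNReal.ofReal p * 2 + ENNReal.ofReal p' * 2 := by
        gcongr
        · exact h.2 _ (by positivity) (by linarith)
        · exact h'.2 _ (by positivity) (by linarith)
    _ = 2 := by
      rw [← add_mul, ← ENNReal.ofReal_add hp0.le hp0'.le, hpp]; simp

end ExpMoments

/-! ### The fluctuation field -/

section Field

variable {N : ℕ} [NeZero N] {Γ : Torus N → ℝ}

set_option linter.unusedSectionVars false

instance : IsProbabilityMeasure (fieldLaw Γ) :=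
  Measure.isProbabilityMeasure_map (by fun_prop)

/-- Linear functionals of the fluctuation field are Gaussian. -/
lemma map_sum_fieldLaw (hΓ : (covMatrix Γ).PosSemidef) (a : Torus N → ℝ) :
    (fieldLaw Γ).map (fun ζ => ∑ x, a x * ζ x) =
      gaussianReal 0 (∑ x, ∑ y, a x * a y * Γ (x - y)).toNNReal := by
  rw [fieldLaw, Measure.map_map (by fun_prop) (by fun_prop)]
  let A : EuclideanSpace ℝ (Torus N) := WithLp.toLp 2 a
  have h1 : ((fun ζ : Torus N → ℝ => ∑ x, a x * ζ x) ∘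
      fun v : EuclideanSpace ℝ (Torus N) => v.ofLp) = innerSL ℝ A := by
    ext v
    simp [A, PiLp.inner_apply, mul_comm]
  rw [h1, IsGaussian.map_eq_gaussianReal, ContinuousLinearMap.integral_comp_id_comm
    IsGaussian.integrable_id]
  congr 2
  · simp
  · have h2 := covarianceBilin_self (μ := multivariateGaussian 0 (covMatrix Γ)) 
      IsGaussian.memLp_two_id A
    rw [covarianceBilin_multivariateGaussian hΓ] at h2
    have h3 : (⇑(innerSL ℝ A) : EuclideanSpace ℝ (Torus N) → ℝ) = fun u => inner ℝ A u := by
      ext; simp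
    rw [h3, ← h2]
    simp only [A, dotProduct, Matrix.mulVec, covMatrix, Matrix.of_apply, Finset.mul_sum]
    refine Finset.sum_congr rfl fun x _ => Finset.sum_congr rfl fun y _ => by ring

/-- The coefficients of `f ↦ ∂^w f (x)`. -/
def diffCoeff : List (Fin 4) → Torus N → Torus N → ℝ
  | [], x => Pi.single x 1
  | μ :: w, x => fun y => diffCoeff w (x + dir N μ) y - diffCoeff w x y

lemma sum_diffCoeff (w : List (Fin 4)) (x : Torus N) (f : Torus N → ℝ) :
    ∑ y, diffCoeff w x y * f y = iterDiff w f x := by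
  induction w generalizing x with
  | nil => simp [diffCoeff, Pi.single_apply]
  | cons μ w ih => simp [diffCoeff, sub_mul, Finset.sum_sub_distrib, ih, diff]

lemma iterDiff_reflect (w : List (Fin 4)) (H : Torus N → ℝ) (y x : Torus N) :
    iterDiff w (fun z => H (y - z)) x = iterDiff (w.map opp) H (y - x) := by
  induction w generalizing x with
  | nil => simp
  | cons μ w ih =>
    simp only [iterDiff_cons, List.map_cons]
    change iterDiff w (fun z => H (y - z)) (x + dir N μ) - iterDiff w (fun z => H (y - z)) x =
      iterDiff (w.map opp) H (y - x + dir N (opp μ)) - iterDiff (w.map opp) H (y - x)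
    rw [ih, ih, dir_opp]
    congr 2; abel

lemma iterDiff_translate (w : List (Fin 4)) (H : Torus N → ℝ) (a x : Torus N) :
    iterDiff w (fun z => H (z - a)) x = iterDiff w H (x - a) := by
  induction w generalizing x with
  | nil => simp
  | cons μ w ih =>
    simp only [iterDiff_cons]
    change iterDiff w (fun z => H (z - a)) (x + dir N μ) - iterDiff w (fun z => H (z - a)) x =
      iterDiff w H (x - a + dir N μ) - iterDiff w H (x - a)
    rw [ih, ih]
    congr 2; abel

/-- Derivatives in the second argument of `Γ(y - z)` act on `Γ` in opposite directions. The variance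
of `∂^w ζ` is therefore a derivative of `Γ` at `0` of twice the order, to which the derivative
bounds of the decomposition apply. -/
lemma variance_diffCoeff (w : List (Fin 4)) (x : Torus N) :
    ∑ y, ∑ z, diffCoeff w x y * diffCoeff w x z * Γ (y - z) =
      iterDiff (w ++ w.map opp) Γ 0 := by
  have h1 : ∀ y, ∑ z, diffCoeff w x y * diffCoeff w x z * Γ (y - z) =
      diffCoeff w x y * iterDiff (w.map opp) Γ (y - x) := by
    intro y
    rw [← iterDiff_reflect, ← sum_diffCoeff, Finset.mul_sum]
    exact Finset.sum_congr rfl fun z _ => by ring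
  simp only [h1]
  rw [sum_diffCoeff w x (fun y => iterDiff (w.map opp) Γ (y - x)), iterDiff_translate, sub_self,
    iterDiff_append]

lemma map_iterDiff_fieldLaw (hΓ : (covMatrix Γ).PosSemidef) (w : List (Fin 4)) (x : Torus N) :
    (fieldLaw Γ).map (fun ζ => iterDiff w ζ x) =
      gaussianReal 0 (iterDiff (w ++ w.map opp) Γ 0).toNNReal := by
  rw [← variance_diffCoeff w x, ← map_sum_fieldLaw hΓ]
  simp only [sum_diffCoeff]

lemma continuous_iterDiff (w : List (Fin 4)) (x : Torus N) :
    Continuous fun ζ : Torus N → ℝ => iterDiff w ζ x := by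
  simp only [← sum_diffCoeff]
  fun_prop

lemma expBdd_iterDiff_sq (hΓ : (covMatrix Γ).PosSemidef) (w : List (Fin 4)) (x : Torus N) {u : ℝ}
    (hu : 0 < u) (h : iterDiff (w ++ w.map opp) Γ 0 ≤ u) :
    ExpBdd (fieldLaw Γ) (fun ζ => (iterDiff w ζ x) ^ 2) (4 * u) := by
  have hm : Measurable fun ζ : Torus N → ℝ => iterDiff w ζ x := (continuous_iterDiff w x).measurable
  refine ⟨hm.pow_const 2, fun t _ hts => ?_⟩
  have := lintegral_exp_sq_gaussianReal_le (v := (iterDiff (w ++ w.map opp) Γ 0).toNNReal) hu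
    (by rw [Real.coe_toNNReal']; exact max_le h hu.le) hts
  rw [← map_iterDiff_fieldLaw hΓ w x, lintegral_map (by fun_prop) hm] at this
  exact this

end Field

/-! ### A discrete Sobolev inequality -/

section Sobolev

/-- For every `i < l`, `|g 0|` is at most `|g i|` plus the total variation on the interval; summing
over `i` gives the claim. -/
lemma abs_le_avg_add_sum (g : ℕ → ℝ) (l : ℕ) :
    (l : ℝ) * |g 0| ≤ ∑ i ∈ Finset.range l, (|g i| + l * |g (i + 1) - g i|) := by
  have h1 : ∀ i ∈ Finset.range l, |g 0| ≤ |g i| + ∑ k ∈ Finset.range l, |g (k + 1) - g k| := by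
    intro i hi
    have h2 : g 0 = g i - ∑ k ∈ Finset.range i, (g (k + 1) - g k) := by
      rw [Finset.sum_range_sub]; ring
    have h3 : |∑ k ∈ Finset.range i, (g (k + 1) - g k)| ≤
        ∑ k ∈ Finset.range l, |g (k + 1) - g k| :=
      (Finset.abs_sum_le_sum_abs _ _).trans (Finset.sum_le_sum_of_subset_of_nonneg
        (Finset.range_subset_range.mpr (Finset.mem_range.mp hi).le) fun _ _ _ => abs_nonneg _)
    calc |g 0| = |g i - ∑ k ∈ Finset.range i, (g (k + 1) - g k)| := by rw [← h2]
      _ ≤ _ := (abs_sub _ _).trans (by gcongr)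
  have h4 := Finset.sum_le_sum h1
  rw [Finset.sum_const, Finset.card_range, nsmul_eq_mul, Finset.sum_add_distrib, Finset.sum_const,
    Finset.card_range, nsmul_eq_mul] at h4
  rw [Finset.sum_add_distrib, ← Finset.mul_sum]
  exact h4

/-- The one-dimensional inequality is applied in each coordinate, which creates the mixed second
difference; Cauchy–Schwarz over the `l²` sites and then over the four terms gives the squares. Only
the square with corner at the origin is used, so no boundary condition enters. -/
lemma sq_le_sobolev_nat (F : ℕ → ℕ → ℝ) {l : ℕ} (hl : 0 < l) :
    (l : ℝ) ^ 2 * (F 0 0) ^ 2 ≤ 4 * ∑ p ∈ Finset.range l ×ˢ Finset.range l,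
      ((F p.1 p.2) ^ 2 + (l * (F p.1 (p.2 + 1) - F p.1 p.2)) ^ 2 +
        (l * (F (p.1 + 1) p.2 - F p.1 p.2)) ^ 2 +
        (l ^ 2 * (F (p.1 + 1) (p.2 + 1) - F p.1 (p.2 + 1) - (F (p.1 + 1) p.2 - F p.1 p.2))) ^ 2) := by
  have hl' : (0 : ℝ) < l := by exact_mod_cast hl
  let a : ℕ × ℕ → ℝ := fun p => |F p.1 p.2| + l * |F p.1 (p.2 + 1) - F p.1 p.2| +
    l * |F (p.1 + 1) p.2 - F p.1 p.2| +
    l ^ 2 * |F (p.1 + 1) (p.2 + 1) - F p.1 (p.2 + 1) - (F (p.1 + 1) p.2 - F p.1 p.2)|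
  have h1 : (l : ℝ) ^ 2 * |F 0 0| ≤ ∑ p ∈ Finset.range l ×ˢ Finset.range l, a p := by
    have h2 := abs_le_avg_add_sum (fun i => F i 0) l
    have h3 : ∀ i ∈ Finset.range l, (l : ℝ) * (|F i 0| + l * |F (i + 1) 0 - F i 0|) ≤
        ∑ k ∈ Finset.range l, a (i, k) := by
      intro i _
      have h4 := abs_le_avg_add_sum (fun k => F i k) l
      have h5 := abs_le_avg_add_sum (fun k => F (i + 1) k - F i k) l
      have h6 := mul_le_mul_of_nonneg_left h5 hl'.le
      rw [Finset.mul_sum] at h6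
      have h7 := add_le_add h4 h6
      rw [← Finset.sum_add_distrib] at h7
      refine le_trans (le_of_eq (by ring)) (h7.trans (le_of_eq (Finset.sum_congr rfl fun k _ => ?_)))
      simp only [a]
      ring
    rw [Finset.sum_product]
    refine le_trans ?_ (Finset.sum_le_sum h3)
    rw [← Finset.mul_sum, sq, mul_assoc]
    gcongr
  have h2 : ((l : ℝ) ^ 2 * |F 0 0|) ^ 2 ≤ (l : ℝ) ^ 2 *
      ∑ p ∈ Finset.range l ×ˢ Finset.range l, (a p) ^ 2 := by
    have h3 := sq_sum_le_card_mul_sum_sq (s := Finset.range l ×ˢ Finset.range l) (f := a)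
    rw [Finset.card_product, Finset.card_range, ← sq, Nat.cast_pow] at h3
    exact (pow_le_pow_left₀ (by positivity) h1 2).trans h3
  have h3 : ((l : ℝ) ^ 2 * |F 0 0|) ^ 2 = (l : ℝ) ^ 2 * ((l : ℝ) ^ 2 * (F 0 0) ^ 2) := by
    rw [mul_pow, sq_abs]; ring
  rw [h3] at h2
  refine (le_of_mul_le_mul_left h2 (by positivity)).trans ?_
  rw [Finset.mul_sum]
  refine Finset.sum_le_sum fun p _ => ?_
  simp only [a, mul_pow]
  rw [← sq_abs (F p.1 p.2), ← sq_abs (F p.1 (p.2 + 1) - F p.1 p.2),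
    ← sq_abs (F (p.1 + 1) p.2 - F p.1 p.2),
    ← sq_abs (F (p.1 + 1) (p.2 + 1) - F p.1 (p.2 + 1) - (F (p.1 + 1) p.2 - F p.1 p.2))]
  generalize |F p.1 p.2| = x
  generalize |F p.1 (p.2 + 1) - F p.1 p.2| = y
  generalize |F (p.1 + 1) p.2 - F p.1 p.2| = z
  generalize |F (p.1 + 1) (p.2 + 1) - F p.1 (p.2 + 1) - (F (p.1 + 1) p.2 - F p.1 p.2)| = w
  nlinarith [sq_nonneg (x - l * y), sq_nonneg (x - l * z), sq_nonneg (x - l ^ 2 * w),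
    sq_nonneg (l * y - l * z), sq_nonneg (l * y - l ^ 2 * w), sq_nonneg (l * z - l ^ 2 * w)]

/-- The derivatives that occur in the discrete Sobolev inequality. -/
def sobolevWords : Finset (List (Fin 4)) := {[], [1], [0], [1, 0]}

variable {N : ℕ} [NeZero N]

lemma sq_le_sobolev {q : ℕ} (hq : 0 < q) (hqN : q ≤ N) (f : Torus N → ℝ) (x : Torus N)
    (S : Finset (Torus N)) (hS : ∀ y, absMax (y - x) ≤ q - 1 → y ∈ S) :
    (q : ℝ) ^ 2 * (f x) ^ 2 ≤
      4 * ∑ y ∈ S, ∑ v ∈ sobolevWords, ((q : ℝ) ^ v.length * iterDiff v f y) ^ 2 := by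
  classical
  let y : ℕ × ℕ → Torus N := fun p => x + ((p.1 : ZMod N), (p.2 : ZMod N))
  have h1 := sq_le_sobolev_nat (fun i k => f (y (i, k))) hq
  have h0 : y (0, 0) = x := by simp [y]
  simp only [h0] at h1
  refine h1.trans (mul_le_mul_of_nonneg_left ?_ (by norm_num))
  have hd0 (i k : ℕ) : y (i + 1, k) = y (i, k) + dir N 0 := by
    simp only [y, dir]
    apply Prod.ext <;> simp; ring
  have hd1 (i k : ℕ) : y (i, k + 1) = y (i, k) + dir N 1 := by
    simp only [y, dir]
    apply Prod.ext <;> simp; ring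
  have hinj : Set.InjOn y (Finset.range q ×ˢ Finset.range q : Finset (ℕ × ℕ)) := by
    rintro ⟨a, b⟩ hp ⟨a', b'⟩ hp' h
    simp only [Finset.coe_product, Finset.coe_range, Set.mem_prod, Set.mem_Iio] at hp hp'
    simp only [y, add_right_inj, Prod.mk.injEq] at h
    have key : ∀ a b : ℕ, a < q → b < q → (a : ZMod N) = b → a = b := by
      intro a b ha hb hab
      rw [ZMod.natCast_eq_natCast_iff'] at hab
      rwa [Nat.mod_eq_of_lt (ha.trans_le hqN), Nat.mod_eq_of_lt (hb.trans_le hqN)] at hab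
    exact Prod.ext (key _ _ hp.1 hp'.1 h.1) (key _ _ hp.2 hp'.2 h.2)
  let g : Torus N → ℝ := fun y => ∑ v ∈ sobolevWords, ((q : ℝ) ^ v.length * iterDiff v f y) ^ 2
  have hg : ∀ p : ℕ × ℕ, (f (y (p.1, p.2))) ^ 2 + (q * (f (y (p.1, p.2 + 1)) - f (y (p.1, p.2)))) ^ 2 +
        (q * (f (y (p.1 + 1, p.2)) - f (y (p.1, p.2)))) ^ 2 +
        (q ^ 2 * (f (y (p.1 + 1, p.2 + 1)) - f (y (p.1, p.2 + 1)) -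
          (f (y (p.1 + 1, p.2)) - f (y (p.1, p.2))))) ^ 2 = g (y p) := by
    intro p
    simp only [g, sobolevWords]
    rw [Finset.sum_insert (by simp), Finset.sum_insert (by simp), Finset.sum_insert (by simp),
      Finset.sum_singleton]
    simp only [hd0, hd1, iterDiff_nil, iterDiff_cons, List.length_nil, List.length_cons, diff]
    simp only [zero_add, pow_zero, pow_one, one_mul]
    rw [show y (p.1, p.2) + dir N 1 + dir N 0 = y (p.1, p.2) + dir N 0 + dir N 1 by abel]
    ring_nf
  rw [Finset.sum_congr rfl fun p _ => hg p]
  rw [← Finset.sum_image (f := g) hinj]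
  refine Finset.sum_le_sum_of_subset_of_nonneg ?_ fun _ _ _ =>
    Finset.sum_nonneg fun _ _ => sq_nonneg _
  intro z hz
  obtain ⟨p, hp, rfl⟩ := Finset.mem_image.mp hz
  simp only [Finset.mem_product, Finset.mem_range] at hp
  refine hS _ ?_
  simp only [y, add_sub_cancel_left]
  have := absMax_intCast_le (N := N) p.1 p.2 (q - 1) (by simp; omega) (by simp; omega)
  simpa using this

end Sobolev

/-! ### Integrability of the field regulator -/

section RegulatorMoments

variable {N L j : ℕ} [NeZero N]

set_option linter.unusedSectionVars false

lemma continuous_linfGrad (n : ℕ) (S : Finset (Torus N)) :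
    Continuous fun φ : Torus N → ℝ => linfGrad L j n S φ := by
  unfold linfGrad
  refine Continuous.finset_sup_apply fun p _ => ?_
  exact continuous_const.mul (continuous_iterDiff _ _).nnnorm

lemma continuous_wHessSq (X : Finset (Torus N)) :
    Continuous fun φ : Torus N → ℝ => wHessSq L j X φ := by
  unfold wHessSq
  refine continuous_finsetSum _ fun B _ => ?_
  exact (NNReal.continuous_coe.comp (continuous_linfGrad 2 _)).pow 2

lemma continuous_gradSq (x : Torus N) : Continuous fun φ : Torus N → ℝ => gradSq φ x := by
  unfold gradSq diff
  fun_prop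

lemma continuous_regExp (c₁ c₃ : ℝ) (X : Finset (Torus N)) :
    Continuous fun φ : Torus N → ℝ => regExp c₁ c₃ L j X φ := by
  unfold regExp l2GradSq l2GradBdrySq diff
  have := continuous_wHessSq (L := L) (j := j) X
  fun_prop

lemma sq_linfGrad_le {n : ℕ} {S : Finset (Torus N)} {φ : Torus N → ℝ} {T : ℝ} (hT : 0 ≤ T)
    (h : ∀ w : List (Fin 4), w.length = n → ∀ x ∈ S,
      ((L : ℝ) ^ (n * j) * |iterDiff w φ x|) ^ 2 ≤ T) :
    ((linfGrad L j n S φ : ℝ≥0) : ℝ) ^ 2 ≤ T := by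
  have hs : linfGrad L j n S φ ≤ Real.toNNReal √T := by
    rw [linfGrad_le_iff]
    intro w hw x hx
    rw [Real.coe_toNNReal _ (Real.sqrt_nonneg T)]
    exact Real.le_sqrt_of_sq_le (h w hw x hx)
  have h1 := NNReal.coe_le_coe.mpr hs
  rw [Real.coe_toNNReal _ (Real.sqrt_nonneg T)] at h1
  calc _ ≤ (√T) ^ 2 := pow_le_pow_left₀ (NNReal.coe_nonneg _) h1 2
    _ = T := Real.sq_sqrt hT

/-- The sum of squares of derivatives that controls `∂^w φ` on `S`. -/
def sobolevSum (L j : ℕ) (S : Finset (Torus N)) (w : List (Fin 4)) (φ : Torus N → ℝ) : ℝ :=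
  ∑ y ∈ S, ∑ u ∈ sobolevWords, ((L : ℝ) ^ (j * (u ++ w).length) * iterDiff (u ++ w) φ y) ^ 2

lemma sobolevSum_nonneg (S : Finset (Torus N)) (w : List (Fin 4)) (φ : Torus N → ℝ) :
    0 ≤ sobolevSum L j S w φ :=
  Finset.sum_nonneg fun _ _ => Finset.sum_nonneg fun _ _ => sq_nonneg _

lemma sq_iterDiff_le_sobolevSum (hL : 0 < L) (hd : L ^ j ∣ N) (w : List (Fin 4)) (φ : Torus N → ℝ)
    (x : Torus N) (S : Finset (Torus N)) (hS : ∀ y, absMax (y - x) ≤ L ^ j - 1 → y ∈ S) :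
    ((L : ℝ) ^ (w.length * j) * |iterDiff w φ x|) ^ 2 ≤
      4 * ((L : ℝ) ^ (2 * j))⁻¹ * sobolevSum L j S w φ := by
  have hLpos : (0 : ℝ) < L := by exact_mod_cast hL
  have h1 := sq_le_sobolev (Nat.pow_pos hL)
    (Nat.le_of_dvd (Nat.pos_of_ne_zero (NeZero.ne N)) hd) (iterDiff w φ) x S hS
  have h3 : sobolevSum L j S w φ =
      ((L : ℝ) ^ (w.length * j)) ^ 2 * ∑ y ∈ S, ∑ u ∈ sobolevWords,
        (((L ^ j : ℕ) : ℝ) ^ u.length * iterDiff u (iterDiff w φ) y) ^ 2 := by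
    rw [sobolevSum, Finset.mul_sum]
    refine Finset.sum_congr rfl fun y _ => ?_
    rw [Finset.mul_sum]
    refine Finset.sum_congr rfl fun u _ => ?_
    rw [iterDiff_append, ← mul_pow, List.length_append, mul_add, pow_add, Nat.cast_pow, ← pow_mul,
      mul_comm j w.length]
    ring
  rw [h3, mul_pow, sq_abs]
  generalize ∑ y ∈ S, ∑ u ∈ sobolevWords,
    (((L ^ j : ℕ) : ℝ) ^ u.length * iterDiff u (iterDiff w φ) y) ^ 2 = A at h1
  rw [Nat.cast_pow, ← pow_mul, mul_comm j 2] at h1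
  have hb : 0 < (L : ℝ) ^ (2 * j) := by positivity
  generalize (L : ℝ) ^ (2 * j) = b at *
  have ha : 0 ≤ ((L : ℝ) ^ (w.length * j)) ^ 2 := by positivity
  generalize ((L : ℝ) ^ (w.length * j)) ^ 2 = a at *
  calc a * iterDiff w φ x ^ 2 = a * (b⁻¹ * (b * iterDiff w φ x ^ 2)) := by field_simp
    _ ≤ a * (b⁻¹ * (4 * A)) := by gcongr
    _ = 4 * b⁻¹ * (a * A) := by ring

/-- The bound on the Hessian by local sums of squares. -/
lemma sq_linfGrad_two_le (hodd : Odd L) (hd : L ^ j ∣ N) {v : Torus N} (φ : Torus N → ℝ)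
    (S : Finset (Torus N)) (hS : ∀ y, 2 * absMax (y - (L ^ j) • v) ≤ 9 * L ^ j → y ∈ S) :
    ((linfGrad L j 2 (nbhd L j (blk (L ^ j) ((L ^ j) • v))) φ : ℝ≥0) : ℝ) ^ 2 ≤
      4 * ((L : ℝ) ^ (2 * j))⁻¹ * ∑ μ : Fin 4, ∑ ν : Fin 4, sobolevSum L j S [μ, ν] φ := by
  have hq : Odd (L ^ j) := hodd.pow
  refine sq_linfGrad_le (mul_nonneg (by positivity)
    (Finset.sum_nonneg fun _ _ => Finset.sum_nonneg fun _ _ => sobolevSum_nonneg _ _ _)) fun w hw x hx => ?_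
  obtain ⟨μ, ν, rfl⟩ := List.length_eq_two.mp hw
  have hpol : IsPolymer L j (blk (L ^ j) ((L ^ j) • v)) := fun y hy =>
    ⟨_, mem_blocksIn.mpr ⟨mem_blocks.mpr ⟨v, rfl⟩, subset_rfl⟩, hy⟩
  obtain ⟨u, hu, hxu⟩ := exists_center_of_mem_nbhd hq hd hpol hx
  rw [center_eq_of_mem_blk hq hd (self_mem_blk _ _) (hu (self_mem_blk _ _))] at hxu
  -- The radius `9/2 L^j` of `S` is `7/2 L^j` for the neighbourhood of the block plus `L^j` for the
  -- Sobolev square.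
  refine (sq_iterDiff_le_sobolevSum hodd.pos hd [μ, ν] φ x S fun y hy => hS y (by
      have := absMax_sub_le y x ((L ^ j) • v)
      omega)).trans ?_
  refine mul_le_mul_of_nonneg_left ?_ (by positivity)
  have h1 := Finset.single_le_sum (f := fun ν : Fin 4 => sobolevSum L j S [μ, ν] φ)
    (fun _ _ => sobolevSum_nonneg _ _ _) (Finset.mem_univ ν)
  have h2 := Finset.single_le_sum (f := fun μ : Fin 4 => ∑ ν : Fin 4, sobolevSum L j S [μ, ν] φ)
    (fun _ _ => Finset.sum_nonneg fun _ _ => sobolevSum_nonneg _ _ _) (Finset.mem_univ μ)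
  exact h1.trans h2

variable {R : ℕ} [NeZero L]

/-- The variance of `∂^w ζ` is at most `C(2|w|) L^{-2j|w|}`, so the rescaled derivative has variance
of order one, uniformly in `j`, `L` and `R`. -/
lemma IsMultiscaleDecomposition.expBdd_iterDiff {C : ℕ → ℝ} {c : ℝ} {Γ : ℕ → Torus (L ^ R) → ℝ}
    (h : IsMultiscaleDecomposition C c L R Γ) (hj : j < R) {D : ℝ} (hD : 0 < D)
    (w : List (Fin 4)) (hw : w ≠ []) (hC : C (2 * w.length) ≤ D) (x : Torus (L ^ R)) :
    ExpBdd (fieldLaw (Γ j)) (fun ζ => ((L : ℝ) ^ (j * w.length) * iterDiff w ζ x) ^ 2) (4 * D) := by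
  have hLpos : (0 : ℝ) < L := by exact_mod_cast Nat.pos_of_ne_zero (NeZero.ne L)
  have hlen : (w ++ w.map opp).length = 2 * w.length := by simp; ring
  have h1 := h.deriv_le j hj 0 (by simp [absMax_zero]) (w ++ w.map opp) (by simp [hw])
  rw [hlen] at h1
  have h2 := expBdd_iterDiff_sq (h.posDef j hj) w x
    (u := D * ((L : ℝ) ^ (j * (2 * w.length)))⁻¹) (by positivity)
    ((le_abs_self _).trans (h1.trans (by gcongr)))
  have h3 := h2.const_mul (a := ((L : ℝ) ^ (j * w.length)) ^ 2) (by positivity)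
  refine h3.mono ?_ (fun ζ => by rw [mul_pow]) (le_of_eq ?_)
  · have := continuous_iterDiff w x
    fun_prop
  · rw [← pow_mul, show j * (2 * w.length) = j * w.length * 2 by ring]
    field_simp

/-- The exponent of the field regulator of a small polymer has exponential moments that are
uniform in the scales. -/
lemma IsMultiscaleDecomposition.expBdd_regExp {C : ℕ → ℝ} {c : ℝ} {Γ : ℕ → Torus (L ^ R) → ℝ}
    (h : IsMultiscaleDecomposition C c L R Γ) (hodd : Odd L) (hj : j < R) {D : ℝ} (hD : 0 < D)
    (hC : ∀ n, 1 ≤ n → n ≤ 4 → C (2 * n) ≤ D) {c₁ c₃ : ℝ} (hc₁ : 0 < c₁) (hc₃ : 0 < c₃)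
    {X : Finset (Torus (L ^ R))} (hX : IsSmall L j X) :
    ExpBdd (fieldLaw (Γ j)) (regExp c₁ c₃ L j X)
      (c₁ * (32 * D) + c₃ * (128 * D) + c₁ * (409600 * D)) := by
  classical
  have hLpos : (0 : ℝ) < L := by exact_mod_cast hodd.pos
  have hq : Odd (L ^ j) := hodd.pow
  have hd : L ^ j ∣ L ^ R := pow_dvd_pow L hj.le
  set b := (L : ℝ) ^ j with hb
  have hb0 : 0 < b := by positivity
  have hgrad : ∀ x, ExpBdd (fieldLaw (Γ j)) (fun ζ => gradSq ζ x) (4 * (4 * D) * (b ^ 2)⁻¹) := by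
    intro x
    have h1 := ExpBdd.sum (P := fieldLaw (Γ j)) (S := (Finset.univ : Finset (Fin 4)))
      (Q := fun μ ζ => ((L : ℝ) ^ (j * [μ].length) * iterDiff [μ] ζ x) ^ 2) (s := 4 * D)
      fun μ _ => h.expBdd_iterDiff hj hD [μ] (by simp)
        (by simpa using hC 1 le_rfl (by norm_num)) x
    refine (h1.const_mul (a := (b ^ 2)⁻¹) (by positivity)).mono
      (continuous_gradSq x).measurable (fun ζ => le_of_eq ?_) (le_of_eq ?_)
    · simp only [gradSq, List.length_singleton, mul_one, iterDiff_cons, iterDiff_nil, mul_pow,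
        ← Finset.mul_sum, ← hb]
      field_simp
    · simp; ring
  have hsum : ∀ (S : Finset (Torus (L ^ R))), ExpBdd (fieldLaw (Γ j))
      (fun ζ => ∑ x ∈ S, gradSq ζ x) (S.card * (4 * (4 * D) * (b ^ 2)⁻¹)) := fun S =>
    ExpBdd.sum fun x _ => hgrad x
  have hQ1 : ExpBdd (fieldLaw (Γ j)) (fun ζ => c₁ * l2GradSq L j X ζ) (c₁ * (32 * D)) := by
    have h1 := (hsum X).const_mul (a := 1 / 2) (by norm_num)
    refine ExpBdd.const_mul (h1.mono ?_ (fun ζ => (l2GradSq_eq hodd.pos X ζ).le) ?_) hc₁.le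
    · simp only [l2GradSq_eq hodd.pos]
      exact h1.1
    · have : (X.card : ℝ) ≤ 4 * b ^ 2 := by rw [hb]; exact_mod_cast hX.card_le hq
      calc 1 / 2 * (X.card * (4 * (4 * D) * (b ^ 2)⁻¹))
          ≤ 1 / 2 * ((4 * b ^ 2) * (4 * (4 * D) * (b ^ 2)⁻¹)) := by gcongr
        _ = 32 * D := by field_simp; norm_num
  have hQ2 : ExpBdd (fieldLaw (Γ j)) (fun ζ => c₃ * l2GradBdrySq L j X ζ) (c₃ * (128 * D)) := by
    have h1 := (hsum (bdry X)).const_mul (a := 1 / 2 * b) (by positivity)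
    refine ExpBdd.const_mul (h1.mono ?_ (fun ζ => (l2GradBdrySq_eq hodd.pos X ζ).le) ?_) hc₃.le
    · simp only [l2GradBdrySq_eq hodd.pos]
      exact h1.1
    · have : ((bdry X).card : ℝ) ≤ 16 * b := by rw [hb]; exact_mod_cast hX.card_bdry_le hq hd
      calc 1 / 2 * b * ((bdry X).card * (4 * (4 * D) * (b ^ 2)⁻¹))
          ≤ 1 / 2 * b * ((16 * b) * (4 * (4 * D) * (b ^ 2)⁻¹)) := by gcongr
        _ = 128 * D := by field_simp; norm_num
  -- The constant is `4 · 4² · 100 · 4 · 4`: the Sobolev factor, the pairs of directions, the sites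
  -- of `S` in units of `L^{2j}`, the Sobolev words, and the factor in `4 * D`. Two Hessian and up
  -- to two Sobolev derivatives require derivatives of `Γ` up to order eight.
  have hB : ∀ B ∈ blocksIn L j X, ExpBdd (fieldLaw (Γ j))
      (fun ζ => ((linfGrad L j 2 (nbhd L j B) ζ : ℝ≥0) : ℝ) ^ 2) (102400 * D) := by
    intro B hB
    obtain ⟨v, rfl⟩ := mem_blocks.mp (mem_blocksIn.mp hB).1
    let S : Finset (Torus (L ^ R)) := Finset.univ.filter fun y =>
      2 * absMax (y - (L ^ j) • v) ≤ 9 * L ^ j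
    have hcard : (S.card : ℝ) ≤ 100 * b ^ 2 := by
      have h1 : S.card ≤ (10 * L ^ j) ^ 2 := by
        refine (card_absMax_le ((L ^ j) • v) ((9 * L ^ j) / 2) S fun x hx => ?_).trans
          (Nat.pow_le_pow_left ?_ 2)
        · have := (Finset.mem_filter.mp hx).2
          omega
        · have := hq.pos
          omega
      calc (S.card : ℝ) ≤ ((10 * L ^ j) ^ 2 : ℕ) := by exact_mod_cast h1
        _ = 100 * b ^ 2 := by rw [hb]; push_cast; ring
    have hwords : ∀ u ∈ sobolevWords, u.length ≤ 2 := by decide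
    have h0 : ∀ μ ν : Fin 4, ExpBdd (fieldLaw (Γ j)) (fun ζ => sobolevSum L j S [μ, ν] ζ)
        (S.card * (sobolevWords.card * (4 * D))) := fun μ ν => by
      unfold sobolevSum
      exact ExpBdd.sum fun y _ => ExpBdd.sum fun u hu =>
        h.expBdd_iterDiff hj hD _ (by simp) (hC _ (by simp) (by
          have := hwords u hu
          simp only [List.length_append, List.length_cons, List.length_nil]
          omega)) y
    have h1 := ExpBdd.sum (P := fieldLaw (Γ j)) (S := (Finset.univ : Finset (Fin 4)))
      fun μ _ => ExpBdd.sum (S := (Finset.univ : Finset (Fin 4)))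
        fun ν _ => h0 μ ν
    refine (h1.const_mul (a := 4 * ((L : ℝ) ^ (2 * j))⁻¹) (by positivity)).mono ?_
      (fun ζ => sq_linfGrad_two_le hodd hd ζ S fun y hy => by simpa [S] using hy) ?_
    · exact ((NNReal.continuous_coe.comp (continuous_linfGrad 2 _)).pow 2).measurable
    · have hc : (sobolevWords.card : ℝ) = 4 := by
        have : sobolevWords.card = 4 := by decide
        exact_mod_cast this
      have hc2 : ((Finset.univ : Finset (Fin 4)).card : ℝ) = 4 := by simp
      rw [hc, hc2, mul_comm 2 j, pow_mul, ← hb]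
      calc 4 * (b ^ 2)⁻¹ * (4 * (4 * (S.card * (4 * (4 * D)))))
          ≤ 4 * (b ^ 2)⁻¹ * (4 * (4 * ((100 * b ^ 2) * (4 * (4 * D))))) := by gcongr
        _ = 102400 * D := by field_simp; norm_num
  have hQ3 : ExpBdd (fieldLaw (Γ j)) (fun ζ => c₁ * wHessSq L j X ζ) (c₁ * (409600 * D)) := by
    refine ExpBdd.const_mul ((ExpBdd.sum (S := blocksIn L j X) hB).mono
      (continuous_wHessSq X).measurable (fun ζ => le_rfl) ?_) hc₁.le
    have : ((blocksIn L j X).card : ℝ) ≤ 4 := by exact_mod_cast hX.2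
    calc ((blocksIn L j X).card : ℝ) * (102400 * D) ≤ 4 * (102400 * D) := by gcongr
      _ = 409600 * D := by ring
  exact (hQ1.add hQ2 (by positivity) (by positivity)).add hQ3 (by positivity) (by positivity)

end RegulatorMoments

/-! ### Directional derivatives along complex test functions -/

section DirectionalDerivatives

set_option linter.unusedSectionVars false

variable {N : ℕ} [NeZero N]

/-- `A ↦ ∑_{x ∈ S} f_x A(e_x)`. -/
def coordSum (S : Finset (Torus N)) (f : Torus N → ℂ) : ((Torus N → ℝ) →L[ℝ] ℂ) →L[ℝ] ℂ :=
  ∑ x ∈ S, f x • ContinuousLinearMap.apply ℝ ℂ (Pi.single x 1 : Torus N → ℝ)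

lemma coordSum_apply (S : Finset (Torus N)) (f : Torus N → ℂ) (A : (Torus N → ℝ) →L[ℝ] ℂ) :
    coordSum S f A = ∑ x ∈ S, f x * A (Pi.single x 1) := by
  simp [coordSum]

/-- The derivative `∑_{x ∈ S} f_x ∂F / ∂φ_x`. -/
def dd (S : Finset (Torus N)) (f : Torus N → ℂ) (F : (Torus N → ℝ) → ℂ) : (Torus N → ℝ) → ℂ :=
  fun φ => coordSum S f (fderiv ℝ F φ)

/-- The iterated derivative along a list of test functions. -/
def ddList (S : Finset (Torus N)) (fs : List (Torus N → ℂ)) (F : (Torus N → ℝ) → ℂ) :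
    (Torus N → ℝ) → ℂ :=
  fs.foldr (dd S) F

variable {S : Finset (Torus N)} {F : (Torus N → ℝ) → ℂ}

@[simp] lemma ddList_nil : ddList S [] F = F := rfl

@[simp] lemma ddList_cons (f : Torus N → ℂ) (fs : List (Torus N → ℂ)) :
    ddList S (f :: fs) F = dd S f (ddList S fs F) := rfl

lemma ddList_append (fs gs : List (Torus N → ℂ)) :
    ddList S (fs ++ gs) F = ddList S fs (ddList S gs F) := by
  simp [ddList, List.foldr_append]

lemma dd_apply (f : Torus N → ℂ) (φ : Torus N → ℝ) :
    dd S f F φ = ∑ x ∈ S, f x * fderiv ℝ F φ (Pi.single x 1) := coordSum_apply _ _ _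

lemma contDiff_dd (hF : ContDiff ℝ ∞ F) (f : Torus N → ℂ) : ContDiff ℝ ∞ (dd S f F) :=
  (coordSum S f).contDiff.comp (contDiff_infty_iff_fderiv.mp hF).2

lemma contDiff_ddList (hF : ContDiff ℝ ∞ F) (fs : List (Torus N → ℂ)) :
    ContDiff ℝ ∞ (ddList S fs F) := by
  induction fs with
  | nil => exact hF
  | cons f fs ih => exact contDiff_dd ih f

lemma dd_add_fun (f g : Torus N → ℂ) : dd S (f + g) F = dd S f F + dd S g F := by
  ext φ
  simp [dd_apply, add_mul, Finset.sum_add_distrib]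

lemma dd_smul_fun (a : ℂ) (f : Torus N → ℂ) : dd S (a • f) F = a • dd S f F := by
  ext φ
  simp [dd_apply, Finset.mul_sum, mul_assoc]

lemma dd_add {G : (Torus N → ℝ) → ℂ} (hF : ContDiff ℝ ∞ F) (hG : ContDiff ℝ ∞ G)
    (f : Torus N → ℂ) : dd S f (F + G) = dd S f F + dd S f G := by
  ext φ
  simp only [dd, Pi.add_apply]
  rw [fderiv_add (hF.differentiable (by simp) φ) (hG.differentiable (by simp) φ), map_add]

lemma dd_smul (hF : ContDiff ℝ ∞ F) (a : ℂ) (f : Torus N → ℂ) :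
    dd S f (a • F) = a • dd S f F := by
  ext φ
  simp only [dd_apply, Pi.smul_apply, smul_eq_mul]
  rw [fderiv_const_smul (hF.differentiable (by simp) φ), Finset.mul_sum]
  refine Finset.sum_congr rfl fun x _ => ?_
  simp; ring

lemma ddList_add {G : (Torus N → ℝ) → ℂ} (hF : ContDiff ℝ ∞ F) (hG : ContDiff ℝ ∞ G)
    (fs : List (Torus N → ℂ)) : ddList S fs (F + G) = ddList S fs F + ddList S fs G := by
  induction fs with
  | nil => rfl
  | cons f fs ih =>
    rw [ddList_cons, ih, dd_add (contDiff_ddList hF fs) (contDiff_ddList hG fs)]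
    rfl

lemma ddList_smul (hF : ContDiff ℝ ∞ F) (a : ℂ) (fs : List (Torus N → ℂ)) :
    ddList S fs (a • F) = a • ddList S fs F := by
  induction fs with
  | nil => rfl
  | cons f fs ih =>
    rw [ddList_cons, ih, dd_smul (contDiff_ddList hF fs)]
    rfl

lemma ddList_replicate_smul (hF : ContDiff ℝ ∞ F) (a : ℂ) (f : Torus N → ℂ) (m : ℕ) :
    ddList S (List.replicate m (a • f)) F = a ^ m • ddList S (List.replicate m f) F := by
  induction m with
  | zero => simp
  | succ m ih =>
    rw [List.replicate_succ, ddList_cons, ih, dd_smul_fun,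
      dd_smul (contDiff_ddList hF _), List.replicate_succ, ddList_cons, smul_smul, pow_succ, mul_comm]

lemma sum_piFinset_succ {n : ℕ} (g : (Fin (n + 1) → Torus N) → ℂ) :
    ∑ x ∈ Fintype.piFinset (fun _ : Fin (n + 1) => S), g x =
      ∑ x₀ ∈ S, ∑ x ∈ Fintype.piFinset (fun _ : Fin n => S), g (Fin.cons x₀ x) := by
  rw [← Finset.sum_product']
  refine Finset.sum_bij' (fun x _ => (x 0, Fin.tail x)) (fun p _ => Fin.cons p.1 p.2) ?_ ?_ ?_ ?_ ?_
  · intro x hx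
    rw [Fintype.mem_piFinset] at hx
    simp only [Finset.mem_product, Fintype.mem_piFinset]
    exact ⟨hx 0, fun i => hx i.succ⟩
  · rintro ⟨a, x⟩ hx
    simp only [Finset.mem_product, Fintype.mem_piFinset] at hx
    rw [Fintype.mem_piFinset]
    intro i
    refine Fin.cases ?_ (fun i => ?_) i
    · simpa using hx.1
    · simpa using hx.2 i
  · intro x _
    simp
  · intro p _
    simp
  · intro x _
    simp

/-- `D^n F(φ) · (f₁, …, fₙ)` is an iterated directional derivative. -/
lemma dirDeriv_eq_ddList (hF : ContDiff ℝ ∞ F) (n : ℕ) (φ : Torus N → ℝ)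
    (f : Fin n → Torus N → ℂ) : dirDeriv S F n φ f = ddList S (List.ofFn f) F φ := by
  induction n generalizing φ with
  | zero => simp [dirDeriv]
  | succ n ih =>
    rw [List.ofFn_succ, ddList_cons, dd_apply]
    have h1 : ddList S (List.ofFn fun i => f i.succ) F = fun φ =>
        ∑ x ∈ Fintype.piFinset (fun _ : Fin n => S),
          (∏ i, f i.succ (x i)) * iteratedFDeriv ℝ n F φ fun i => Pi.single (x i) 1 := by
      ext φ
      rw [← ih]; rfl
    have hd : Differentiable ℝ (iteratedFDeriv ℝ n F) :=
      hF.differentiable_iteratedFDeriv (by exact_mod_cast WithTop.coe_lt_top _)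
    rw [dirDeriv, sum_piFinset_succ]
    refine Finset.sum_congr rfl fun x₀ _ => ?_
    have h2 : fderiv ℝ (ddList S (List.ofFn fun i => f i.succ) F) φ (Pi.single x₀ 1) =
        ∑ x ∈ Fintype.piFinset (fun _ : Fin n => S),
          (∏ i, f i.succ (x i)) *
            fderiv ℝ (iteratedFDeriv ℝ n F) φ (Pi.single x₀ 1) fun i => Pi.single (x i) 1 := by
      rw [h1]
      have h3 : ∀ x : Fin n → Torus N, HasFDerivAt (fun φ =>
          (∏ i, f i.succ (x i)) * iteratedFDeriv ℝ n F φ fun i => Pi.single (x i) 1)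
          ((∏ i, f i.succ (x i)) • ((ContinuousMultilinearMap.apply ℝ (fun _ : Fin n => Torus N → ℝ) ℂ
            (fun i => Pi.single (x i) 1)).comp (fderiv ℝ (iteratedFDeriv ℝ n F) φ))) φ := by
        intro x
        refine HasFDerivAt.const_mul ?_ _
        exact ((ContinuousMultilinearMap.apply ℝ (fun _ : Fin n => Torus N → ℝ) ℂ
            (fun i => Pi.single (x i) 1)).hasFDerivAt).comp φ (hd φ).hasFDerivAt
      rw [(HasFDerivAt.fun_sum fun x _ => h3 x).fderiv]
      simp
    rw [h2, Finset.mul_sum]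
    refine Finset.sum_congr rfl fun x _ => ?_
    rw [Fin.prod_univ_succ, iteratedFDeriv_succ_apply_left]
    simp only [Fin.cons_zero, Fin.cons_succ, mul_assoc]
    rfl

/-- `F` depends on the restriction of the field to `S` only. -/
def DependsOn (S : Finset (Torus N)) (F : (Torus N → ℝ) → ℂ) : Prop :=
  ∀ φ ψ : Torus N → ℝ, (∀ x ∈ S, φ x = ψ x) → F φ = F ψ

/-- The restriction of fields to `S`. -/
def restrictTo (S : Finset (Torus N)) : (Torus N → ℝ) →L[ℝ] (Torus N → ℝ) :=
  ∑ x ∈ S, (ContinuousLinearMap.proj (R := ℝ) (φ := fun _ : Torus N => ℝ) x).smulRight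
    (Pi.single x 1 : Torus N → ℝ)

lemma restrictTo_apply (φ : Torus N → ℝ) :
    restrictTo S φ = ∑ x ∈ S, φ x • (Pi.single x 1 : Torus N → ℝ) := by
  simp [restrictTo]

lemma restrictTo_eq (φ : Torus N → ℝ) {x : Torus N} (hx : x ∈ S) : restrictTo S φ x = φ x := by
  rw [restrictTo_apply, Finset.sum_apply, Finset.sum_eq_single x]
  · simp
  · intro y _ hy
    simp [Ne.symm hy]
  · exact fun h => absurd hx h

lemma DependsOn.comp_restrictTo (h : DependsOn S F) : F ∘ restrictTo S = F := by
  ext φ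
  exact h _ _ fun x hx => restrictTo_eq φ hx

lemma DependsOn.fderiv_eq (h : DependsOn S F) (hF : ContDiff ℝ ∞ F) (φ : Torus N → ℝ) :
    fderiv ℝ F φ = (fderiv ℝ F (restrictTo S φ)).comp (restrictTo S) := by
  have h1 := fderiv_comp φ (hF.differentiable (by simp) (restrictTo S φ))
    (restrictTo S).differentiableAt
  rw [h.comp_restrictTo, ContinuousLinearMap.fderiv] at h1
  exact h1

/-- The norms only test the coordinates in `S`. As `F` ignores the others, these coordinates already
give the full derivative, and Fréchet derivatives can be estimated by the norms. -/
lemma DependsOn.fderiv_apply (h : DependsOn S F) (hF : ContDiff ℝ ∞ F) (φ v : Torus N → ℝ) :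
    fderiv ℝ F φ v = dd S (fun x => (v x : ℂ)) F φ := by
  have h1 : fderiv ℝ F φ v = fderiv ℝ F φ (restrictTo S v) := by
    have h2 : restrictTo S (restrictTo S v) = restrictTo S v := by
      conv_lhs => rw [restrictTo_apply]
      conv_rhs => rw [restrictTo_apply]
      exact Finset.sum_congr rfl fun x hx => by rw [restrictTo_eq v hx]
    rw [h.fderiv_eq hF φ, ContinuousLinearMap.comp_apply, ContinuousLinearMap.comp_apply, h2]
  rw [h1, restrictTo_apply, map_sum, dd_apply]
  refine Finset.sum_congr rfl fun x _ => ?_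
  rw [map_smul]; simp

lemma DependsOn.dd (h : DependsOn S F) (hF : ContDiff ℝ ∞ F) (f : Torus N → ℂ) :
    DependsOn S (dd S f F) := by
  intro φ ψ hφψ
  have h1 : restrictTo S φ = restrictTo S ψ := by
    rw [restrictTo_apply, restrictTo_apply]
    exact Finset.sum_congr rfl fun x hx => by rw [hφψ x hx]
  rw [CoulombGas.dd, CoulombGas.dd, h.fderiv_eq hF φ, h.fderiv_eq hF ψ, h1]

lemma DependsOn.ddList (h : DependsOn S F) (hF : ContDiff ℝ ∞ F) (fs : List (Torus N → ℂ)) :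
    DependsOn S (ddList S fs F) := by
  induction fs with
  | nil => exact h
  | cons f fs ih => exact ih.dd (contDiff_ddList hF fs) f

/-- A smooth function of charge `κ`: `F(φ + s) = e^{iκs} F(φ)`. -/
structure IsCharged (S : Finset (Torus N)) (κ : ℝ) (F : (Torus N → ℝ) → ℂ) : Prop where
  smooth : ContDiff ℝ ∞ F
  dependsOn : DependsOn S F
  shift : ∀ (φ : Torus N → ℝ) (s : ℝ),
    F (φ + fun _ => s) = Complex.exp (Complex.I * κ * s) * F φ

lemma IsCharged.dd {κ : ℝ} (h : IsCharged S κ F) (f : Torus N → ℂ) : IsCharged S κ (dd S f F) := by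
  refine ⟨contDiff_dd h.smooth f, h.dependsOn.dd h.smooth f, fun φ s => ?_⟩
  have h1 : (fun φ : Torus N → ℝ => F (φ + fun _ => s)) =
      (Complex.exp (Complex.I * κ * s)) • F := by
    ext φ; simp [h.shift]
  have h2 := fderiv_comp_add_right (𝕜 := ℝ) (f := F) (x := φ) (fun _ : Torus N => s)
  rw [h1, fderiv_const_smul (h.smooth.differentiable (by simp) φ)] at h2
  simp only [dd_apply]
  rw [← h2, Finset.mul_sum]
  refine Finset.sum_congr rfl fun x _ => ?_
  simp; ring

lemma IsCharged.ddList {κ : ℝ} (h : IsCharged S κ F) (fs : List (Torus N → ℂ)) :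
    IsCharged S κ (ddList S fs F) := by
  induction fs with
  | nil => exact h
  | cons f fs ih => exact ih.dd f

/-- The derivative of a charged function in the constant direction. -/
lemma IsCharged.dd_one {κ : ℝ} (h : IsCharged S κ F) :
    CoulombGas.dd S 1 F = (Complex.I * κ) • F := by
  ext φ
  have h1 := h.dependsOn.fderiv_apply h.smooth φ (fun _ => 1)
  have h2 : (fun x : Torus N => (((fun _ => 1 : Torus N → ℝ) x : ℝ) : ℂ)) = 1 := by ext; simp
  rw [h2] at h1
  rw [← h1]
  have hc : HasDerivAt (fun s : ℝ => φ + fun _ : Torus N => s) (fun _ => (1 : ℝ)) 0 := by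
    refine HasDerivAt.const_add _ ?_
    rw [hasDerivAt_pi]
    exact fun _ => hasDerivAt_id 0
  have h3 : HasDerivAt (fun s : ℝ => F (φ + fun _ => s)) (fderiv ℝ F φ (fun _ => 1)) 0 := by
    have h4 : HasFDerivAt F (fderiv ℝ F φ) (φ + fun _ : Torus N => (0 : ℝ)) := by
      have : (φ + fun _ : Torus N => (0 : ℝ)) = φ := by ext; simp
      rw [this]
      exact (h.smooth.differentiable (by simp) φ).hasFDerivAt
    exact h4.comp_hasDerivAt (0 : ℝ) hc
  simp only [h.shift] at h3
  have h5 : HasDerivAt (fun s : ℝ => Complex.exp (Complex.I * κ * s) * F φ)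
      (Complex.I * κ * F φ) 0 := by
    have h6 : HasDerivAt (fun s : ℝ => Complex.I * κ * (s : ℂ)) (Complex.I * κ) 0 := by
      simpa using (Complex.ofRealCLM.hasDerivAt (x := (0 : ℝ))).const_mul (Complex.I * (κ : ℂ))
    have h7 := (h6.cexp).mul_const (F φ)
    simpa using h7
  rw [h3.unique h5]
  simp

end DirectionalDerivatives

/-! ### Functions dominated by a regulator -/

section Dominated

variable {V : Type} [NormedAddCommGroup V] [NormedSpace ℝ V]
  {E : Type} [NormedAddCommGroup E] [NormedSpace ℂ E]

/-- `F` is smooth and all its derivatives are bounded by multiples of `G`. -/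
def Dominated (G : V → ℝ) (F : V → E) : Prop :=
  ContDiff ℝ ∞ F ∧ ∀ n : ℕ, ∃ C : ℝ, 0 ≤ C ∧ ∀ φ, ‖iteratedFDeriv ℝ n F φ‖ ≤ C * G φ

lemma Dominated.bound {G : V → ℝ} {F : V → E} (h : Dominated G F) :
    ∃ C : ℝ, 0 ≤ C ∧ ∀ φ, ‖F φ‖ ≤ C * G φ := by
  obtain ⟨C, hC0, hC⟩ := h.2 0
  exact ⟨C, hC0, fun φ => by simpa using hC φ⟩

lemma Dominated.fderiv {G : V → ℝ} {F : V → E} (h : Dominated G F) :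
    Dominated G (_root_.fderiv ℝ F) := by
  refine ⟨(contDiff_infty_iff_fderiv.mp h.1).2, fun n => ?_⟩
  obtain ⟨C, hC0, hC⟩ := h.2 (n + 1)
  exact ⟨C, hC0, fun φ => by rw [norm_iteratedFDeriv_fderiv]; exact hC φ⟩

variable {Ω : Type*} [MeasurableSpace Ω] {ν : Measure Ω} {Z : Ω → V} {w : Ω → ℂ} {G : V → ℝ}

/-- Near every field, the shifted regulators have a common integrable bound. -/
def ShiftIntegrable (ν : Measure Ω) (Z : Ω → V) (G : V → ℝ) : Prop :=
  ∀ φ₀ : V, ∃ B : Ω → ℝ, Integrable B ν ∧ ∀ φ ∈ Metric.ball φ₀ 1, ∀ z, G (φ + Z z) ≤ B z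

variable [MeasurableSpace V] [BorelSpace V] [SecondCountableTopology V]

lemma Dominated.aestronglyMeasurable {F : V → E} (h : Dominated G F) (hZ : Measurable Z)
    (hw : Measurable w) (φ : V) : AEStronglyMeasurable (fun z => w z • F (φ + Z z)) ν := by
  have h1 : StronglyMeasurable F := h.1.continuous.stronglyMeasurable
  exact (hw.stronglyMeasurable.smul (h1.comp_measurable (hZ.const_add φ))).aestronglyMeasurable

lemma Dominated.integrable {F : V → E} (h : Dominated G F) (hG : ShiftIntegrable ν Z G)
    (hZ : Measurable Z) (hw : Measurable w) (hw1 : ∀ z, ‖w z‖ ≤ 1) (φ : V) :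
    Integrable (fun z => w z • F (φ + Z z)) ν := by
  obtain ⟨C, hC0, hC⟩ := h.bound
  obtain ⟨B, hB, hGB⟩ := hG φ
  refine (hB.const_mul C).mono' (h.aestronglyMeasurable hZ hw φ) (Eventually.of_forall fun z => ?_)
  rw [norm_smul]
  calc ‖w z‖ * ‖F (φ + Z z)‖ ≤ 1 * (C * G (φ + Z z)) := by
        gcongr
        · exact hw1 z
        · exact hC _
    _ ≤ C * B z := by
        rw [one_mul]
        exact mul_le_mul_of_nonneg_left (hGB φ (Metric.mem_ball_self one_pos) z) hC0

lemma Dominated.hasFDerivAt_integral {F : V → E} (h : Dominated G F)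
    (hG : ShiftIntegrable ν Z G) (hZ : Measurable Z) (hw : Measurable w) (hw1 : ∀ z, ‖w z‖ ≤ 1)
    (φ : V) : HasFDerivAt (fun φ => ∫ z, w z • F (φ + Z z) ∂ν)
      (∫ z, w z • _root_.fderiv ℝ F (φ + Z z) ∂ν) φ := by
  obtain ⟨C, hC0, hC⟩ := h.fderiv.bound
  obtain ⟨B, hB, hGB⟩ := hG φ
  refine hasFDerivAt_integral_of_dominated_of_fderiv_le (𝕜 := ℝ)
    (F := fun φ z => w z • F (φ + Z z)) (F' := fun φ z => w z • _root_.fderiv ℝ F (φ + Z z))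
    (bound := fun z => C * B z)
    (Metric.ball_mem_nhds φ one_pos)
    (Eventually.of_forall fun x => h.aestronglyMeasurable hZ hw x) (h.integrable hG hZ hw hw1 φ)
    (h.fderiv.aestronglyMeasurable hZ hw φ) ?_ (hB.const_mul C) ?_
  · refine Eventually.of_forall fun z x hx => ?_
    rw [norm_smul]
    calc ‖w z‖ * ‖_root_.fderiv ℝ F (x + Z z)‖ ≤ 1 * (C * G (x + Z z)) := by
          gcongr
          · exact hw1 z
          · exact hC _
      _ ≤ C * B z := by
          rw [one_mul]
          exact mul_le_mul_of_nonneg_left (hGB x hx z) hC0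
  · refine Eventually.of_forall fun z x _ => ?_
    have h1 : HasFDerivAt (fun x => F (x + Z z)) (_root_.fderiv ℝ F (x + Z z)) x :=
      by
      rw [hasFDerivAt_comp_add_right]
      exact (h.1.differentiable (by simp) (x + Z z)).hasFDerivAt
    exact h1.const_smul (w z)

lemma Dominated.fderiv_integral {F : V → E} (h : Dominated G F)
    (hG : ShiftIntegrable ν Z G) (hZ : Measurable Z) (hw : Measurable w) (hw1 : ∀ z, ‖w z‖ ≤ 1) :
    _root_.fderiv ℝ (fun φ => ∫ z, w z • F (φ + Z z) ∂ν) =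
      fun φ => ∫ z, w z • _root_.fderiv ℝ F (φ + Z z) ∂ν :=
  funext fun φ => (h.hasFDerivAt_integral hG hZ hw hw1 φ).fderiv

/-- Differentiation under the integral sign preserves the form of the integral, and dominated
functions are stable under `fderiv`. The target space changes at each step, so the induction is over
all `E` at once. -/
lemma Dominated.contDiff_integral (hG : ShiftIntegrable ν Z G) (hZ : Measurable Z)
    (hw : Measurable w) (hw1 : ∀ z, ‖w z‖ ≤ 1) {F : V → E} (h : Dominated G F) :
    ContDiff ℝ ∞ (fun φ => ∫ z, w z • F (φ + Z z) ∂ν) := by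
  rw [contDiff_infty]
  intro n
  induction n generalizing E with
  | zero =>
    rw [CharP.cast_eq_zero, contDiff_zero]
    exact continuous_iff_continuousAt.mpr fun φ =>
      (h.hasFDerivAt_integral hG hZ hw hw1 φ).continuousAt
  | succ n ih =>
    rw [Nat.cast_succ, contDiff_succ_iff_fderiv]
    refine ⟨fun φ => (h.hasFDerivAt_integral hG hZ hw hw1 φ).differentiableAt, fun hn => ?_, ?_⟩
    · exact absurd hn (by simp)
    · rw [h.fderiv_integral hG hZ hw hw1]
      exact ih h.fderiv

lemma Dominated.norm_iteratedFDeriv_integral_le (hG : ShiftIntegrable ν Z G) (hZ : Measurable Z)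
    (hw : Measurable w) (hw1 : ∀ z, ‖w z‖ ≤ 1) {F : V → E} (h : Dominated G F) (n : ℕ) (φ : V) :
    ‖iteratedFDeriv ℝ n (fun φ => ∫ z, w z • F (φ + Z z) ∂ν) φ‖ ≤
      ∫ z, ‖iteratedFDeriv ℝ n F (φ + Z z)‖ ∂ν := by
  induction n generalizing E with
  | zero =>
    simp only [norm_iteratedFDeriv_zero]
    refine (norm_integral_le_integral_norm _).trans (integral_mono_of_nonneg
      (Eventually.of_forall fun _ => norm_nonneg _) ?_ (Eventually.of_forall fun z => ?_))
    · simpa using (h.integrable hG hZ (w := fun _ => 1) (by fun_prop) (by simp) φ).norm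
    · simp only [norm_smul]
      exact mul_le_of_le_one_left (norm_nonneg _) (hw1 z)
  | succ n ih =>
    simp only [← norm_iteratedFDeriv_fderiv]
    rw [h.fderiv_integral hG hZ hw hw1]
    exact ih h.fderiv

end Dominated

/-! ### Series of extended nonnegative numbers -/

section Series

/-- This inequality needs no measurability. That matters because the seminorms are suprema over
uncountable families of test functions. -/
lemma tsum_lintegral_le {Ω : Type*} [MeasurableSpace Ω] (ν : Measure Ω) (f : ℕ → Ω → ℝ≥0∞) :
    ∑' n, ∫⁻ z, f n z ∂ν ≤ ∫⁻ z, ∑' n, f n z ∂ν := by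
  have h : ∀ s : Finset ℕ, ∑ n ∈ s, ∫⁻ z, f n z ∂ν ≤ ∫⁻ z, ∑ n ∈ s, f n z ∂ν := by
    intro s
    classical
    induction s using Finset.induction_on with
    | empty => simp
    | insert a s ha ih =>
      simp only [Finset.sum_insert ha]
      exact (add_le_add le_rfl ih).trans (le_lintegral_add _ _)
  rw [ENNReal.tsum_eq_iSup_sum]
  exact iSup_le fun s => (h s).trans (lintegral_mono fun z => ENNReal.sum_le_tsum s)

lemma tsum_antidiagonal (f : ℕ → ℕ → ℝ≥0∞) :
    ∑' n, ∑ p ∈ Finset.HasAntidiagonal.antidiagonal n, f p.1 p.2 = ∑' a, ∑' b, f a b := by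
  rw [← ENNReal.tsum_prod, ← Finset.HasAntidiagonal.sigmaAntidiagonalEquivProd.tsum_eq, ENNReal.tsum_sigma']
  refine tsum_congr fun n => ?_
  rw [tsum_fintype, Finset.univ_eq_attach]
  exact (Finset.sum_attach _ fun p : ℕ × ℕ => f p.1 p.2).symm

/-- The terms `xⁿ / n!` of the exponential series. -/
def expTerm (x : ℝ) (n : ℕ) : ℝ≥0∞ := ENNReal.ofReal (x ^ n / n.factorial)

lemma expTerm_mul_pow {x : ℝ} (hx : 0 ≤ x) (y : ℝ) (n : ℕ) :
    expTerm x n * ENNReal.ofReal (y ^ n) = expTerm (x * y) n := by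
  rw [expTerm, expTerm, ← ENNReal.ofReal_mul (by positivity), mul_pow]
  congr 1; ring

lemma sum_antidiagonal_expTerm {x y : ℝ} (hx : 0 ≤ x) (hy : 0 ≤ y) (n : ℕ) :
    ∑ p ∈ Finset.HasAntidiagonal.antidiagonal n, expTerm x p.1 * expTerm y p.2 = expTerm (x + y) n := by
  have h1 : (x + y) ^ n / n.factorial = ∑ p ∈ Finset.HasAntidiagonal.antidiagonal n,
      (x ^ p.1 / p.1.factorial) * (y ^ p.2 / p.2.factorial) := by
    rw [(Commute.all x y).add_pow', Finset.sum_div]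
    refine Finset.sum_congr rfl fun p hp => ?_
    rw [Finset.HasAntidiagonal.mem_antidiagonal] at hp
    rw [← hp, nsmul_eq_mul, Nat.cast_add_choose]
    have := Nat.factorial_ne_zero (p.1 + p.2)
    field_simp
  rw [expTerm, h1, ENNReal.ofReal_sum_of_nonneg fun p _ => by positivity]
  exact Finset.sum_congr rfl fun p _ => (ENNReal.ofReal_mul (by positivity)).symm

lemma tsum_expTerm {x : ℝ} (hx : 0 ≤ x) : ∑' n, expTerm x n = ENNReal.ofReal (Real.exp x) := by
  have h := NormedSpace.expSeries_div_hasSum_exp (𝔸 := ℝ) x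
  rw [← Real.exp_eq_exp_ℝ] at h
  rw [← h.tsum_eq, ENNReal.ofReal_tsum_of_nonneg (fun n => by positivity) h.summable]
  rfl

lemma expTerm_mono {x y : ℝ} (hx : 0 ≤ x) (hxy : x ≤ y) (n : ℕ) : expTerm x n ≤ expTerm y n :=
  ENNReal.ofReal_le_ofReal (by gcongr)

/-- `∑_{a + b = n} n! / (a! b!) Aᵃ εᵇ N_{k + b}`. -/
def wordBound (A ε : ℝ) (N : ℕ → ℝ≥0∞) (n k : ℕ) : ℝ≥0∞ :=
  ∑ p ∈ Finset.HasAntidiagonal.antidiagonal n, (n.choose p.1 : ℝ≥0∞) *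
    (ENNReal.ofReal A ^ p.1 * ENNReal.ofReal ε ^ p.2 * N (k + p.2))

lemma wordBound_zero (A ε : ℝ) (N : ℕ → ℝ≥0∞) (k : ℕ) : wordBound A ε N 0 k = N k := by
  simp [wordBound]

/-- Pascal's rule, matching the split of one more test function into its constant part, of weight
`A`, and its small part, of weight `ε`, which uses one more derivative. -/
lemma wordBound_succ (A ε : ℝ) (N : ℕ → ℝ≥0∞) (n k : ℕ) :
    wordBound A ε N (n + 1) k =
      ENNReal.ofReal A * wordBound A ε N n k + ENNReal.ofReal ε * wordBound A ε N n (k + 1) := by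
  rw [wordBound, Finset.sum_antidiagonal_choose_succ_mul (R := ℝ≥0∞)
    (fun a b => ENNReal.ofReal A ^ a * ENNReal.ofReal ε ^ b * N (k + b)), add_comm, wordBound,
    wordBound, Finset.mul_sum, Finset.mul_sum]
  congr 1
  · refine Finset.sum_congr rfl fun p hp => ?_
    rw [Finset.HasAntidiagonal.mem_antidiagonal] at hp
    rw [Nat.choose_symm_of_eq_add (by omega : n = p.1 + p.2) |>.symm, pow_succ]
    ring
  · refine Finset.sum_congr rfl fun p _ => ?_
    rw [pow_succ, show k + (p.2 + 1) = k + 1 + p.2 by ring]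
    ring

lemma expTerm_mul_wordBound {h A ε : ℝ} (hh : 0 ≤ h) (hA : 0 ≤ A) (hε : 0 ≤ ε) (N : ℕ → ℝ≥0∞)
    (n k : ℕ) : expTerm h n * wordBound A ε N n k = ∑ p ∈ Finset.HasAntidiagonal.antidiagonal n,
      expTerm (h * A) p.1 * (expTerm (h * ε) p.2 * N (k + p.2)) := by
  rw [wordBound, Finset.mul_sum]
  refine Finset.sum_congr rfl fun p hp => ?_
  rw [Finset.HasAntidiagonal.mem_antidiagonal] at hp
  rw [← mul_assoc, ← mul_assoc, ← mul_assoc, ← mul_assoc]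
  congr 1
  rw [← ENNReal.ofReal_pow hA, ← ENNReal.ofReal_pow hε, ← ENNReal.ofReal_natCast, expTerm, expTerm,
    expTerm, ← ENNReal.ofReal_mul (by positivity), ← ENNReal.ofReal_mul (by positivity),
    ← ENNReal.ofReal_mul (by positivity), ← ENNReal.ofReal_mul (by positivity), ← hp,
    Nat.cast_add_choose]
  congr 1
  have := Nat.factorial_ne_zero (p.1 + p.2)
  field_simp
  ring

/-- The constant directions factor out and sum to `e^{hA}`. The shift directions of radius `ρ` and
the small directions of radius `hε` combine by the binomial theorem into the radius `ρ + hε ≤ h`, so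
what remains is the norm with parameter `h`. -/
lemma tsum_wordBound_le {h A ε ρ : ℝ} (hh : 0 ≤ h) (hA : 0 ≤ A) (hε : 0 ≤ ε) (hρ : 0 ≤ ρ)
    (hle : ρ + h * ε ≤ h) (N : ℕ → ℝ≥0∞) :
    ∑' n, ∑' m, expTerm h n * (expTerm ρ m * wordBound A ε N n m) ≤
      ENNReal.ofReal (Real.exp (h * A)) * ∑' k, expTerm h k * N k := by
  have h1 : ∀ m, ∑' n, expTerm h n * wordBound A ε N n m =
      ENNReal.ofReal (Real.exp (h * A)) * ∑' b, expTerm (h * ε) b * N (m + b) := by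
    intro m
    simp only [expTerm_mul_wordBound hh hA hε]
    rw [tsum_antidiagonal (fun a b => expTerm (h * A) a * (expTerm (h * ε) b * N (m + b)))]
    simp only [ENNReal.tsum_mul_left, ENNReal.tsum_mul_right]
    rw [tsum_expTerm (by positivity)]
  have h2 : ∑' m, ∑' b, expTerm ρ m * (expTerm (h * ε) b * N (m + b)) =
      ∑' k, expTerm (ρ + h * ε) k * N k := by
    rw [← tsum_antidiagonal (fun m b => expTerm ρ m * (expTerm (h * ε) b * N (m + b)))]
    refine tsum_congr fun k => ?_
    rw [← sum_antidiagonal_expTerm hρ (by positivity), Finset.sum_mul]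
    refine Finset.sum_congr rfl fun p hp => ?_
    rw [Finset.HasAntidiagonal.mem_antidiagonal] at hp
    rw [hp, mul_assoc]
  calc ∑' n, ∑' m, expTerm h n * (expTerm ρ m * wordBound A ε N n m)
      = ∑' m, expTerm ρ m * ∑' n, expTerm h n * wordBound A ε N n m := by
        rw [ENNReal.tsum_comm]
        refine tsum_congr fun m => ?_
        rw [← ENNReal.tsum_mul_left]
        exact tsum_congr fun n => by ring
    _ = ENNReal.ofReal (Real.exp (h * A)) * ∑' k, expTerm (ρ + h * ε) k * N k := by
        simp only [h1]
        rw [← h2, ← ENNReal.tsum_mul_left]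
        refine tsum_congr fun m => ?_
        rw [ENNReal.tsum_mul_left]
        ring
    _ ≤ _ := by
        gcongr with k
        exact expTerm_mono (by positivity) hle k

end Series

/-! ### Seminorms of functions of the field -/

section Seminorms

set_option linter.unusedSectionVars false

variable {N : ℕ} [NeZero N] {S : Finset (Torus N)} {F : (Torus N → ℝ) → ℂ} {G : (Torus N → ℝ) → ℝ}

/-- `‖F(φ)‖_{Tⁿ_j}`. -/
def tSemi (L j : ℕ) (S : Finset (Torus N)) (F : (Torus N → ℝ) → ℂ) (φ : Torus N → ℝ) (n : ℕ) :
    ℝ≥0∞ :=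
  ⨆ (f : Fin n → Torus N → ℂ) (_ : ∀ i, c2Norm L j S (f i) ≤ 1), ‖dirDeriv S F n φ f‖ₑ

lemma tNorm_eq (h : ℝ) (L j : ℕ) (S : Finset (Torus N)) (F : (Torus N → ℝ) → ℂ)
    (φ : Torus N → ℝ) : tNorm h L j S F φ = ∑' n, expTerm h n * tSemi L j S F φ n := rfl

lemma enorm_ddList_le_tSemi (hF : ContDiff ℝ ∞ F) (L j : ℕ) (φ : Torus N → ℝ)
    (fs : List (Torus N → ℂ)) (hfs : ∀ f ∈ fs, c2Norm L j S f ≤ 1) :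
    ‖ddList S fs F φ‖ₑ ≤ tSemi L j S F φ fs.length := by
  have h := dirDeriv_eq_ddList (S := S) hF fs.length φ fs.get
  rw [List.ofFn_get] at h
  rw [← h]
  exact le_iSup₂_of_le fs.get (fun i => hfs _ (List.get_mem _ _)) le_rfl

/-- Each `f = a • 1 + ε • g` is split, innermost derivative first. The constant direction acts on a
charged function as multiplication by `iκ` and uses no derivative; the other produces the factor `ε`
and moves `g` into the list `gs`. -/
lemma enorm_ddList_words_le {κ : ℝ} (hF : IsCharged S κ F) {L j : ℕ} {A ε : ℝ} (hA : |κ| ≤ A)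
    (hε : 0 ≤ ε) (φ : Torus N → ℝ) (ps fs gs : List (Torus N → ℂ))
    (hps : ∀ f ∈ ps, c2Norm L j S f ≤ 1) (hgs : ∀ f ∈ gs, c2Norm L j S f ≤ 1)
    (hfs : ∀ f ∈ fs, ∃ (a : ℂ) (g : Torus N → ℂ), ‖a‖ ≤ 1 ∧ c2Norm L j S g ≤ 1 ∧
      f = a • 1 + (ε : ℂ) • g) :
    ‖ddList S (ps ++ fs ++ gs) F φ‖ₑ ≤
      wordBound A ε (tSemi L j S F φ) fs.length (ps.length + gs.length) := by
  induction fs using List.reverseRecOn generalizing gs with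
  | nil =>
    rw [List.length_nil, wordBound_zero, ← List.length_append, List.append_nil]
    refine enorm_ddList_le_tSemi hF.smooth L j φ _ fun f hf => ?_
    rcases List.mem_append.mp hf with h | h
    exacts [hps f h, hgs f h]
  | append_singleton fs f ih =>
    have hfs' : ∀ f ∈ fs, ∃ (a : ℂ) (g : Torus N → ℂ), ‖a‖ ≤ 1 ∧ c2Norm L j S g ≤ 1 ∧
      f = a • 1 + (ε : ℂ) • g := fun f hf => hfs f (List.mem_append_left _ hf)
    obtain ⟨a, g, ha, hg, rfl⟩ := hfs f (by simp)
    have hH := hF.ddList gs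
    have h1 : ddList S (ps ++ (fs ++ [a • 1 + (ε : ℂ) • g]) ++ gs) F =
        (a * (Complex.I * κ)) • ddList S (ps ++ fs ++ gs) F +
          (ε : ℂ) • ddList S (ps ++ fs ++ (g :: gs)) F := by
      rw [show ps ++ (fs ++ [a • 1 + (ε : ℂ) • g]) ++ gs =
        (ps ++ fs) ++ ((a • 1 + (ε : ℂ) • g) :: gs) by simp, ddList_append, ddList_cons, dd_add_fun,
        dd_smul_fun, dd_smul_fun, hH.dd_one, smul_smul,
        ddList_add (F := (a * (Complex.I * κ)) • ddList S gs F)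
          (G := (ε : ℂ) • dd S g (ddList S gs F)) (hH.smooth.const_smul (a * (Complex.I * κ)))
          ((contDiff_dd hH.smooth g).const_smul (ε : ℂ)),
        ddList_smul hH.smooth, ddList_smul (contDiff_dd hH.smooth g), ← ddList_append,
        ← ddList_cons, ← ddList_append]
    rw [h1, List.length_append, List.length_singleton, wordBound_succ]
    simp only [Pi.add_apply, Pi.smul_apply, smul_eq_mul]
    refine (enorm_add_le _ _).trans (add_le_add ?_ ?_)
    · rw [enorm_mul]
      refine mul_le_mul' ?_ (ih gs hgs hfs')
      rw [← ofReal_norm]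
      refine ENNReal.ofReal_le_ofReal ?_
      rw [norm_mul, norm_mul, Complex.norm_I, one_mul, Complex.norm_real, Real.norm_eq_abs]
      exact (mul_le_of_le_one_left (abs_nonneg _) ha).trans hA
    · rw [enorm_mul]
      refine mul_le_mul' ?_ ?_
      · rw [← ofReal_norm, Complex.norm_real, Real.norm_of_nonneg hε]
      · have h2 := ih (g :: gs) (by simpa using ⟨hg, hgs⟩) hfs'
        rwa [List.length_cons, ← add_assoc] at h2

lemma DependsOn.iteratedFDeriv_apply (h : DependsOn S F) (hF : ContDiff ℝ ∞ F) (n : ℕ)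
    (φ : Torus N → ℝ) (v : Fin n → Torus N → ℝ) :
    iteratedFDeriv ℝ n F φ v = CoulombGas.ddList S (List.ofFn fun i x => (v i x : ℂ)) F φ := by
  induction n generalizing φ with
  | zero => simp
  | succ n ih =>
    rw [List.ofFn_succ, ddList_cons, iteratedFDeriv_succ_apply_left,
      ← (h.ddList hF _).fderiv_apply (contDiff_ddList hF _)]
    have hd : Differentiable ℝ (iteratedFDeriv ℝ n F) :=
      hF.differentiable_iteratedFDeriv (by exact_mod_cast WithTop.coe_lt_top _)
    have h1 : CoulombGas.ddList S (List.ofFn fun (i : Fin n) x => (v i.succ x : ℂ)) F =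
        fun φ => iteratedFDeriv ℝ n F φ (Fin.tail v) := by
      ext φ
      exact (ih φ (Fin.tail v)).symm
    rw [h1]
    have h2 := ((ContinuousMultilinearMap.apply ℝ (fun _ : Fin n => Torus N → ℝ) ℂ
      (Fin.tail v)).hasFDerivAt).comp φ (hd φ).hasFDerivAt
    exact (congrArg (fun A => A (v 0)) h2.fderiv).symm

lemma norm_iterDiff_le {E : Type*} [NormedAddCommGroup E] (w : List (Fin 4)) (f : Torus N → E)
    {r : ℝ} (hr : ∀ x, ‖f x‖ ≤ r) (x : Torus N) : ‖iterDiff w f x‖ ≤ 2 ^ w.length * r := by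
  induction w generalizing x with
  | nil => simpa using hr x
  | cons μ w ih =>
    rw [iterDiff_cons, List.length_cons, pow_succ]
    calc ‖diff μ (iterDiff w f) x‖ ≤ ‖iterDiff w f (x + dir N μ)‖ + ‖iterDiff w f x‖ :=
          norm_sub_le _ _
      _ ≤ 2 ^ w.length * r + 2 ^ w.length * r := add_le_add (ih _) (ih _)
      _ = _ := by ring

lemma c2Norm_ofReal_le_one {L : ℕ} (hL : 1 ≤ L) (j : ℕ) (v : Torus N → ℝ)
    (hv : 4 * (L : ℝ) ^ (2 * j) * ‖v‖ ≤ 1) : c2Norm L j S (fun x => (v x : ℂ)) ≤ 1 := by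
  rw [c2Norm_le_iff]
  intro w hw x _
  have h1 : ∀ x, ‖((v x : ℝ) : ℂ)‖ ≤ ‖v‖ := fun x => by
    rw [Complex.norm_real]; exact norm_le_pi_norm v x
  have hL' : (1 : ℝ) ≤ L := by exact_mod_cast hL
  calc (L : ℝ) ^ (w.length * j) * ‖iterDiff w (fun x => (v x : ℂ)) x‖
      ≤ (L : ℝ) ^ (2 * j) * (2 ^ w.length * ‖v‖) := by
        gcongr
        · exact Nat.lt_succ_iff.mp hw
        · exact norm_iterDiff_le w _ h1 x
    _ ≤ (L : ℝ) ^ (2 * j) * (2 ^ 2 * ‖v‖) := by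
        gcongr
        · norm_num
        · exact Nat.lt_succ_iff.mp hw
    _ ≤ 1 := by linarith
    _ = ((1 : ℝ≥0) : ℝ) := by simp

/-- A single term of the series defining the norm bounds the `n`-th derivative on unit test
functions, and `4 L^{2j} ‖v‖ ≤ 1` makes `v` one. The constants may depend on `n` and `L^j`, since
the result only serves to justify differentiation under integrals. -/
lemma dominated_of_tNorm_le (hF : ContDiff ℝ ∞ F) (hS : DependsOn S F) (hG : ∀ φ, 0 ≤ G φ)
    {L j : ℕ} (hL : 1 ≤ L) {h : ℝ} (hh : 0 < h) {M : ℝ} (hM : 0 ≤ M)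
    (hle : ∀ φ, tNorm h L j S F φ ≤ ENNReal.ofReal (M * G φ)) : Dominated G F := by
  refine ⟨hF, fun n => ?_⟩
  set D : ℝ := 4 * (L : ℝ) ^ (2 * j) with hD
  have hL' : (0 : ℝ) < L := by exact_mod_cast hL
  have hD0 : 0 < D := by positivity
  set b : ℝ := h ^ n / n.factorial with hb
  have hb0 : 0 < b := by positivity
  have h1 : ∀ φ (v : Fin n → Torus N → ℝ), (∀ i, D * ‖v i‖ ≤ 1) →
      ‖iteratedFDeriv ℝ n F φ v‖ ≤ b⁻¹ * (M * G φ) := by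
    intro φ v hv
    rw [hS.iteratedFDeriv_apply hF]
    have h2 := enorm_ddList_le_tSemi (S := S) hF L j φ (List.ofFn fun i x => (v i x : ℂ)) (by
      intro f hf
      obtain ⟨i, rfl⟩ := (List.mem_ofFn' _ _).mp hf
      exact c2Norm_ofReal_le_one hL j _ (hv i))
    rw [List.length_ofFn] at h2
    have h3 : ENNReal.ofReal b * ‖ddList S (List.ofFn fun i x => (v i x : ℂ)) F φ‖ₑ ≤
        ENNReal.ofReal (M * G φ) :=
      (mul_le_mul' le_rfl h2).trans ((ENNReal.le_tsum n).trans (hle φ))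
    rw [← ofReal_norm, ← ENNReal.ofReal_mul hb0.le,
      ENNReal.ofReal_le_ofReal_iff (mul_nonneg hM (hG φ))] at h3
    rw [inv_mul_eq_div, le_div_iff₀ hb0]
    linarith
  refine ⟨D ^ n * (b⁻¹ * M), by positivity, fun φ => ?_⟩
  refine ContinuousMultilinearMap.opNorm_le_bound (by have := hG φ; positivity) fun v => ?_
  have h4 : v = fun i => (D * ‖v i‖) • ((D * ‖v i‖)⁻¹ • v i) := by
    ext1 i
    rcases eq_or_ne (v i) 0 with h0 | h0
    · simp [h0]
    · rw [smul_smul, mul_inv_cancel₀ (by have := norm_pos_iff.mpr h0; positivity), one_smul]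
  have h5 := h1 φ (fun i => (D * ‖v i‖)⁻¹ • v i) (fun i => by
    rw [norm_smul, norm_inv, Real.norm_of_nonneg (by positivity)]
    rcases eq_or_ne (v i) 0 with h0 | h0
    · simp [h0]
    · have := norm_pos_iff.mpr h0
      rw [mul_inv]; field_simp; rfl)
  conv_lhs => rw [h4]
  rw [ContinuousMultilinearMap.map_smul_univ, norm_smul]
  calc ‖∏ i, D * ‖v i‖‖ * ‖iteratedFDeriv ℝ n F φ fun i => (D * ‖v i‖)⁻¹ • v i‖
      ≤ (D ^ n * ∏ i, ‖v i‖) * (b⁻¹ * (M * G φ)) := by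
        gcongr
        rw [Real.norm_of_nonneg (Finset.prod_nonneg fun i _ => by positivity),
          Finset.prod_mul_distrib]
        simp
    _ = _ := by ring

end Seminorms

/-! ### Directional derivatives of integrals of dominated functions -/

section DominatedCalculus

set_option linter.unusedSectionVars false

lemma Dominated.clm_comp {V E E' : Type} [NormedAddCommGroup V] [NormedSpace ℝ V]
    [NormedAddCommGroup E] [NormedSpace ℂ E] [NormedAddCommGroup E'] [NormedSpace ℂ E']
    {G : V → ℝ} {F : V → E} (T : E →L[ℝ] E') (h : Dominated G F) :
    Dominated G (fun φ => T (F φ)) := by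
  refine ⟨T.contDiff.comp h.1, fun n => ?_⟩
  obtain ⟨C, hC0, hC⟩ := h.2 n
  refine ⟨‖T‖ * C, by positivity, fun φ => ?_⟩
  have h1 := T.norm_iteratedFDeriv_comp_left (N := (n : WithTop ℕ∞)) (n := n) (f := F) (x := φ)
    (h.1.of_le (by exact_mod_cast le_top)).contDiffAt le_rfl
  calc _ ≤ ‖T‖ * ‖iteratedFDeriv ℝ n F φ‖ := h1
    _ ≤ ‖T‖ * (C * G φ) := by gcongr; exact hC φ
    _ = _ := by ring

variable {N : ℕ} [NeZero N] {S : Finset (Torus N)} {F : (Torus N → ℝ) → ℂ} {G : (Torus N → ℝ) → ℝ}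

lemma Dominated.dd (h : Dominated G F) (f : Torus N → ℂ) : Dominated G (dd S f F) :=
  h.fderiv.clm_comp (coordSum S f)

lemma Dominated.ddList (h : Dominated G F) (fs : List (Torus N → ℂ)) :
    Dominated G (ddList S fs F) := by
  induction fs with
  | nil => exact h
  | cons f fs ih => exact ih.dd f

variable {Ω : Type*} [MeasurableSpace Ω] {ν : Measure Ω} {Z : Ω → Torus N → ℝ} {w : Ω → ℂ}

lemma Dominated.ddList_integral (hG : ShiftIntegrable ν Z G) (hZ : Measurable Z)
    (hw : Measurable w) (hw1 : ∀ z, ‖w z‖ ≤ 1) (h : Dominated G F) (fs : List (Torus N → ℂ)) :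
    CoulombGas.ddList S fs (fun φ => ∫ z, w z • F (φ + Z z) ∂ν) =
      fun φ => ∫ z, w z • CoulombGas.ddList S fs F (φ + Z z) ∂ν := by
  induction fs with
  | nil => rfl
  | cons f fs ih =>
    have hd : Dominated G (CoulombGas.ddList S fs F) := h.ddList fs
    rw [ddList_cons, ih]
    ext φ
    rw [CoulombGas.dd, hd.fderiv_integral hG hZ hw hw1,
      ← ContinuousLinearMap.integral_comp_comm _ (hd.fderiv.integrable hG hZ hw hw1 φ)]
    congr 1
    ext z
    rw [ddList_cons, CoulombGas.dd, coordSum_apply, coordSum_apply, smul_eq_mul, Finset.mul_sum]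
    refine Finset.sum_congr rfl fun x _ => ?_
    simp; ring

end DominatedCalculus

/-! ### Charge components -/

section Charge

set_option linter.unusedSectionVars false

variable {N : ℕ} [NeZero N] {S : Finset (Torus N)} {F : (Torus N → ℝ) → ℂ} {G : (Torus N → ℝ) → ℝ}

/-- The shifts of the field by constants. -/
def constShift (N : ℕ) (s : ℝ) : Torus N → ℝ := fun _ => s

/-- The phases of the Fourier coefficients. -/
def phase (κ : ℝ) (s : ℝ) : ℂ := Complex.exp (-(Complex.I * κ * s))

lemma norm_phase (κ s : ℝ) : ‖phase κ s‖ = 1 := by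
  rw [phase, Complex.norm_exp]; simp

lemma measurable_phase (κ : ℝ) : Measurable (phase κ) := by unfold phase; fun_prop

lemma continuous_constShift : Continuous (constShift N) := by unfold constShift; fun_prop

/-- The uniform measure on a period. -/
def periodMeasure (T : ℝ) : Measure ℝ := volume.restrict (Set.Ioc 0 T)

instance (T : ℝ) : IsFiniteMeasure (periodMeasure T) := by unfold periodMeasure; infer_instance

lemma chargeComponent_eq {α : ℝ} (hα : 0 < α) (q : ℤ) (F : (Torus N → ℝ) → ℂ) :
    chargeComponent α q F = ((α / (2 * Real.pi) : ℝ) : ℂ) • fun φ =>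
      ∫ s, phase (q * α) s • F (φ + constShift N s) ∂(periodMeasure (2 * Real.pi / α)) := by
  ext φ
  rw [chargeComponent, intervalIntegral.integral_of_le (by positivity)]
  simp only [Pi.smul_apply, smul_eq_mul, periodMeasure, phase]
  congr 2
  ext s
  rw [mul_comm]
  push_cast
  congr 2
  ring

lemma shiftIntegrable_constShift (hG : Continuous G) (hs : ∀ φ s, G (φ + constShift N s) = G φ)
    (T : ℝ) : ShiftIntegrable (periodMeasure T) (constShift N) G := by
  intro φ₀
  obtain ⟨b, hb⟩ := (isCompact_closedBall φ₀ 1).bddAbove_image hG.continuousOn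
  refine ⟨fun _ => b, integrable_const b, fun φ hφ s => ?_⟩
  rw [hs]
  exact hb ⟨φ, Metric.ball_subset_closedBall hφ, rfl⟩

lemma Dominated.chargeComponent (h : Dominated G F) (hG : Continuous G)
    (hs : ∀ φ s, G (φ + constShift N s) = G φ) {α : ℝ} (hα : 0 < α) (q : ℤ) :
    Dominated G (chargeComponent α q F) := by
  have hsi := shiftIntegrable_constShift hG hs (2 * Real.pi / α)
  have hZ : Measurable (constShift N) := continuous_constShift.measurable
  have hw := measurable_phase (q * α)
  have hw1 : ∀ s, ‖phase (q * α) s‖ ≤ 1 := fun s => (norm_phase _ s).le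
  have key : Dominated G fun φ =>
      ∫ s, phase (q * α) s • F (φ + constShift N s) ∂(periodMeasure (2 * Real.pi / α)) := by
    refine ⟨h.contDiff_integral hsi hZ hw hw1, fun n => ?_⟩
    obtain ⟨C, hC0, hC⟩ := h.2 n
    refine ⟨(periodMeasure (2 * Real.pi / α)).real Set.univ * C, by positivity, fun φ => ?_⟩
    refine (h.norm_iteratedFDeriv_integral_le hsi hZ hw hw1 n φ).trans ?_
    calc ∫ s, ‖iteratedFDeriv ℝ n F (φ + constShift N s)‖ ∂(periodMeasure (2 * Real.pi / α))
        ≤ ∫ _, C * G φ ∂(periodMeasure (2 * Real.pi / α)) := by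
          refine integral_mono_of_nonneg (Eventually.of_forall fun _ => norm_nonneg _)
            (integrable_const _) (Eventually.of_forall fun s => ?_)
          simpa [hs] using hC (φ + constShift N s)
      _ = _ := by rw [integral_const, smul_eq_mul]; ring
  rw [chargeComponent_eq hα]
  exact key.clm_comp (((α / (2 * Real.pi) : ℝ) : ℂ) • ContinuousLinearMap.id ℝ ℂ)

/-- Because `q` is an integer, the integrand `F(φ + s) e^{-iqαs}` has period `2π/α` in `s`. A shift
of `φ` by `s₀` translates the integration interval, which changes nothing but the phase. -/
lemma isCharged_chargeComponent {α : ℝ} (hα : 0 < α) (q : ℤ)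
    (hsm : ContDiff ℝ ∞ (chargeComponent α q F)) (hS : DependsOn S F)
    (hper : ∀ φ : Torus N → ℝ, F (φ + constShift N (2 * Real.pi / α)) = F φ) :
    IsCharged S (q * α) (chargeComponent α q F) := by
  refine ⟨hsm, fun φ ψ hφψ => ?_, fun φ s₀ => ?_⟩
  · rw [chargeComponent, chargeComponent]
    congr 2
    ext s
    rw [hS _ _ fun x hx => by rw [hφψ x hx]]
  · set u : ℝ → ℂ := fun s => F (fun x => φ x + s) * Complex.exp (-(Complex.I * q * α * s)) with hu
    have hup : Function.Periodic u (2 * Real.pi / α) := by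
      intro s
      simp only [hu]
      have h1 : (fun x => φ x + (s + 2 * Real.pi / α)) =
          (fun x => φ x + s) + constShift N (2 * Real.pi / α) := by
        ext x; simp [constShift]; ring
      rw [h1, hper]
      congr 1
      rw [Complex.exp_eq_exp_iff_exists_int]
      refine ⟨-q, ?_⟩
      have : (α : ℂ) ≠ 0 := by exact_mod_cast hα.ne'
      push_cast
      field_simp
      ring
    have h2 : ∀ s : ℝ, F (fun x => (φ + fun _ : Torus N => s₀) x + s) *
        Complex.exp (-(Complex.I * q * α * s)) =
        Complex.exp (Complex.I * ((q * α : ℝ) : ℂ) * s₀) * u (s₀ + s) := by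
      intro s
      simp only [hu]
      rw [mul_left_comm, ← Complex.exp_add]
      congr 2
      · ext x; simp [add_assoc]
      · push_cast; ring
    rw [CoulombGas.chargeComponent, CoulombGas.chargeComponent]
    simp only [h2]
    rw [intervalIntegral.integral_const_mul, intervalIntegral.integral_comp_add_left, add_zero,
      hup.intervalIntegral_add_eq s₀ 0, zero_add]
    ring

/-- The charge component averages `F` over constant shifts with phases of modulus one, and `G` is
invariant under such shifts; the bound therefore passes through the average without loss. -/
lemma tNorm_chargeComponent_le (h : Dominated G F) (hG : Continuous G)
    (hs : ∀ φ s, G (φ + constShift N s) = G φ) {α : ℝ} (hα : 0 < α) (q : ℤ) {L j : ℕ} {t : ℝ}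
    {M : ℝ} (hle : ∀ φ, tNorm t L j S F φ ≤ ENNReal.ofReal (M * G φ)) (φ : Torus N → ℝ) :
    tNorm t L j S (chargeComponent α q F) φ ≤ ENNReal.ofReal (M * G φ) := by
  have hsi := shiftIntegrable_constShift hG hs (2 * Real.pi / α)
  have hZ : Measurable (constShift N) := continuous_constShift.measurable
  have hw := measurable_phase (q * α)
  have hw1 : ∀ s, ‖phase (q * α) s‖ ≤ 1 := fun s => (norm_phase _ s).le
  have hc0 : 0 < α / (2 * Real.pi) := by positivity
  set c : ℝ≥0∞ := ENNReal.ofReal (α / (2 * Real.pi)) with hc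
  set ν := periodMeasure (2 * Real.pi / α) with hν
  have hsm := (h.contDiff_integral hsi hZ hw hw1)
  have h1 : ∀ n, tSemi L j S (CoulombGas.chargeComponent α q F) φ n ≤
      c * ∫⁻ s, tSemi L j S F (φ + constShift N s) n ∂ν := by
    intro n
    refine iSup₂_le fun f hf => ?_
    rw [dirDeriv_eq_ddList (h.chargeComponent hG hs hα q).1, chargeComponent_eq hα,
      ddList_smul hsm, h.ddList_integral hsi hZ hw hw1, Pi.smul_apply, smul_eq_mul, enorm_mul,
      ← ofReal_norm, Complex.norm_real, Real.norm_of_nonneg hc0.le]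
    refine mul_le_mul' le_rfl ((enorm_integral_le_lintegral_enorm _).trans
      (lintegral_mono fun s => ?_))
    rw [smul_eq_mul, enorm_mul, ← ofReal_norm, norm_phase, ENNReal.ofReal_one, one_mul,
      ← dirDeriv_eq_ddList h.1]
    exact le_iSup₂_of_le f hf le_rfl
  calc tNorm t L j S (CoulombGas.chargeComponent α q F) φ
      ≤ ∑' n, c * ∫⁻ s, expTerm t n * tSemi L j S F (φ + constShift N s) n ∂ν := by
        rw [tNorm_eq]
        refine ENNReal.tsum_le_tsum fun n => (mul_le_mul' le_rfl (h1 n)).trans ?_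
        rw [mul_left_comm]
        exact mul_le_mul' le_rfl (lintegral_const_mul_le _ _)
    _ ≤ c * ∫⁻ s, ∑' n, expTerm t n * tSemi L j S F (φ + constShift N s) n ∂ν := by
        rw [ENNReal.tsum_mul_left]
        exact mul_le_mul' le_rfl (tsum_lintegral_le _ _)
    _ ≤ c * ∫⁻ _, ENNReal.ofReal (M * G φ) ∂ν := by
        refine mul_le_mul' le_rfl (lintegral_mono fun s => ?_)
        have := hle (φ + constShift N s)
        rwa [tNorm_eq, hs] at this
    _ = ENNReal.ofReal (M * G φ) := by
        rw [lintegral_const, hν, periodMeasure, Measure.restrict_apply_univ, Real.volume_Ioc, hc,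
          mul_left_comm, ← ENNReal.ofReal_mul hc0.le]
        have : α / (2 * Real.pi) * (2 * Real.pi / α - 0) = 1 := by
          have := Real.pi_pos
          field_simp; simp
        rw [this, ENNReal.ofReal_one, mul_one]

end Charge

/-! ### The Cameron–Martin formula -/

section CameronMartin

set_option linter.unusedSectionVars false

variable {N : ℕ} [NeZero N] {Γ : Torus N → ℝ}

lemma covMatrix_neg (hΓ : (covMatrix Γ).PosSemidef) (x : Torus N) : Γ (-x) = Γ x := by
  have h := hΓ.isHermitian.apply x 0
  simpa [covMatrix] using h

lemma quadForm_nonneg (hΓ : (covMatrix Γ).PosSemidef) (a : Torus N → ℝ) :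
    0 ≤ ∑ x, ∑ y, a x * a y * Γ (x - y) := by
  have h := hΓ.dotProduct_mulVec_nonneg a
  simp only [dotProduct, Matrix.mulVec, covMatrix, Matrix.of_apply, Pi.star_apply, star_trivial,
    Finset.mul_sum] at h
  refine h.trans_eq (Finset.sum_congr rfl fun x _ => Finset.sum_congr rfl fun y _ => by ring)

lemma quadForm_single_add (hΓ : (covMatrix Γ).PosSemidef) (a : Torus N → ℝ) (x₀ : Torus N)
    (s t : ℝ) :
    ∑ x, ∑ y, (s * a x + t * Pi.single (M := fun _ => ℝ) x₀ 1 x) *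
        (s * a y + t * Pi.single (M := fun _ => ℝ) x₀ 1 y) * Γ (x - y) =
      s ^ 2 * (∑ x, ∑ y, a x * a y * Γ (x - y)) + 2 * s * t * (∑ x, a x * Γ (x - x₀)) +
        t ^ 2 * Γ 0 := by
  have h1 : ∀ x y, (s * a x + t * Pi.single (M := fun _ => ℝ) x₀ 1 x) *
      (s * a y + t * Pi.single (M := fun _ => ℝ) x₀ 1 y) * Γ (x - y) =
      s ^ 2 * (a x * a y * Γ (x - y)) +
      s * t * (a x * (if y = x₀ then Γ (x - y) else 0)) +
      s * t * (if x = x₀ then a y * Γ (x - y) else 0) +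
      t ^ 2 * (if x = x₀ then (if y = x₀ then Γ (x - y) else 0) else 0) := by
    intro x y
    simp only [Pi.single_apply]
    split_ifs <;> ring
  simp only [h1, Finset.sum_add_distrib, ← Finset.mul_sum]
  have h2 : ∑ x, ∑ y, (if x = x₀ then a y * Γ (x - y) else 0) = ∑ x, a x * Γ (x - x₀) := by
    rw [Finset.sum_comm]
    refine Finset.sum_congr rfl fun y _ => ?_
    rw [Finset.sum_ite_eq' Finset.univ x₀, if_pos (Finset.mem_univ _), ← covMatrix_neg hΓ, neg_sub]
  have h3 : ∑ x, ∑ y, (if x = x₀ then (if y = x₀ then Γ (x - y) else 0) else 0) = Γ 0 := by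
    rw [Finset.sum_eq_single x₀]
    · simp
    · intro x _ hx; simp [hx]
    · simp
  have h4 : ∀ x, (∑ y, if y = x₀ then Γ (x - y) else 0) = Γ (x - x₀) := by
    intro x; simp
  rw [h2, h3]
  simp only [h4]
  ring

lemma integrable_exp_sum (hΓ : (covMatrix Γ).PosSemidef) (a : Torus N → ℝ) (s : ℝ) :
    Integrable (fun ζ : Torus N → ℝ => Real.exp (s * ∑ x, a x * ζ x)) (fieldLaw Γ) := by
  have h := integrable_exp_mul_gaussianReal (μ := 0)
    (v := (∑ x, ∑ y, a x * a y * Γ (x - y)).toNNReal) s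
  rw [← map_sum_fieldLaw hΓ a] at h
  exact h.comp_measurable (by fun_prop)

lemma integral_exp_sum (hΓ : (covMatrix Γ).PosSemidef) (a : Torus N → ℝ) :
    ∫ ζ, Real.exp (∑ x, a x * ζ x) ∂(fieldLaw Γ) =
      Real.exp ((∑ x, ∑ y, a x * a y * Γ (x - y)) / 2) := by
  have h := mgf_gaussianReal (map_sum_fieldLaw hΓ a) 1
  rw [mgf, Real.coe_toNNReal _ (quadForm_nonneg hΓ a)] at h
  simpa using h

/-- The Cameron–Martin formula: an exponential tilt is a shift. -/
lemma withDensity_fieldLaw (hΓ : (covMatrix Γ).PosSemidef) (x₀ : Torus N) (t : ℝ) :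
    (fieldLaw Γ).withDensity (fun ζ => ENNReal.ofReal (Real.exp (t * ζ x₀ - t ^ 2 * Γ 0 / 2))) =
      (fieldLaw Γ).map (fun ζ => ζ + fun x => t * Γ (x - x₀)) := by
  have hdec : ∀ (s : ℝ) (a ζ : Torus N → ℝ), s * (∑ x, a x * ζ x) + t * ζ x₀ =
      ∑ x, (s * a x + t * Pi.single (M := fun _ => ℝ) x₀ 1 x) * ζ x := by
    intro s a ζ
    simp only [add_mul, Finset.sum_add_distrib, Finset.mul_sum, mul_assoc]
    congr 1
    rw [Finset.sum_eq_single x₀]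
    · simp
    · intro x _ hx; simp [hx]
    · simp
  have hmeas : Measurable fun ζ : Torus N → ℝ => Real.exp (t * ζ x₀ - t ^ 2 * Γ 0 / 2) := by
    fun_prop
  have hshift : Measurable fun ζ : Torus N → ℝ => ζ + fun x => t * Γ (x - x₀) := by fun_prop
  have hint : Integrable (fun ζ : Torus N → ℝ => Real.exp (t * ζ x₀ - t ^ 2 * Γ 0 / 2))
      (fieldLaw Γ) := by
    have h := (integrable_exp_sum hΓ (fun x => 0 * (0 : Torus N → ℝ) x +
      t * Pi.single (M := fun _ => ℝ) x₀ 1 x) 1).div_const (Real.exp (t ^ 2 * Γ 0 / 2))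
    refine h.congr (Eventually.of_forall fun ζ => ?_)
    simp only
    rw [one_mul, ← hdec, Real.exp_sub, zero_mul, zero_add]
  have : IsFiniteMeasure ((fieldLaw Γ).withDensity
      (fun ζ => ENNReal.ofReal (Real.exp (t * ζ x₀ - t ^ 2 * Γ 0 / 2)))) :=
    isFiniteMeasure_withDensity_ofReal hint.2
  have : IsProbabilityMeasure ((fieldLaw Γ).map (fun ζ => ζ + fun x => t * Γ (x - x₀))) :=
    Measure.isProbabilityMeasure_map hshift.aemeasurable
  -- The two laws are compared through characteristic functions. For each linear functional the real
  -- moment generating functions agree by an explicit Gaussian computation, and they exist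
  -- everywhere, so the agreement continues to the imaginary axis.
  refine (Measure.ext_of_charFunDual (funext fun ℓ => ?_)).symm
  set a : Torus N → ℝ := fun x => ℓ (Pi.single x 1) with ha
  have hℓ : ∀ ζ, ℓ ζ = ∑ x, a x * ζ x := by
    intro ζ
    conv_lhs => rw [← Finset.univ_sum_single ζ, map_sum]
    refine Finset.sum_congr rfl fun x _ => ?_
    rw [show (Pi.single x (ζ x) : Torus N → ℝ) = ζ x • Pi.single x 1 by
      rw [← Pi.single_smul, smul_eq_mul, mul_one], map_smul, smul_eq_mul, mul_comm]
  have hℓu : ∀ ζ : Torus N → ℝ, ℓ (ζ + fun x => t * Γ (x - x₀)) =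
      ∑ x, a x * ζ x + t * ∑ x, a x * Γ (x - x₀) := by
    intro ζ
    rw [hℓ, Finset.mul_sum, ← Finset.sum_add_distrib]
    exact Finset.sum_congr rfl fun x _ => by simp only [Pi.add_apply]; ring
  have hm : mgf ℓ ((fieldLaw Γ).map (fun ζ => ζ + fun x => t * Γ (x - x₀))) =
      mgf ℓ ((fieldLaw Γ).withDensity
        (fun ζ => ENNReal.ofReal (Real.exp (t * ζ x₀ - t ^ 2 * Γ 0 / 2)))) := by
    ext s
    rw [mgf, mgf, integral_map hshift.aemeasurable (by fun_prop),
      integral_withDensity_eq_integral_toReal_smul (by fun_prop) (by simp)]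
    have h1 : ∀ ζ : Torus N → ℝ, (ENNReal.ofReal (Real.exp (t * ζ x₀ - t ^ 2 * Γ 0 / 2))).toReal •
        Real.exp (s * ℓ ζ) = Real.exp (-(t ^ 2 * Γ 0 / 2)) *
        Real.exp (∑ x, (s * a x + t * Pi.single (M := fun _ => ℝ) x₀ 1 x) * ζ x) := by
      intro ζ
      rw [ENNReal.toReal_ofReal (Real.exp_pos _).le, smul_eq_mul, ← Real.exp_add, ← Real.exp_add,
        ← hdec, hℓ]
      congr 1; ring
    have h2 : ∀ ζ : Torus N → ℝ, Real.exp (s * ℓ (ζ + fun x => t * Γ (x - x₀))) =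
        Real.exp (s * (t * ∑ x, a x * Γ (x - x₀))) * Real.exp (∑ x, (s * a x) * ζ x) := by
      intro ζ
      rw [hℓu, ← Real.exp_add, mul_add, Finset.mul_sum, add_comm]
      simp only [mul_assoc]
    simp only [h1, h2]
    rw [integral_const_mul, integral_const_mul, integral_exp_sum hΓ, integral_exp_sum hΓ,
      quadForm_single_add hΓ, ← Real.exp_add, ← Real.exp_add]
    congr 1
    have h3 : ∑ x, ∑ y, s * a x * (s * a y) * Γ (x - y) =
        s ^ 2 * ∑ x, ∑ y, a x * a y * Γ (x - y) := by
      simp only [Finset.mul_sum]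
      exact Finset.sum_congr rfl fun x _ => Finset.sum_congr rfl fun y _ => by ring
    rw [h3]; ring
  have hset : integrableExpSet ℓ
      ((fieldLaw Γ).map (fun ζ => ζ + fun x => t * Γ (x - x₀))) = Set.univ := by
    refine Set.eq_univ_of_forall fun s => ?_
    change Integrable _ _
    rw [integrable_map_measure (by fun_prop) hshift.aemeasurable]
    refine ((integrable_exp_sum hΓ a s).const_mul
      (Real.exp (s * (t * ∑ x, a x * Γ (x - x₀))))).congr (Eventually.of_forall fun ζ => ?_)
    simp only [Function.comp_apply]
    rw [hℓu, ← Real.exp_add]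
    congr 1; ring
  have key := eqOn_complexMGF_of_mgf hm (x := Complex.I) (by simp [hset])
  rw [charFunDual_apply, charFunDual_apply]
  simp only [complexMGF] at key
  simpa only [mul_comm Complex.I] using key

lemma integral_cexp_mul_fieldLaw (hΓ : (covMatrix Γ).PosSemidef) (x₀ : Torus N) (t : ℝ)
    {f : (Torus N → ℝ) → ℂ} (hf : Continuous f) :
    ∫ ζ, Complex.exp (t * ζ x₀) * f ζ ∂(fieldLaw Γ) =
      Complex.exp (t ^ 2 * Γ 0 / 2) * ∫ ζ, f (ζ + fun x => t * Γ (x - x₀)) ∂(fieldLaw Γ) := by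
  have hshift : Measurable fun ζ : Torus N → ℝ => ζ + fun x => t * Γ (x - x₀) := by fun_prop
  rw [← integral_map (f := f) hshift.aemeasurable hf.aestronglyMeasurable,
    ← withDensity_fieldLaw hΓ,
    integral_withDensity_eq_integral_toReal_smul (by fun_prop) (by simp), ← integral_const_mul]
  refine integral_congr_ae (Eventually.of_forall fun ζ => ?_)
  simp only
  rw [ENNReal.toReal_ofReal (Real.exp_pos _).le, Complex.real_smul, ← mul_assoc, Complex.ofReal_exp,
    ← Complex.exp_add]
  congr 2
  push_cast; ring

end CameronMartin

/-! ### Taylor series -/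

section Taylor

/-- The derivative of the remainder of order `n + 1` is the remainder of order `n` of the shifted
family, so the bound integrates up. Growth of the norm replaces the Lagrange form, which fails for
complex values. -/
lemma norm_taylor_le {B T : ℝ} (n : ℕ) {g : ℕ → ℝ → ℂ}
    (hg : ∀ n t, HasDerivAt (g n) (g (n + 1) t) t)
    (hB : ∀ t ∈ Set.Icc 0 T, ‖g n t‖ ≤ B) : ∀ t ∈ Set.Icc 0 T,
    ‖g 0 t - ∑ m ∈ Finset.range n, ((t ^ m / m.factorial : ℝ) : ℂ) * g m 0‖ ≤
      B * (t ^ n / n.factorial) := by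
  induction n generalizing g with
  | zero => intro t ht; simpa using hB t ht
  | succ n ih =>
    have h1 := ih (g := fun m => g (m + 1)) (fun m t => hg (m + 1) t) hB
    have hpow : ∀ (m : ℕ) (t : ℝ), HasDerivAt (fun t : ℝ => t ^ (m + 1) / (m + 1).factorial)
        (t ^ m / m.factorial) t := by
      intro m t
      have h := (hasDerivAt_pow (m + 1) t).div_const ((m + 1).factorial : ℝ)
      refine h.congr_deriv ?_
      rw [Nat.factorial_succ]
      push_cast
      have : (m.factorial : ℝ) ≠ 0 := by positivity
      field_simp
    have hd : ∀ t, HasDerivAt (fun t => g 0 t -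
        ∑ m ∈ Finset.range (n + 1), ((t ^ m / m.factorial : ℝ) : ℂ) * g m 0)
        (g 1 t - ∑ m ∈ Finset.range n, ((t ^ m / m.factorial : ℝ) : ℂ) * g (m + 1) 0) t := by
      intro t
      simp only [Finset.sum_range_succ']
      refine (hg 0 t).sub ?_
      have h2 := HasDerivAt.fun_sum (u := Finset.range n) fun m _ =>
        ((hpow m t).ofReal_comp.mul_const (g (m + 1) 0))
      simpa using h2
    refine image_norm_le_of_norm_deriv_right_le_deriv_boundary
      (fun t _ => (hd t).continuousAt.continuousWithinAt) (fun t _ => (hd t).hasDerivWithinAt)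
      (B := fun t => B * (t ^ (n + 1) / (n + 1).factorial)) (B' := fun t => B * (t ^ n / n.factorial))
      ?_ (fun t => (hpow n t).const_mul B) (fun t ht => h1 t (Set.Ico_subset_Icc_self ht))
    simp [Finset.sum_range_succ']

/-- The hypothesis is a family of Cauchy estimates of radius `r`, uniform along the segment; it
makes the Taylor remainder at most `B (t / r)^n`. -/
lemma hasSum_taylor {g : ℕ → ℝ → ℂ} (hg : ∀ n t, HasDerivAt (g n) (g (n + 1) t) t) {r t B : ℝ}
    (ht : 0 ≤ t) (htr : t < r)
    (hB : ∀ n, ∀ s ∈ Set.Icc 0 t, r ^ n / n.factorial * ‖g n s‖ ≤ B) :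
    HasSum (fun m => ((t ^ m / m.factorial : ℝ) : ℂ) * g m 0) (g 0 t) := by
  have hr : 0 < r := ht.trans_lt htr
  have hq0 : 0 ≤ t / r := by positivity
  have hq1 : t / r < 1 := (div_lt_one hr).mpr htr
  have hb : ∀ n, ∀ s ∈ Set.Icc 0 t, ‖g n s‖ ≤ B * (n.factorial / r ^ n) := by
    intro n s hs
    have h := hB n s hs
    have : (0 : ℝ) < n.factorial := by positivity
    calc ‖g n s‖ = (r ^ n / n.factorial * ‖g n s‖) * (n.factorial / r ^ n) := by field_simp
      _ ≤ _ := by gcongr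
  have hterm : ∀ n : ℕ, B * (n.factorial / r ^ n) * (t ^ n / n.factorial) = B * (t / r) ^ n := by
    intro n
    have : (0 : ℝ) < n.factorial := by positivity
    rw [div_pow]; field_simp
  have hs : Summable fun m => ((t ^ m / m.factorial : ℝ) : ℂ) * g m 0 := by
    refine Summable.of_norm_bounded ((summable_geometric_of_lt_one hq0 hq1).mul_left B) fun m => ?_
    rw [norm_mul, Complex.norm_real, Real.norm_of_nonneg (by positivity), ← hterm, mul_comm]
    gcongr
    exact hb m 0 ⟨le_rfl, ht⟩
  have hlim : Tendsto (fun n => ∑ m ∈ Finset.range n, ((t ^ m / m.factorial : ℝ) : ℂ) * g m 0)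
      atTop (𝓝 (g 0 t)) := by
    rw [tendsto_iff_norm_sub_tendsto_zero]
    refine squeeze_zero (fun _ => norm_nonneg _) (g := fun n => B * (t / r) ^ n) (fun n => ?_) ?_
    · rw [norm_sub_rev, ← hterm]
      exact norm_taylor_le n hg (hb n) t ⟨ht, le_rfl⟩
    · simpa using (tendsto_pow_atTop_nhds_zero_of_lt_one hq0 hq1).const_mul B
  have := tendsto_nhds_unique hs.hasSum.tendsto_sum_nat hlim
  exact this ▸ hs.hasSum

end Taylor

/-! ### The complex shift of a charged function -/

section ComplexShift

set_option linter.unusedSectionVars false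

variable {N : ℕ} [NeZero N] {Γ : Torus N → ℝ} {S : Finset (Torus N)} {G : (Torus N → ℝ) → ℝ}
  {H : (Torus N → ℝ) → ℂ} {κ η r : ℝ} {x₀ : Torus N}

/-- `x ↦ Γ(x - x₀) - Γ(0)`. -/
def increment (Γ : Torus N → ℝ) (x₀ : Torus N) : Torus N → ℝ := fun x => Γ (x - x₀) - Γ 0

lemma ofReal_pow_div_mul_eq (hr : 0 ≤ r) (n : ℕ) (z : ℂ) :
    ENNReal.ofReal (r ^ n / n.factorial * ‖z‖) = expTerm r n * ‖z‖ₑ := by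
  rw [ENNReal.ofReal_mul (by positivity), ofReal_norm, expTerm]

/-- The hypothesis `hdom` holds at every field, and `G` is bounded on the compact segment from `φ`
to `φ + tψ`. This supplies the uniform Cauchy estimates for the Taylor series. -/
lemma IsCharged.hasSum_shift (hH : IsCharged S κ H) (hG : Continuous G) (ψ : Torus N → ℝ)
    (hG0 : ∀ φ, 0 ≤ G φ)
    (hdom : ∀ φ, ∑' m, expTerm r m *
      ‖CoulombGas.ddList S (List.replicate m fun x => (ψ x : ℂ)) H φ‖ₑ ≤ ENNReal.ofReal (G φ))
    (φ : Torus N → ℝ) {t : ℝ} (ht : 0 ≤ t) (htr : t < r) :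
    HasSum (fun m => ((t ^ m / m.factorial : ℝ) : ℂ) *
      CoulombGas.ddList S (List.replicate m fun x => (ψ x : ℂ)) H φ) (H (φ + t • ψ)) := by
  have hr : 0 < r := ht.trans_lt htr
  set g : ℕ → ℝ → ℂ := fun m t =>
    CoulombGas.ddList S (List.replicate m fun x => (ψ x : ℂ)) H (φ + t • ψ) with hgdef
  have hg : ∀ n t, HasDerivAt (g n) (g (n + 1) t) t := by
    intro n t
    have hc := hH.ddList (List.replicate n fun x => (ψ x : ℂ))
    have h1 : HasDerivAt (fun t : ℝ => φ + t • ψ) ψ t := by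
      simpa using ((hasDerivAt_id t).smul_const ψ).const_add φ
    have h2 := ((hc.smooth.differentiable (by simp) (φ + t • ψ)).hasFDerivAt).comp_hasDerivAt t h1
    rw [hc.dependsOn.fderiv_apply hc.smooth] at h2
    exact h2
  obtain ⟨B, hB⟩ := (isCompact_Icc (a := (0 : ℝ)) (b := t)).bddAbove_image
    (f := fun s => G (φ + s • ψ)) (by fun_prop)
  have hb : ∀ n, ∀ s ∈ Set.Icc 0 t, r ^ n / n.factorial * ‖g n s‖ ≤ B := by
    intro n s hs
    have h1 := (ENNReal.le_tsum n).trans (hdom (φ + s • ψ))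
    rw [← ofReal_pow_div_mul_eq hr.le, ENNReal.ofReal_le_ofReal_iff (hG0 _)] at h1
    exact h1.trans (hB ⟨s, hs, rfl⟩)
  have := hasSum_taylor hg ht htr hb
  simpa [hgdef] using this

/-- The weighted function whose exponential moments are continued analytically. -/
def twist (η : ℝ) (x₀ : Torus N) (F : (Torus N → ℝ) → ℂ) : (Torus N → ℝ) → ℂ :=
  fun φ => Complex.exp (-(Complex.I * η * φ x₀)) * F φ

lemma norm_twist (F : (Torus N → ℝ) → ℂ) (φ : Torus N → ℝ) : ‖twist η x₀ F φ‖ = ‖F φ‖ := by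
  rw [twist, norm_mul, Complex.norm_exp]; simp

lemma enorm_twist (F : (Torus N → ℝ) → ℂ) (φ : Torus N → ℝ) : ‖twist η x₀ F φ‖ₑ = ‖F φ‖ₑ := by
  rw [← ofReal_norm, norm_twist, ofReal_norm]

lemma continuous_twist {F : (Torus N → ℝ) → ℂ} (hF : Continuous F) :
    Continuous (twist η x₀ F) := by
  unfold twist; fun_prop

lemma differentiable_integral_cexp {ν : Measure (Torus N → ℝ)} {f : (Torus N → ℝ) → ℂ}
    (hf : Continuous f) {g : (Torus N → ℝ) → ℝ} (hfg : ∀ ζ, ‖f ζ‖ ≤ g ζ)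
    (hint : ∀ a : ℝ, 0 ≤ a → Integrable (fun ζ => Real.exp (a * |ζ x₀|) * g ζ) ν) :
    Differentiable ℂ fun z : ℂ => ∫ ζ, Complex.exp (z * ζ x₀) * f ζ ∂ν := by
  intro z₀
  have hexp : ∀ (z : ℂ) (ζ : Torus N → ℝ), ‖Complex.exp (z * ζ x₀)‖ ≤ Real.exp (‖z‖ * |ζ x₀|) := by
    intro z ζ
    refine (Complex.norm_exp_le_exp_norm _).trans (le_of_eq ?_)
    rw [norm_mul, Complex.norm_real, Real.norm_eq_abs]
  -- In the exponent `‖z₀‖ + 2`, one unit covers the ball around `z₀` and the other absorbs the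
  -- factor `|ζ x₀| ≤ e^{|ζ x₀|}`.
  have h := hasDerivAt_integral_of_dominated_loc_of_deriv_le (𝕜 := ℂ) (μ := ν)
    (F := fun z ζ => Complex.exp (z * ζ x₀) * f ζ)
    (F' := fun z ζ => Complex.exp (z * ζ x₀) * ζ x₀ * f ζ)
    (bound := fun ζ => Real.exp ((‖z₀‖ + 2) * |ζ x₀|) * g ζ)
    (Metric.ball_mem_nhds z₀ one_pos)
    (Eventually.of_forall fun z => Continuous.aestronglyMeasurable (by fun_prop)) ?_
    (Continuous.aestronglyMeasurable (by fun_prop)) ?_ (hint _ (by positivity)) ?_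
  · exact h.2.differentiableAt
  · refine (hint ‖z₀‖ (norm_nonneg _)).mono' (Continuous.aestronglyMeasurable (by fun_prop))
      (Eventually.of_forall fun ζ => ?_)
    rw [norm_mul]
    exact mul_le_mul (hexp z₀ ζ) (hfg ζ) (norm_nonneg _) (Real.exp_pos _).le
  · refine Eventually.of_forall fun ζ z hz => ?_
    have hz' : ‖z‖ ≤ ‖z₀‖ + 1 := by
      have h1 := norm_sub_norm_le z z₀
      have h2 : ‖z - z₀‖ < 1 := by simpa [dist_eq_norm] using hz
      linarith
    rw [norm_mul, norm_mul, Complex.norm_real, Real.norm_eq_abs]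
    refine mul_le_mul ?_ (hfg ζ) (norm_nonneg _) (Real.exp_pos _).le
    calc ‖Complex.exp (z * ζ x₀)‖ * |ζ x₀|
        ≤ Real.exp ((‖z₀‖ + 1) * |ζ x₀|) * Real.exp |ζ x₀| := by
          refine mul_le_mul ((hexp z ζ).trans (Real.exp_le_exp.mpr (by gcongr))) ?_ (abs_nonneg _)
            (Real.exp_pos _).le
          linarith [Real.add_one_le_exp |ζ x₀|]
      _ = Real.exp ((‖z₀‖ + 2) * |ζ x₀|) := by rw [← Real.exp_add]; congr 1; ring
  · refine Eventually.of_forall fun ζ z _ => ?_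
    have h1 : HasDerivAt (fun z : ℂ => z * (ζ x₀ : ℂ)) (ζ x₀ : ℂ) z := by
      simpa using (hasDerivAt_id z).mul_const (ζ x₀ : ℂ)
    exact h1.cexp.mul_const (f ζ)

/-- The bound on the expectation of a charged function that results from a shift of the field by
`iη(Γ(· - x₀) - Γ(0))`. -/
lemma IsCharged.enorm_integral_le (hΓ : (covMatrix Γ).PosSemidef) (hH : IsCharged S κ H)
    (hG : Continuous G) (hG0 : ∀ φ, 0 ≤ G φ) (hη : |η| < r)
    (hdom : ∀ φ, ∑' m, expTerm r m *
      ‖CoulombGas.ddList S (List.replicate m fun x => (increment Γ x₀ x : ℂ)) H φ‖ₑ ≤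
        ENNReal.ofReal (G φ))
    (φ' : Torus N → ℝ) (hint : ∀ a : ℝ, 0 ≤ a →
      Integrable (fun ζ => Real.exp (a * |ζ x₀|) * G (φ' + ζ)) (fieldLaw Γ)) :
    ‖∫ ζ, H (φ' + ζ) ∂(fieldLaw Γ)‖ₑ ≤ ENNReal.ofReal (Real.exp ((η ^ 2 / 2 - κ * η) * Γ 0)) *
      ∫⁻ ζ, ∑' m, expTerm |η| m *
        ‖CoulombGas.ddList S (List.replicate m fun x => (increment Γ x₀ x : ℂ)) H (φ' + ζ)‖ₑ
          ∂(fieldLaw Γ) := by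
  have hr : 0 < r := (abs_nonneg η).trans_lt hη
  set ν := fieldLaw Γ with hν
  set Dm : ℕ → (Torus N → ℝ) → ℂ := fun m =>
    CoulombGas.ddList S (List.replicate m fun x => (increment Γ x₀ x : ℂ)) H with hDm
  have hDcont : ∀ m, Continuous (Dm m) := fun m => (contDiff_ddList hH.smooth _).continuous
  set c : ℕ → ℂ := fun m => ∫ ζ, twist η x₀ (Dm m) (φ' + ζ) ∂ν with hc
  have hce : ∀ m, ‖c m‖ₑ ≤ ∫⁻ ζ, ‖Dm m (φ' + ζ)‖ₑ ∂ν := by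
    intro m
    refine (enorm_integral_le_lintegral_enorm _).trans (le_of_eq ?_)
    simp only [enorm_twist]
  have hGint : Integrable (fun ζ => G (φ' + ζ)) ν := by simpa using hint 0 le_rfl
  have hsumfin : ∀ ρ : ℝ, 0 ≤ ρ → ρ ≤ r →
      ∑' m, ∫⁻ ζ, expTerm ρ m * ‖Dm m (φ' + ζ)‖ₑ ∂ν ≠ ⊤ := by
    intro ρ hρ hρr
    refine ((tsum_lintegral_le _ _).trans (lintegral_mono fun ζ => ?_)).trans_lt
      hGint.lintegral_lt_top |>.ne
    refine le_trans (ENNReal.tsum_le_tsum fun m => ?_) (hdom (φ' + ζ))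
    exact mul_le_mul' (expTerm_mono hρ hρr m) le_rfl
  have hHG : ∀ φ, ‖H φ‖ ≤ G φ := by
    intro φ
    have h1 := (ENNReal.le_tsum 0).trans (hdom φ)
    rw [← ofReal_pow_div_mul_eq hr.le, ENNReal.ofReal_le_ofReal_iff (hG0 _)] at h1
    simpa using h1
  -- `Λ` is entire by the exponential moments in `hint`. At `z = iη` the exponential cancels the
  -- twist, up to the phase `e^{-iηφ'(x₀)}`, and leaves the expectation of `H`.
  set Λ : ℂ → ℂ := fun z => ∫ ζ, Complex.exp (z * ζ x₀) * twist η x₀ H (φ' + ζ) ∂ν with hΛ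
  have hΛd : Differentiable ℂ Λ := by
    refine differentiable_integral_cexp (g := fun ζ => G (φ' + ζ))
      ((continuous_twist hH.smooth.continuous).comp (by fun_prop)) (fun ζ => ?_) hint
    rw [norm_twist]
    exact hHG _
  set term : ℕ → ℂ → ℂ := fun m z => z ^ m / m.factorial * c m with hterm
  have hterm_enorm : ∀ m z, ‖term m z‖ₑ = expTerm ‖z‖ m * ‖c m‖ₑ := by
    intro m z
    rw [← ofReal_pow_div_mul_eq (norm_nonneg z), ← ofReal_norm, hterm]
    simp
  -- `ρ` is the outcome of the Cameron–Martin shift for real `z`: the Gaussian factor, the phase of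
  -- the constant shift `z Γ(0)` for the twisted charge `κ - η`, and the Taylor series in the
  -- increment, which converges for `|z| < r`.
  set ρ : ℂ → ℂ := fun z => Complex.exp (z ^ 2 * Γ 0 / 2 + Complex.I * (κ - η) * Γ 0 * z) *
    ∑' m, term m z with hρ
  have hsum_u : Summable fun m => ‖term m (r : ℂ)‖ := by
    rw [← tsum_enorm_ne_top_iff_summable_norm]
    refine ne_top_of_le_ne_top (hsumfin r hr.le le_rfl) (ENNReal.tsum_le_tsum fun m => ?_)
    rw [hterm_enorm, Complex.norm_real, Real.norm_of_nonneg hr.le]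
    exact (mul_le_mul' le_rfl (hce m)).trans (lintegral_const_mul_le _ _)
  have hρd : DifferentiableOn ℂ ρ (Metric.ball 0 r) := by
    refine DifferentiableOn.mul (by fun_prop)
      (Complex.differentiableOn_tsum_of_summable_norm hsum_u (fun m => by fun_prop)
        Metric.isOpen_ball fun m z hz => ?_)
    rw [mem_ball_zero_iff] at hz
    simp only [hterm, norm_mul, norm_div, norm_pow, Complex.norm_real, Real.norm_of_nonneg hr.le]
    gcongr
  have hreal : ∀ t : ℝ, 0 < t → t < r → Λ t = ρ t := by
    intro t ht htr
    have h1 := integral_cexp_mul_fieldLaw hΓ x₀ t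
      (f := fun ζ => twist η x₀ H (φ' + ζ))
      ((continuous_twist hH.smooth.continuous).comp (by fun_prop))
    simp only [hΛ]
    rw [h1]
    have h2 : ∀ ζ : Torus N → ℝ, twist η x₀ H (φ' + (ζ + fun x => t * Γ (x - x₀))) =
        Complex.exp (Complex.I * (κ - η) * Γ 0 * t) *
          ∑' m, ((t ^ m / m.factorial : ℝ) : ℂ) * twist η x₀ (Dm m) (φ' + ζ) := by
      intro ζ
      have h3 := (hH.hasSum_shift hG (increment Γ x₀) hG0 hdom (φ' + ζ) ht.le htr).mul_left
        (Complex.exp (-(Complex.I * η * ((φ' + ζ) x₀ : ℝ))))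
      have h4 : ∀ m, Complex.exp (-(Complex.I * η * ((φ' + ζ) x₀ : ℝ))) *
          (((t ^ m / m.factorial : ℝ) : ℂ) * CoulombGas.ddList S
            (List.replicate m fun x => (increment Γ x₀ x : ℂ)) H (φ' + ζ)) =
          ((t ^ m / m.factorial : ℝ) : ℂ) * twist η x₀ (Dm m) (φ' + ζ) := fun m => by
        rw [twist, mul_left_comm]
      simp only [h4] at h3
      rw [h3.tsum_eq]
      -- The shift is split into the increment, which vanishes at `x₀` and so does not affect the
      -- twist, and the constant `t Γ(0)`, which is seen by the charge.
      have h5 : φ' + (ζ + fun x => t * Γ (x - x₀)) =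
          (φ' + ζ + t • increment Γ x₀) + fun _ => t * Γ 0 := by
        ext x
        simp only [Pi.add_apply, Pi.smul_apply, smul_eq_mul, increment]
        ring
      rw [twist, h5, hH.shift, ← mul_assoc, ← mul_assoc, ← Complex.exp_add, ← Complex.exp_add]
      congr 2
      simp only [Pi.add_apply, Pi.smul_apply, smul_eq_mul, increment, sub_self]
      push_cast
      ring
    simp only [h2]
    rw [integral_const_mul, integral_tsum]
    · rw [← mul_assoc, ← Complex.exp_add]
      simp only [hρ, hterm, integral_const_mul, hc]
      push_cast
      rfl
    · intro m
      exact Continuous.aestronglyMeasurable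
        (continuous_const.mul ((continuous_twist (hDcont m)).comp (by fun_prop)))
    · refine ne_top_of_le_ne_top (hsumfin t ht.le htr.le) (ENNReal.tsum_le_tsum fun m =>
        lintegral_mono fun ζ => le_of_eq ?_)
      rw [enorm_mul, enorm_twist, ← ofReal_norm, Complex.norm_real,
        Real.norm_of_nonneg (by positivity), expTerm]
  -- Equality on the real interval `(0, r)`, which accumulates at `0`, extends to the whole disc by
  -- the identity theorem.
  have hfreq : ∃ᶠ z : ℂ in 𝓝[≠] 0, Λ z = ρ z := by
    have h1 : Tendsto (fun t : ℝ => (t : ℂ)) (𝓝[>] 0) (𝓝[≠] 0) := by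
      refine tendsto_nhdsWithin_iff.mpr ⟨?_, ?_⟩
      · exact (Complex.continuous_ofReal.tendsto' 0 0 (by simp)).mono_left nhdsWithin_le_nhds
      · filter_upwards [self_mem_nhdsWithin] with t ht
        simpa using (ne_of_gt ht)
    refine h1.frequently (Eventually.frequently ?_)
    filter_upwards [Ioo_mem_nhdsGT hr] with t ht
    exact hreal t ht.1 ht.2
  have heq : Set.EqOn Λ ρ (Metric.ball 0 r) :=
    (hΛd.differentiableOn.analyticOnNhd Metric.isOpen_ball).eqOn_of_preconnected_of_frequently_eq
      (hρd.analyticOnNhd Metric.isOpen_ball) (convex_ball 0 r).isPreconnected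
      (Metric.mem_ball_self hr) hfreq
  have hmem : Complex.I * (η : ℂ) ∈ Metric.ball (0 : ℂ) r := by
    rw [mem_ball_zero_iff]; simpa using hη
  have hnorm : ‖Complex.I * (η : ℂ)‖ = |η| := by simp
  have hkey := heq hmem
  have hL : ‖Λ (Complex.I * η)‖ₑ = ‖∫ ζ, H (φ' + ζ) ∂ν‖ₑ := by
    have h1 : Λ (Complex.I * η) = Complex.exp (-(Complex.I * η * φ' x₀)) * ∫ ζ, H (φ' + ζ) ∂ν := by
      rw [← integral_const_mul]
      refine integral_congr_ae (Eventually.of_forall fun ζ => ?_)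
      simp only [twist]
      rw [← mul_assoc, ← Complex.exp_add]
      congr 2
      simp only [Pi.add_apply]
      push_cast; ring
    rw [h1, enorm_mul, ← ofReal_norm, Complex.norm_exp]
    simp
  rw [← hL, hkey, hρ, enorm_mul]
  refine mul_le_mul' (le_of_eq ?_) ?_
  · rw [← ofReal_norm, Complex.norm_exp]
    congr 2
    -- At `z = iη` the Gaussian factor contributes `-η²/2` and the phase contributes `-(κ - η)η`, in
    -- units of `Γ(0)`.
    have h1 : (Complex.I * (η : ℂ)) ^ 2 * Γ 0 / 2 + Complex.I * (κ - η) * Γ 0 * (Complex.I * η) =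
        (((η ^ 2 / 2 - κ * η) * Γ 0 : ℝ) : ℂ) := by
      push_cast
      linear_combination ((η : ℂ) ^ 2 * Γ 0 / 2 + (κ - η) * Γ 0 * η) * Complex.I_sq
    rw [h1, Complex.ofReal_re]
  · refine enorm_tsum_le_tsum_enorm.trans ((ENNReal.tsum_le_tsum fun m => ?_).trans
      (tsum_lintegral_le _ _))
    rw [hterm_enorm, hnorm]
    exact (mul_le_mul' le_rfl (hce m)).trans (lintegral_const_mul_le _ _)

end ComplexShift

/-! ### Translations of polymers -/

section Translation

set_option linter.unusedSectionVars false

variable {N : ℕ} [NeZero N] {L j : ℕ}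

open Classical in
/-- The translate `X + a`. -/
def translate (a : Torus N) (X : Finset (Torus N)) : Finset (Torus N) :=
  Finset.univ.filter fun x => x - a ∈ X

lemma mem_translate {a x : Torus N} {X : Finset (Torus N)} : x ∈ translate a X ↔ x - a ∈ X := by
  simp [translate]

lemma translate_translate (a : Torus N) (X : Finset (Torus N)) :
    translate (-a) (translate a X) = X := by
  ext x; simp [mem_translate]

lemma translate_subset {a : Torus N} {X Y : Finset (Torus N)} (h : X ⊆ Y) :
    translate a X ⊆ translate a Y := fun x hx => by
  rw [mem_translate] at hx ⊢
  exact h hx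

lemma translate_mem_blocks {B : Finset (Torus N)} (v : Torus N) (hB : B ∈ blocks N L j) :
    translate ((L ^ j) • v) B ∈ blocks N L j := by
  obtain ⟨w, rfl⟩ := mem_blocks.mp hB
  refine mem_blocks.mpr ⟨w + v, ?_⟩
  ext x
  rw [mem_translate, mem_blk, mem_blk, smul_add, ← sub_sub, sub_right_comm]

lemma translate_mem_blocksIn {B X : Finset (Torus N)} (v : Torus N) (hB : B ∈ blocksIn L j X) :
    translate ((L ^ j) • v) B ∈ blocksIn L j (translate ((L ^ j) • v) X) := by
  rw [mem_blocksIn] at hB ⊢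
  exact ⟨translate_mem_blocks v hB.1, translate_subset hB.2⟩

lemma exists_eq_translate {B X : Finset (Torus N)} (v : Torus N)
    (hB : B ∈ blocksIn L j (translate ((L ^ j) • v) X)) :
    ∃ D ∈ blocksIn L j X, B = translate ((L ^ j) • v) D := by
  refine ⟨translate ((L ^ j) • (-v)) B, ?_, ?_⟩
  · have h := translate_mem_blocksIn (-v) hB
    rwa [smul_neg, translate_translate, ← smul_neg] at h
  · have h := translate_translate ((L ^ j) • (-v)) B
    rw [← smul_neg, neg_neg] at h
    exact h.symm

lemma Touch.translate {B D : Finset (Torus N)} (h : Touch B D) (a : Torus N) :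
    Touch (translate a B) (translate a D) := by
  obtain ⟨x, hx, y, hy, hxy⟩ := h
  exact ⟨x + a, by simpa [mem_translate] using hx, y + a, by simpa [mem_translate] using hy,
    by simpa using hxy⟩

lemma IsSmall.translate {X : Finset (Torus N)} (hX : IsSmall L j X) (v : Torus N) :
    IsSmall L j (translate ((L ^ j) • v) X) := by
  classical
  obtain ⟨⟨⟨x, hx⟩, hpol, hconn⟩, hcard⟩ := hX
  refine ⟨⟨⟨x + (L ^ j) • v, by simpa [mem_translate] using hx⟩, fun y hy => ?_, ?_⟩, ?_⟩
  · obtain ⟨B, hB, hyB⟩ := hpol _ (mem_translate.mp hy)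
    exact ⟨_, translate_mem_blocksIn v hB, mem_translate.mpr hyB⟩
  · intro B hB D hD
    obtain ⟨B, hB', rfl⟩ := exists_eq_translate v hB
    obtain ⟨D, hD', rfl⟩ := exists_eq_translate v hD
    exact (hconn B hB' D hD').lift (CoulombGas.translate ((L ^ j) • v))
      fun B D h => ⟨translate_mem_blocksIn v h.1, h.2.translate _⟩
  · refine le_trans ?_ hcard
    refine (Finset.card_le_card fun B hB => ?_).trans
      (Finset.card_image_le (s := blocksIn L j X) (f := CoulombGas.translate ((L ^ j) • v)))
    obtain ⟨D, hD, rfl⟩ := exists_eq_translate v hB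
    exact Finset.mem_image_of_mem _ hD

lemma sub_mem_nbhd_translate {X : Finset (Torus N)} {x : Torus N} (v : Torus N)
    (hx : x ∈ nbhd L j X) : x - (L ^ j) • v ∈ nbhd L j (translate ((L ^ j) • (-v)) X) := by
  classical
  simp only [nbhd, Finset.mem_filter, Finset.mem_univ, true_and] at hx ⊢
  obtain ⟨Y, hY, hxY, ⟨y, hy⟩⟩ := hx
  rw [Finset.mem_inter] at hy
  refine ⟨_, hY.translate (-v), ?_, ⟨y - (L ^ j) • v, ?_⟩⟩
  · simpa [mem_translate] using hxY
  · simpa [mem_translate] using hy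

/-- `BoundsIncrements` for polymers with a block centred at `x₀`. -/
lemma BoundsIncrements.c2Norm_le {C : ℕ → ℝ} {c C₀ : ℝ} (hC₀ : 0 ≤ C₀)
    (h : BoundsIncrements C c C₀) [NeZero L] {R : ℕ} {Γ : ℕ → Torus (L ^ R) → ℝ} (hodd : Odd L)
    (hL : 1 < L) (hΓ : IsMultiscaleDecomposition C c L R Γ) (hj : j < R)
    {X : Finset (Torus (L ^ R))} (hX : IsSmall L j X) {v : Torus (L ^ R)}
    (hv : blk (L ^ j) ((L ^ j) • v) ⊆ X) :
    c2Norm L j (nbhd L j X) (increment (Γ j) ((L ^ j) • v)) ≤ C₀.toNNReal := by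
  have h0 : (0 : Torus (L ^ R)) ∈ translate ((L ^ j) • (-v)) X := by
    rw [mem_translate]
    have := hv (self_mem_blk (L ^ j) ((L ^ j) • v))
    simpa using this
  have h1 := h L R Γ hodd hL hΓ j hj _ (hX.translate (-v)) h0
  rw [c2Norm_le_iff]
  intro w hw x hx
  rw [Real.coe_toNNReal _ hC₀]
  refine le_trans ?_ h1
  have h2 := le_c2Norm (L := L) (j := j) (fun x => Γ j x - Γ j 0) w hw (sub_mem_nbhd_translate v hx)
  have h3 := iterDiff_translate w (fun x => Γ j x - Γ j 0) ((L ^ j) • v) x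
  rw [← h3] at h2
  exact h2

end Translation

/-! ### The exponent of the regulator -/

section RegExp

set_option linter.unusedSectionVars false

variable {N : ℕ} [NeZero N] {L j : ℕ}

lemma iterDiff_add {E : Type*} [NormedAddCommGroup E] (w : List (Fin 4)) (f g : Torus N → E) :
    iterDiff w (f + g) = iterDiff w f + iterDiff w g := by
  induction w with
  | nil => rfl
  | cons μ w ih => rw [iterDiff_cons, ih]; ext x; simp [diff]; abel

lemma linfGrad_add_le {E : Type*} [NormedAddCommGroup E] (n : ℕ) (S : Finset (Torus N))
    (f g : Torus N → E) : linfGrad L j n S (f + g) ≤ linfGrad L j n S f + linfGrad L j n S g := by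
  rw [linfGrad_le_iff]
  intro w hw x hx
  rw [iterDiff_add, NNReal.coe_add]
  refine le_trans ?_ (add_le_add (le_linfGrad f w hw hx) (le_linfGrad g w hw hx))
  rw [← mul_add]
  gcongr
  exact norm_add_le _ _

lemma gradSq_add_le (φ ψ : Torus N → ℝ) (x : Torus N) :
    gradSq (φ + ψ) x ≤ 2 * gradSq φ x + 2 * gradSq ψ x := by
  simp only [gradSq, Finset.mul_sum, ← Finset.sum_add_distrib]
  refine Finset.sum_le_sum fun μ _ => ?_
  have : diff μ (φ + ψ) x = diff μ φ x + diff μ ψ x := by simp [diff]; ring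
  rw [this]
  nlinarith [sq_nonneg (diff μ φ x - diff μ ψ x)]

lemma sum_gradSq_add_le (X : Finset (Torus N)) (φ ψ : Torus N → ℝ) :
    ∑ x ∈ X, gradSq (φ + ψ) x ≤ 2 * ∑ x ∈ X, gradSq φ x + 2 * ∑ x ∈ X, gradSq ψ x := by
  rw [Finset.mul_sum, Finset.mul_sum, ← Finset.sum_add_distrib]
  exact Finset.sum_le_sum fun x _ => gradSq_add_le φ ψ x

lemma wHessSq_add_le (X : Finset (Torus N)) (φ ψ : Torus N → ℝ) :
    wHessSq L j X (φ + ψ) ≤ 2 * wHessSq L j X φ + 2 * wHessSq L j X ψ := by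
  simp only [wHessSq, Finset.mul_sum, ← Finset.sum_add_distrib]
  refine Finset.sum_le_sum fun B _ => ?_
  have h := NNReal.coe_le_coe.mpr (linfGrad_add_le (L := L) (j := j) 2 (nbhd L j B) φ ψ)
  have ha : 0 ≤ ((linfGrad L j 2 (nbhd L j B) (φ + ψ) : ℝ≥0) : ℝ) := NNReal.coe_nonneg _
  rw [NNReal.coe_add] at h
  generalize ((linfGrad L j 2 (nbhd L j B) (φ + ψ) : ℝ≥0) : ℝ) = a at h ha ⊢
  generalize ((linfGrad L j 2 (nbhd L j B) φ : ℝ≥0) : ℝ) = b at h ⊢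
  generalize ((linfGrad L j 2 (nbhd L j B) ψ : ℝ≥0) : ℝ) = c at h ⊢
  nlinarith [pow_le_pow_left₀ ha h 2, sq_nonneg (b - c)]

/-- Every term is a square of a seminorm, and `(a + b)² ≤ 2a² + 2b²`. The factor two is compensated
by `two_mul_regExp_le`. -/
lemma regExp_add_le {c₁ c₃ : ℝ} (hc₁ : 0 ≤ c₁) (hc₃ : 0 ≤ c₃) (hL : 0 < L) (X : Finset (Torus N))
    (φ ψ : Torus N → ℝ) :
    regExp c₁ c₃ L j X (φ + ψ) ≤ 2 * regExp c₁ c₃ L j X φ + 2 * regExp c₁ c₃ L j X ψ := by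
  have h1 := sum_gradSq_add_le X φ ψ
  have h2 := sum_gradSq_add_le (bdry X) φ ψ
  have h3 := wHessSq_add_le (L := L) (j := j) X φ ψ
  simp only [regExp, l2GradSq_eq hL, l2GradBdrySq_eq hL]
  have e1 := mul_le_mul_of_nonneg_left h1 (by positivity : 0 ≤ c₁ * (1 / 2))
  have e2 := mul_le_mul_of_nonneg_left h2 (by positivity : 0 ≤ c₃ * (1 / 2 * (L : ℝ) ^ j))
  have e3 := mul_le_mul_of_nonneg_left h3 hc₁
  linarith

lemma diff_add_constShift (μ : Fin 4) (φ : Torus N → ℝ) (s : ℝ) :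
    diff μ (φ + constShift N s) = diff μ φ := by
  ext x; simp [diff, constShift]

lemma regExp_add_constShift (c₁ c₃ : ℝ) (X : Finset (Torus N)) (φ : Torus N → ℝ) (s : ℝ) :
    regExp c₁ c₃ L j X (φ + constShift N s) = regExp c₁ c₃ L j X φ := by
  have h : ∀ B : Finset (Torus N), linfGrad L j 2 B (φ + constShift N s) = linfGrad L j 2 B φ := by
    intro B
    have h1 : ∀ w : List (Fin 4), w.length = 2 →
        iterDiff w (φ + constShift N s) = iterDiff w φ := by
      intro w hw
      have := iterDiff_sub_const w (by rintro rfl; simp at hw) φ (-s)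
      rw [← this]
      congr 1; ext x; simp [constShift]
    refine le_antisymm ?_ ?_ <;> rw [linfGrad_le_iff] <;> intro w hw x hx
    · rw [h1 w hw]; exact le_linfGrad φ w hw hx
    · rw [← h1 w hw]; exact le_linfGrad _ w hw hx
  simp only [regExp, l2GradSq, l2GradBdrySq, wHessSq, diff_add_constShift, h]

end RegExp

/-! ### Decomposition of test functions -/

section TestFunctions

set_option linter.unusedSectionVars false

variable {N : ℕ} [NeZero N] {L j : ℕ}

lemma iterDiff_smul {𝕜 E : Type*} [NormedField 𝕜] [NormedAddCommGroup E] [NormedSpace 𝕜 E]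
    (w : List (Fin 4)) (a : 𝕜) (f : Torus N → E) : iterDiff w (a • f) = a • iterDiff w f := by
  induction w with
  | nil => rfl
  | cons μ w ih => rw [iterDiff_cons, ih]; ext x; simp [diff, smul_sub]

lemma c2Norm_smul_le_one {E : Type*} [NormedAddCommGroup E] [NormedSpace ℝ E]
    {S : Finset (Torus N)} {f : Torus N → E} {r : ℝ} (hr : 0 < r)
    (hf : c2Norm L j S f ≤ r.toNNReal) : c2Norm L j S (r⁻¹ • f) ≤ 1 := by
  rw [c2Norm_le_iff] at hf ⊢
  intro w hw x hx
  have h := hf w hw x hx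
  rw [Real.coe_toNNReal _ hr.le] at h
  rw [iterDiff_smul, Pi.smul_apply, norm_smul, norm_inv, Real.norm_of_nonneg hr.le, NNReal.coe_one,
    mul_left_comm, inv_mul_le_iff₀ hr, mul_one]
  exact h

lemma iterDiff_ofReal (w : List (Fin 4)) (f : Torus N → ℝ) :
    iterDiff w (fun x => (f x : ℂ)) = fun x => ((iterDiff w f x : ℝ) : ℂ) := by
  induction w with
  | nil => rfl
  | cons μ w ih => rw [iterDiff_cons, ih]; ext x; simp [diff]

lemma c2Norm_ofReal_le {S : Finset (Torus N)} {f : Torus N → ℝ} {r : ℝ≥0}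
    (hf : c2Norm L j S f ≤ r) : c2Norm L j S (fun x => (f x : ℂ)) ≤ r := by
  rw [c2Norm_le_iff] at hf ⊢
  intro w hw x hx
  rw [iterDiff_ofReal, Complex.norm_real]
  exact hf w hw x hx

/-- On the next scale, a unit test function is a constant plus a small test function. -/
lemma exists_const_add_small (hL : 0 < L) (hq : Odd (L ^ j)) (hd : L ^ j ∣ N)
    {X : Finset (Torus N)} (hX : IsSmall L j X) {f : Torus N → ℂ}
    (hf : c2Norm L (j + 1) (nbhd L j X) f ≤ 1) :
    ∃ (a : ℂ) (g : Torus N → ℂ), ‖a‖ ≤ 1 ∧ c2Norm L j (nbhd L j X) g ≤ 1 ∧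
      f = a • 1 + ((28 / L : ℝ) : ℂ) • g := by
  obtain ⟨x, hx⟩ := hX.1.1
  obtain ⟨v, hv, -⟩ := hX.1.2.1.exists_center hx
  obtain ⟨h1, h2⟩ := c2Norm_sub_const_le hL hq hd hX hv f hf
  have hLpos : (0 : ℝ) < L := by exact_mod_cast hL
  have hr : (0 : ℝ) < 28 / L := by positivity
  refine ⟨f ((L ^ j) • v), (28 / L : ℝ)⁻¹ • fun x => f x - f ((L ^ j) • v), h1,
    c2Norm_smul_le_one hr (h2.trans (le_of_eq ?_)), ?_⟩
  · apply NNReal.coe_injective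
    rw [Real.coe_toNNReal _ hr.le, NNReal.coe_div]
    simp
  · ext x
    have : (L : ℂ) ≠ 0 := by exact_mod_cast hL.ne'
    simp only [Pi.add_apply, Pi.smul_apply, Pi.one_apply, smul_eq_mul, mul_one, Complex.real_smul]
    push_cast
    field_simp
    ring

end TestFunctions

/-! ### The expectation of a charged function -/

section ChargedExpectation

set_option linter.unusedSectionVars false

variable {N : ℕ} [NeZero N] {Γ : Torus N → ℝ} {S : Finset (Torus N)} {G : (Torus N → ℝ) → ℝ}
  {F : (Torus N → ℝ) → ℂ} {κ η r A ε C₀ h : ℝ} {x₀ : Torus N} {L j : ℕ}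

/-- Writing `ψ = C₀ ψ'` with `ψ'` a unit test function, the `m` shift derivatives turn the radius
`ρ` into `ρ C₀` and become the first `m` letters of a word. -/
lemma IsCharged.enorm_shifted_word_le (hF : IsCharged S κ F) (hA : |κ| ≤ A) (hε : 0 ≤ ε)
    (hC₀ : 0 < C₀) {ψ : Torus N → ℝ} (hψ : c2Norm L j S ψ ≤ C₀.toNNReal)
    {fs : List (Torus N → ℂ)}
    (hfs : ∀ f ∈ fs, ∃ (a : ℂ) (g : Torus N → ℂ), ‖a‖ ≤ 1 ∧ c2Norm L j S g ≤ 1 ∧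
      f = a • 1 + (ε : ℂ) • g) {ρ : ℝ} (hρ : 0 ≤ ρ) (φ : Torus N → ℝ) (m : ℕ) :
    expTerm ρ m * ‖CoulombGas.ddList S (List.replicate m fun x => (ψ x : ℂ))
        (CoulombGas.ddList S fs F) φ‖ₑ ≤
      expTerm (ρ * C₀) m * wordBound A ε (tSemi L j S F φ) fs.length m := by
  set ψ' : Torus N → ℂ := fun x => ((C₀⁻¹ • ψ) x : ℝ) with hψ'
  have h1 : c2Norm L j S ψ' ≤ 1 := c2Norm_ofReal_le (c2Norm_smul_le_one hC₀ hψ)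
  have h2 : (fun x => (ψ x : ℂ)) = (C₀ : ℂ) • ψ' := by
    ext x
    have : (C₀ : ℂ) ≠ 0 := by exact_mod_cast hC₀.ne'
    simp only [hψ', Pi.smul_apply, smul_eq_mul]
    push_cast
    field_simp
  have h3 := enorm_ddList_words_le hF hA hε φ (List.replicate m ψ') fs []
    (fun f hf => (List.eq_of_mem_replicate hf) ▸ h1) (by simp) hfs
  rw [List.append_nil, List.length_nil, add_zero, List.length_replicate, ddList_append] at h3
  rw [h2, ddList_replicate_smul (contDiff_ddList hF.smooth fs), Pi.smul_apply, smul_eq_mul,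
    enorm_mul, ← mul_assoc, ← expTerm_mul_pow hρ]
  refine mul_le_mul' (mul_le_mul' le_rfl (le_of_eq ?_)) h3
  rw [← ofReal_norm, norm_pow, Complex.norm_real, Real.norm_of_nonneg hC₀.le]

lemma fluctExp_eq (F : (Torus N → ℝ) → ℂ) :
    fluctExp Γ F = fun φ => ∫ ζ, (1 : ℂ) • F (φ + id ζ) ∂(fieldLaw Γ) := by
  ext φ; simp [fluctExp]

/-- The norm of the expectation of a charged function. -/
theorem tNorm_fluctExp_le (hΓ : (covMatrix Γ).PosSemidef) (hF : IsCharged S κ F)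
    (hD : Dominated G F) (hG : Continuous G) (hG0 : ∀ φ, 0 ≤ G φ)
    (hsi : ShiftIntegrable (fieldLaw Γ) id G) (hA : |κ| ≤ A) (hε : 0 ≤ ε) (hC₀ : 0 < C₀)
    (hh : 0 < h) (hη : |η| < r) (hr : r * C₀ + h * ε ≤ h) {M : ℝ} (hM : 0 ≤ M)
    (hle : ∀ φ, tNorm h L j S F φ ≤ ENNReal.ofReal (M * G φ))
    (hdec : ∀ f : Torus N → ℂ, c2Norm L (j + 1) S f ≤ 1 →
      ∃ (a : ℂ) (g : Torus N → ℂ), ‖a‖ ≤ 1 ∧ c2Norm L j S g ≤ 1 ∧ f = a • 1 + (ε : ℂ) • g)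
    (hψ : c2Norm L j S (increment Γ x₀) ≤ C₀.toNNReal) (φ' : Torus N → ℝ)
    (hint : ∀ a : ℝ, 0 ≤ a →
      Integrable (fun ζ => Real.exp (a * |ζ x₀|) * G (φ' + ζ)) (fieldLaw Γ)) :
    tNorm h L (j + 1) S (fluctExp Γ F) φ' ≤
      ENNReal.ofReal (Real.exp ((η ^ 2 / 2 - κ * η) * Γ 0)) *
        (ENNReal.ofReal (Real.exp (h * A)) *
          ∫⁻ ζ, ENNReal.ofReal (M * G (φ' + ζ)) ∂(fieldLaw Γ)) := by
  have hA0 : 0 ≤ A := (abs_nonneg κ).trans hA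
  have hr0 : 0 < r := (abs_nonneg η).trans_lt hη
  have hw : ∀ ρ : ℝ, 0 ≤ ρ → ρ ≤ r → ∀ φ,
      ∑' n, ∑' m, expTerm h n * (expTerm (ρ * C₀) m * wordBound A ε (tSemi L j S F φ) n m) ≤
        ENNReal.ofReal (Real.exp (h * A)) * ENNReal.ofReal (M * G φ) := by
    intro ρ hρ hρr φ
    refine (tsum_wordBound_le hh.le hA0 hε (by positivity) ?_ _).trans
      (mul_le_mul' le_rfl (hle φ))
    have := mul_le_mul_of_nonneg_right hρr hC₀.le
    linarith
  have hsm : ContDiff ℝ ∞ (fluctExp Γ F) := by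
    rw [fluctExp_eq]
    exact hD.contDiff_integral hsi measurable_id measurable_const (by simp)
  set E₀ := ENNReal.ofReal (Real.exp ((η ^ 2 / 2 - κ * η) * Γ 0)) with hE₀
  have hsemi : ∀ n, tSemi L (j + 1) S (fluctExp Γ F) φ' n ≤ E₀ *
      ∫⁻ ζ, ∑' m, expTerm (|η| * C₀) m * wordBound A ε (tSemi L j S F (φ' + ζ)) n m
        ∂(fieldLaw Γ) := by
    intro n
    refine iSup₂_le fun f hf => ?_
    have hfs : ∀ g ∈ List.ofFn f, ∃ (a : ℂ) (g' : Torus N → ℂ), ‖a‖ ≤ 1 ∧ c2Norm L j S g' ≤ 1 ∧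
        g = a • 1 + (ε : ℂ) • g' := by
      intro g hg
      obtain ⟨i, rfl⟩ := (List.mem_ofFn' _ _).mp hg
      exact hdec _ (hf i)
    have hlen : (List.ofFn f).length = n := List.length_ofFn
    have h1 : dirDeriv S (fluctExp Γ F) n φ' f =
        ∫ ζ, CoulombGas.ddList S (List.ofFn f) F (φ' + ζ) ∂(fieldLaw Γ) := by
      rw [dirDeriv_eq_ddList hsm, fluctExp_eq,
        hD.ddList_integral hsi measurable_id measurable_const (by simp)]
      simp
    -- The domination required for one fixed `n` is obtained by retaining the `n`-th term of the
    -- double series and dividing by its weight `b`. It only ensures convergence: the conclusion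
    -- keeps the full series under the integral.
    set b : ℝ := h ^ n / n.factorial with hb
    have hb0 : 0 < b := by positivity
    rw [h1]
    refine (IsCharged.enorm_integral_le (x₀ := x₀) hΓ (hF.ddList (List.ofFn f))
      (G := fun φ => b⁻¹ * (Real.exp (h * A) * (M * G φ))) (by fun_prop)
      (fun φ => by have := hG0 φ; positivity) hη (fun φ => ?_) φ' (fun a ha => ?_)).trans ?_
    · have h2 : ENNReal.ofReal b * ∑' m, expTerm r m * ‖CoulombGas.ddList S
          (List.replicate m fun x => (increment Γ x₀ x : ℂ))
            (CoulombGas.ddList S (List.ofFn f) F) φ‖ₑ ≤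
          ENNReal.ofReal (Real.exp (h * A)) * ENNReal.ofReal (M * G φ) := by
        refine le_trans ?_ ((ENNReal.le_tsum n).trans (hw r hr0.le le_rfl φ))
        rw [← ENNReal.tsum_mul_left]
        refine ENNReal.tsum_le_tsum fun m => mul_le_mul' le_rfl ?_
        have := hF.enorm_shifted_word_le hA hε hC₀ hψ hfs hr0.le φ m
        rwa [hlen] at this
      rw [ENNReal.ofReal_mul (by positivity), ENNReal.ofReal_inv_of_pos hb0,
        ENNReal.ofReal_mul (Real.exp_pos _).le, mul_comm, ← div_eq_mul_inv,
        ENNReal.le_div_iff_mul_le (Or.inl (by simpa using hb0)) (Or.inl ENNReal.ofReal_ne_top),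
        mul_comm]
      exact h2
    · refine ((hint a ha).const_mul (b⁻¹ * (Real.exp (h * A) * M))).congr
        (Eventually.of_forall fun ζ => ?_)
      simp only
      ring
    · refine mul_le_mul' le_rfl (lintegral_mono fun ζ => ENNReal.tsum_le_tsum fun m => ?_)
      have := hF.enorm_shifted_word_le hA hε hC₀ hψ hfs (abs_nonneg η) (φ' + ζ) m
      rwa [hlen] at this
  -- The sum over `n` is brought under the integral before anything is estimated, so that the double
  -- series is bounded pointwise in the field, without summing separate bounds for each `n`.
  calc tNorm h L (j + 1) S (fluctExp Γ F) φ'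
      ≤ ∑' n, E₀ * ∫⁻ ζ, ∑' m, expTerm h n *
          (expTerm (|η| * C₀) m * wordBound A ε (tSemi L j S F (φ' + ζ)) n m) ∂(fieldLaw Γ) := by
        rw [tNorm_eq]
        refine ENNReal.tsum_le_tsum fun n => (mul_le_mul' le_rfl (hsemi n)).trans ?_
        rw [mul_left_comm]
        refine mul_le_mul' le_rfl ((lintegral_const_mul_le _ _).trans (lintegral_mono fun ζ => ?_))
        rw [ENNReal.tsum_mul_left]
    _ ≤ E₀ * ∫⁻ ζ, ENNReal.ofReal (Real.exp (h * A)) * ENNReal.ofReal (M * G (φ' + ζ))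
          ∂(fieldLaw Γ) := by
        rw [ENNReal.tsum_mul_left]
        exact mul_le_mul' le_rfl ((tsum_lintegral_le _ _).trans
          (lintegral_mono fun ζ => hw |η| (abs_nonneg η) hη.le (φ' + ζ)))
    _ = _ := by rw [lintegral_const_mul' _ _ ENNReal.ofReal_ne_top]

end ChargedExpectation

/-! ### Integrability of the regulator -/

section RegulatorIntegrability

set_option linter.unusedSectionVars false

variable {N : ℕ} [NeZero N] {Γ : Torus N → ℝ} {Q : (Torus N → ℝ) → ℝ} {κ s : ℝ}

lemma ExpBdd.integrable {P : Measure (Torus N → ℝ)} (h : ExpBdd P Q s) {t : ℝ} (ht : 0 ≤ t)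
    (hts : t * s ≤ 1) : Integrable (fun ζ => Real.exp (t * Q ζ)) P := by
  refine ⟨((h.1.const_mul t).exp).aestronglyMeasurable, ?_⟩
  rw [hasFiniteIntegral_iff_ofReal (Eventually.of_forall fun ζ => (Real.exp_pos _).le)]
  exact (h.2 t ht hts).trans_lt (by simp)

lemma shiftIntegrable_exp (hQ : ExpBdd (fieldLaw Γ) Q s) (hQc : Continuous Q)
    (hadd : ∀ φ ψ, Q (φ + ψ) ≤ 2 * Q φ + 2 * Q ψ) (hκ : 0 ≤ κ) (hκs : 2 * κ * s ≤ 1) :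
    ShiftIntegrable (fieldLaw Γ) id fun φ => Real.exp (κ * Q φ) := by
  intro φ₀
  obtain ⟨b, hb⟩ := (isCompact_closedBall φ₀ 1).bddAbove_image hQc.continuousOn
  refine ⟨fun ζ => Real.exp (2 * κ * b) * Real.exp (2 * κ * Q ζ),
    (hQ.integrable (by positivity) hκs).const_mul _, fun φ hφ ζ => ?_⟩
  simp only [id]
  rw [← Real.exp_add, Real.exp_le_exp]
  have h1 : Q φ ≤ b := hb ⟨φ, Metric.ball_subset_closedBall hφ, rfl⟩
  have h2 := mul_le_mul_of_nonneg_left (hadd φ ζ) hκ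
  have h3 := mul_le_mul_of_nonneg_left h1 hκ
  linarith

/-- A product is bounded by the sum of squares, which separates the Gaussian moment of `ζ x₀` from
the regulator. Squaring, together with `hadd`, is the origin of the `4κ` in the hypothesis. -/
lemma integrable_exp_abs_mul (hΓ : (covMatrix Γ).PosSemidef) (hQ : ExpBdd (fieldLaw Γ) Q s)
    (hQc : Continuous Q) (hadd : ∀ φ ψ, Q (φ + ψ) ≤ 2 * Q φ + 2 * Q ψ) (hκ : 0 ≤ κ)
    (hκs : 4 * κ * s ≤ 1) (x₀ : Torus N) (φ' : Torus N → ℝ) (a : ℝ) :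
    Integrable (fun ζ => Real.exp (a * |ζ x₀|) * Real.exp (κ * Q (φ' + ζ))) (fieldLaw Γ) := by
  have hsingle : ∀ ζ : Torus N → ℝ, ∑ x, Pi.single (M := fun _ => ℝ) x₀ 1 x * ζ x = ζ x₀ := by
    intro ζ
    rw [Finset.sum_eq_single x₀]
    · simp
    · intro x _ hx; simp [hx]
    · simp
  have h1 := integrable_exp_sum hΓ (Pi.single x₀ 1) (2 * a)
  have h2 := integrable_exp_sum hΓ (Pi.single x₀ 1) (-(2 * a))
  simp only [hsingle] at h1 h2
  have h3 := (hQ.integrable (by positivity) hκs).const_mul (Real.exp (4 * κ * Q φ'))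
  refine ((h1.add h2).add h3).mono' (Continuous.aestronglyMeasurable (by fun_prop))
    (Eventually.of_forall fun ζ => ?_)
  rw [Real.norm_of_nonneg (by positivity)]
  simp only [Pi.add_apply]
  have e1 : Real.exp (a * |ζ x₀|) ^ 2 ≤ Real.exp (2 * a * ζ x₀) + Real.exp (-(2 * a) * ζ x₀) := by
    rw [← Real.exp_nat_mul]
    have p1 := Real.exp_pos (2 * a * ζ x₀)
    have p2 := Real.exp_pos (-(2 * a) * ζ x₀)
    rcases le_total 0 (ζ x₀) with h0 | h0
    · rw [abs_of_nonneg h0]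
      have : ((2 : ℕ) : ℝ) * (a * ζ x₀) = 2 * a * ζ x₀ := by push_cast; ring
      rw [this]; linarith
    · rw [abs_of_nonpos h0]
      have : ((2 : ℕ) : ℝ) * (a * -ζ x₀) = -(2 * a) * ζ x₀ := by push_cast; ring
      rw [this]; linarith
  have e2 : Real.exp (κ * Q (φ' + ζ)) ^ 2 ≤ Real.exp (4 * κ * Q φ') * Real.exp (4 * κ * Q ζ) := by
    rw [← Real.exp_nat_mul, ← Real.exp_add, Real.exp_le_exp]
    have := mul_le_mul_of_nonneg_left (hadd φ' ζ) hκ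
    push_cast
    linarith
  nlinarith [sq_nonneg (Real.exp (a * |ζ x₀|) - Real.exp (κ * Q (φ' + ζ))),
    Real.exp_pos (a * |ζ x₀|), Real.exp_pos (κ * Q (φ' + ζ))]

lemma lintegral_exp_shift_le (hQ : ExpBdd (fieldLaw Γ) Q s)
    (hadd : ∀ φ ψ, Q (φ + ψ) ≤ 2 * Q φ + 2 * Q ψ) (hκ : 0 ≤ κ)
    (hκs : 2 * κ * s ≤ 1) {M : ℝ} (hM : 0 ≤ M) (φ' : Torus N → ℝ) :
    ∫⁻ ζ, ENNReal.ofReal (M * Real.exp (κ * Q (φ' + ζ))) ∂(fieldLaw Γ) ≤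
      ENNReal.ofReal (2 * M * Real.exp (κ * (2 * Q φ'))) := by
  calc ∫⁻ ζ, ENNReal.ofReal (M * Real.exp (κ * Q (φ' + ζ))) ∂(fieldLaw Γ)
      ≤ ∫⁻ ζ, ENNReal.ofReal (M * Real.exp (κ * (2 * Q φ'))) *
          ENNReal.ofReal (Real.exp (2 * κ * Q ζ)) ∂(fieldLaw Γ) := by
        refine lintegral_mono fun ζ => ?_
        rw [← ENNReal.ofReal_mul (by positivity), mul_assoc, ← Real.exp_add]
        refine ENNReal.ofReal_le_ofReal ?_
        gcongr
        have := mul_le_mul_of_nonneg_left (hadd φ' ζ) hκ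
        linarith
    _ ≤ ENNReal.ofReal (M * Real.exp (κ * (2 * Q φ'))) * 2 := by
        rw [lintegral_const_mul' _ _ ENNReal.ofReal_ne_top]
        exact mul_le_mul' le_rfl (hQ.2 _ (by positivity) hκs)
    _ = _ := by
        rw [show (2 : ℝ≥0∞) = ENNReal.ofReal 2 by simp, ← ENNReal.ofReal_mul (by positivity)]
        congr 1; ring

end RegulatorIntegrability

/-! ### The contraction of the charged components -/

section Contraction

set_option linter.unusedSectionVars false

lemma tNorm_le_of_activityNorm {N : ℕ} [NeZero N] {c₁ c₃ κ h A : ℝ} {L j : ℕ} (hA : 1 < A)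
    {K : Finset (Torus N) → (Torus N → ℝ) → ℂ} (hK : activityNorm c₁ c₃ κ h A L j K ≠ ⊤)
    {X : Finset (Torus N)} (hX : IsConnPolymer L j X) (φ : Torus N → ℝ) :
    tNorm h L j (nbhd L j X) (K X) φ ≤
      ENNReal.ofReal ((activityNorm c₁ c₃ κ h A L j K).toReal / A ^ numBlocks L j X *
        regulator c₁ c₃ κ L j X φ) := by
  have hA0 : 0 < A ^ numBlocks L j X := by positivity
  have hG : 0 < regulator c₁ c₃ κ L j X φ := Real.exp_pos _
  have h1 : ENNReal.ofReal (A ^ numBlocks L j X) * (tNorm h L j (nbhd L j X) (K X) φ /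
      ENNReal.ofReal (regulator c₁ c₃ κ L j X φ)) ≤ activityNorm c₁ c₃ κ h A L j K :=
    le_iSup₂_of_le X hX (mul_le_mul' le_rfl (le_iSup (fun φ => tNorm h L j (nbhd L j X) (K X) φ /
      ENNReal.ofReal (regulator c₁ c₃ κ L j X φ)) φ))
  rw [mul_comm, ← ENNReal.le_div_iff_mul_le (Or.inl (by simpa using hA0))
    (Or.inl ENNReal.ofReal_ne_top), ENNReal.div_le_iff_le_mul (Or.inl (by simpa using hG))
    (Or.inl ENNReal.ofReal_ne_top)] at h1
  refine h1.trans (le_of_eq ?_)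
  rw [ENNReal.ofReal_mul (by positivity), ENNReal.ofReal_div_of_pos hA0, ENNReal.ofReal_toReal hK]

lemma inv_pow_le_zpow_half {A : ℝ} (hA : 1 < A) (n : ℕ) : (A ^ n)⁻¹ ≤ (A / 2) ^ (-(n : ℤ)) := by
  rw [zpow_neg, zpow_natCast]
  gcongr
  linarith

lemma mul_le_of_le_of_le {P I a : ℝ≥0∞} {e z y' y g' g : ℝ} (ha : a ≠ ⊤) (he : 0 ≤ e) (hz : 0 ≤ z)
    (hy' : 0 ≤ y') (hg' : 0 ≤ g') (hP : P ≤ ENNReal.ofReal (e * z))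
    (hI : I ≤ ENNReal.ofReal (2 * (a.toReal / y'⁻¹) * g')) (hy : y' ≤ y) (hg : g' ≤ g) :
    P * I ≤ ENNReal.ofReal (2 * e * z) * a * ENNReal.ofReal y * ENNReal.ofReal g := by
  refine (mul_le_mul' hP hI).trans ?_
  have ht : 0 ≤ a.toReal := ENNReal.toReal_nonneg
  have hy0 := hy'.trans hy
  conv_rhs => rw [← ENNReal.ofReal_toReal ha]
  rw [div_inv_eq_mul, ← ENNReal.ofReal_mul (mul_nonneg he hz),
    ← ENNReal.ofReal_mul (by positivity), ← ENNReal.ofReal_mul (by positivity),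
    ← ENNReal.ofReal_mul (by positivity)]
  refine ENNReal.ofReal_le_ofReal ?_
  calc e * z * (2 * (a.toReal * y') * g') = 2 * e * z * a.toReal * y' * g' := by ring
    _ ≤ 2 * e * z * a.toReal * y * g := by gcongr

/-- The power counting. -/
lemma exp_mul_exp_le {α h c C : ℝ} {L j : ℕ} {q : ℤ} (hα : 0 < α) (hα8 : 8 * Real.pi ≤ α ^ 2)
    (hh : 0 ≤ h) (hL : 1 < L) (hLb : Real.exp (α ^ 2 * |c| + h * α) ≤ L) (hq : 1 ≤ |q|)
    (hC : |C - Real.log L / (2 * Real.pi)| ≤ c * (L : ℝ) ^ (-((j : ℝ) / 4))) :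
    Real.exp (-(α ^ 2 * (|(q : ℝ)| - 1 / 2)) * C) * Real.exp (h * (|(q : ℝ)| * α)) ≤
      Real.exp (α ^ 2 * |c| + h * α) * (L : ℝ) ^ (-(2 * |q|)) := by
  have hL1 : (1 : ℝ) < L := by exact_mod_cast hL
  have hLpos : (0 : ℝ) < L := by linarith
  set n : ℝ := |(q : ℝ)| with hn
  have hn1 : 1 ≤ n := by rw [hn]; exact_mod_cast hq
  set b := α ^ 2 * |c| + h * α with hb
  have hb0 : 0 ≤ b := by positivity
  have hlog : b ≤ Real.log L := by
    rw [Real.le_log_iff_exp_le hLpos]; exact hLb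
  have hpi := Real.pi_pos
  have hpow : (L : ℝ) ^ (-((j : ℝ) / 4)) ≤ 1 :=
    Real.rpow_le_one_of_one_le_of_nonpos hL1.le (by have : (0 : ℝ) ≤ j := by positivity
                                                    linarith)
  have hC1 : Real.log L / (2 * Real.pi) - |c| ≤ C := by
    have h1 : c * (L : ℝ) ^ (-((j : ℝ) / 4)) ≤ |c| := by
      calc c * (L : ℝ) ^ (-((j : ℝ) / 4)) ≤ |c| * (L : ℝ) ^ (-((j : ℝ) / 4)) := by
            gcongr; exact le_abs_self c
        _ ≤ |c| * 1 := by gcongr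
        _ = |c| := mul_one _
    have h2 := (abs_le.mp hC).1
    linarith
  have hlog0 : 0 ≤ Real.log L := hb0.trans hlog
  have hα4 : 4 * Real.log L ≤ α ^ 2 * (Real.log L / (2 * Real.pi)) := by
    rw [mul_div_assoc', le_div_iff₀ (by positivity)]
    nlinarith
  have hzpow : (L : ℝ) ^ (-(2 * |q|)) = Real.exp (-(2 * n * Real.log L)) := by
    rw [← Real.rpow_intCast, Real.rpow_def_of_pos hLpos]
    congr 1
    push_cast
    rw [hn]; ring
  rw [hzpow, ← Real.exp_add, ← Real.exp_add, Real.exp_le_exp]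
  have h3 : α ^ 2 * (Real.log L / (2 * Real.pi) - |c|) ≤ α ^ 2 * C := by gcongr
  have h4 : (n - 1 / 2) * (4 * Real.log L - α ^ 2 * |c|) ≤ (n - 1 / 2) * (α ^ 2 * C) := by
    refine mul_le_mul_of_nonneg_left ?_ (by linarith)
    linarith
  -- The decay is `(4n - 2) ln L = 2n ln L + (2n - 2) ln L`. The surplus, with `ln L ≥ b`, pays for
  -- the factors growing with `n`; at `n = 1` there is no surplus and `e^b` stays in the constant.
  have h5 : (n - 1) * (2 * b) ≤ (n - 1) * (2 * Real.log L) := by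
    refine mul_le_mul_of_nonneg_left (by linarith) (by linarith)
  have h6 : 0 ≤ α ^ 2 * |c| := by positivity
  have h7 : 0 ≤ h * α := by positivity
  have h8 : 0 ≤ (n - 1) * b := mul_nonneg (by linarith) hb0
  have h9 : h * (n * α) = n * (b - α ^ 2 * |c|) := by rw [hb]; ring
  rw [h9]
  nlinarith

/-- The contraction of the charged components of a polymer activity. -/
theorem contraction (C : ℕ → ℝ) (c C₀ : ℝ) (hC₀ : 0 < C₀) (hbd : BoundsIncrements C c C₀)
    (c₁ c₃ : ℝ) (hc₁ : 0 < c₁) (hc₃ : 0 < c₃) :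
    ∃ c₀ : ℝ, 0 < c₀ ∧ ∀ cκ : ℝ, 0 < cκ → cκ ≤ c₀ →
      ∀ α h : ℝ, 0 < α → 8 * Real.pi ≤ α ^ 2 → 1 < h → 2 * α * C₀ ≤ h →
      ∃ Cα : ℝ, 0 < Cα ∧ ∃ L₀ : ℕ,
        ∀ (L : ℕ) [NeZero L] (R : ℕ) (Γ : ℕ → Torus (L ^ R) → ℝ),
          Odd L → 1 < L → L₀ ≤ L → IsMultiscaleDecomposition C c L R Γ →
        ∀ j : ℕ, j < R → ∀ A : ℝ, 1 < A →
        ∀ K : Finset (Torus (L ^ R)) → (Torus (L ^ R) → ℝ) → ℂ, IsActivity α L j K →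
        ∀ q : ℤ, 1 ≤ |q| →
        ∀ X : Finset (Torus (L ^ R)), IsSmall L j X →
          (activityNorm c₁ c₃ (cκ / Real.log L) h A L j K ≠ ⊤ →
            (∀ φ' : Torus (L ^ R) → ℝ, MeasureTheory.Integrable
              (fun ζ => chargeComponent α q (K X) (φ' + ζ)) (fieldLaw (Γ j))) ∧
            ContDiff ℝ ∞ (fluctExp (Γ j) (chargeComponent α q (K X)))) ∧
          ∀ φ' : Torus (L ^ R) → ℝ,
            tNorm h L (j + 1) (nbhd L j X)
                (fluctExp (Γ j) (chargeComponent α q (K X))) φ' ≤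
              ENNReal.ofReal (Cα * (L : ℝ) ^ (-(2 * |q|))) *
                activityNorm c₁ c₃ (cκ / Real.log L) h A L j K *
                ENNReal.ofReal ((A / 2) ^ (-(numBlocks L j X : ℤ))) *
                ENNReal.ofReal
                  (regulator c₁ c₃ (cκ / Real.log L) L (j + 1) (polymerClosure L (j + 1) X) φ') := by
  -- Variances of up to four derivatives of the field involve derivatives of `Γ` of orders `2, 4, 6,
  -- 8`.
  set D : ℝ := 1 + (|C 2| + |C 4| + |C 6| + |C 8|) with hD
  have hD0 : 0 < D := by positivity
  have hCD : ∀ n, 1 ≤ n → n ≤ 4 → C (2 * n) ≤ D := by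
    intro n h1 h2
    have a2 := le_abs_self (C 2)
    have a4 := le_abs_self (C 4)
    have a6 := le_abs_self (C 6)
    have a8 := le_abs_self (C 8)
    have b2 := abs_nonneg (C 2)
    have b4 := abs_nonneg (C 4)
    have b6 := abs_nonneg (C 6)
    have b8 := abs_nonneg (C 8)
    interval_cases n <;> norm_num <;> linarith
  set s : ℝ := c₁ * (32 * D) + c₃ * (128 * D) + c₁ * (409600 * D) with hs
  have hs0 : 0 < s := by positivity
  -- Once `ln L ≥ 1`, the coupling `κ` is at most `cκ`, so this choice of `c₀` gives `4κs ≤ 1`, the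
  -- strongest smallness needed for integrability.
  refine ⟨(4 * s)⁻¹, by positivity, fun cκ hcκ hcκ' α h hα hα8 hh hhα => ?_⟩
  set b := α ^ 2 * |c| + h * α with hb
  -- The three terms of `L₀` serve the power counting (`L ≥ e^b`), the test functions (`28 / L ≤
  -- 1/4` for `L ≥ 112`) and the comparison of regulators. The `2` in the constant is the bound on
  -- the exponential moment.
  refine ⟨2 * Real.exp b, by positivity, ⌈Real.exp b⌉₊ + 112 + ⌈(136 * c₁ + 512 * c₃) / c₁⌉₊, ?_⟩
  intro L _ R Γ hodd hL1 hL₀ hΓ j hj A hA K hK q hq X hX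
  have hL112 : 112 ≤ L := by omega
  have hLpos : (0 : ℝ) < L := by exact_mod_cast (by omega : 0 < L)
  have hLR : (112 : ℝ) ≤ L := by exact_mod_cast hL112
  have hLexp : Real.exp b ≤ L :=
    (Nat.le_ceil _).trans (by exact_mod_cast (by omega : ⌈Real.exp b⌉₊ ≤ L))
  have hLc : 136 * c₁ + 512 * c₃ ≤ (L : ℝ) ^ 2 * c₁ := by
    have h1 : (136 * c₁ + 512 * c₃) / c₁ ≤ L :=
      (Nat.le_ceil _).trans (by exact_mod_cast (by omega : ⌈(136 * c₁ + 512 * c₃) / c₁⌉₊ ≤ L))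
    rw [div_le_iff₀ hc₁] at h1
    have h2 : (L : ℝ) ≤ (L : ℝ) ^ 2 := by nlinarith
    nlinarith
  have hlog : 1 ≤ Real.log L := by
    rw [Real.le_log_iff_exp_le hLpos]
    linarith [Real.exp_one_lt_d9]
  set κ := cκ / Real.log L with hκ
  have hκ0 : 0 < κ := by positivity
  have hκs : 4 * κ * s ≤ 1 := by
    have h1 : κ ≤ (4 * s)⁻¹ := (div_le_self hcκ.le hlog).trans hcκ'
    calc 4 * κ * s ≤ 4 * (4 * s)⁻¹ * s := by gcongr
      _ = 1 := by field_simp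
  have hκs2 : 2 * κ * s ≤ 1 := by nlinarith [mul_pos hκ0 hs0]
  set a := activityNorm c₁ c₃ κ h A L j K with ha
  set F := K X with hF
  set Q := regExp c₁ c₃ L j X (N := L ^ R) with hQ
  set G : (Torus (L ^ R) → ℝ) → ℝ := fun φ => Real.exp (κ * Q φ) with hG
  have hreg : ∀ φ, regulator c₁ c₃ κ L j X φ = G φ := fun φ => regulator_eq _ _ _ _ _
  have hQc : Continuous Q := continuous_regExp c₁ c₃ X
  have hQb := hΓ.expBdd_regExp hodd hj hD0 hCD hc₁ hc₃ hX
  have hQadd : ∀ φ ψ, Q (φ + ψ) ≤ 2 * Q φ + 2 * Q ψ :=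
    regExp_add_le hc₁.le hc₃.le (by omega) X
  have hGc : Continuous G := by fun_prop
  have hG0 : ∀ φ, 0 ≤ G φ := fun φ => (Real.exp_pos _).le
  have hGs : ∀ φ t, G (φ + constShift (L ^ R) t) = G φ := fun φ t => by
    simp only [hG, hQ, regExp_add_constShift]
  have hPSD := hΓ.posDef j hj
  have hsi : ShiftIntegrable (fieldLaw (Γ j)) id G :=
    shiftIntegrable_exp hQb hQc hQadd hκ0.le hκs2
  have hSm := hK.smooth X hX.1
  have hloc : DependsOn (nbhd L j X) F := hK.local_nbhd X hX.1
  have hDom : a ≠ ⊤ → Dominated G F := fun htop =>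
    dominated_of_tNorm_le (h := h) (L := L) (j := j) hSm hloc hG0 (by omega) (by linarith)
      (M := a.toReal / A ^ numBlocks L j X)
      (by positivity) fun φ => by
        have := tNorm_le_of_activityNorm hA htop hX.1 φ
        rwa [hreg] at this
  have hDomq : a ≠ ⊤ → Dominated G (chargeComponent α q F) := fun htop =>
    (hDom htop).chargeComponent hGc hGs hα q
  refine ⟨fun htop => ⟨fun φ' => ?_, ?_⟩, fun φ' => ?_⟩
  · simpa using (hDomq htop).integrable hsi measurable_id (measurable_const (a := (1 : ℂ)))
      (by simp) φ'
  · rw [fluctExp_eq]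
    exact (hDomq htop).contDiff_integral hsi measurable_id measurable_const (by simp)
  · by_cases htop : a = ⊤
    · rw [htop, ENNReal.mul_top, ENNReal.top_mul, ENNReal.top_mul]
      · exact le_top
      · simp only [ne_eq, ENNReal.ofReal_eq_zero, not_le]; exact Real.exp_pos _
      · simp only [ne_eq, ENNReal.ofReal_eq_zero, not_le]; positivity
      · simp only [ne_eq, ENNReal.ofReal_eq_zero, not_le]; positivity
    set M : ℝ := a.toReal / A ^ numBlocks L j X with hM
    have hM0 : 0 ≤ M := by positivity
    have hle : ∀ φ, tNorm h L j (nbhd L j X) F φ ≤ ENNReal.ofReal (M * G φ) := fun φ => by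
      have := tNorm_le_of_activityNorm hA htop hX.1 φ
      rwa [hreg] at this
    have hch : IsCharged (nbhd L j X) (q * α) (chargeComponent α q F) := by
      refine isCharged_chargeComponent hα q (hDomq htop).1 hloc fun φ => ?_
      have := hK.periodic X hX.1 1 φ
      refine Eq.trans (congrArg (K X) ?_) this
      ext x; simp [constShift]
    have hdj : L ^ j ∣ L ^ R := pow_dvd_pow L hj.le
    obtain ⟨x, hx⟩ := hX.1.1
    obtain ⟨v, hv, -⟩ := hX.1.2.1.exists_center hx
    have hψ := hbd.c2Norm_le hC₀.le hodd hL1 hΓ hj hX hv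
    -- The direction of the complex shift follows the sign of `q`, so that `-qαη` is negative.
    set σ : ℝ := if 0 ≤ q then 1 else -1 with hσ
    have hσ2 : σ ^ 2 = 1 := by rw [hσ]; split_ifs <;> norm_num
    have hσq : (q : ℝ) * σ = |(q : ℝ)| := by
      rw [hσ]
      split_ifs with h0
      · rw [abs_of_nonneg (by exact_mod_cast h0), mul_one]
      · rw [abs_of_neg (by exact_mod_cast not_le.mp h0)]; ring
    have hσa : |σ| = 1 := by rw [hσ]; split_ifs <;> norm_num
    -- The radius `r = 3α/2` exceeds `|η| = α` strictly, while `r C₀ ≤ 3h/4` by `2αC₀ ≤ h`; the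
    -- remaining `h/4` accommodates the small parts of the test functions.
    have key := tNorm_fluctExp_le (x₀ := (L ^ j) • v) (h := h) (L := L) (j := j)
      (η := σ * α) (r := 3 / 2 * α) (A := |(q : ℝ)| * α) (ε := 28 / L) hPSD hch (hDomq htop) hGc hG0
      hsi (by rw [abs_mul, abs_of_pos hα]) (by positivity) hC₀ (by linarith)
      (by rw [abs_mul, hσa, abs_of_pos hα]; linarith)
      (by
        have : 28 / (L : ℝ) ≤ 1 / 4 := by rw [div_le_iff₀ hLpos]; linarith
        nlinarith) hM0
      (tNorm_chargeComponent_le (hDom htop) hGc hGs hα q hle)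
      (fun f hf => exists_const_add_small (by omega) hodd.pow hdj hX hf) hψ φ'
      (fun t _ => integrable_exp_abs_mul hPSD hQb hQc hQadd hκ0.le hκs _ φ' t)
    refine key.trans ?_
    have hexp : (σ * α) ^ 2 / 2 - q * α * (σ * α) = -(α ^ 2 * (|(q : ℝ)| - 1 / 2)) := by
      rw [← hσq, mul_pow, hσ2]; ring
    rw [hexp, ← mul_assoc, ← ENNReal.ofReal_mul (Real.exp_pos _).le]
    have hpc := exp_mul_exp_le (h := h) hα hα8 (by linarith) hL1 hLexp hq (hΓ.diag j hj)
    have hint := lintegral_exp_shift_le hQb hQadd hκ0.le hκs2 hM0 φ'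
    have hregle : Real.exp (κ * (2 * Q φ')) ≤
        regulator c₁ c₃ κ L (j + 1) (polymerClosure L (j + 1) X) φ' := by
      rw [regulator_eq, Real.exp_le_exp]
      exact mul_le_mul_of_nonneg_left (two_mul_regExp_le hc₁ hc₃ (by omega) hodd
        (pow_dvd_pow L hj) hLc hX φ') hκ0.le
    have hA2 := inv_pow_le_zpow_half hA (numBlocks L j X)
    exact mul_le_of_le_of_le htop (Real.exp_pos b).le (zpow_nonneg hLpos.le _)
      (inv_nonneg.mpr (pow_nonneg (by linarith) _)) (Real.exp_pos _).le
      (ENNReal.ofReal_le_ofReal hpc) (by rwa [inv_inv]) hA2 hregle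

end Contraction

/-! ### Translation invariant kernels on the torus -/

section Kernels

set_option linter.unusedSectionVars false

variable {N : ℕ} [NeZero N]

/-- The character `z ↦ e^{ik·z}` with `k = 2πn / N`. -/
def torusChar (n z : Torus N) : ℂ := ZMod.stdAddChar (n.1 * z.1 + n.2 * z.2)

/-- `cos (2πa / N)`. -/
def cosZ (a : ZMod N) : ℝ := (ZMod.stdAddChar a).re

/-- `(cos k₁ + cos k₂) / 2`. -/
def meanCos (n : Torus N) : ℝ := (cosZ n.1 + cosZ n.2) / 2

lemma stdAddChar_re_natCast (k : ℕ) :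
    (ZMod.stdAddChar (k : ZMod N)).re = Real.cos (2 * Real.pi / N * k) := by
  have h := ZMod.stdAddChar_coe (N := N) (k : ℤ)
  rw [Int.cast_natCast] at h
  rw [h, show 2 * (Real.pi : ℂ) * Complex.I * ((k : ℤ) : ℂ) / N =
    ((2 * Real.pi / N * k : ℝ) : ℂ) * Complex.I by push_cast; ring, Complex.exp_ofReal_mul_I_re]

lemma cosZ_eq (a : ZMod N) : cosZ a = Real.cos (2 * Real.pi / N * a.val) := by
  rw [← stdAddChar_re_natCast, ZMod.natCast_zmod_val]; rfl

lemma torusChar_re (n z : Torus N) : (torusChar n z).re =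
    Real.cos (2 * Real.pi / N * ((n.1.val : ℝ) * z.1.val + (n.2.val : ℝ) * z.2.val)) := by
  have h := stdAddChar_re_natCast (N := N) (n.1.val * z.1.val + n.2.val * z.2.val)
  push_cast at h
  rw [← h, torusChar, ZMod.natCast_zmod_val, ZMod.natCast_zmod_val, ZMod.natCast_zmod_val,
    ZMod.natCast_zmod_val]

lemma torusChar_add (n x y : Torus N) : torusChar n (x + y) = torusChar n x * torusChar n y := by
  rw [torusChar, torusChar, torusChar, ← AddChar.map_add_eq_mul]
  congr 1
  simp only [Prod.fst_add, Prod.snd_add]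
  ring

lemma norm_torusChar (n x : Torus N) : ‖torusChar n x‖ = 1 := AddChar.norm_apply _ _

lemma torusChar_neg (n x : Torus N) : torusChar n (-x) = (starRingEnd ℂ) (torusChar n x) := by
  rw [torusChar, torusChar, ← AddChar.map_neg_eq_conj]
  congr 1
  simp only [Prod.fst_neg, Prod.snd_neg]
  ring

lemma stdAddChar_neg (a : ZMod N) :
    ZMod.stdAddChar (-a) = (starRingEnd ℂ) (ZMod.stdAddChar a) := AddChar.map_neg_eq_conj _ _

lemma cosZ_le_one (a : ZMod N) : cosZ a ≤ 1 := by rw [cosZ_eq]; exact Real.cos_le_one _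

lemma neg_one_le_cosZ (a : ZMod N) : -1 ≤ cosZ a := by rw [cosZ_eq]; exact Real.neg_one_le_cos _

lemma meanCos_mem (n : Torus N) : meanCos n ∈ Set.Icc (-1 : ℝ) 1 := by
  have h1 := cosZ_le_one n.1
  have h2 := cosZ_le_one n.2
  have h3 := neg_one_le_cosZ n.1
  have h4 := neg_one_le_cosZ n.2
  constructor <;> unfold meanCos <;> linarith

/-- The translation invariant kernel with spectral weights `w`. -/
def ker (w : Torus N → ℝ) (z : Torus N) : ℝ :=
  ((N : ℝ) ^ 2)⁻¹ * ∑ n : Torus N, w n * (torusChar n z).re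

lemma yukawa_eq_ker (m : ℝ) (z : Torus N) :
    yukawa N m z = ker (fun n => 1 / (m ^ 2 + 4 * (1 - meanCos n))) z := by
  simp only [yukawa, ker, torusChar_re]
  congr 1
  refine Finset.sum_congr rfl fun n _ => ?_
  rw [meanCos, cosZ_eq, cosZ_eq, div_eq_mul_inv, mul_comm, one_div]
  congr 2
  ring

lemma ker_add (w w' : Torus N → ℝ) (z : Torus N) :
    ker (fun n => w n + w' n) z = ker w z + ker w' z := by
  simp only [ker, add_mul, Finset.sum_add_distrib, mul_add]

lemma ker_sum {ι : Type*} (s : Finset ι) (w : ι → Torus N → ℝ) (z : Torus N) :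
    ker (fun n => ∑ i ∈ s, w i n) z = ∑ i ∈ s, ker (w i) z := by
  simp only [ker, Finset.sum_mul, ← Finset.mul_sum]
  rw [Finset.sum_comm]

lemma ker_const_mul (a : ℝ) (w : Torus N → ℝ) (z : Torus N) :
    ker (fun n => a * w n) z = a * ker w z := by
  simp only [ker, mul_assoc, ← Finset.mul_sum]
  ring

lemma ker_zero_apply (w : Torus N → ℝ) : ker w 0 = ((N : ℝ) ^ 2)⁻¹ * ∑ n : Torus N, w n := by
  simp [ker, torusChar]

lemma posSemidef_ker {w : Torus N → ℝ} (hw : ∀ n, 0 ≤ w n) : (covMatrix (ker w)).PosSemidef := by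
  have hre : ∀ n x y : Torus N, (torusChar n (x - y)).re =
      (torusChar n x).re * (torusChar n y).re + (torusChar n x).im * (torusChar n y).im := by
    intro n x y
    rw [sub_eq_add_neg, torusChar_add, torusChar_neg]
    simp
  refine Matrix.PosSemidef.of_dotProduct_mulVec_nonneg ?_ fun v => ?_
  · ext x y
    simp only [covMatrix, Matrix.conjTranspose_apply, Matrix.of_apply, star_trivial, ker]
    congr 1
    refine Finset.sum_congr rfl fun n _ => ?_
    rw [hre, hre]; ring
  · have h : star v ⬝ᵥ (covMatrix (ker w)).mulVec v = ((N : ℝ) ^ 2)⁻¹ * ∑ n : Torus N, w n *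
        ((∑ x, v x * (torusChar n x).re) ^ 2 + (∑ x, v x * (torusChar n x).im) ^ 2) := by
      simp only [dotProduct, Matrix.mulVec, covMatrix, Matrix.of_apply, star_trivial, ker, hre,
        sq (∑ x, _), ← Finset.sum_add_distrib, Finset.mul_sum, Finset.sum_mul,
        Pi.star_apply]
      conv_rhs => rw [Finset.sum_comm]
      refine Finset.sum_congr rfl fun x _ => ?_
      conv_rhs => rw [Finset.sum_comm]
      refine Finset.sum_congr rfl fun y _ => ?_
      refine Finset.sum_congr rfl fun n _ => ?_
      ring
    rw [h]
    exact mul_nonneg (by positivity) (Finset.sum_nonneg fun n _ =>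
      mul_nonneg (hw n) (by positivity))

lemma sum_torusChar_dir (n : Torus N) : ∑ μ, torusChar n (dir N μ) = 4 * meanCos n := by
  have h : ∀ a : ZMod N, ZMod.stdAddChar a + ZMod.stdAddChar (-a) = 2 * (cosZ a : ℂ) := by
    intro a
    rw [stdAddChar_neg, Complex.add_conj, cosZ]
    push_cast; rfl
  have h1 := h n.1
  have h2 := h n.2
  simp only [Fin.sum_univ_four, torusChar, dir, meanCos]
  simp only [Matrix.cons_val_zero, Matrix.cons_val_one, Matrix.cons_val, mul_one, mul_zero,
    add_zero, zero_add, mul_neg]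
  push_cast
  linear_combination h1 + h2

/-- `meanCos` is the Fourier symbol of averaging over the four nearest neighbours. -/
lemma ker_meanCos_mul (w : Torus N → ℝ) (z : Torus N) :
    ker (fun n => meanCos n * w n) z = 1 / 4 * ∑ μ, ker w (z + dir N μ) := by
  simp only [ker, torusChar_add, ← Finset.mul_sum]
  rw [Finset.sum_comm, mul_left_comm]
  congr 1
  rw [Finset.mul_sum]
  refine Finset.sum_congr rfl fun n _ => ?_
  rw [← Finset.mul_sum, ← Complex.re_sum, ← Finset.mul_sum, sum_torusChar_dir]
  simp
  ring

lemma ker_one {z : Torus N} (hz : z ≠ 0) : ker (fun _ => 1) z = 0 := by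
  have h1 : ∀ b : ZMod N, b ≠ 0 → ∑ a : ZMod N, ZMod.stdAddChar (a * b) = (0 : ℂ) := by
    intro b hb
    rw [AddChar.sum_mulShift b (ZMod.isPrimitive_stdAddChar N)]
    simp [hb]
  have h2 : ∑ n : Torus N, torusChar n z = 0 := by
    have : ∑ n : Torus N, torusChar n z =
        (∑ a : ZMod N, ZMod.stdAddChar (a * z.1)) * ∑ b : ZMod N, ZMod.stdAddChar (b * z.2) := by
      rw [Finset.sum_mul_sum, ← Finset.sum_product']
      exact Finset.sum_congr rfl fun n _ => AddChar.map_add_eq_mul _ _ _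
    rw [this]
    by_cases h : z.1 = 0
    · rw [h1 z.2 (fun h' => hz (Prod.ext h h')), mul_zero]
    · rw [h1 z.1 h, zero_mul]
  simp only [ker, one_mul]
  rw [← Complex.re_sum, h2]
  simp

/-- The kernel of the constant symbol `1` is supported at the origin, and each averaging enlarges
the support by one lattice step. -/
lemma ker_meanCos_pow {d : ℕ} {z : Torus N} (hz : d < absMax z) :
    ker (fun n => meanCos n ^ d) z = 0 := by
  induction d generalizing z with
  | zero =>
    simp only [pow_zero]
    refine ker_one ?_
    rintro rfl
    simp [absMax_zero] at hz
  | succ d ih =>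
    simp only [pow_succ']
    rw [ker_meanCos_mul, Finset.sum_eq_zero fun μ _ => ih ?_, mul_zero]
    have h1 := absMax_add_le (z + dir N μ) (-dir N μ)
    rw [add_neg_cancel_right, absMax_neg] at h1
    have h2 := absMax_dir_le (N := N) μ
    omega

open Polynomial in
/-- The kernel of a polynomial of the nearest neighbour averaging operator has finite range. -/
lemma ker_eval_eq_zero {P : ℝ[X]} {z : Torus N} (hz : P.natDegree < absMax z) :
    ker (fun n => P.eval (meanCos n)) z = 0 := by
  simp only [eval_eq_sum_range]
  rw [ker_sum]
  refine Finset.sum_eq_zero fun d hd => ?_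
  rw [ker_const_mul, ker_meanCos_pow, mul_zero]
  rw [Finset.mem_range] at hd
  omega

/-- A real function on the torus with complex Fourier coefficients `b`. -/
def reFourier (b : Torus N → ℂ) (z : Torus N) : ℝ := ∑ n, (b n * torusChar n z).re

lemma iterDiff_reFourier (w : List (Fin 4)) (b : Torus N → ℂ) : iterDiff w (reFourier b) =
    reFourier fun n => b n * (w.map fun μ => torusChar n (dir N μ) - 1).prod := by
  induction w with
  | nil => simp
  | cons μ w ih =>
    rw [iterDiff_cons, ih]
    ext z
    simp only [diff, reFourier, ← Finset.sum_sub_distrib, ← Complex.sub_re, torusChar_add,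
      List.map_cons, List.prod_cons]
    refine Finset.sum_congr rfl fun n _ => ?_
    congr 1; ring

lemma norm_torusChar_dir_sub_one_sq_le (n : Torus N) (μ : Fin 4) :
    ‖torusChar n (dir N μ) - 1‖ ^ 2 ≤ 4 * (1 - meanCos n) := by
  have h1 : ∀ ζ : ℂ, ‖ζ‖ = 1 → ‖ζ - 1‖ ^ 2 = 2 * (1 - ζ.re) := by
    intro ζ hζ
    have h2 : ζ.re * ζ.re + ζ.im * ζ.im = 1 := by
      rw [← Complex.normSq_apply, Complex.normSq_eq_norm_sq, hζ, one_pow]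
    rw [← Complex.normSq_eq_norm_sq, Complex.normSq_apply]
    simp
    nlinarith
  have h2 : (torusChar n (dir N μ)).re = cosZ n.1 ∨ (torusChar n (dir N μ)).re = cosZ n.2 := by
    fin_cases μ <;> simp [torusChar, dir, cosZ, stdAddChar_neg]
  rw [h1 _ (norm_torusChar _ _), meanCos]
  have h3 := cosZ_le_one n.1
  have h4 := cosZ_le_one n.2
  rcases h2 with h | h <;> rw [h] <;> linarith

/-- A lattice derivative multiplies a Fourier mode by `e^{ik·μ} - 1`, whose squared modulus `2(1 -
cos kᵢ)` is at most the symbol `4(1 - meanCos n)` of the Laplacian. -/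
lemma abs_iterDiff_ker_le (l : List (Fin 4)) {w : Torus N → ℝ} (hw : ∀ n, 0 ≤ w n) (z : Torus N) :
    |iterDiff l (ker w) z| ≤
      ((N : ℝ) ^ 2)⁻¹ * ∑ n, w n * √(4 * (1 - meanCos n)) ^ l.length := by
  have h1 : ker w = reFourier fun n => ((((N : ℝ) ^ 2)⁻¹ * w n : ℝ) : ℂ) := by
    ext z
    simp only [ker, reFourier, Complex.re_ofReal_mul, Finset.mul_sum, mul_assoc]
  rw [h1, iterDiff_reFourier, reFourier, Finset.mul_sum]
  refine (Finset.abs_sum_le_sum_abs _ _).trans (Finset.sum_le_sum fun n _ => ?_)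
  refine (Complex.abs_re_le_norm _).trans ?_
  rw [norm_mul, norm_mul, norm_torusChar, mul_one, Complex.norm_real,
    Real.norm_of_nonneg (mul_nonneg (by positivity) (hw n)), mul_assoc]
  refine mul_le_mul_of_nonneg_left (mul_le_mul_of_nonneg_left ?_ (hw n)) (by positivity)
  induction l with
  | nil => simp
  | cons μ l ih =>
    rw [List.map_cons, List.prod_cons, norm_mul, List.length_cons, pow_succ']
    refine mul_le_mul ?_ ih (norm_nonneg _) (Real.sqrt_nonneg _)
    exact Real.le_sqrt_of_sq_le (norm_torusChar_dir_sub_one_sq_le n μ)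

end Kernels

/-! ### Spectral polynomials of the decomposition -/

section SpectralPolynomials

open Polynomial

/-- The third Chebyshev polynomial `cos θ ↦ cos 3θ`. -/
def cheb3 : ℝ[X] := 4 * X ^ 3 - 3 * X

/-- The Fourier multiplier of the averaging over `3 ^ i` consecutive points. -/
def avgPoly : ℕ → ℝ[X]
  | 0 => 1
  | i + 1 => (avgPoly i).comp cheb3 * (C (1 / 3) * (1 + 2 * X))

/-- The quotient of `1 - (avgPoly i) ^ 2` by `4 (1 - X)`. -/
def defectPoly : ℕ → ℝ[X]
  | 0 => 0
  | i + 1 => C (1 / 9) * (1 + 2 * X) ^ 4 * (defectPoly i).comp cheb3 + C (1 / 9) * (2 + X)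

/-- The product of the multipliers `(avgPoly l) ^ 2` of the scales `l < i`. -/
def cutoffPoly (i : ℕ) : ℝ[X] := ∏ l ∈ Finset.range i, avgPoly l ^ 2

/-- The spectral density of the `i`-th fluctuation covariance. -/
def slicePoly (i : ℕ) : ℝ[X] := cutoffPoly i * defectPoly i

/-- `x ↦ 4 x ^ 3 - 3 x`. -/
def tripling (x : ℝ) : ℝ := 4 * x ^ 3 - 3 * x

lemma eval_cheb3 (x : ℝ) : cheb3.eval x = tripling x := by simp [cheb3, tripling]

lemma one_sub_tripling (x : ℝ) : 1 - tripling x = (1 - x) * (1 + 2 * x) ^ 2 := by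
  unfold tripling; ring

lemma tripling_mem {x : ℝ} (hx : x ∈ Set.Icc (-1 : ℝ) 1) : tripling x ∈ Set.Icc (-1 : ℝ) 1 := by
  have h1 := one_sub_tripling x
  have h2 : 1 + tripling x = (1 + x) * (1 - 2 * x) ^ 2 := by unfold tripling; ring
  have h3 : 0 ≤ (1 - x) * (1 + 2 * x) ^ 2 := mul_nonneg (by linarith [hx.2]) (sq_nonneg _)
  have h4 : 0 ≤ (1 + x) * (1 - 2 * x) ^ 2 := mul_nonneg (by linarith [hx.1]) (sq_nonneg _)
  constructor <;> linarith

lemma eval_avgPoly_succ (i : ℕ) (x : ℝ) :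
    (avgPoly (i + 1)).eval x = (avgPoly i).eval (tripling x) * ((1 + 2 * x) / 3) := by
  simp only [avgPoly, eval_mul, eval_comp, eval_cheb3, eval_C, eval_add, eval_X, eval_one,
    eval_ofNat]
  ring

lemma eval_defectPoly_succ (i : ℕ) (x : ℝ) : (defectPoly (i + 1)).eval x =
    (1 + 2 * x) ^ 4 / 9 * (defectPoly i).eval (tripling x) + (2 + x) / 9 := by
  simp [defectPoly, eval_cheb3]
  ring

/-- The recursion of `defectPoly` is made for this induction: `1 - tripling x = (1 - x)(1 + 2x)²`
carries over the previous step, and `1 - ((1 + 2x)/3)² = 4(1 - x)(2 + x)/9` gives the new term. -/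
lemma one_sub_eval_avgPoly_sq (i : ℕ) (x : ℝ) :
    1 - (avgPoly i).eval x ^ 2 = 4 * (1 - x) * (defectPoly i).eval x := by
  induction i generalizing x with
  | zero => simp [avgPoly, defectPoly]
  | succ i ih =>
    have h := ih (tripling x)
    rw [one_sub_tripling] at h
    rw [eval_avgPoly_succ, eval_defectPoly_succ]
    linear_combination ((1 + 2 * x) / 3) ^ 2 * h

lemma eval_cutoffPoly_succ (i : ℕ) (x : ℝ) :
    (cutoffPoly (i + 1)).eval x = (cutoffPoly i).eval x * (avgPoly i).eval x ^ 2 := by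
  rw [cutoffPoly, Finset.prod_range_succ, eval_mul, eval_pow, cutoffPoly]

lemma eval_cutoffPoly_zero (x : ℝ) : (cutoffPoly 0).eval x = 1 := by simp [cutoffPoly]

/-- Self-similarity of the cutoffs: the factor `l = 0` is trivial, and each of the other `i` factors
is a previous one at the tripled angle times `((1 + 2x)/3)²`. -/
lemma eval_cutoffPoly_succ' (i : ℕ) (x : ℝ) : (cutoffPoly (i + 1)).eval x =
    (cutoffPoly i).eval (tripling x) * ((1 + 2 * x) / 3) ^ (2 * i) := by
  induction i with
  | zero => simp [cutoffPoly, avgPoly]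
  | succ i ih =>
    rw [eval_cutoffPoly_succ, ih, eval_avgPoly_succ, eval_cutoffPoly_succ]
    ring

/-- The slices telescope to `(1 - χ_n) / 4(1 - x)`, an approximation of the symbol of the inverse
Laplacian. -/
lemma four_mul_eval_slicePoly (i : ℕ) (x : ℝ) : 4 * (1 - x) * (slicePoly i).eval x =
    (cutoffPoly i).eval x - (cutoffPoly (i + 1)).eval x := by
  rw [slicePoly, eval_mul, eval_cutoffPoly_succ]
  linear_combination -(cutoffPoly i).eval x * one_sub_eval_avgPoly_sq i x

lemma four_mul_sum_eval_slicePoly (n : ℕ) (x : ℝ) :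
    4 * (1 - x) * ∑ i ∈ Finset.range n, (slicePoly i).eval x = 1 - (cutoffPoly n).eval x := by
  rw [Finset.mul_sum, Finset.sum_congr rfl fun i _ => four_mul_eval_slicePoly i x,
    Finset.sum_range_sub', eval_cutoffPoly_zero]

lemma defectPoly_nonneg (i : ℕ) {x : ℝ} (hx : x ∈ Set.Icc (-1 : ℝ) 1) :
    0 ≤ (defectPoly i).eval x := by
  induction i generalizing x with
  | zero => simp [defectPoly]
  | succ i ih =>
    rw [eval_defectPoly_succ]
    have h1 := ih (tripling_mem hx)
    have h2 : 0 ≤ (2 + x) / 9 := by linarith [hx.1]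
    positivity

lemma defectPoly_le (i : ℕ) {x : ℝ} (hx : x ∈ Set.Icc (-1 : ℝ) 1) :
    (defectPoly i).eval x ≤ (9 ^ i - 1) / 24 := by
  induction i generalizing x with
  | zero => simp [defectPoly]
  | succ i ih =>
    rw [eval_defectPoly_succ]
    have h1 := ih (tripling_mem hx)
    have h2 : (1 + 2 * x) ^ 4 / 9 ≤ 9 := by
      have h3 : |1 + 2 * x| ≤ 3 := abs_le.2 ⟨by linarith [hx.1], by linarith [hx.2]⟩
      have h4 := pow_le_pow_left₀ (abs_nonneg _) h3 4
      rw [pow_abs, abs_of_nonneg (by positivity)] at h4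
      linarith
    have h5 := mul_le_mul h2 h1 (defectPoly_nonneg i (tripling_mem hx)) (by norm_num)
    rw [pow_succ (9 : ℝ)]
    linarith [hx.2]

lemma avgPoly_sq_le_one (i : ℕ) {x : ℝ} (hx : x ∈ Set.Icc (-1 : ℝ) 1) :
    (avgPoly i).eval x ^ 2 ≤ 1 := by
  have h1 := one_sub_eval_avgPoly_sq i x
  have h2 : 0 ≤ 4 * (1 - x) * (defectPoly i).eval x :=
    mul_nonneg (by linarith [hx.2]) (defectPoly_nonneg i hx)
  linarith

/-- For `x = cos θ`, `avgPoly i` is `sin(3^i θ/2) / (3^i sin(θ/2))`, and the left side is `1 -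
cos(3^i θ)`. The quantity is thus invariant under tripling, which is the induction. -/
lemma avgPoly_sq_mul_le (i : ℕ) {x : ℝ} (hx : x ∈ Set.Icc (-1 : ℝ) 1) :
    9 ^ i * (avgPoly i).eval x ^ 2 * (1 - x) ≤ 2 := by
  induction i generalizing x with
  | zero => simp [avgPoly]; linarith [hx.1]
  | succ i ih =>
    have h := ih (tripling_mem hx)
    rw [one_sub_tripling] at h
    rw [eval_avgPoly_succ]
    refine le_trans (le_of_eq ?_) h
    ring

lemma cutoffPoly_nonneg (i : ℕ) (x : ℝ) : 0 ≤ (cutoffPoly i).eval x := by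
  rw [cutoffPoly, eval_prod]
  exact Finset.prod_nonneg fun l _ => by rw [eval_pow]; positivity

lemma cutoffPoly_le_one (i : ℕ) {x : ℝ} (hx : x ∈ Set.Icc (-1 : ℝ) 1) :
    (cutoffPoly i).eval x ≤ 1 := by
  rw [cutoffPoly, eval_prod]
  refine Finset.prod_le_one (fun l _ => by rw [eval_pow]; positivity) fun l _ => ?_
  rw [eval_pow]
  exact avgPoly_sq_le_one l hx

lemma slicePoly_nonneg (i : ℕ) {x : ℝ} (hx : x ∈ Set.Icc (-1 : ℝ) 1) :
    0 ≤ (slicePoly i).eval x := by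
  rw [slicePoly, eval_mul]
  exact mul_nonneg (cutoffPoly_nonneg i x) (defectPoly_nonneg i hx)

lemma slicePoly_le (i : ℕ) {x : ℝ} (hx : x ∈ Set.Icc (-1 : ℝ) 1) :
    (slicePoly i).eval x ≤ 9 ^ i * (cutoffPoly i).eval x := by
  rw [slicePoly, eval_mul, mul_comm]
  refine mul_le_mul_of_nonneg_right ((defectPoly_le i hx).trans ?_) (cutoffPoly_nonneg i x)
  have : (0 : ℝ) < 9 ^ i := by positivity
  linarith

/-- The last factor `avgPoly n ^ 2` of the cutoff supplies one power of decay; the preceding cutoff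
supplies the others by induction on `m`. -/
lemma exists_cutoffPoly_decay (m : ℕ) : ∃ K : ℝ, 0 ≤ K ∧ ∀ (n : ℕ) (x : ℝ),
    x ∈ Set.Icc (-1 : ℝ) 1 →
    (cutoffPoly n).eval x * (1 + 9 ^ n * (4 * (1 - x))) ^ m ≤ K := by
  induction m with
  | zero => exact ⟨1, by norm_num, fun n x hx => by simpa using cutoffPoly_le_one n hx⟩
  | succ m ih =>
    obtain ⟨K, hK, h⟩ := ih
    -- `73 = 1 + 36 · 2` bounds the last factor by `avgPoly_sq_mul_le`, `9^m` pays for replacing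
    -- `9^{n+1}` by `9^n` in the other factors, and `9^{m+1}` covers `n = 0`, where the cutoff is
    -- `1`.
    refine ⟨9 ^ m * K * 73 + 9 ^ (m + 1), by positivity, fun n x hx => ?_⟩
    have hx1 : 0 ≤ 1 - x := by linarith [hx.2]
    rcases n with _ | n
    · rw [eval_cutoffPoly_zero]
      have h1 : (1 : ℝ) + 9 ^ 0 * (4 * (1 - x)) ≤ 9 := by linarith [hx.1]
      have h2 := pow_le_pow_left₀ (by positivity) h1 (m + 1)
      have h3 : 0 ≤ 9 ^ m * K * 73 := by positivity
      linarith
    · rw [eval_cutoffPoly_succ, pow_succ]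
      have h1 : (1 + 9 ^ (n + 1) * (4 * (1 - x))) ^ m ≤
          9 ^ m * (1 + 9 ^ n * (4 * (1 - x))) ^ m := by
        rw [← mul_pow]
        refine pow_le_pow_left₀ (by positivity) ?_ m
        rw [pow_succ]
        linarith
      have h2 : (avgPoly n).eval x ^ 2 * (1 + 9 ^ (n + 1) * (4 * (1 - x))) ≤ 73 := by
        have h3 := avgPoly_sq_mul_le n hx
        have h4 := avgPoly_sq_le_one n hx
        rw [pow_succ (9 : ℝ) n]
        linarith
      have h5 := h n x hx
      have h6 := cutoffPoly_nonneg n x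
      calc _ = ((cutoffPoly n).eval x * (1 + 9 ^ (n + 1) * (4 * (1 - x))) ^ m) *
            ((avgPoly n).eval x ^ 2 * (1 + 9 ^ (n + 1) * (4 * (1 - x)))) := by ring
        _ ≤ (9 ^ m * K) * 73 := by
          refine mul_le_mul ?_ h2 (by positivity) (by positivity)
          calc _ ≤ (cutoffPoly n).eval x * (9 ^ m * (1 + 9 ^ n * (4 * (1 - x))) ^ m) :=
                mul_le_mul_of_nonneg_left h1 h6
            _ = 9 ^ m * ((cutoffPoly n).eval x * (1 + 9 ^ n * (4 * (1 - x))) ^ m) := by ring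
            _ ≤ 9 ^ m * K := mul_le_mul_of_nonneg_left h5 (by positivity)
        _ ≤ _ := le_add_of_nonneg_right (by positivity)

lemma natDegree_cheb3_le : cheb3.natDegree ≤ 3 := by unfold cheb3; compute_degree

lemma natDegree_comp_cheb3_le (p : ℝ[X]) : (p.comp cheb3).natDegree ≤ p.natDegree * 3 :=
  natDegree_comp_le.trans (Nat.mul_le_mul_left _ natDegree_cheb3_le)

lemma two_mul_natDegree_avgPoly_lt (i : ℕ) : 2 * (avgPoly i).natDegree < 3 ^ i := by
  induction i with
  | zero => simp [avgPoly]
  | succ i ih =>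
    have h1 := natDegree_comp_cheb3_le (avgPoly i)
    have h2 : (C (1 / 3 : ℝ) * (1 + 2 * X)).natDegree ≤ 1 := by compute_degree
    have h3 := natDegree_mul_le (p := (avgPoly i).comp cheb3) (q := C (1 / 3 : ℝ) * (1 + 2 * X))
    rw [avgPoly, pow_succ]
    omega

lemma natDegree_defectPoly_le (i : ℕ) : (defectPoly (i + 1)).natDegree + 2 ≤ 3 ^ (i + 1) := by
  have h4 : (C (1 / 9 : ℝ) * (2 + X)).natDegree ≤ 1 := by compute_degree
  induction i with
  | zero =>
    have : defectPoly 1 = C (1 / 9 : ℝ) * (2 + X) := by simp [defectPoly]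
    rw [this]
    omega
  | succ i ih =>
    have h1 := natDegree_comp_cheb3_le (defectPoly (i + 1))
    have h2 : (C (1 / 9 : ℝ) * (1 + 2 * X) ^ 4).natDegree ≤ 4 := by compute_degree
    have h3 := natDegree_mul_le (p := C (1 / 9 : ℝ) * (1 + 2 * X) ^ 4)
      (q := (defectPoly (i + 1)).comp cheb3)
    have h5 := natDegree_add_le (C (1 / 9 : ℝ) * (1 + 2 * X) ^ 4 * (defectPoly (i + 1)).comp cheb3)
      (C (1 / 9 : ℝ) * (2 + X))
    rw [defectPoly, pow_succ 3 (i + 1)]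
    omega

lemma two_mul_natDegree_cutoffPoly_lt (i : ℕ) : 2 * (cutoffPoly i).natDegree < 3 ^ i := by
  induction i with
  | zero => simp [cutoffPoly]
  | succ i ih =>
    have h1 := two_mul_natDegree_avgPoly_lt i
    have h2 : cutoffPoly (i + 1) = cutoffPoly i * avgPoly i ^ 2 := Finset.prod_range_succ _ _
    have h3 := natDegree_mul_le (p := cutoffPoly i) (q := avgPoly i ^ 2)
    have h4 := natDegree_pow_le (p := avgPoly i) (n := 2)
    rw [h2, pow_succ 3 i]
    omega

/-- The cutoff has degree below `3^i/2` and the defect at most `3^i - 2`. The bound `3^{i+1}/2`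
gives the finite range, and the spare unit allows a further factor `1 - X` in the quadrature. -/
lemma two_mul_natDegree_slicePoly_lt (i : ℕ) : 2 * (slicePoly i).natDegree + 2 < 3 ^ (i + 1) := by
  rcases i with _ | i
  · simp [slicePoly, defectPoly]
  · have h1 := two_mul_natDegree_cutoffPoly_lt (i + 1)
    have h2 := natDegree_defectPoly_le i
    have h3 := natDegree_mul_le (p := cutoffPoly (i + 1)) (q := defectPoly (i + 1))
    rw [slicePoly, pow_succ 3 (i + 1)]
    omega

end SpectralPolynomials

/-! ### Averages over the dual torus -/

/-- Each term is dominated by a difference of consecutive values of `2 / (τ (1 + τv))`, a discrete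
version of integrating `(1 + τv)^{-2}`. -/
lemma sum_range_inv_one_add_sq_le {τ : ℝ} (hτ : 0 < τ) (n : ℕ) :
    ∑ v ∈ Finset.range n, (1 + (τ * v) ^ 2)⁻¹ ≤ 1 + 2 / τ := by
  have key : ∀ n : ℕ, ∑ v ∈ Finset.range (n + 1), (1 + (τ * v) ^ 2)⁻¹ ≤
      1 + 2 / τ * (1 - (1 + τ * n)⁻¹) := by
    intro n
    induction n with
    | zero => simp
    | succ n ih =>
      rw [Finset.sum_range_succ]
      have h1 : (1 + (τ * (n + 1 : ℕ)) ^ 2)⁻¹ ≤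
          2 / τ * ((1 + τ * n)⁻¹ - (1 + τ * (n + 1 : ℕ))⁻¹) := by
        push_cast
        have h2 : 0 < 1 + τ * n := by positivity
        have h3 : 0 < 1 + τ * (n + 1) := by positivity
        rw [inv_sub_inv h2.ne' h3.ne', show 2 / τ * ((1 + τ * (n + 1) - (1 + τ * n)) /
          ((1 + τ * n) * (1 + τ * (n + 1)))) = 2 / ((1 + τ * n) * (1 + τ * (n + 1))) by
            field_simp; ring, ← one_div, div_le_div_iff₀ (by positivity) (by positivity)]
        nlinarith [sq_nonneg (τ * (n + 1) - 1)]
      linarith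
  rcases n with _ | n
  · simp; positivity
  · refine (key n).trans ?_
    have h1 : 0 ≤ 2 / τ * (1 + τ * n)⁻¹ := by positivity
    linarith

section Averages

set_option linter.unusedSectionVars false

variable {N : ℕ} [NeZero N]

lemma sum_zmod_val (f : ℕ → ℝ) : ∑ a : ZMod N, f a.val = ∑ v ∈ Finset.range N, f v := by
  rcases N with _ | k
  · exact absurd rfl (NeZero.ne 0)
  · exact Fin.sum_univ_eq_sum_range f (k + 1)

lemma cosZ_neg (a : ZMod N) : cosZ (-a) = cosZ a := by rw [cosZ, stdAddChar_neg, cosZ]; rfl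

lemma sq_val_le_one_sub_cosZ {a : ZMod N} (ha : 2 * a.val ≤ N) :
    (4 / N * a.val : ℝ) ^ 2 ≤ 2 * (1 - cosZ a) := by
  have hN : (0 : ℝ) < N := by exact_mod_cast NeZero.pos N
  have ha' : 2 * (a.val : ℝ) ≤ N := by exact_mod_cast ha
  have h1 : 2 * (1 - cosZ a) = (2 * Real.sin (Real.pi / N * a.val)) ^ 2 := by
    rw [cosZ_eq, show 2 * Real.pi / N * (a.val : ℝ) = 2 * (Real.pi / N * a.val) by ring,
      Real.cos_two_mul, mul_pow, Real.sin_sq]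
    ring
  have h2 : Real.pi / N * a.val ≤ Real.pi / 2 := by
    rw [div_mul_eq_mul_div, div_le_div_iff₀ hN two_pos]
    nlinarith [Real.pi_pos]
  have h3 := Real.mul_le_sin (by positivity) h2
  have h4 : 2 / Real.pi * (Real.pi / N * a.val) = 2 / N * a.val := by
    field_simp
  rw [h4] at h3
  rw [h1]
  refine pow_le_pow_left₀ (by positivity) ?_ 2
  calc (4 / N * a.val : ℝ) = 2 * (2 / N * a.val) := by ring
    _ ≤ _ := by linarith

/-- Either `a` or `-a` has its representative in `[0, N/2]`, where `1 - cos` is bounded below by a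
quadratic. Adding the terms of `a` and `-a` avoids splitting the sum. -/
lemma sum_inv_one_add_cosZ_le {t : ℝ} (ht : 0 < t) (htN : t ≤ N) :
    ∑ a : ZMod N, (1 + t ^ 2 * (2 * (1 - cosZ a)))⁻¹ ≤ 3 * N / t := by
  have hN : (0 : ℝ) < N := by exact_mod_cast NeZero.pos N
  set τ := t * (4 / N) with hτ_def
  have hτ : 0 < τ := by positivity
  have key : ∀ a : ZMod N, 2 * a.val ≤ N →
      (1 + t ^ 2 * (2 * (1 - cosZ a)))⁻¹ ≤ (1 + (τ * a.val) ^ 2)⁻¹ := by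
    intro a ha
    refine inv_anti₀ (by positivity) ?_
    have h1 := mul_le_mul_of_nonneg_left (sq_val_le_one_sub_cosZ ha) (sq_nonneg t)
    rw [← mul_pow, ← mul_assoc, ← hτ_def] at h1
    linarith
  have h1 : ∀ a : ZMod N, (1 + t ^ 2 * (2 * (1 - cosZ a)))⁻¹ ≤
      (1 + (τ * a.val) ^ 2)⁻¹ + (1 + (τ * (-a).val) ^ 2)⁻¹ := by
    intro a
    by_cases ha : 2 * a.val ≤ N
    · exact (key a ha).trans (le_add_of_nonneg_right (by positivity))
    · have ha0 : a ≠ 0 := by rintro rfl; simp at ha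
      have h2 : 2 * (-a).val ≤ N := by
        rw [ZMod.neg_val, if_neg ha0]
        omega
      have h3 := key (-a) h2
      rw [cosZ_neg] at h3
      exact h3.trans (le_add_of_nonneg_left (by positivity))
  have h2 : ∑ a : ZMod N, (1 + (τ * a.val) ^ 2)⁻¹ ≤ 1 + 2 / τ := by
    rw [sum_zmod_val fun v => (1 + (τ * v) ^ 2)⁻¹]
    exact sum_range_inv_one_add_sq_le hτ N
  have h3 : ∑ a : ZMod N, (1 + (τ * (-a).val) ^ 2)⁻¹ = ∑ a : ZMod N, (1 + (τ * a.val) ^ 2)⁻¹ :=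
    Equiv.sum_comp (Equiv.neg (ZMod N)) fun a : ZMod N => (1 + (τ * (a.val : ℝ)) ^ 2)⁻¹
  have h4 : 2 * (1 + 2 / τ) = 2 + N / t := by rw [hτ_def]; field_simp; ring
  have h5 : 1 ≤ N / t := (one_le_div ht).2 htN
  calc _ ≤ ∑ a : ZMod N, ((1 + (τ * a.val) ^ 2)⁻¹ + (1 + (τ * (-a).val) ^ 2)⁻¹) :=
        Finset.sum_le_sum fun a _ => h1 a
    _ ≤ 2 * (1 + 2 / τ) := by rw [Finset.sum_add_distrib, h3]; linarith
    _ = 2 + N / t := h4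
    _ ≤ _ := by rw [mul_div_assoc]; linarith

/-- Since `(1 + u + v)² ≥ (1 + u)(1 + v)` for nonnegative `u`, `v`, the average over the dual torus
factorises into two one-dimensional averages. -/
lemma avg_inv_sq_le {i : ℕ} (hi : 3 ^ i ≤ N) :
    ((N : ℝ) ^ 2)⁻¹ * ∑ n : Torus N, ((1 + 9 ^ i * (4 * (1 - meanCos n))) ^ 2)⁻¹ ≤
      9 * (9 ^ i)⁻¹ := by
  have hN : (0 : ℝ) < N := by exact_mod_cast NeZero.pos N
  have h9 : (9 : ℝ) ^ i = (3 ^ i) ^ 2 := by rw [← pow_mul, mul_comm, pow_mul]; norm_num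
  have hs := sum_inv_one_add_cosZ_le (N := N) (t := 3 ^ i) (by positivity) (by exact_mod_cast hi)
  set f : ZMod N → ℝ := fun a => (1 + (3 ^ i) ^ 2 * (2 * (1 - cosZ a)))⁻¹ with hf
  have hf0 : ∀ a, 0 ≤ f a := fun a => by
    have := cosZ_le_one a
    have h1 : 0 ≤ 1 - cosZ a := by linarith
    rw [hf]; positivity
  have h1 : ∀ n : Torus N, ((1 + 9 ^ i * (4 * (1 - meanCos n))) ^ 2)⁻¹ ≤ f n.1 * f n.2 := by
    intro n
    have h2 : 0 ≤ 2 * (1 - cosZ n.1) := by linarith [cosZ_le_one n.1]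
    have h3 : 0 ≤ 2 * (1 - cosZ n.2) := by linarith [cosZ_le_one n.2]
    rw [hf, ← mul_inv, ← h9]
    refine inv_anti₀ (by positivity) ?_
    have h4 : 4 * (1 - meanCos n) = 2 * (1 - cosZ n.1) + 2 * (1 - cosZ n.2) := by
      unfold meanCos; ring
    rw [h4]
    have h5 : (0 : ℝ) ≤ 9 ^ i := by positivity
    have h6 := mul_nonneg h5 h2
    have h7 := mul_nonneg h5 h3
    nlinarith [mul_nonneg h6 h7]
  have h8 : ∑ n : Torus N, f n.1 * f n.2 = (∑ a, f a) ^ 2 := by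
    rw [sq, Finset.sum_mul_sum, ← Finset.sum_product']
    rfl
  calc _ ≤ ((N : ℝ) ^ 2)⁻¹ * (3 * N / 3 ^ i) ^ 2 := by
        refine mul_le_mul_of_nonneg_left ?_ (by positivity)
        refine (Finset.sum_le_sum fun n _ => h1 n).trans ?_
        rw [h8]
        exact pow_le_pow_left₀ (Finset.sum_nonneg fun a _ => hf0 a) hs 2
    _ = _ := by rw [h9]; field_simp; norm_num

lemma exists_avg_cutoffPoly_le : ∃ K : ℝ, 0 ≤ K ∧ ∀ (N : ℕ) [NeZero N] (i : ℕ), 3 ^ i ≤ N →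
    ((N : ℝ) ^ 2)⁻¹ * ∑ n : Torus N, (cutoffPoly i).eval (meanCos n) ≤ K * (9 ^ i)⁻¹ := by
  obtain ⟨K, hK, h⟩ := exists_cutoffPoly_decay 2
  refine ⟨K * 9, by positivity, fun N _ i hi => ?_⟩
  have h1 : ∀ n : Torus N, (cutoffPoly i).eval (meanCos n) ≤
      K * ((1 + 9 ^ i * (4 * (1 - meanCos n))) ^ 2)⁻¹ := by
    intro n
    have h2 : 0 ≤ 1 - meanCos n := by linarith [(meanCos_mem n).2]
    rw [← div_eq_mul_inv, le_div_iff₀ (by positivity)]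
    exact h i _ (meanCos_mem n)
  calc _ ≤ ((N : ℝ) ^ 2)⁻¹ * ∑ n : Torus N, K * ((1 + 9 ^ i * (4 * (1 - meanCos n))) ^ 2)⁻¹ :=
        mul_le_mul_of_nonneg_left (Finset.sum_le_sum fun n _ => h1 n) (by positivity)
    _ = K * (((N : ℝ) ^ 2)⁻¹ * ∑ n : Torus N, ((1 + 9 ^ i * (4 * (1 - meanCos n))) ^ 2)⁻¹) := by
        rw [← Finset.mul_sum]; ring
    _ ≤ K * (9 * (9 ^ i)⁻¹) := mul_le_mul_of_nonneg_left (avg_inv_sq_le hi) hK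
    _ = _ := by ring

/-- With `l + 2` powers of decay, `l` of them absorb the factors `3^i √(4(1 - x))`; the last two
give a torus average of order `9^{-i}`, which cancels the `9^i` in `slicePoly_le`. -/
lemma exists_avg_slicePoly_mul_le (l : ℕ) : ∃ K : ℝ, 0 ≤ K ∧ ∀ (N : ℕ) [NeZero N] (i : ℕ),
    3 ^ i ≤ N → ((N : ℝ) ^ 2)⁻¹ * ∑ n : Torus N,
      (slicePoly i).eval (meanCos n) * √(4 * (1 - meanCos n)) ^ l ≤ K * ((3 ^ i) ^ l)⁻¹ := by
  obtain ⟨K, hK, h⟩ := exists_cutoffPoly_decay (l + 2)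
  refine ⟨K * 9, by positivity, fun N _ i hi => ?_⟩
  have h9 : (9 : ℝ) ^ i = (3 ^ i) ^ 2 := by rw [← pow_mul, mul_comm, pow_mul]; norm_num
  have h1 : ∀ n : Torus N, (slicePoly i).eval (meanCos n) * √(4 * (1 - meanCos n)) ^ l ≤
      K * 9 ^ i * ((3 ^ i) ^ l)⁻¹ * ((1 + 9 ^ i * (4 * (1 - meanCos n))) ^ 2)⁻¹ := by
    intro n
    have hn := meanCos_mem n
    set y := 4 * (1 - meanCos n) with hy
    have hy0 : 0 ≤ y := by rw [hy]; linarith [hn.2]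
    have h2 := slicePoly_le i hn
    have h3 := h i _ hn
    rw [← hy] at h3
    have h4 : (3 ^ i * √y) ^ l ≤ (1 + 9 ^ i * y) ^ l := by
      refine pow_le_pow_left₀ (by positivity) ?_ l
      have h5 : (3 ^ i * √y) ^ 2 = 9 ^ i * y := by rw [mul_pow, Real.sq_sqrt hy0, h9]
      nlinarith [sq_nonneg (3 ^ i * √y - 1 / 2)]
    have hc := cutoffPoly_nonneg i (meanCos n)
    rw [← div_eq_mul_inv, ← div_eq_mul_inv, div_div, le_div_iff₀ (by positivity)]
    calc _ ≤ 9 ^ i * (cutoffPoly i).eval (meanCos n) * √y ^ l *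
          ((3 ^ i) ^ l * (1 + 9 ^ i * y) ^ 2) := by gcongr
      _ = 9 ^ i * (cutoffPoly i).eval (meanCos n) * (1 + 9 ^ i * y) ^ 2 *
          (3 ^ i * √y) ^ l := by rw [mul_pow]; ring
      _ ≤ 9 ^ i * (cutoffPoly i).eval (meanCos n) * (1 + 9 ^ i * y) ^ 2 *
          (1 + 9 ^ i * y) ^ l := by gcongr
      _ = 9 ^ i * ((cutoffPoly i).eval (meanCos n) * (1 + 9 ^ i * y) ^ (l + 2)) := by ring
      _ ≤ 9 ^ i * K := by gcongr
      _ = _ := by ring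
  calc _ ≤ ((N : ℝ) ^ 2)⁻¹ * ∑ n : Torus N,
        K * 9 ^ i * ((3 ^ i) ^ l)⁻¹ * ((1 + 9 ^ i * (4 * (1 - meanCos n))) ^ 2)⁻¹ :=
        mul_le_mul_of_nonneg_left (Finset.sum_le_sum fun n _ => h1 n) (by positivity)
    _ = K * 9 ^ i * ((3 ^ i) ^ l)⁻¹ *
        (((N : ℝ) ^ 2)⁻¹ * ∑ n : Torus N, ((1 + 9 ^ i * (4 * (1 - meanCos n))) ^ 2)⁻¹) := by
        rw [← Finset.mul_sum]; ring
    _ ≤ K * 9 ^ i * ((3 ^ i) ^ l)⁻¹ * (9 * (9 ^ i)⁻¹) :=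
        mul_le_mul_of_nonneg_left (avg_inv_sq_le hi) (by positivity)
    _ = _ := by field_simp

end Averages

/-! ### Torus averages of polynomials of the averaging operator -/

section DensityOfStates

set_option linter.unusedSectionVars false

open Polynomial

variable {N : ℕ} [NeZero N]

/-- The moments of `cos` over the `N`-th roots of unity. -/
def cosMoment (N : ℕ) [NeZero N] (d : ℕ) : ℝ := (N : ℝ)⁻¹ * ∑ a : ZMod N, cosZ a ^ d

/-- In the binomial expansion the frequencies `2j - d` have modulus at most `d < N`, so there is no
aliasing and only frequency zero survives. -/
lemma cosMoment_eq {d : ℕ} (hd : d < N) :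
    cosMoment N d = ∑ j ∈ Finset.range (d + 1), if 2 * j = d then (d.choose j : ℝ) / 2 ^ d else 0 := by
  have hN : (N : ℂ) ≠ 0 := by exact_mod_cast NeZero.ne N
  have h1 : ∀ a : ZMod N, ((cosZ a : ℝ) : ℂ) ^ d = ∑ j ∈ Finset.range (d + 1),
      (d.choose j : ℂ) / 2 ^ d * ZMod.stdAddChar (a * ((2 * j - d : ℤ) : ZMod N)) := by
    intro a
    have h2 : ((cosZ a : ℝ) : ℂ) = (ZMod.stdAddChar a + ZMod.stdAddChar (-a)) / 2 := by
      rw [stdAddChar_neg, Complex.add_conj, cosZ]; push_cast; ring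
    rw [h2, div_pow, add_pow, Finset.sum_div]
    refine Finset.sum_congr rfl fun j hj => ?_
    have hj' : j ≤ d := Nat.lt_succ_iff.1 (Finset.mem_range.1 hj)
    rw [← AddChar.map_nsmul_eq_pow, ← AddChar.map_nsmul_eq_pow, ← AddChar.map_add_eq_mul]
    have h3 : j • a + (d - j) • -a = a * ((2 * j - d : ℤ) : ZMod N) := by
      rw [nsmul_eq_mul, nsmul_eq_mul, Nat.cast_sub hj']
      push_cast
      ring
    rw [h3]
    ring
  have h4 : ((cosMoment N d : ℝ) : ℂ) =
      ((∑ j ∈ Finset.range (d + 1), if 2 * j = d then (d.choose j : ℝ) / 2 ^ d else 0 : ℝ) : ℂ) := by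
    rw [cosMoment]
    push_cast
    rw [Finset.sum_congr rfl fun a _ => h1 a, Finset.sum_comm, Finset.mul_sum]
    refine Finset.sum_congr rfl fun j hj => ?_
    have hj' : j ≤ d := Nat.lt_succ_iff.1 (Finset.mem_range.1 hj)
    rw [← Finset.mul_sum, AddChar.sum_mulShift _ (ZMod.isPrimitive_stdAddChar N), ZMod.card]
    have h5 : ((2 * j - d : ℤ) : ZMod N) = 0 ↔ 2 * j = d := by
      rw [ZMod.intCast_zmod_eq_zero_iff_dvd]
      constructor
      · intro h
        have := Int.eq_zero_of_abs_lt_dvd h (by rw [abs_lt]; constructor <;> omega)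
        omega
      · intro h
        rw [show (2 * j - d : ℤ) = 0 by omega]
        exact dvd_zero _
    by_cases h : 2 * j = d
    · rw [if_pos (h5.2 h), if_pos h]
      push_cast
      field_simp
    · rw [if_neg (h5.not.2 h), if_neg h]
      simp
  exact_mod_cast h4

lemma cosMoment_odd {k : ℕ} (hk : 2 * k + 1 < N) : cosMoment N (2 * k + 1) = 0 := by
  rw [cosMoment_eq hk]
  exact Finset.sum_eq_zero fun j _ => if_neg (by omega)

lemma cosMoment_even {k : ℕ} (hk : 2 * k < N) :
    cosMoment N (2 * k) = ∏ i ∈ Finset.range k, (2 * (i : ℝ) + 1) / (2 * i + 2) := by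
  rw [cosMoment_eq hk, Finset.sum_eq_single k, if_pos rfl]
  · rw [← Nat.centralBinom_eq_two_mul_choose]
    clear hk
    induction k with
    | zero => simp
    | succ k ih =>
      rw [Finset.prod_range_succ, ← ih]
      have h := Nat.succ_mul_centralBinom_succ k
      have h' : ((k : ℝ) + 1) * (k + 1).centralBinom = 2 * (2 * k + 1) * k.centralBinom := by
        exact_mod_cast h
      have hk : (k : ℝ) + 1 ≠ 0 := by positivity
      rw [show 2 * (k + 1) = 2 * k + 2 by ring, pow_add]
      field_simp
      linear_combination h'
  · intro j _ hj
    exact if_neg (by omega)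
  · intro h
    simp at h
    omega

/-- For even `d < N` the discrete moment equals the continuous one. For odd `d` it vanishes while
the integral over a quarter period does not, hence the extra factor `cosMoment N d` on both sides.
-/
lemma cosMoment_eq_integral {d : ℕ} (hd : d < N) : cosMoment N d *
    (2 / Real.pi * ∫ v in (0 : ℝ)..Real.pi / 2, Real.cos v ^ d) = cosMoment N d ^ 2 := by
  rcases Nat.even_or_odd' d with ⟨k, rfl | rfl⟩
  · rw [EulerSine.integral_cos_pow_eq, integral_sin_pow_even, cosMoment_even hd]
    field_simp
  · rw [cosMoment_odd hd]; ring

/-- The Wallis products for the powers `2k` and `2k + 1` multiply to `1/(2k + 1)`, a moment of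
Lebesgue measure: with the weight `cos v`, the product `cos s cos v` has moments proportional to
those of the uniform law on `[-1, 1]`. -/
lemma cosMoment_mul_integral_succ {d : ℕ} (hd : d < N) : cosMoment N d *
    (2 / Real.pi * ∫ v in (0 : ℝ)..Real.pi / 2, Real.cos v ^ (d + 1)) =
      1 / Real.pi * ∫ x in (-1 : ℝ)..1, x ^ d := by
  rw [integral_pow]
  rcases Nat.even_or_odd' d with ⟨k, rfl | rfl⟩
  · rw [EulerSine.integral_cos_pow_eq, integral_sin_pow_odd, cosMoment_even hd]
    have h : (∏ i ∈ Finset.range k, (2 * (i : ℝ) + 1) / (2 * i + 2)) *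
        (∏ i ∈ Finset.range k, (2 * (i : ℝ) + 2) / (2 * i + 3)) = 1 / (2 * k + 1) := by
      clear hd
      rw [← Finset.prod_mul_distrib]
      induction k with
      | zero => simp
      | succ k ih =>
        rw [Finset.prod_range_succ, ih]
        push_cast
        field_simp
        ring
    have h1 : (-1 : ℝ) ^ (2 * k + 1) = -1 := Odd.neg_one_pow ⟨k, rfl⟩
    rw [h1, one_pow]
    push_cast
    linear_combination (2 / Real.pi) * h
  · rw [cosMoment_odd hd]
    have h1 : (-1 : ℝ) ^ (2 * k + 1 + 1) = 1 := Even.neg_one_pow ⟨k + 1, by ring⟩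
    rw [h1]
    simp

/-- The average of `P (cos s cos v) (cos v) ^ e` over discrete `s` and continuous `v`. -/
lemma integral_avg_eval (P : ℝ[X]) (e : ℕ) :
    2 / Real.pi * ∫ v in (0 : ℝ)..Real.pi / 2,
      ((N : ℝ)⁻¹ * ∑ a : ZMod N, P.eval (cosZ a * Real.cos v)) * Real.cos v ^ e =
    ∑ d ∈ Finset.range (P.natDegree + 1), P.coeff d *
      (cosMoment N d * (2 / Real.pi * ∫ v in (0 : ℝ)..Real.pi / 2, Real.cos v ^ (d + e))) := by
  have h1 : ∀ v : ℝ, ((N : ℝ)⁻¹ * ∑ a : ZMod N, P.eval (cosZ a * Real.cos v)) * Real.cos v ^ e =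
      ∑ d ∈ Finset.range (P.natDegree + 1),
        P.coeff d * cosMoment N d * Real.cos v ^ (d + e) := by
    intro v
    simp only [eval_eq_sum_range, cosMoment]
    rw [Finset.sum_comm, Finset.mul_sum, Finset.sum_mul]
    refine Finset.sum_congr rfl fun d _ => ?_
    simp only [mul_pow, ← Finset.mul_sum, ← Finset.sum_mul]
    ring
  simp only [h1]
  rw [intervalIntegral.integral_finsetSum fun d _ =>
    (Continuous.intervalIntegrable (by fun_prop) _ _), Finset.mul_sum]
  refine Finset.sum_congr rfl fun d _ => ?_
  rw [intervalIntegral.integral_const_mul]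
  ring

lemma cosZ_mul_cosZ (s t : ZMod N) : meanCos (s + t, s - t) = cosZ s * cosZ t := by
  simp only [meanCos, cosZ, sub_eq_add_neg, AddChar.map_add_eq_mul, stdAddChar_neg]
  simp

/-- For odd `N` the map `(s, t) ↦ (s + t, s - t)` is a bijection, since `2` is invertible; it turns
the mean of two cosines into a product. -/
lemma sum_comp_meanCos (hN : Odd N) (f : ℝ → ℝ) :
    ∑ n : Torus N, f (meanCos n) = ∑ n : Torus N, f (cosZ n.1 * cosZ n.2) := by
  have h2 : IsUnit (2 : ZMod N) := by
    have := (ZMod.isUnit_iff_coprime 2 N).2 (Nat.coprime_two_left.2 hN)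
    exact_mod_cast this
  have hinj : Function.Injective fun n : Torus N => ((n.1 + n.2, n.1 - n.2) : Torus N) := by
    rintro ⟨s, t⟩ ⟨s', t'⟩ h
    obtain ⟨h3, h4⟩ := Prod.ext_iff.1 h
    simp only at h3 h4
    have h5 : s = s' := h2.mul_left_cancel (by linear_combination h3 + h4)
    have h6 : t = t' := h2.mul_left_cancel (by linear_combination h3 - h4)
    rw [h5, h6]
  have hbij := (Fintype.bijective_iff_injective_and_card _).2 ⟨hinj, rfl⟩
  rw [← hbij.sum_comp fun n => f (meanCos n)]
  exact Finset.sum_congr rfl fun n _ => by rw [cosZ_mul_cosZ]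

lemma avg_eval_meanCos (hN : Odd N) {P : ℝ[X]} (hP : P.natDegree < N) :
    ((N : ℝ) ^ 2)⁻¹ * ∑ n : Torus N, P.eval (meanCos n) =
      2 / Real.pi * ∫ v in (0 : ℝ)..Real.pi / 2,
        ((N : ℝ)⁻¹ * ∑ a : ZMod N, P.eval (cosZ a * Real.cos v)) := by
  have h1 := integral_avg_eval (N := N) P 0
  simp only [pow_zero, mul_one, add_zero] at h1
  rw [h1, sum_comp_meanCos hN fun x => P.eval x]
  simp only [eval_eq_sum_range]
  rw [Finset.sum_comm, Finset.mul_sum]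
  refine Finset.sum_congr rfl fun d hd => ?_
  rw [cosMoment_eq_integral (by rw [Finset.mem_range] at hd; omega), ← Finset.mul_sum]
  have h2 : ∑ n : Torus N, (cosZ n.1 * cosZ n.2) ^ d = (∑ a : ZMod N, cosZ a ^ d) ^ 2 := by
    rw [sq, Finset.sum_mul_sum, ← Finset.sum_product']
    exact Finset.sum_congr rfl fun n _ => mul_pow _ _ _
  rw [h2, cosMoment]
  field_simp

lemma integral_eval_eq {P : ℝ[X]} (hP : P.natDegree < N) :
    1 / Real.pi * ∫ x in (-1 : ℝ)..1, P.eval x =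
      2 / Real.pi * ∫ v in (0 : ℝ)..Real.pi / 2,
        ((N : ℝ)⁻¹ * ∑ a : ZMod N, P.eval (cosZ a * Real.cos v)) * Real.cos v := by
  have h1 := integral_avg_eval (N := N) P 1
  simp only [pow_one] at h1
  rw [h1]
  simp only [eval_eq_sum_range]
  rw [intervalIntegral.integral_finsetSum fun d _ =>
    (Continuous.intervalIntegrable (by fun_prop) _ _), Finset.mul_sum]
  refine Finset.sum_congr rfl fun d hd => ?_
  rw [cosMoment_mul_integral_succ (by rw [Finset.mem_range] at hd; omega),
    intervalIntegral.integral_const_mul]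
  ring

/-- The torus average of a nonnegative polynomial of the averaging operator is close to its
integral if the polynomial is concentrated near `1`. -/
lemma abs_avg_sub_integral_le (hN : Odd N) {P : ℝ[X]} (hP : P.natDegree + 1 < N)
    (hP0 : ∀ x ∈ Set.Icc (-1 : ℝ) 1, 0 ≤ P.eval x) :
    |((N : ℝ) ^ 2)⁻¹ * ∑ n : Torus N, P.eval (meanCos n) -
        1 / Real.pi * ∫ x in (-1 : ℝ)..1, P.eval x| ≤
      ((N : ℝ) ^ 2)⁻¹ * ∑ n : Torus N, (1 - meanCos n) * P.eval (meanCos n) := by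
  have hdeg : ((1 - X) * P).natDegree < N := by
    have h1 := natDegree_mul_le (p := (1 - X : ℝ[X])) (q := P)
    have h2 : (1 - X : ℝ[X]).natDegree ≤ 1 := by compute_degree
    omega
  have h3 := avg_eval_meanCos hN hdeg
  simp only [eval_mul, eval_sub, eval_one, eval_X] at h3
  have hcont : Continuous fun v : ℝ => (N : ℝ)⁻¹ * ∑ a : ZMod N, P.eval (cosZ a * Real.cos v) := by
    fun_prop
  have hcont' : Continuous fun v : ℝ =>
      ((N : ℝ)⁻¹ * ∑ a : ZMod N, P.eval (cosZ a * Real.cos v)) * Real.cos v := by fun_prop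
  rw [h3, avg_eval_meanCos hN (by omega : P.natDegree < N),
    integral_eval_eq (N := N) (by omega : P.natDegree < N), ← mul_sub,
    ← intervalIntegral.integral_sub (hcont.intervalIntegrable _ _)
      (hcont'.intervalIntegrable _ _)]
  have hpi : 0 ≤ Real.pi / 2 := by positivity
  have hmem : ∀ v ∈ Set.Icc 0 (Real.pi / 2), ∀ a : ZMod N,
      cosZ a * Real.cos v ∈ Set.Icc (-1 : ℝ) 1 ∧ cosZ a * Real.cos v ≤ Real.cos v := by
    intro v hv a
    have h4 : 0 ≤ Real.cos v :=
      Real.cos_nonneg_of_mem_Icc ⟨by linarith [hv.1, Real.pi_pos], hv.2⟩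
    have h5 := Real.cos_le_one v
    have h6 := cosZ_le_one a
    have h7 := neg_one_le_cosZ a
    refine ⟨⟨by nlinarith, by nlinarith⟩, by nlinarith⟩
  have hnn : ∀ v ∈ Set.Icc 0 (Real.pi / 2),
      0 ≤ (N : ℝ)⁻¹ * ∑ a : ZMod N, P.eval (cosZ a * Real.cos v) := fun v hv =>
    mul_nonneg (by positivity) (Finset.sum_nonneg fun a _ => hP0 _ (hmem v hv a).1)
  -- The two integrals differ by the nonnegative weight `1 - cos v`, and `cos s cos v ≤ cos v`
  -- bounds it by `1 - cos s cos v`, that is, by the factor `1 - x` at the argument of `P`.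
  rw [abs_of_nonneg]
  · refine mul_le_mul_of_nonneg_left ?_ (by positivity)
    refine intervalIntegral.integral_mono_on hpi (Continuous.intervalIntegrable
      (hcont.sub hcont') _ _)
      (Continuous.intervalIntegrable (by fun_prop) _ _) fun v hv => ?_
    rw [mul_assoc, ← mul_sub, Finset.sum_mul, ← Finset.sum_sub_distrib]
    refine mul_le_mul_of_nonneg_left (Finset.sum_le_sum fun a _ => ?_) (by positivity)
    obtain ⟨h4, h5⟩ := hmem v hv a
    have h6 := hP0 _ h4
    nlinarith
  · refine mul_nonneg (by positivity) (intervalIntegral.integral_nonneg hpi fun v hv => ?_)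
    have h4 := hnn v hv
    have h5 := Real.cos_le_one v
    nlinarith

end DensityOfStates

/-! ### The integral of the spectral density of a slice -/

section SliceIntegral

open Polynomial

/-- The accumulated spectral density `(1 - χ_n(x)) / (1 - x)`. -/
def accPoly (n : ℕ) : ℝ[X] := C 4 * ∑ i ∈ Finset.range n, slicePoly i

lemma one_sub_mul_eval_accPoly (n : ℕ) (x : ℝ) :
    (1 - x) * (accPoly n).eval x = 1 - (cutoffPoly n).eval x := by
  rw [← four_mul_sum_eval_slicePoly, accPoly, eval_mul, eval_C, eval_finsetSum]
  ring

/-- Substitution by `tripling`, which maps `[1/2, 1]` increasingly onto `[-1, 1]`. -/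
lemma integral_accPoly_tripling (n : ℕ) :
    ∫ x in (1 / 2 : ℝ)..1, (accPoly n).eval (tripling x) * (3 * (2 * x - 1) * (2 * x + 1)) =
      ∫ x in (-1 : ℝ)..1, (accPoly n).eval x := by
  have h := intervalIntegral.integral_comp_mul_deriv (a := 1 / 2) (b := 1) (f := tripling)
    (f' := fun x => 3 * (2 * x - 1) * (2 * x + 1)) (g := fun x => (accPoly n).eval x)
    (fun x _ => by
      have h1 := ((hasDerivAt_pow 3 x).const_mul 4).sub ((hasDerivAt_id x).const_mul 3)
      refine h1.congr_deriv ?_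
      norm_num
      ring)
    (by fun_prop) (by fun_prop)
  rw [show tripling (1 / 2) = -1 by norm_num [tripling],
    show tripling 1 = 1 by norm_num [tripling]] at h
  exact h

lemma integral_inv_one_sub : ∫ x in (-1 : ℝ)..(1 / 2), (1 - x)⁻¹ = 2 * Real.log 2 := by
  have hne : ∀ x ∈ Set.uIcc (-1 : ℝ) (1 / 2), 1 - x ≠ 0 := by
    intro x hx
    rw [Set.uIcc_of_le (by norm_num)] at hx
    linarith [hx.2]
  rw [intervalIntegral.integral_eq_sub_of_hasDerivAt (f := fun x => -Real.log (1 - x))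
    (fun x hx => by
      have h1 := (((hasDerivAt_id x).const_sub 1).log (hne x hx)).neg
      refine h1.congr_deriv ?_
      simp [neg_div])
    (ContinuousOn.intervalIntegrable (by fun_prop (disch := exact hne)))]
  rw [show (1 : ℝ) - 1 / 2 = 2⁻¹ by norm_num, Real.log_inv]
  norm_num
  ring

lemma integral_inv_two_mul_add_one :
    ∫ x in (1 / 2 : ℝ)..1, 4 * (2 * x + 1)⁻¹ = 2 * (Real.log 3 - Real.log 2) := by
  have hne : ∀ x ∈ Set.uIcc (1 / 2 : ℝ) 1, 2 * x + 1 ≠ 0 := by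
    intro x hx
    rw [Set.uIcc_of_le (by norm_num)] at hx
    linarith [hx.1]
  rw [intervalIntegral.integral_eq_sub_of_hasDerivAt (f := fun x => 2 * Real.log (2 * x + 1))
    (fun x hx => by
      have h1 := (((((hasDerivAt_id x).const_mul 2).add_const 1)).log (hne x hx)).const_mul 2
      refine h1.congr_deriv ?_
      simp [div_eq_mul_inv]
      ring)
    (ContinuousOn.intervalIntegrable (by fun_prop (disch := exact hne)))]
  norm_num
  ring

lemma integral_inv_sq_le {b : ℝ} (hb : 0 < b) :
    ∫ x in (1 / 2 : ℝ)..1, ((1 + b * (1 - x)) ^ 2)⁻¹ ≤ b⁻¹ := by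
  have hne : ∀ x ∈ Set.uIcc (1 / 2 : ℝ) 1, 1 + b * (1 - x) ≠ 0 := by
    intro x hx
    rw [Set.uIcc_of_le (by norm_num)] at hx
    have : 0 ≤ b * (1 - x) := mul_nonneg hb.le (by linarith [hx.2])
    linarith
  rw [intervalIntegral.integral_eq_sub_of_hasDerivAt (f := fun x => b⁻¹ * (1 + b * (1 - x))⁻¹)
    (fun x hx => by
      have h1 := ((((((hasDerivAt_id x).const_sub 1).const_mul b).const_add 1)).inv
        (hne x hx)).const_mul b⁻¹
      refine h1.congr_deriv ?_
      have := hne x hx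
      simp only [id]
      field_simp)
    (ContinuousOn.intervalIntegrable (by
      refine ContinuousOn.inv₀ (by fun_prop) fun x hx => pow_ne_zero 2 (hne x hx)))]
  have : 0 ≤ b⁻¹ * (1 + b * (1 - 1 / 2))⁻¹ := by
    norm_num; positivity
  simp only [sub_self, mul_zero, add_zero, inv_one, mul_one]
  linarith

/-- Without cutoffs the identity is exact: `1/(1 - x)` minus its pullback under tripling times the
Jacobian equals `4/(2x + 1)`. The error comes from the cutoffs, which by self-similarity differ by
`a^{2n}`, and `1 - a^{2n} ≤ 2n(1 - x)` by Bernoulli. -/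
lemma abs_accPoly_succ_sub_le (n : ℕ) {x : ℝ} (hx : x ∈ Set.Ioo (1 / 2 : ℝ) 1) :
    |(accPoly (n + 1)).eval x - (accPoly n).eval (tripling x) * (3 * (2 * x - 1) * (2 * x + 1)) -
        4 * (2 * x + 1)⁻¹| ≤ (2 * n + 2) * (cutoffPoly n).eval (tripling x) := by
  obtain ⟨hx1, hx2⟩ := hx
  have h1 := one_sub_mul_eval_accPoly (n + 1) x
  have h2 := one_sub_mul_eval_accPoly n (tripling x)
  rw [eval_cutoffPoly_succ'] at h1
  rw [one_sub_tripling] at h2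
  have hχ := cutoffPoly_nonneg n (tripling x)
  set χ := (cutoffPoly n).eval (tripling x)
  set a := (1 + 2 * x) / 3 with ha
  have ha0 : 0 ≤ a := by rw [ha]; linarith
  have ha1 : a ≤ 1 := by rw [ha]; linarith
  have hp1 : a ^ (2 * n) ≤ 1 := pow_le_one₀ ha0 ha1
  have hp2 : 1 - a ^ (2 * n) ≤ 2 * n * (1 - x) := by
    have h := one_add_mul_le_pow (by linarith : (-2 : ℝ) ≤ a - 1) (2 * n)
    rw [add_sub_cancel] at h
    push_cast at h
    have h3 : 1 - a ≤ 1 - x := by rw [ha]; linarith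
    have h4 : (0 : ℝ) ≤ 2 * n := by positivity
    nlinarith
  have hne : 1 - x ≠ 0 := by linarith
  have hne' : 2 * x + 1 ≠ 0 := by linarith
  have e1 : (accPoly (n + 1)).eval x = (1 - χ * a ^ (2 * n)) / (1 - x) := by
    rw [eq_div_iff hne]; linear_combination h1
  have e2 : (accPoly n).eval (tripling x) * (2 * x + 1) = (1 - χ) / ((1 - x) * (2 * x + 1)) := by
    rw [eq_div_iff (mul_ne_zero hne hne')]; linear_combination h2
  have e3 : (accPoly (n + 1)).eval x -
      (accPoly n).eval (tripling x) * (3 * (2 * x - 1) * (2 * x + 1)) - 4 * (2 * x + 1)⁻¹ =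
      χ * ((1 - a ^ (2 * n)) / (1 - x)) - χ * (4 / (2 * x + 1)) := by
    rw [show (accPoly n).eval (tripling x) * (3 * (2 * x - 1) * (2 * x + 1)) =
      3 * (2 * x - 1) * ((accPoly n).eval (tripling x) * (2 * x + 1)) by ring, e1, e2]
    field_simp
    ring
  have h5 : (1 - a ^ (2 * n)) / (1 - x) ≤ 2 * n := (div_le_iff₀ (by linarith)).2 hp2
  have h6 : 0 ≤ (1 - a ^ (2 * n)) / (1 - x) := div_nonneg (by linarith) (by linarith)
  have h7 : 4 / (2 * x + 1) ≤ 2 := by rw [div_le_iff₀ (by linarith)]; linarith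
  have h8 : 0 ≤ 4 / (2 * x + 1) := div_nonneg (by norm_num) (by linarith)
  rw [e3, ← mul_sub, abs_mul, abs_of_nonneg hχ, mul_comm]
  refine mul_le_mul_of_nonneg_right (abs_le.2 ⟨?_, ?_⟩) hχ
  · have : (0 : ℝ) ≤ n := by positivity
    linarith
  · linarith

lemma abs_integral_right_sub_le {K : ℝ} (n : ℕ) (hK : ∀ x ∈ Set.Icc (-1 : ℝ) 1,
    (cutoffPoly n).eval x * (1 + 9 ^ n * (4 * (1 - x))) ^ 2 ≤ K) (hK0 : 0 ≤ K) :
    |(∫ x in (1 / 2 : ℝ)..1, (accPoly (n + 1)).eval x) - (∫ x in (-1 : ℝ)..1, (accPoly n).eval x) -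
      2 * (Real.log 3 - Real.log 2)| ≤ K * (n + 1) * (9 ^ n)⁻¹ := by
  have hc1 : Continuous fun x => (accPoly (n + 1)).eval x := by fun_prop
  have hc2 : Continuous fun x : ℝ =>
      (accPoly n).eval (tripling x) * (3 * (2 * x - 1) * (2 * x + 1)) := by
    unfold tripling; fun_prop
  have hc3 : ContinuousOn (fun x : ℝ => 4 * (2 * x + 1)⁻¹) (Set.uIcc (1 / 2) 1) := by
    refine continuousOn_const.mul (ContinuousOn.inv₀ (by fun_prop) fun x hx => ?_)
    rw [Set.uIcc_of_le (by norm_num)] at hx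
    linarith [hx.1]
  have hb : (0 : ℝ) < 16 * 9 ^ n := by positivity
  have hc4 : ContinuousOn (fun x : ℝ => (2 * n + 2) * K * ((1 + 16 * 9 ^ n * (1 - x)) ^ 2)⁻¹)
      (Set.uIcc (1 / 2) 1) := by
    refine continuousOn_const.mul (ContinuousOn.inv₀ (by fun_prop) fun x hx => pow_ne_zero 2 ?_)
    rw [Set.uIcc_of_le (by norm_num)] at hx
    have : 0 ≤ 16 * 9 ^ n * (1 - x) := mul_nonneg hb.le (by linarith [hx.2])
    linarith
  have hi12 := (hc1.intervalIntegrable (μ := volume) (1 / 2) 1).sub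
    (hc2.intervalIntegrable (1 / 2) 1)
  have hi := hi12.sub hc3.intervalIntegrable
  rw [← integral_accPoly_tripling, ← integral_inv_two_mul_add_one,
    ← intervalIntegral.integral_sub (hc1.intervalIntegrable _ _) (hc2.intervalIntegrable _ _),
    ← intervalIntegral.integral_sub hi12 hc3.intervalIntegrable]
  refine (intervalIntegral.abs_integral_le_integral_abs (by norm_num)).trans ?_
  refine (intervalIntegral.integral_mono_on_of_le_Ioo (by norm_num) hi.abs hc4.intervalIntegrable
    fun x hx => (abs_accPoly_succ_sub_le n hx).trans ?_).trans ?_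
  · have hx1 := hx.1
    have hx2 : 0 ≤ 1 - x := by linarith [hx.2]
    have h1 := hK (tripling x) (tripling_mem ⟨by linarith, by linarith⟩)
    have h2 : 4 * (1 - x) ≤ 1 - tripling x := by
      rw [one_sub_tripling, mul_comm]
      exact mul_le_mul_of_nonneg_left (by nlinarith) hx2
    have h3 : 1 + 16 * 9 ^ n * (1 - x) ≤ 1 + 9 ^ n * (4 * (1 - tripling x)) := by
      have : (0 : ℝ) ≤ 9 ^ n := by positivity
      nlinarith
    rw [mul_assoc]
    refine mul_le_mul_of_nonneg_left ?_ (by positivity)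
    rw [← div_eq_mul_inv, le_div_iff₀ (by positivity)]
    refine le_trans (mul_le_mul_of_nonneg_left ?_ (cutoffPoly_nonneg _ _)) h1
    exact pow_le_pow_left₀ (by positivity) h3 2
  · rw [intervalIntegral.integral_const_mul]
    refine (mul_le_mul_of_nonneg_left (integral_inv_sq_le hb) (by positivity)).trans ?_
    rw [mul_inv]
    have h4 : (0 : ℝ) ≤ K * (n + 1) * (9 ^ n)⁻¹ := by positivity
    linarith

lemma abs_integral_left_sub_le {K : ℝ} (n : ℕ) (hK : ∀ x ∈ Set.Icc (-1 : ℝ) 1,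
    (cutoffPoly (n + 1)).eval x * (1 + 9 ^ (n + 1) * (4 * (1 - x))) ^ 2 ≤ K) (hK0 : 0 ≤ K) :
    |(∫ x in (-1 : ℝ)..(1 / 2), (accPoly (n + 1)).eval x) - 2 * Real.log 2| ≤
      3 * K * (9 ^ n)⁻¹ := by
  have hc1 : Continuous fun x => (accPoly (n + 1)).eval x := by fun_prop
  have hc2 : ContinuousOn (fun x : ℝ => (1 - x)⁻¹) (Set.uIcc (-1) (1 / 2)) := by
    refine ContinuousOn.inv₀ (by fun_prop) fun x hx => ?_
    rw [Set.uIcc_of_le (by norm_num)] at hx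
    linarith [hx.2]
  have hi := (hc1.intervalIntegrable (μ := volume) (-1) (1 / 2)).sub hc2.intervalIntegrable
  rw [← integral_inv_one_sub,
    ← intervalIntegral.integral_sub (hc1.intervalIntegrable _ _) hc2.intervalIntegrable]
  refine (intervalIntegral.abs_integral_le_integral_abs (by norm_num)).trans ?_
  refine (intervalIntegral.integral_mono_on (by norm_num) hi.abs
    (g := fun _ => 2 * K * (9 ^ n)⁻¹) (by simp) fun x hx => ?_).trans ?_
  · have hx1 := hx.1
    have hx2 : 1 / 2 ≤ 1 - x := by linarith [hx.2]
    have h1 := hK x ⟨hx.1, by linarith⟩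
    have hχ := cutoffPoly_nonneg (n + 1) x
    have h2 : (accPoly (n + 1)).eval x - (1 - x)⁻¹ = -((cutoffPoly (n + 1)).eval x / (1 - x)) := by
      have h3 := one_sub_mul_eval_accPoly (n + 1) x
      have hne : 1 - x ≠ 0 := by linarith
      field_simp
      linear_combination h3
    rw [h2, abs_neg, abs_of_nonneg (div_nonneg hχ (by linarith)), div_le_iff₀ (by linarith)]
    have h4 : (cutoffPoly (n + 1)).eval x * 9 ^ n ≤ K := by
      refine le_trans (mul_le_mul_of_nonneg_left ?_ hχ) h1
      have h5 : (0 : ℝ) < 9 ^ n := by positivity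
      rw [pow_succ (9 : ℝ) n]
      have h6 : (9 : ℝ) ^ n ≤ 9 ^ n * 9 * (4 * (1 - x)) := by nlinarith
      nlinarith
    have h7 : (cutoffPoly (n + 1)).eval x ≤ K * (9 ^ n)⁻¹ := by
      rw [← div_eq_mul_inv, le_div_iff₀ (by positivity)]
      exact h4
    have h8 : 0 ≤ K * (9 ^ n)⁻¹ := by positivity
    nlinarith
  · rw [intervalIntegral.integral_const, smul_eq_mul]
    have h8 : 0 ≤ K * (9 ^ n)⁻¹ := by positivity
    linarith

/-- The integral is the increment of the integrals of `accPoly`, split at `1/2`. The left part tends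
to `2 ln 2`; the right part reproduces the previous integral plus `2(ln 3 - ln 2)`. -/
lemma exists_integral_slicePoly : ∃ K : ℝ, 0 ≤ K ∧ ∀ n : ℕ,
    |4 * (∫ x in (-1 : ℝ)..1, (slicePoly n).eval x) - 2 * Real.log 3| ≤
      K * (n + 1) * (9 ^ n)⁻¹ := by
  obtain ⟨K, hK0, hK⟩ := exists_cutoffPoly_decay 2
  refine ⟨4 * K, by positivity, fun n => ?_⟩
  have h1 := abs_integral_right_sub_le n (hK n) hK0
  have h2 := abs_integral_left_sub_le n (hK (n + 1)) hK0
  have hc : ∀ m : ℕ, Continuous fun x => (accPoly m).eval x := fun m => by fun_prop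
  have h3 := intervalIntegral.integral_add_adjacent_intervals
    ((hc (n + 1)).intervalIntegrable (μ := volume) (-1) (1 / 2))
    ((hc (n + 1)).intervalIntegrable (1 / 2) 1)
  have h4 : ∫ x in (-1 : ℝ)..1, (accPoly (n + 1)).eval x =
      (∫ x in (-1 : ℝ)..1, (accPoly n).eval x) + 4 * ∫ x in (-1 : ℝ)..1, (slicePoly n).eval x := by
    rw [← intervalIntegral.integral_const_mul, ← intervalIntegral.integral_add
      ((hc n).intervalIntegrable _ _) (Continuous.intervalIntegrable (by fun_prop) _ _)]
    refine intervalIntegral.integral_congr fun x _ => ?_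
    simp only [accPoly, Finset.sum_range_succ, eval_mul, eval_add, eval_C, mul_add]
  have h5 : 3 * K * (9 ^ n)⁻¹ ≤ 3 * (K * (n + 1) * (9 ^ n)⁻¹) := by
    have h6 : 0 ≤ K * n * (9 ^ n)⁻¹ := by positivity
    linarith
  calc _ = |((∫ x in (1 / 2 : ℝ)..1, (accPoly (n + 1)).eval x) -
        (∫ x in (-1 : ℝ)..1, (accPoly n).eval x) - 2 * (Real.log 3 - Real.log 2)) +
        ((∫ x in (-1 : ℝ)..(1 / 2), (accPoly (n + 1)).eval x) - 2 * Real.log 2)| := by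
        congr 1; linarith
    _ ≤ _ := (abs_add_le _ _).trans (by linarith)

end SliceIntegral

/-! ### Finite range multiscale decompositions -/

section Decomposition

open Polynomial

lemma sum_Ico_pow_le {q : ℝ} (hq : 0 ≤ q) (hq' : q ≤ 1 / 3) (a b : ℕ) :
    ∑ i ∈ Finset.Ico a b, q ^ i ≤ 3 / 2 * q ^ a := by
  refine (geom_sum_Ico_le_of_lt_one hq (by linarith)).trans ?_
  rw [div_le_iff₀ (by linarith)]
  have : 0 ≤ q ^ a := pow_nonneg hq a
  nlinarith

/-- The spectral weight of the fluctuation covariance of scale `j`. -/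
def scaleWeight (M j : ℕ) (x : ℝ) : ℝ :=
  ∑ i ∈ Finset.Ico (j * M) ((j + 1) * M), (slicePoly i).eval x

lemma scaleWeight_nonneg (M j : ℕ) {x : ℝ} (hx : x ∈ Set.Icc (-1 : ℝ) 1) :
    0 ≤ scaleWeight M j x :=
  Finset.sum_nonneg fun i _ => slicePoly_nonneg i hx

lemma sum_scaleWeight (M R : ℕ) (x : ℝ) : ∑ j ∈ Finset.range R, scaleWeight M j x =
    ∑ i ∈ Finset.range (R * M), (slicePoly i).eval x := by
  induction R with
  | zero => simp
  | succ R ih =>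
    rw [Finset.sum_range_succ, ih, scaleWeight, Finset.sum_range_add_sum_Ico _
      (Nat.mul_le_mul_right M (Nat.le_succ R))]

lemma four_mul_sum_scaleWeight_le (M R : ℕ) (x : ℝ) :
    4 * (1 - x) * ∑ j ∈ Finset.range R, scaleWeight M j x ≤ 1 := by
  rw [sum_scaleWeight, four_mul_sum_eval_slicePoly]
  linarith [cutoffPoly_nonneg (R * M) x]

lemma pow_le_side {M R j i : ℕ} (hj : j < R) (hi : i < (j + 1) * M) :
    3 ^ (i + 1) ≤ (3 ^ M) ^ R := by
  rw [← pow_mul]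
  refine Nat.pow_le_pow_right (by norm_num) ?_
  have : (j + 1) * M ≤ R * M := Nat.mul_le_mul_right M hj
  rw [mul_comm M R]
  omega

/-- For `l ≥ 1` the slices decay geometrically with ratio `3^{-l}`, so the first one, `i = jM` with
`3^{jM} = L^j`, dominates and the constant does not depend on `M`. For `l = 0` the sum would grow
with `M`, as the logarithm does. -/
lemma exists_abs_iterDiff_ker_scaleWeight_le (l : ℕ) : ∃ K : ℝ, l ≠ 0 → ∀ M R j : ℕ, j < R →
    ∀ (x : Torus ((3 ^ M) ^ R)) (w : List (Fin 4)), w.length = l →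
    |iterDiff w (ker fun n => scaleWeight M j (meanCos n)) x| ≤
      K * (((3 ^ M : ℕ) : ℝ) ^ (j * l))⁻¹ := by
  obtain ⟨K, hK0, hK⟩ := exists_avg_slicePoly_mul_le l
  refine ⟨K * (3 / 2), fun hl M R j hj x w hw => ?_⟩
  refine (abs_iterDiff_ker_le w (fun n => scaleWeight_nonneg M j (meanCos_mem n)) x).trans ?_
  simp only [hw, scaleWeight, Finset.sum_mul]
  rw [Finset.sum_comm, Finset.mul_sum]
  have hq : ((3 : ℝ) ^ l)⁻¹ ≤ 1 / 3 := by
    rw [one_div]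
    exact inv_anti₀ (by norm_num) (le_self_pow₀ (by norm_num) hl)
  calc _ ≤ ∑ i ∈ Finset.Ico (j * M) ((j + 1) * M), K * (((3 : ℝ) ^ l)⁻¹) ^ i := by
        refine Finset.sum_le_sum fun i hi => ?_
        have h1 := hK ((3 ^ M) ^ R) i ((Nat.pow_le_pow_right (by norm_num) (Nat.le_succ i)).trans
          (pow_le_side hj (Finset.mem_Ico.1 hi).2))
        rwa [inv_pow, pow_right_comm (3 : ℝ) l i]
    _ ≤ K * (3 / 2 * (((3 : ℝ) ^ l)⁻¹) ^ (j * M)) := by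
        rw [← Finset.mul_sum]
        exact mul_le_mul_of_nonneg_left (sum_Ico_pow_le (by positivity) hq _ _) hK0
    _ = _ := by
        push_cast
        rw [inv_pow, ← pow_mul, ← pow_mul, mul_assoc]
        congr 4
        ring

/-- The torus average is compared with the integral at the cost of the average of `χ_i`, of order
`9^{-i}`, and the integral with its logarithmic value at the cost `(i + 1) 9^{-i}`. -/
lemma exists_abs_ker_slicePoly_sub_le : ∃ K : ℝ, 0 ≤ K ∧ ∀ (N : ℕ) [NeZero N] (i : ℕ),
    Odd N → 3 ^ (i + 1) ≤ N →
    |ker (fun n : Torus N => (slicePoly i).eval (meanCos n)) 0 - Real.log 3 / (2 * Real.pi)| ≤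
      K * (1 / 3) ^ i := by
  obtain ⟨K₁, hK₁, h₁⟩ := exists_avg_cutoffPoly_le
  obtain ⟨K₂, hK₂, h₂⟩ := exists_integral_slicePoly
  refine ⟨K₁ + K₂, by positivity, fun N _ i hN hi => ?_⟩
  have hdeg := two_mul_natDegree_slicePoly_lt i
  have a1 := abs_avg_sub_integral_le hN (P := slicePoly i) (by omega)
    fun x hx => slicePoly_nonneg i hx
  have a2 := h₁ N i ((Nat.pow_le_pow_right (by norm_num) (Nat.le_succ i)).trans hi)
  have a3 : ((N : ℝ) ^ 2)⁻¹ * ∑ n : Torus N, (1 - meanCos n) * (slicePoly i).eval (meanCos n) ≤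
      ((N : ℝ) ^ 2)⁻¹ * ∑ n : Torus N, (cutoffPoly i).eval (meanCos n) := by
    refine mul_le_mul_of_nonneg_left (Finset.sum_le_sum fun n _ => ?_) (by positivity)
    have h3 := four_mul_eval_slicePoly i (meanCos n)
    have h4 := cutoffPoly_nonneg (i + 1) (meanCos n)
    have h5 := cutoffPoly_nonneg i (meanCos n)
    linarith
  have a4 := h₂ i
  set I := ∫ x in (-1 : ℝ)..1, (slicePoly i).eval x
  have a5 : |1 / Real.pi * I - Real.log 3 / (2 * Real.pi)| ≤ K₂ * (i + 1) * (9 ^ i)⁻¹ := by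
    have h3 : 1 / Real.pi * I - Real.log 3 / (2 * Real.pi) =
        (4 * Real.pi)⁻¹ * (4 * I - 2 * Real.log 3) := by
      field_simp; ring
    rw [h3, abs_mul, abs_of_pos (by positivity)]
    refine (mul_le_of_le_one_left (abs_nonneg _) ?_).trans a4
    exact inv_le_one_of_one_le₀ (by linarith [Real.pi_gt_three])
  have h9 : ((i : ℝ) + 1) * (9 ^ i)⁻¹ ≤ (1 / 3) ^ i := by
    have h3 : (i : ℝ) + 1 ≤ 3 ^ i := by
      have := one_add_mul_le_pow (by norm_num : (-2 : ℝ) ≤ 2) i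
      norm_num at this
      have h0 : (0 : ℝ) ≤ i := by positivity
      linarith
    rw [show (9 : ℝ) = 3 * 3 by norm_num, mul_pow, mul_inv, one_div, inv_pow, ← mul_assoc]
    refine mul_le_of_le_one_left (by positivity) ?_
    rw [← div_eq_mul_inv]
    exact (div_le_one (by positivity)).2 h3
  have h0 : (0 : ℝ) ≤ i := by positivity
  have h9' : ((9 : ℝ) ^ i)⁻¹ ≤ (1 / 3) ^ i := by
    refine le_trans ?_ h9
    exact le_mul_of_one_le_left (by positivity) (by linarith)
  rw [ker_zero_apply]
  calc _ ≤ |((N : ℝ) ^ 2)⁻¹ * ∑ n : Torus N, (slicePoly i).eval (meanCos n) - 1 / Real.pi * I| +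
        |1 / Real.pi * I - Real.log 3 / (2 * Real.pi)| := abs_sub_le _ _ _
    _ ≤ K₁ * (9 ^ i)⁻¹ + K₂ * (i + 1) * (9 ^ i)⁻¹ := add_le_add (a1.trans (a3.trans a2)) a5
    _ ≤ K₁ * (1 / 3) ^ i + K₂ * (1 / 3) ^ i := by
        rw [mul_assoc K₂]
        gcongr
    _ = _ := by ring

lemma exists_abs_ker_scaleWeight_sub_le : ∃ c : ℝ, ∀ M R j : ℕ, j < R →
    |ker (fun n : Torus ((3 ^ M) ^ R) => scaleWeight M j (meanCos n)) 0 -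
      Real.log (3 ^ M : ℕ) / (2 * Real.pi)| ≤ c * ((3 ^ M : ℕ) : ℝ) ^ (-((j : ℝ) / 4)) := by
  obtain ⟨K, hK0, hK⟩ := exists_abs_ker_slicePoly_sub_le
  refine ⟨K * (3 / 2), fun M R j hj => ?_⟩
  have hodd : Odd ((3 ^ M) ^ R) := Odd.pow (Odd.pow (by decide))
  have h1 : ker (fun n : Torus ((3 ^ M) ^ R) => scaleWeight M j (meanCos n)) 0 -
      Real.log (3 ^ M : ℕ) / (2 * Real.pi) = ∑ i ∈ Finset.Ico (j * M) ((j + 1) * M),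
        (ker (fun n : Torus ((3 ^ M) ^ R) => (slicePoly i).eval (meanCos n)) 0 -
          Real.log 3 / (2 * Real.pi)) := by
    simp only [scaleWeight]
    rw [ker_sum, Finset.sum_sub_distrib, Finset.sum_const, Nat.card_Ico,
      show (j + 1) * M - j * M = M by rw [Nat.succ_mul, Nat.add_sub_cancel_left]]
    push_cast
    rw [Real.log_pow, nsmul_eq_mul]
    ring
  rw [h1]
  calc _ ≤ ∑ i ∈ Finset.Ico (j * M) ((j + 1) * M), K * (1 / 3) ^ i :=
        (Finset.abs_sum_le_sum_abs _ _).trans (Finset.sum_le_sum fun i hi =>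
          hK _ i hodd (pow_le_side hj (Finset.mem_Ico.1 hi).2))
    _ ≤ K * (3 / 2 * (1 / 3) ^ (j * M)) := by
        rw [← Finset.mul_sum]
        exact mul_le_mul_of_nonneg_left (sum_Ico_pow_le (by norm_num) le_rfl _ _) hK0
    _ = K * (3 / 2) * ((3 ^ M : ℕ) : ℝ) ^ (-(j : ℝ)) := by
        rw [Real.rpow_neg (by positivity), Real.rpow_natCast]
        push_cast
        rw [one_div, inv_pow, ← pow_mul, mul_comm j M, mul_assoc]
    -- The error is of order `L^{-j}`, better than the required `L^{-j/4}`.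
    _ ≤ _ := by
        refine mul_le_mul_of_nonneg_left (Real.rpow_le_rpow_of_exponent_le ?_ ?_) (by positivity)
        · exact_mod_cast Nat.one_le_pow _ _ (by norm_num)
        · have : (0 : ℝ) ≤ j := by positivity
          linarith

lemma ker_scaleWeight_eq_zero {M R j : ℕ} {x : Torus ((3 ^ M) ^ R)}
    (hx : (3 ^ M) ^ (j + 1) ≤ 2 * absMax x) :
    ker (fun n => scaleWeight M j (meanCos n)) x = 0 := by
  simp only [scaleWeight]
  rw [ker_sum]
  refine Finset.sum_eq_zero fun i hi => ker_eval_eq_zero ?_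
  have h1 := two_mul_natDegree_slicePoly_lt i
  have h2 := pow_le_side (R := j + 1) (Nat.lt_succ_self j) (Finset.mem_Ico.1 hi).2
  omega

/-- The massive covariances: the spectral weights are divided by `1 + m² ∑ j, scaleWeight M j`. -/
lemma exists_massive_decomposition (M R : ℕ) :
    ∃ (Γm : ℝ → ℕ → Torus ((3 ^ M) ^ R) → ℝ) (tail : ℝ → Torus ((3 ^ M) ^ R) → ℝ) (m₀ : ℝ),
    0 < m₀ ∧
    (∀ m, 0 < m → m < m₀ →
      (∀ j < R, (covMatrix (Γm m j)).PosSemidef) ∧ (covMatrix (tail m)).PosSemidef ∧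
      ∀ x, yukawa ((3 ^ M) ^ R) m x = ∑ j ∈ Finset.range R, Γm m j x + tail m x) ∧
    ∀ j < R, ∀ x, Tendsto (fun m => Γm m j x) (𝓝[>] 0)
      (𝓝 (ker (fun n => scaleWeight M j (meanCos n)) x)) := by
  set G : ℝ → ℝ := fun x => ∑ j ∈ Finset.range R, scaleWeight M j x with hG
  have hG0 : ∀ n : Torus ((3 ^ M) ^ R), 0 ≤ G (meanCos n) := fun n =>
    Finset.sum_nonneg fun j _ => scaleWeight_nonneg M j (meanCos_mem n)
  refine ⟨fun m j => ker fun n => scaleWeight M j (meanCos n) / (1 + m ^ 2 * G (meanCos n)),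
    fun m => ker fun n => 1 / (m ^ 2 + 4 * (1 - meanCos n)) -
      G (meanCos n) / (1 + m ^ 2 * G (meanCos n)), 1, one_pos, fun m hm _ => ⟨fun j _ => ?_, ?_,
      fun x => ?_⟩, fun j _ x => ?_⟩
  · refine posSemidef_ker fun n => div_nonneg (scaleWeight_nonneg M j (meanCos_mem n)) ?_
    have := hG0 n
    positivity
  · refine posSemidef_ker fun n => ?_
    have h1 := hG0 n
    have h2 : 0 ≤ 1 - meanCos n := by linarith [(meanCos_mem n).2]
    -- After cross-multiplication the mass terms cancel, and positivity of the tail becomes `4(1 -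
    -- x) G(x) ≤ 1`.
    rw [sub_nonneg, div_le_div_iff₀ (by positivity) (by positivity)]
    have h3 := four_mul_sum_scaleWeight_le M R (meanCos n)
    linarith
  · rw [yukawa_eq_ker, ← ker_sum, ← ker_add]
    congr 1
    ext n
    rw [← Finset.sum_div, hG]
    ring
  · have hc : ContinuousAt (fun m : ℝ => ker (fun n : Torus ((3 ^ M) ^ R) =>
        scaleWeight M j (meanCos n) / (1 + m ^ 2 * G (meanCos n))) x) 0 := by
      unfold ker
      refine continuousAt_const.mul (tendsto_finsetSum _ fun n _ => ?_)
      refine ContinuousAt.mul (ContinuousAt.div continuousAt_const (by fun_prop) ?_)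
        continuousAt_const
      simp
    have h := hc.tendsto.mono_left (nhdsWithin_le_nhds (s := Set.Ioi 0))
    simpa using h

/-- Decompositions exist for all `L = 3 ^ M`, with constants independent of `M`. -/
theorem exists_isMultiscaleDecomposition : ∃ (C : ℕ → ℝ) (c : ℝ), ∀ M R : ℕ,
    ∃ Γ : ℕ → Torus ((3 ^ M) ^ R) → ℝ, IsMultiscaleDecomposition C c (3 ^ M) R Γ := by
  choose C hC using exists_abs_iterDiff_ker_scaleWeight_le
  obtain ⟨c, hc⟩ := exists_abs_ker_scaleWeight_sub_le
  refine ⟨C, c, fun M R => ⟨fun j => ker fun n => scaleWeight M j (meanCos n), ?_⟩⟩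
  exact
    { posDef := fun j _ => posSemidef_ker fun n => scaleWeight_nonneg M j (meanCos_mem n)
      decomposition := exists_massive_decomposition M R
      finiteRange := fun j _ x hx => ker_scaleWeight_eq_zero hx
      deriv_le := fun j hj x _ w hw => hC w.length (by simpa using hw) M R j hj x w rfl
      diag := fun j hj => hc M R j hj }

end Decomposition

end CoulombGas

end

open CoulombGas in
theorem mainTheorem6 :
    -- finite range multiscale decompositions exist, with constants independent of `M` and `R`
    (∃ γ : ℕ, ∃ (_ : NeZero γ) (C : ℕ → ℝ) (c : ℝ), Odd γ ∧ 1 < γ ∧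
      ∀ M R : ℕ, 1 ≤ M → 1 ≤ R →
        ∃ Γ : ℕ → Torus ((γ ^ M) ^ R) → ℝ, IsMultiscaleDecomposition C c (γ ^ M) R Γ) ∧
    -- the constant that restricts `h` exists
    (∀ (C : ℕ → ℝ) (c : ℝ), ∃ C₀ : ℝ, 0 < C₀ ∧ BoundsIncrements C c C₀) ∧
    -- the contraction of the charged components
    ∃ ϑ : ℝ, 0 < ϑ ∧
      ∀ (C : ℕ → ℝ) (c C₀ : ℝ), 0 < C₀ → BoundsIncrements C c C₀ →
      ∀ c₁ c₃ : ℝ, 0 < c₁ → 0 < c₃ → c₃ < ϑ * c₁ →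
      ∃ c₀ : ℝ, 0 < c₀ ∧ ∀ cκ : ℝ, 0 < cκ → cκ ≤ c₀ →
      ∀ α h : ℝ, 0 < α → 8 * Real.pi ≤ α ^ 2 → 1 < h → 2 * α * C₀ ≤ h →
      ∃ Cα : ℝ, 0 < Cα ∧ ∃ L₀ : ℕ,
        ∀ (L : ℕ) [NeZero L] (R : ℕ) (Γ : ℕ → Torus (L ^ R) → ℝ),
          Odd L → 1 < L → L₀ ≤ L → IsMultiscaleDecomposition C c L R Γ →
        ∀ j : ℕ, j < R → ∀ A : ℝ, 1 < A →
        ∀ K : Finset (Torus (L ^ R)) → (Torus (L ^ R) → ℝ) → ℂ, IsActivity α L j K →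
        ∀ q : ℤ, 1 ≤ |q| →
        ∀ X : Finset (Torus (L ^ R)), IsSmall L j X →
          (activityNorm c₁ c₃ (cκ / Real.log L) h A L j K ≠ ⊤ →
            (∀ φ' : Torus (L ^ R) → ℝ, MeasureTheory.Integrable
              (fun ζ => chargeComponent α q (K X) (φ' + ζ)) (fieldLaw (Γ j))) ∧
            ContDiff ℝ ∞ (fluctExp (Γ j) (chargeComponent α q (K X)))) ∧
          ∀ φ' : Torus (L ^ R) → ℝ,
            tNorm h L (j + 1) (nbhd L j X)
                (fluctExp (Γ j) (chargeComponent α q (K X))) φ' ≤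
              ENNReal.ofReal (Cα * (L : ℝ) ^ (-(2 * |q|))) *
                activityNorm c₁ c₃ (cκ / Real.log L) h A L j K *
                ENNReal.ofReal ((A / 2) ^ (-(numBlocks L j X : ℤ))) *
                ENNReal.ofReal
                  (regulator c₁ c₃ (cκ / Real.log L) L (j + 1) (polymerClosure L (j + 1) X) φ') := by
  refine ⟨?_, exists_boundsIncrements, 1, one_pos, ?_⟩
  · obtain ⟨C, c, h⟩ := exists_isMultiscaleDecomposition
    exact ⟨3, inferInstance, C, c, by decide, by norm_num, fun M R _ _ => h M R⟩
  · intro C c C₀ hC₀ hbd c₁ c₃ hc₁ hc₃ _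
    exact contraction C c C₀ hC₀ hbd c₁ c₃ hc₁ hc₃
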